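/- **Setting.** Let $\varphi=(\varphi_1,\varphi_2,\varphi_3)\in\mathbb R^3$ with $\varphi_k\notin\frac{\pi}{2}\mathbb Z$ and $\varphi_k-\varphi_\ell\notin\frac{\pi}{2}\mathbb Z$ for $k\ne\ell$, and put $s_k=1+\tan\varphi_\ell\tan\varphi_m$ for $(k,\ell,m)$ a cyclic permutation of $(1,2,3)$. Let $$F_\varphi=\Big\{Z\in P_3(\mathbb C)\ :\ \frac{Z_0^2-Z_1^2}{s_1}=\frac{Z_0^2-Z_2^2}{s_2}=\frac{Z_0^2-Z_3^2}{s_3}\Big\},$$ an elliptic curve with origin $p_0=(1,1,1,1)$, and let $\sigma:F_\varphi\to F_\varphi$ be the translation which maps $Z$ to the unique $W\in P_3(\mathbb C)$ with $$Z_0W_k-Z_kW_0=Z_\ell W_m+Z_mW_\ell,\qquad s_k(Z_\ell W_m-Z_mW_\ell)=-(s_\ell-s_m)(Z_0W_k+Z_kW_0)$$ for all cyclic $(k,\ell,m)$. Assume that $\varphi$ is *generic*, i.e. moreover $\sigma$ has infinite order, and *even*, i.e. $s_1,s_2,s_3$ have the same sign. Let $C_\varphi$ be the connected component of $F_\varphi\cap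 P_3(\mathbb R)$ containing $p_0$. Put $u=\mathsf MZ$ with $$\mathsf M=\tfrac12\begin{pmatrix}1&1&1&1\\1&1&-1&-1\\1&-1&1&-1\\1&-1&-1&1\end{pmatrix},$$ and let $F_{\mathbb T}(\varphi)^0$ be the connected component containing $q_0=(-1,1,1,1)$ of $F_{\mathbb T}(\varphi)=\{Z\in F_\varphi: |u_0|=|u_1|=|u_2|=|u_3|\}$. Let $\mathcal L$ be the restriction to $F_\varphi$ of the dual of the tautological line bundle, with the hermitian metric $\langle L,L'\rangle(Z)=L(Z)\overline{L'(Z)}\big/\sum_\mu|\rho_\mu|^2|Z_\mu|^2$, where $|\rho_0|^2=\prod_{k<\ell}|\sin(\varphi_k-\varphi_\ell)|$ and $|\rho_k|^2=|\cos\varphi_\ell\cos\varphi_m\sin(\varphi_\ell-\varphi_m)|$. Let $A=C(F_\varphi)\times_{\sigma,\mathcal L}\mathbb Z$ be the twisted crossed product C\*-algebra, generated by $C(F_\varphi)$ and elements $\xi W$, $\xi\in C(F_\varphi,\mathcal L)$, with $(\xi W)f=(f\circ\sigma)\,\xi W$, $(\xi W)(\zeta W)^*=\langle\xi,\zeta\rangle$,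 $(\zeta W)^*(\xi W)=\langle\xi,\zeta\rangle\circ\sigma^{-1}$, with the norm of the regular representation (which is also the maximal C\*-norm), and let $A^\infty=C^\infty(F_\varphi)\times_{\sigma,\mathcal L}\mathbb Z$ be the $*$-subalgebra generated by the smooth $f$ and the $\xi W$ with $\xi$ smooth. **Statement.** (i) Each connected component of $F_\varphi\cap P_3(\mathbb R)$ is a minimal compact $\sigma$-invariant set. (ii) Every compact $K\subset F_\varphi$ with $\sigma(K)=K$ is the sum, in the elliptic curve $F_\varphi$ with origin $p_0$, of $K\cap F_{\mathbb T}(\varphi)^0$ and $C_\varphi$. (iii) There is an irrational $\eta$ and a homeomorphism $\mathbb R/\mathbb Z\to C_\varphi$ which carries the rotation by $\eta$ to $\sigma|_{C_\varphi}$; the crossed product $C_\varphi\times_\sigma\mathbb Z$ is isomorphic to the noncommutative torus $C(\mathbb T^2_\eta)$, the C\*-algebra with unitary generators $U_1U_2=e^{2\pi i\eta}U_2U_1$; the matrix $\begin{pmatrix}1&4\\0&1\end{pmatrix}$ defines a $*$-automorphism $\beta$ of $C(\mathbb T^2_\eta)$ by $\beta(U_1)=U_1$, $\beta(U_2)=U_1^4U_2$;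 and $A$ is $*$-isomorphic to the mapping torus $\{x\in C(\mathbb R,C(\mathbb T^2_\eta)):x(t+1)=\beta(x(t))\ \forall t\}$ of $\beta$. (iv) $A^\infty$ is dense in $A$, and there are a faithful tracial state $\tau$ on $A$ and an injective homomorphism of Lie algebras $X\mapsto\delta_X$ from the three-dimensional real Heisenberg Lie algebra $\mathfrak h_3$ to the $*$-derivations of $A^\infty$ such that $\tau\circ\delta_X=0$ for all $X$, and such that the action is elliptic: for the standard basis $X_1,X_2,X_3$ of $\mathfrak h_3$, the Laplacian $-\sum_j\delta_{X_j}^2$ on $L^2(A,\tau)$ has compact resolvent, i.e. $\{a\in A^\infty:\|a\|_\tau^2+\sum_j\|\delta_{X_j}a\|_\tau^2\le1\}$ is totally bounded for $\|a\|_\tau=\tau(a^*a)^{1/2}$. -/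

import Mathlib

open scoped LinearAlgebra.Projectivization BoundedContinuousFunction ContDiff

attribute [local instance] LieRing.ofAssociativeRing

noncomputable section

namespace NC3

/-! ### The elliptic curve, its correspondence, and its distinguished points -/

/-- Complex projective three-space. -/
abbrev P3 : Type := ℙ ℂ (Fin 4 → ℂ)

/-- The quotient topology on projective space. -/
instance : TopologicalSpace P3 :=
  TopologicalSpace.coinduced
    (fun v : {v : Fin 4 → ℂ // v ≠ 0} => Projectivization.mk ℂ v.1 v.2) inferInstance

/-- The parameters `s_k = 1 + tan φ_ℓ tan φ_m`, `(k, ℓ, m)` a cyclic permutation of the three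
indices. The three angles are indexed by `Fin 3`, so that `ℓ = k + 1` and `m = k + 2`. -/
def s (φ : Fin 3 → ℝ) (k : Fin 3) : ℝ := 1 + Real.tan (φ (k + 1)) * Real.tan (φ (k + 2))

/-- Homogeneous equations `(Z₀² - Z₁²)/s₁ = (Z₀² - Z₂²)/s₂ = (Z₀² - Z₃²)/s₃` of the curve, with
the denominators cleared. -/
def OnCurve (φ : Fin 3 → ℝ) (z : Fin 4 → ℂ) : Prop :=
  ∀ k l : Fin 3, (s φ l : ℂ) * (z 0 ^ 2 - z k.succ ^ 2) = (s φ k : ℂ) * (z 0 ^ 2 - z l.succ ^ 2)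

/-- The elliptic curve `F_φ` in `P₃(ℂ)`, in the coordinates `Z`. -/
def curve (φ : Fin 3 → ℝ) : Set P3 := {Z | OnCurve φ Z.rep}

/-- The six bilinear relations
`Z₀ W_k - Z_k W₀ = Z_ℓ W_m + Z_m W_ℓ`, `Z_ℓ W_m - Z_m W_ℓ = - J_{ℓm} (Z₀ W_k + Z_k W₀)` with
`J_{ℓm} = (s_ℓ - s_m)/s_k`, that is `N(Z) W = 0`. They are the defining relations of the quadratic
algebra `[Y₀, Y_k]₋ = [Y_ℓ, Y_m]₊`, `[Y_ℓ, Y_m]₋ = - J_{ℓm} [Y₀, Y_k]₊`, read as bilinear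
forms. -/
def Corr (φ : Fin 3 → ℝ) (z w : Fin 4 → ℂ) : Prop :=
  ∀ k : Fin 3,
    z 0 * w k.succ - z k.succ * w 0
        = z (k + 1).succ * w (k + 2).succ + z (k + 2).succ * w (k + 1).succ ∧
    (s φ k : ℂ) * (z (k + 1).succ * w (k + 2).succ - z (k + 2).succ * w (k + 1).succ)
        = - ((s φ (k + 1) - s φ (k + 2) : ℝ) : ℂ) * (z 0 * w k.succ + z k.succ * w 0)

/-- The correspondence `σ` of the geometric data: `σ(Z)` is the solution `W` of `N(Z) W = 0`
(a single projective point when `Z` lies on the curve). -/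
def sigma (φ : Fin 3 → ℝ) (Z : P3) : P3 := Classical.epsilon fun W : P3 => Corr φ Z.rep W.rep

/-- `φ` is generic: none of `φ_k`, `φ_k - φ_ℓ` lies in `(π/2)ℤ`, and the translation `σ` of the
elliptic curve has infinite order. -/
structure IsGeneric (φ : Fin 3 → ℝ) : Prop where
  angle : ∀ (k : Fin 3) (n : ℤ), φ k ≠ n * (Real.pi / 2)
  diff : ∀ k l : Fin 3, k ≠ l → ∀ n : ℤ, φ k - φ l ≠ n * (Real.pi / 2)
  infiniteOrder : ∀ n : ℕ, 0 < n → ∃ Z ∈ curve φ, (sigma φ)^[n] Z ≠ Z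

/-- `φ` is even: all `s_k` have the same sign. -/
def IsEven (φ : Fin 3 → ℝ) : Prop := (∀ k, 0 < s φ k) ∨ (∀ k, s φ k < 0)

/-- The matrix of the involutive change of coordinates `Z = M u`, `u = M Z`. -/
def M : Matrix (Fin 4) (Fin 4) ℂ :=
  (1 / 2 : ℂ) • !![1, 1, 1, 1; 1, 1, -1, -1; 1, -1, 1, -1; 1, -1, -1, 1]

/-- The point `p₀`, with coordinates `u = (1, 0, 0, 0)`, that is `Z = (1, 1, 1, 1)`. -/
def p₀ : P3 := Projectivization.mk ℂ ![1, 1, 1, 1] (fun h => one_ne_zero (congrFun h 0))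

/-- The point `q₀`, with coordinates `u = (-1, 1, 1, 1)`, that is `Z = (-1, 1, 1, 1)`. -/
def q₀ : P3 := Projectivization.mk ℂ ![-1, 1, 1, 1] (fun h => one_ne_zero (congrFun h 1))

/-- The real points `F_φ ∩ P₃(ℝ)`. -/
def realCurve (φ : Fin 3 → ℝ) : Set P3 :=
  {Z ∈ curve φ | ∃ (v : Fin 4 → ℝ) (h : (fun i => (v i : ℂ)) ≠ 0),
    Z = Projectivization.mk ℂ (fun i => (v i : ℂ)) h}

/-- The connected component `C_φ` of `F_φ ∩ P₃(ℝ)` containing `p₀`. -/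
def realComp (φ : Fin 3 → ℝ) : Set P3 := connectedComponentIn (realCurve φ) p₀

/-- The intersection `F_𝕋(φ)` of `F_φ` with the torus where all `|u_μ|` are equal. -/
def torusCurve (φ : Fin 3 → ℝ) : Set P3 :=
  {Z ∈ curve φ | ∀ μ ν : Fin 4, ‖M.mulVec Z.rep μ‖ = ‖M.mulVec Z.rep ν‖}

/-- The connected component `F_𝕋(φ)⁰` of `F_𝕋(φ)` containing `q₀`. -/
def torusComp (φ : Fin 3 → ℝ) : Set P3 := connectedComponentIn (torusCurve φ) q₀

/-- `C` is a minimal compact invariant set of `f`. -/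
def IsMinimalInvariant (f : P3 → P3) (C : Set P3) : Prop :=
  C.Nonempty ∧ IsCompact C ∧ f '' C = C ∧
    ∀ K ⊆ C, K.Nonempty → IsCompact K → f '' K = K → K = C

/-- A holomorphic isomorphism of `ℂ / (ℤ ω₁ + ℤ ω₂)` with the curve `F_φ`, sending `0` to `p₀`;
it is given by an entire nowhere vanishing map to the cone over `F_φ`. -/
structure Uniformization (φ : Fin 3 → ℝ) where
  ω₁ : ℂ
  ω₂ : ℂ
  indep : LinearIndependent ℝ ![ω₁, ω₂]
  lift : ℂ → Fin 4 → ℂ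
  holo : Differentiable ℂ lift
  ne_zero : ∀ z, lift z ≠ 0
  map_zero : Projectivization.mk ℂ (lift 0) (ne_zero 0) = p₀
  range_eq : Set.range (fun z => Projectivization.mk ℂ (lift z) (ne_zero z)) = curve φ
  eq_iff : ∀ z w, Projectivization.mk ℂ (lift z) (ne_zero z) =
    Projectivization.mk ℂ (lift w) (ne_zero w) ↔ ∃ m n : ℤ, z - w = m * ω₁ + n * ω₂

/-- The point of the curve with parameter `z`. -/
def Uniformization.pt {φ : Fin 3 → ℝ} (U : Uniformization φ) (z : ℂ) : P3 :=
  Projectivization.mk ℂ (U.lift z) (U.ne_zero z)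

/-- The sum `A + B` of two subsets of the elliptic curve `F_φ` with origin `p₀`. -/
def ellSum (φ : Fin 3 → ℝ) (A B : Set P3) : Set P3 :=
  {Z | ∃ (U : Uniformization φ) (a b : ℂ), U.pt a ∈ A ∧ U.pt b ∈ B ∧ U.pt (a + b) = Z}

/-! ### Operators on `ℓ²` -/

/-- The Hilbert space `ℓ²(ι)`. -/
abbrev L2 (ι : Type*) : Type _ := lp (fun _ : ι => ℂ) 2

lemma wsh_summable {ι : Type*} (e : Equiv.Perm ι) (w : ι → ℂ) (C : ℝ) (hw : ∀ i, ‖w i‖ ≤ C)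
    (v : L2 ι) : Summable (fun i => C ^ 2 * ‖v (e i)‖ ^ 2) ∧
      ∀ i, ‖w i * v (e i)‖ ^ 2 ≤ C ^ 2 * ‖v (e i)‖ ^ 2 := by
  constructor
  · have h := (lp.memℓp v).summable (by norm_num)
    simp only [ENNReal.toReal_ofNat, Real.rpow_ofNat] at h
    exact ((e.summable_iff (f := fun i => ‖v i‖ ^ 2)).2 h).mul_left _
  · intro i
    rw [norm_mul, mul_pow]
    gcongr
    exact hw i

/-- The bounded operator `(T v)(i) = w(i) v(e i)` on `ℓ²(ι)`, for a permutation `e` of `ι` and a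
bounded function `w`. -/
def weightedShift {ι : Type*} (e : Equiv.Perm ι) (w : ι → ℂ) (C : ℝ) (hw : ∀ i, ‖w i‖ ≤ C) :
    L2 ι →L[ℂ] L2 ι :=
  LinearMap.mkContinuous
    { toFun := fun v => ⟨fun i => w i * v (e i), by
        refine memℓp_gen ?_
        simp only [ENNReal.toReal_ofNat, Real.rpow_ofNat]
        exact Summable.of_nonneg_of_le (fun i => by positivity) (wsh_summable e w C hw v).2
          (wsh_summable e w C hw v).1⟩
      map_add' := fun v v' => by ext i; exact mul_add _ _ _
      map_smul' := fun c v => by ext i; exact mul_left_comm _ _ _ }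
    |C| (fun v => by
      refine lp.norm_le_of_tsum_le (by norm_num) (by positivity) ?_
      simp only [ENNReal.toReal_ofNat, Real.rpow_ofNat]
      have hv := lp.norm_rpow_eq_tsum (p := 2) (by norm_num) v
      simp only [ENNReal.toReal_ofNat, Real.rpow_ofNat] at hv
      have hs := wsh_summable e w C hw v
      calc ∑' i, ‖w i * v (e i)‖ ^ 2 ≤ ∑' i, C ^ 2 * ‖v (e i)‖ ^ 2 :=
            (Summable.of_nonneg_of_le (fun i => by positivity) hs.2 hs.1).tsum_le_tsum hs.2 hs.1
        _ = C ^ 2 * ∑' i, ‖v (e i)‖ ^ 2 := tsum_mul_left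
        _ = C ^ 2 * ∑' i, ‖v i‖ ^ 2 := by rw [e.tsum_eq (fun i => ‖v i‖ ^ 2)]
        _ = (|C| * ‖v‖) ^ 2 := by rw [← hv, mul_pow, sq_abs])

lemma weightedShift_apply {ι : Type*} (e : Equiv.Perm ι) (w : ι → ℂ) (C : ℝ)
    (hw : ∀ i, ‖w i‖ ≤ C) (v : L2 ι) (i : ι) : weightedShift e w C hw v i = w i * v (e i) := rfl

/-! ### The noncommutative torus and mapping tori -/

/-- The unitary `(u₁ v)(m, n) = v(m + 1, n)` on `ℓ²(ℤ²)`. -/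
def u₁ : L2 (ℤ × ℤ) →L[ℂ] L2 (ℤ × ℤ) :=
  weightedShift (Equiv.prodCongr (Equiv.addRight 1) (Equiv.refl ℤ)) (fun _ => 1) 1
    (fun _ => by simp)

/-- The unitary `(u₂ v)(m, n) = e^{2πiηm} v(m, n + 1)` on `ℓ²(ℤ²)`; one has
`u₁ u₂ = e^{2πiη} u₂ u₁`. -/
def u₂ (η : ℝ) : L2 (ℤ × ℤ) →L[ℂ] L2 (ℤ × ℤ) :=
  weightedShift (Equiv.prodCongr (Equiv.refl ℤ) (Equiv.addRight 1))
    (fun i => Complex.exp ((2 * Real.pi * η * i.1 : ℝ) * Complex.I)) 1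
    (fun _ => (Complex.norm_exp_ofReal_mul_I _).le)

lemma u₁_mul_u₂ (η : ℝ) :
    u₁ * u₂ η = Complex.exp ((2 * Real.pi * η : ℝ) * Complex.I) • (u₂ η * u₁) := by
  ext v ⟨m, n⟩
  change 1 * (Complex.exp ((2 * Real.pi * η * ((m + 1 : ℤ) : ℝ) : ℝ) * Complex.I) *
      v (m + 1, n + 1)) = Complex.exp ((2 * Real.pi * η : ℝ) * Complex.I) *
      (Complex.exp ((2 * Real.pi * η * ((m : ℤ) : ℝ) : ℝ) * Complex.I) * (1 * v (m + 1, n + 1)))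
  rw [one_mul, one_mul, ← mul_assoc, ← Complex.exp_add]
  congr 2
  push_cast
  ring

/-- The C*-algebra `C(𝕋²_η)` of the noncommutative torus, generated by two unitaries with
`U₁ U₂ = e^{2πiη} U₂ U₁`, in its regular representation on `ℓ²(ℤ²)`. -/
def ncTorus (η : ℝ) : StarSubalgebra ℂ (L2 (ℤ × ℤ) →L[ℂ] L2 (ℤ × ℤ)) :=
  (StarAlgebra.adjoin ℂ {u₁, u₂ η}).topologicalClosure

/-- The generator `U₁` of the noncommutative torus. -/
def U₁ (η : ℝ) : ncTorus η :=
  ⟨u₁, StarSubalgebra.le_topologicalClosure _ (StarAlgebra.subset_adjoin ℂ _ (by simp))⟩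

/-- The generator `U₂` of the noncommutative torus. -/
def U₂ (η : ℝ) : ncTorus η :=
  ⟨u₂ η, StarSubalgebra.le_topologicalClosure _ (StarAlgebra.subset_adjoin ℂ _ (by simp))⟩

/-- The mapping torus of an automorphism `β` of `C(𝕋²_η)`: the continuous maps
`x : ℝ → C(𝕋²_η)` with `x(t + 1) = β(x(t))`. -/
def mappingTorus {η : ℝ} (β : ncTorus η ≃⋆ₐ[ℂ] ncTorus η) :
    StarSubalgebra ℂ C(ℝ, ncTorus η) where
  carrier := {x | ∀ t, x (t + 1) = β (x t)}
  mul_mem' hx hy t := by simp [hx t, hy t]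
  one_mem' t := by simp
  add_mem' hx hy t := by simp [hx t, hy t]
  zero_mem' t := by simp
  algebraMap_mem' c t := (AlgHomClass.commutes β c).symm
  star_mem' {x} hx t := by
    change star (x (t + 1)) = β (star (x t))
    rw [hx t]
    exact (map_star β (x t)).symm

/-! ### Twisted crossed products by `ℤ`

Let `σ` be a homeomorphism of a compact space `K` and `𝓛` a hermitian line bundle on `K`. Write
`P → K` for the bundle of unit vectors of the dual of `𝓛`; continuous sections of `𝓛` are the
continuous functions on `P` which are homogeneous of degree one, and `⟨ξ, η⟩ = ξ η̄`. The
crossed product `C(K) ×_{σ,𝓛} ℤ` is the C*-algebra generated by `f ∈ C(K)` and the `ξ W`,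
`ξ ∈ C(K, 𝓛)`, in the regular representation. The latter is the direct sum over all orbits
`(x_n)` of `σ` and all trivializations of `𝓛` along them, that is over all sequences of unit
vectors `p_n` over `x_n`, `x_{n+1} = σ(x_n)`; it is given by `(f v)(p, n) = f(x_n) v(p, n)` and
`(ξ W v)(p, n) = ξ(p_n) v(p, n+1)`, so that `(ξ W) f = (f ∘ σ) (ξ W)`,
`(ξ W) (η W)^* = ⟨ξ, η⟩` and `(η W)^* (ξ W) = ⟨ξ, η⟩ ∘ σ⁻¹`. -/

/-- Two-sided sequences `p` with `p_n`, `p_{n+1}` related by `step`. -/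
def Chain {P : Type} (step : P → P → Prop) : Type := {p : ℤ → P // ∀ n, step (p n) (p (n + 1))}

section Crossed

variable {P : Type} [TopologicalSpace P] (step : P → P → Prop)

/-- The operator `(a v)(p, n) = a(p_n) v(p, n)`. -/
def mulOp (a : P →ᵇ ℂ) : L2 (Chain step × ℤ) →L[ℂ] L2 (Chain step × ℤ) :=
  weightedShift (Equiv.refl _) (fun i => a (i.1.1 i.2)) ‖a‖ (fun _ => a.norm_coe_le_norm _)

/-- The operator `(ξ W v)(p, n) = ξ(p_n) v(p, n + 1)`. -/
def shiftOp (ξ : P →ᵇ ℂ) : L2 (Chain step × ℤ) →L[ℂ] L2 (Chain step × ℤ) :=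
  weightedShift (Equiv.prodCongr (Equiv.refl _) (Equiv.addRight 1)) (fun i => ξ (i.1.1 i.2)) ‖ξ‖
    (fun _ => ξ.norm_coe_le_norm _)

/-- The `*`-algebra generated by the functions `a ∈ A₀` and the `ξ W`, `ξ ∈ A₁`. -/
def algCrossed (A₀ A₁ : Set (P →ᵇ ℂ)) :
    StarSubalgebra ℂ (L2 (Chain step × ℤ) →L[ℂ] L2 (Chain step × ℤ)) :=
  StarAlgebra.adjoin ℂ (mulOp step '' A₀ ∪ shiftOp step '' A₁)

end Crossed

/-- The weights `|ρ_μ|²` of the change of generators `x^μ = ρ_μ Y_μ` between the hermitian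
generators `x^μ` and the generators `Y_μ`:
`|ρ₀|² = ∏ |sin (φ_k - φ_ℓ)|` and `|ρ_k|² = |cos φ_ℓ cos φ_m sin (φ_ℓ - φ_m)|`. -/
def weight (φ : Fin 3 → ℝ) : Fin 4 → ℝ :=
  Fin.cons |Real.sin (φ 0 - φ 1) * Real.sin (φ 1 - φ 2) * Real.sin (φ 2 - φ 0)|
    (fun k : Fin 3 => |Real.cos (φ (k + 1)) * Real.cos (φ (k + 2)) *
      Real.sin (φ (k + 1) - φ (k + 2))|)

/-- `Q(Z, j(Z)) = ∑ |x^μ(Z)|² = ∑ |ρ_μ|² |Z_μ|²`: the squared length of a vector `Z` of the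
tautological line bundle, for the metric defined by the central form `Q = ∑ (x^μ)²`. -/
def hermSq (φ : Fin 3 → ℝ) (z : Fin 4 → ℂ) : ℝ := ∑ μ, weight φ μ * ‖z μ‖ ^ 2

lemma hermSq_zero (φ : Fin 3 → ℝ) : hermSq φ 0 = 0 := by simp [hermSq]

/-- Unit vectors of the tautological line bundle over `F_φ`. -/
def Sph (φ : Fin 3 → ℝ) : Type := {z : Fin 4 → ℂ // OnCurve φ z ∧ hermSq φ z = 1}

instance (φ : Fin 3 → ℝ) : TopologicalSpace (Sph φ) := instTopologicalSpaceSubtype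

lemma Sph.ne_zero {φ : Fin 3 → ℝ} (p : Sph φ) : p.1 ≠ 0 := fun h => by
  have := p.2.2
  rw [h, hermSq_zero] at this
  exact zero_ne_one this

lemma OnCurve.smul {φ : Fin 3 → ℝ} {z : Fin 4 → ℂ} (h : OnCurve φ z) (c : ℂ) :
    OnCurve φ (c • z) := fun k l => by
  simp only [Pi.smul_apply, smul_eq_mul]
  linear_combination c ^ 2 * h k l

/-- The projection of the unit vectors to `F_φ`. -/
def Sph.toCurve {φ : Fin 3 → ℝ} (p : Sph φ) : curve φ :=
  ⟨Projectivization.mk ℂ p.1 p.ne_zero, by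
    obtain ⟨a, ha⟩ := Projectivization.exists_smul_eq_mk_rep ℂ p.1 p.ne_zero
    change OnCurve φ _
    rw [← ha]
    exact p.2.1.smul (a : ℂ)⟩

/-- `p'` is a unit vector over `σ(x)` when `p` is one over `x`. -/
def Sph.Step {φ : Fin 3 → ℝ} (p p' : Sph φ) : Prop :=
  (p'.toCurve : P3) = sigma φ (p.toCurve : P3)

/-- The continuous functions on `F_φ`, as functions on the unit vectors. -/
def baseFun (φ : Fin 3 → ℝ) : Set (Sph φ →ᵇ ℂ) :=
  {a | ∃ f : C(curve φ, ℂ), ∀ p, a p = f p.toCurve}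

/-- The continuous sections over `F_φ` of the dual `𝓛` of the tautological line bundle: functions
on the unit vectors which are homogeneous of degree one. -/
def lineSec (φ : Fin 3 → ℝ) : Set (Sph φ →ᵇ ℂ) :=
  {ξ | ∀ (p p' : Sph φ) (c : ℂ), p'.1 = c • p.1 → ξ p' = c * ξ p}

/-- Smoothness of a function on the compact submanifold of unit vectors: it is the restriction of
a smooth function on `ℂ⁴`. -/
def smoothFun (φ : Fin 3 → ℝ) : Set (Sph φ →ᵇ ℂ) :=
  {a | ∃ g : (Fin 4 → ℂ) → ℂ, ContDiff ℝ ∞ g ∧ ∀ p, a p = g p.1}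

/-- The C*-algebra `C(F_φ) ×_{σ,𝓛} ℤ`. -/
def crossedProduct (φ : Fin 3 → ℝ) :
    StarSubalgebra ℂ (L2 (Chain (Sph.Step (φ := φ)) × ℤ) →L[ℂ] L2 (Chain (Sph.Step (φ := φ)) × ℤ)) :=
  (algCrossed Sph.Step (baseFun φ) (lineSec φ)).topologicalClosure

/-- The `*`-algebra `C^∞(F_φ) ×_{σ,𝓛} ℤ`: the linear span of the monomials `ξ Wⁿ`,
`W*ⁿ η*` with `ξ`, `η` smooth sections of `𝓛_n`. -/
def smoothCrossed (φ : Fin 3 → ℝ) :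
    StarSubalgebra ℂ (L2 (Chain (Sph.Step (φ := φ)) × ℤ) →L[ℂ] L2 (Chain (Sph.Step (φ := φ)) × ℤ)) :=
  algCrossed Sph.Step (baseFun φ ∩ smoothFun φ) (lineSec φ ∩ smoothFun φ)

lemma smoothCrossed_le (φ : Fin 3 → ℝ) : smoothCrossed φ ≤ crossedProduct φ :=
  (StarAlgebra.adjoin_mono (Set.union_subset_union
    (Set.image_mono Set.inter_subset_left) (Set.image_mono Set.inter_subset_left))).trans
    (StarSubalgebra.le_topologicalClosure _)

/-- The inclusion of the smooth `*`-algebra in the C*-algebra. -/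
def incl (φ : Fin 3 → ℝ) (a : smoothCrossed φ) : crossedProduct φ :=
  ⟨a.1, smoothCrossed_le φ a.2⟩

/-- The orbit relation `y = σ(x)` on the circle `C_φ`. -/
def circleStep (φ : Fin 3 → ℝ) (x y : realComp φ) : Prop := (y : P3) = sigma φ (x : P3)

/-- The (untwisted) crossed product C*-algebra `C_φ ×_σ ℤ`, in its regular representation. -/
def circleCrossed (φ : Fin 3 → ℝ) :
    StarSubalgebra ℂ (L2 (Chain (circleStep φ) × ℤ) →L[ℂ] L2 (Chain (circleStep φ) × ℤ)) :=
  (algCrossed (circleStep φ) Set.univ Set.univ).topologicalClosure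

/-! ### Heisenberg actions and traces -/

/-- The three-dimensional Heisenberg Lie algebra `𝔥₃` of strictly upper triangular real
`3 × 3` matrices. -/
def heisenberg : LieSubalgebra ℝ (Matrix (Fin 3) (Fin 3) ℝ) where
  carrier := {A | ∀ i j, j ≤ i → A i j = 0}
  add_mem' hA hB i j h := by simp [hA i j h, hB i j h]
  zero_mem' i j h := by simp
  smul_mem' c A hA i j h := by simp [hA i j h]
  lie_mem' {A B} hA hB i j h := by
    have key : ∀ X Y : Matrix (Fin 3) (Fin 3) ℝ, (∀ i j, j ≤ i → X i j = 0) →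
        (∀ i j, j ≤ i → Y i j = 0) → (X * Y) i j = 0 := by
      intro X Y hX hY
      rw [Matrix.mul_apply]
      refine Finset.sum_eq_zero fun k _ => ?_
      rcases le_or_gt k i with hk | hk
      · rw [hX i k hk, zero_mul]
      · rw [hY k j (h.trans hk.le), mul_zero]
    rw [LieRing.of_associative_ring_bracket, Matrix.sub_apply, key A B hA hB, key B A hB hA, sub_zero]

/-- The basis element of `𝔥₃` given by a matrix unit above the diagonal. -/
def heisenbergUnit (i j : Fin 3) (hij : i < j) : heisenberg :=
  ⟨Matrix.single i j 1, fun k l hkl => by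
    rw [Matrix.single_apply_of_ne]
    rintro ⟨h₁, h₂⟩
    rw [h₁, h₂] at hij
    exact absurd hij (not_lt.mpr hkl)⟩

/-- The standard basis `E₀₁, E₁₂, E₀₂` of `𝔥₃`. -/
def hBasis : Fin 3 → heisenberg :=
  ![heisenbergUnit 0 1 (by decide), heisenbergUnit 1 2 (by decide), heisenbergUnit 0 2 (by decide)]

/-- A faithful tracial state on the C*-algebra `C(F_φ) ×_{σ,𝓛} ℤ`. -/
structure IsFaithfulTrace {φ : Fin 3 → ℝ} (τ : crossedProduct φ →ₗ[ℂ] ℂ) : Prop where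
  map_one : τ 1 = 1
  trace : ∀ a b, τ (a * b) = τ (b * a)
  real : ∀ a, (τ (star a * a)).im = 0
  pos : ∀ a, a ≠ 0 → 0 < (τ (star a * a)).re

/-- An effective action of `𝔥₃` by `*`-derivations on `C^∞(F_φ) ×_{σ,𝓛} ℤ`. -/
structure IsDerivationAction {φ : Fin 3 → ℝ}
    (δ : heisenberg →ₗ⁅ℝ⁆ Module.End ℂ (smoothCrossed φ)) : Prop where
  leibniz : ∀ X a b, δ X (a * b) = δ X a * b + a * δ X b
  map_star : ∀ X a, δ X (star a) = star (δ X a)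
  injective : Function.Injective δ

/-- The squared norm `τ(a^* a)` of the Hilbert space `L²(τ)`. -/
def l2Sq {φ : Fin 3 → ℝ} (τ : crossedProduct φ →ₗ[ℂ] ℂ) (a : smoothCrossed φ) : ℝ :=
  (τ (incl φ (star a * a))).re

/-- Ellipticity of the action with respect to an invariant trace `τ`: the Laplacian
`-∑ δ_j²` on `L²(τ)` has compact resolvent, that is, the set of all `a` with
`‖a‖² + ∑ ‖δ_j(a)‖² ≤ 1` is totally bounded for the norm of `L²(τ)`. -/
def IsElliptic {φ : Fin 3 → ℝ} (δ : heisenberg →ₗ⁅ℝ⁆ Module.End ℂ (smoothCrossed φ))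
    (τ : crossedProduct φ →ₗ[ℂ] ℂ) : Prop :=
  ∀ ε > 0, ∃ t : Set (smoothCrossed φ), t.Finite ∧
    ∀ a, l2Sq τ a + ∑ j, l2Sq τ (δ (hBasis j) a) ≤ 1 → ∃ b ∈ t, l2Sq τ (a - b) < ε

end NC3

end

/-! ### Theta functions: product and addition formulas -/

noncomputable section

namespace NC3

/-! Evenness makes the s_k a common sign times their absolute values, which are distinct by
genericity (`absS_injective`), and the equations of the curve and of σ only depend on these up to a
common factor. For parameters 0 < a < b < c the curve is the image of Z(z) = (Aθ₁, θ₄, Bθ₃, Cθ₂)(z;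
it) with real A, B, C and t > 0. Indeed the squares of the four theta functions lie in the plane
spanned by θ₃(2z; 2it) and θ₂(2z; 2it), so the two quadrics amount to four equations for A², B², C²
and one theta constant. The latter is adjusted by an intermediate value argument in t
(`exists_theta_constants`). The period lattice is rectangular, 2ℤ + 2itℤ, and the point (1, 1, 1, 1)
has a real parameter z₀ (`exists_real_base`). The addition formulas show that Z(x + z₀) and Z(x −
z₀) satisfy the bilinear relations (`ThetaData.corrS`). Since a solution of these relations is
unique up to a factor (`CorrS.unique`), σ is z ↦ z − 2z₀, and its infinite order says that z₀ is
irrational. This z₀ is the η of the theorem.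

The real points are those with Im z ∈ tℤ: two circles on which σ is an irrational rotation. Density
of the orbits gives (i), and it shows that a compact invariant set is stable under all real
translations of the parameter. Along the vertical line through −z₀, the correspondence between Z and
its complex conjugate is the equality of all |u_μ|, so this line lies in the torus component, and
every point of K is a point of K on this line plus a point of the real circle. Sums are allowed to
be formed with any uniformization. The ratios Z_k/Z₀ solve Euler's equations with constant
coefficients, so by uniqueness of solutions each uniformization is a linear reparametrization of the
theta one (`Uniformization.exists_pt_eq`).

For (iii) and (iv) write z = 2x − 2ity. The normalized vector Z is a frame e(x, y) of unit vectors
with e(x + 1, y) = e(x, y) and e(x, y + 1) = exp(8πix) e(x, y), and σ becomes x ↦ x − η. Every chain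
is, up to phases, an orbit of this frame. An operator T of the crossed product is therefore known
from its coefficients T_n(x, y) (`OrbitFrame.coef`), which multiply by the twisted convolution
(ST)_n(x, y) = Σ S_k(x, y) T_{n−k}(x − kη, y). The mean of T₀ over the unit square is a faithful
trace. For fixed y the algebra looks like Laurent polynomials in U₁ = exp(2πix) and the shift U₂,
and the phase exp(8πix) replaces U₂ by U₁⁴U₂ when y advances by 1: this is the mapping torus. No
homomorphism has to be written down. Pairs of corresponding generators generate a *-algebra in the
product of the two C*-algebras, on which the two traces agree. As the traces are faithful, the
closure of this *-algebra is the graph of an isomorphism (`exists_starAlgEquiv_of_graph`). The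
crossed product of the real circle is treated in the same way, with a second variable that plays no
role.

The elements of A^∞ are exactly the finite families of smooth coefficients with the
quasi-periodicity `IsQP` (`ThetaData.isQP_cf`, `ThetaData.exists_smooth`), because the coordinates
form a smooth normalized system of sections. The Heisenberg algebra acts coefficientwise by first
order operators: ∂_y, the operator ∂_x − 8πiny, and the multiplication by 8πin. Invariance of the
trace is the vanishing of the mean of a derivative of a periodic function. For ellipticity, the
multiplication by 8πin controls the degrees |n| > M. In the remaining finitely many degrees, the
Poincaré inequality on the squares of side 1/M leaves finitely many mean values to be controlled
(`ThetaData.l2Sq_le`), which gives total boundedness. -/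

open Complex Real in
/-- The theta function `θ₃(w; 2τ)`. -/
def tF (τ w : ℂ) : ℂ := jacobiTheta₂ w (2 * τ)

open Complex Real in
/-- The theta function `θ₂(w; 2τ)`. -/
def tG (τ w : ℂ) : ℂ := cexp (π * I * τ / 2 + π * I * w) * jacobiTheta₂ (w + τ) (2 * τ)

open Complex Real in
/-- The Jacobi theta function `θ₁`. -/
def th1 (τ z : ℂ) : ℂ := -I * cexp (π * I * τ / 4 + π * I * z) * jacobiTheta₂ (z + 1 / 2 + τ / 2) τ

open Complex Real in
/-- The Jacobi theta function `θ₂`. -/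
def th2 (τ z : ℂ) : ℂ := cexp (π * I * τ / 4 + π * I * z) * jacobiTheta₂ (z + τ / 2) τ

/-- The Jacobi theta function `θ₃`. -/
def th3 (τ z : ℂ) : ℂ := jacobiTheta₂ z τ

/-- The Jacobi theta function `θ₄`. -/
def th4 (τ z : ℂ) : ℂ := jacobiTheta₂ (z + 1 / 2) τ

section Theta

open Complex Real

variable {τ : ℂ}

lemma exp_pi_I_div_two_add (w : ℂ) : cexp (w + π * I / 2) = I * cexp w := by
  rw [Complex.exp_add, show (π : ℂ) * I / 2 = π / 2 * I by ring, Complex.exp_pi_div_two_mul_I,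
    mul_comm]

lemma exp_pi_I_add (w : ℂ) : cexp (w + π * I) = -cexp w := by
  rw [Complex.exp_add, Complex.exp_pi_mul_I, mul_neg_one]

lemma exp_sub_pi_I (w : ℂ) : cexp (w - π * I) = -cexp w := by
  rw [← neg_neg (cexp (w - π * I)), ← exp_pi_I_add, sub_add_cancel]

lemma tF_add_one (w : ℂ) : tF τ (w + 1) = tF τ w := jacobiTheta₂_add_left _ _

lemma tG_add_one (w : ℂ) : tG τ (w + 1) = -tG τ w := by
  unfold tG
  rw [show w + 1 + τ = w + τ + 1 by ring, jacobiTheta₂_add_left,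
    show π * I * τ / 2 + π * I * (w + 1) = π * I * τ / 2 + π * I * w + π * I by ring, exp_pi_I_add,
    neg_mul]

lemma tF_neg (w : ℂ) : tF τ (-w) = tF τ w := jacobiTheta₂_neg_left _ _

lemma tF_add_tau (w : ℂ) : tF τ (w + τ) = cexp (-(π * I * τ / 2) - π * I * w) * tG τ w := by
  unfold tF tG
  rw [← mul_assoc, ← Complex.exp_add]
  ring_nf
  simp

lemma tG_add_tau (w : ℂ) : tG τ (w + τ) = cexp (-(π * I * τ / 2) - π * I * w) * tF τ w := by
  unfold tF tG
  rw [show w + τ + τ = w + 2 * τ by ring, jacobiTheta₂_add_left', ← mul_assoc, ← Complex.exp_add]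
  ring_nf

lemma tG_neg (w : ℂ) : tG τ (-w) = tG τ w := by
  have h := tG_add_tau (τ := τ) (-w - τ)
  rw [sub_add_cancel, show -w - τ = -(w + τ) by ring, tF_neg, tF_add_tau, ← mul_assoc,
    ← Complex.exp_add] at h
  rw [h]
  ring_nf
  simp

/-- The pairs (m, n) with m + n even are the (p + q, p − q), those with m + n odd are the (p + q +
1, p − q); the two ranges are complementary. -/
lemma hasSum_parity {f : ℤ × ℤ → ℂ} {a b : ℂ}
    (h₀ : HasSum (fun p : ℤ × ℤ => f (p.1 + p.2, p.1 - p.2)) a)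
    (h₁ : HasSum (fun p : ℤ × ℤ => f (p.1 + p.2 + 1, p.1 - p.2)) b) : HasSum f (a + b) := by
  let e₀ : ℤ × ℤ → ℤ × ℤ := fun p => (p.1 + p.2, p.1 - p.2)
  let e₁ : ℤ × ℤ → ℤ × ℤ := fun p => (p.1 + p.2 + 1, p.1 - p.2)
  have i₀ : Function.Injective e₀ := by
    rintro ⟨a, b⟩ ⟨c, d⟩ h
    simp only [e₀, Prod.mk.injEq] at h ⊢
    omega
  have i₁ : Function.Injective e₁ := by
    rintro ⟨a, b⟩ ⟨c, d⟩ h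
    simp only [e₁, Prod.mk.injEq] at h ⊢
    omega
  refine (i₀.hasSum_range_iff.2 h₀).add_isCompl ?_ (i₁.hasSum_range_iff.2 h₁)
  refine ⟨Set.disjoint_left.2 ?_, codisjoint_iff.2 ?_⟩
  · rintro _ ⟨⟨a, b⟩, rfl⟩ ⟨⟨c, d⟩, h⟩
    simp only [e₀, e₁, Prod.mk.injEq] at h
    omega
  · ext ⟨m, n⟩
    simp only [Set.sup_eq_union, Set.top_eq_univ, Set.mem_union, Set.mem_range, Set.mem_univ, iff_true]
    rcases Int.emod_two_eq_zero_or_one (m + n) with h | h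
    · exact Or.inl ⟨((m + n) / 2, (m - n) / 2), by simp only [e₀, Prod.mk.injEq]; omega⟩
    · exact Or.inr ⟨((m + n - 1) / 2, (m - n - 1) / 2), by simp only [e₁, Prod.mk.injEq]; omega⟩

lemma two_mul_im_pos (hτ : 0 < τ.im) : 0 < (2 * τ).im := by simpa using hτ

lemma summable_norm_theta (z : ℂ) (hτ : 0 < τ.im) :
    Summable fun n : ℤ => ‖jacobiTheta₂_term n z τ‖ :=
  ((summable_jacobiTheta₂_term_iff z τ).2 hτ).norm

lemma hasSum_theta_mul (u v : ℂ) {τ' : ℂ} (hτ : 0 < τ.im) (hτ' : 0 < τ'.im) :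
    HasSum (fun p : ℤ × ℤ => jacobiTheta₂_term p.1 u τ * jacobiTheta₂_term p.2 v τ')
      (jacobiTheta₂ u τ * jacobiTheta₂ v τ') := by
  have h := summable_mul_of_summable_norm (summable_norm_theta u hτ) (summable_norm_theta v hτ')
  rw [jacobiTheta₂, jacobiTheta₂, tsum_mul_tsum_of_summable_norm (summable_norm_theta u hτ)
    (summable_norm_theta v hτ')]
  exact h.hasSum

/-- The product formula for theta functions. -/
lemma theta_mul_theta (hτ : 0 < τ.im) (u v : ℂ) : jacobiTheta₂ u τ * jacobiTheta₂ v τ =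
    tF τ (u + v) * tF τ (u - v) + tG τ (u + v) * tG τ (u - v) := by
  have h2 := two_mul_im_pos hτ
  refine (hasSum_theta_mul u v hτ hτ).unique (hasSum_parity ?_ ?_)
  · refine (congrArg (HasSum · _) (funext fun p => ?_)).mpr (hasSum_theta_mul (u + v) (u - v) h2 h2)
    simp only [jacobiTheta₂_term, ← Complex.exp_add]
    push_cast
    ring_nf
  · have h := (hasSum_theta_mul (u + v + τ) (u - v + τ) h2 h2).mul_left
      (cexp (π * I * τ / 2 + π * I * (u + v)) * cexp (π * I * τ / 2 + π * I * (u - v)))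
    rw [mul_mul_mul_comm] at h
    refine (congrArg (HasSum · _) (funext fun p => ?_)).mpr h
    simp only [jacobiTheta₂_term, ← Complex.exp_add]
    push_cast
    ring_nf

/-- Equal arguments in `theta_mul_theta`, up to half periods. All four squares lie in the plane
spanned by `tF τ (2 * z)` and `tG τ (2 * z)`; this linear dependence is what puts the theta
functions on an intersection of two quadrics. -/
lemma th1_sq (hτ : 0 < τ.im) (z : ℂ) :
    th1 τ z ^ 2 = tF τ (2 * z) * tG τ 0 - tG τ (2 * z) * tF τ 0 := by
  have h := theta_mul_theta hτ (z + 1 / 2 + τ / 2) (z + 1 / 2 + τ / 2)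
  rw [show z + 1 / 2 + τ / 2 + (z + 1 / 2 + τ / 2) = 2 * z + 1 + τ by ring, sub_self, tF_add_tau,
    tG_add_tau, tF_add_one, tG_add_one, show -(π * I * τ / 2) - π * I * (2 * z + 1) =
    (-(π * I * τ / 2) - π * I * (2 * z) - 2 * π * I) + π * I by ring, exp_pi_I_add,
    Complex.exp_sub _ (2 * π * I), Complex.exp_two_pi_mul_I, div_one] at h
  have he : cexp (π * I * τ / 4 + π * I * z) ^ 2 * cexp (-(π * I * τ / 2) - π * I * (2 * z)) = 1 := by
    rw [sq, ← Complex.exp_add, ← Complex.exp_add]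
    ring_nf
    simp
  unfold th1
  linear_combination (-cexp (π * I * τ / 4 + π * I * z) ^ 2) * h +
    (tF τ (2 * z) * tG τ 0 - tG τ (2 * z) * tF τ 0) * he +
    cexp (π * I * τ / 4 + π * I * z) ^ 2 * jacobiTheta₂ (z + 1 / 2 + τ / 2) τ ^ 2 * Complex.I_sq

lemma th2_sq (hτ : 0 < τ.im) (z : ℂ) :
    th2 τ z ^ 2 = tG τ (2 * z) * tF τ 0 + tF τ (2 * z) * tG τ 0 := by
  have h := theta_mul_theta hτ (z + τ / 2) (z + τ / 2)
  rw [show z + τ / 2 + (z + τ / 2) = 2 * z + τ by ring, sub_self, tF_add_tau, tG_add_tau] at h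
  have he : cexp (π * I * τ / 4 + π * I * z) ^ 2 * cexp (-(π * I * τ / 2) - π * I * (2 * z)) = 1 := by
    rw [sq, ← Complex.exp_add, ← Complex.exp_add]
    ring_nf
    simp
  unfold th2
  linear_combination (cexp (π * I * τ / 4 + π * I * z) ^ 2) * h +
    (tF τ (2 * z) * tG τ 0 + tG τ (2 * z) * tF τ 0) * he

lemma th3_sq (hτ : 0 < τ.im) (z : ℂ) :
    th3 τ z ^ 2 = tF τ (2 * z) * tF τ 0 + tG τ (2 * z) * tG τ 0 := by
  have h := theta_mul_theta hτ z z
  rw [← two_mul, sub_self] at h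
  rw [← h, th3, sq]

lemma th4_sq (hτ : 0 < τ.im) (z : ℂ) :
    th4 τ z ^ 2 = tF τ (2 * z) * tF τ 0 - tG τ (2 * z) * tG τ 0 := by
  have h := theta_mul_theta hτ (z + 1 / 2) (z + 1 / 2)
  rw [show z + 1 / 2 + (z + 1 / 2) = 2 * z + 1 by ring, sub_self, tF_add_one, tG_add_one] at h
  rw [th4, sq, h]
  ring

lemma th1_add_one (z : ℂ) : th1 τ (z + 1) = -th1 τ z := by
  unfold th1
  rw [show z + 1 + 1 / 2 + τ / 2 = z + 1 / 2 + τ / 2 + 1 by ring, jacobiTheta₂_add_left,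
    show π * I * τ / 4 + π * I * (z + 1) = π * I * τ / 4 + π * I * z + π * I by ring, exp_pi_I_add]
  ring

lemma th2_add_one (z : ℂ) : th2 τ (z + 1) = -th2 τ z := by
  unfold th2
  rw [show z + 1 + τ / 2 = z + τ / 2 + 1 by ring, jacobiTheta₂_add_left,
    show π * I * τ / 4 + π * I * (z + 1) = π * I * τ / 4 + π * I * z + π * I by ring, exp_pi_I_add]
  ring

lemma th3_add_one (z : ℂ) : th3 τ (z + 1) = th3 τ z := jacobiTheta₂_add_left _ _

lemma th4_add_one (z : ℂ) : th4 τ (z + 1) = th4 τ z := by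
  unfold th4
  rw [show z + 1 + 1 / 2 = z + 1 / 2 + 1 by ring, jacobiTheta₂_add_left]

/-- The automorphy factor of the theta functions for the period `τ`. -/
def autFactor (τ z : ℂ) : ℂ := cexp (-(π * I * τ) - 2 * π * I * z)

lemma autFactor_ne_zero (z : ℂ) : autFactor τ z ≠ 0 := Complex.exp_ne_zero _

lemma th3_add_tau (z : ℂ) : th3 τ (z + τ) = autFactor τ z * th3 τ z := by
  unfold th3 autFactor
  rw [jacobiTheta₂_add_left']
  ring_nf

lemma th4_add_tau (z : ℂ) : th4 τ (z + τ) = -(autFactor τ z * th4 τ z) := by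
  unfold th4 autFactor
  rw [show z + τ + 1 / 2 = z + 1 / 2 + τ by ring, jacobiTheta₂_add_left',
    show -π * I * (τ + 2 * (z + 1 / 2)) = (-(π * I * τ) - 2 * π * I * z - 2 * π * I) + π * I by ring,
    exp_pi_I_add, Complex.exp_sub _ (2 * π * I), Complex.exp_two_pi_mul_I]
  ring

lemma th2_add_tau (z : ℂ) : th2 τ (z + τ) = autFactor τ z * th2 τ z := by
  unfold th2 autFactor
  rw [show z + τ + τ / 2 = z + τ / 2 + τ by ring, jacobiTheta₂_add_left', ← mul_assoc, ← mul_assoc,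
    ← Complex.exp_add, ← Complex.exp_add]
  ring_nf

lemma th1_add_tau (z : ℂ) : th1 τ (z + τ) = -(autFactor τ z * th1 τ z) := by
  unfold th1 autFactor
  rw [show z + τ + 1 / 2 + τ / 2 = z + 1 / 2 + τ / 2 + τ by ring, jacobiTheta₂_add_left']
  have : cexp (π * I * τ / 4 + π * I * (z + τ)) * cexp (-π * I * (τ + 2 * (z + 1 / 2 + τ / 2))) =
      -(cexp (-(π * I * τ) - 2 * π * I * z) * cexp (π * I * τ / 4 + π * I * z)) := by
    rw [← Complex.exp_add, ← Complex.exp_add, ← exp_sub_pi_I]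
    ring_nf
  linear_combination (-I * jacobiTheta₂ (z + 1 / 2 + τ / 2) τ) * this

lemma th3_neg (z : ℂ) : th3 τ (-z) = th3 τ z := jacobiTheta₂_neg_left _ _

lemma th4_neg (z : ℂ) : th4 τ (-z) = th4 τ z := by
  unfold th4
  rw [← jacobiTheta₂_neg_left, ← jacobiTheta₂_add_left]
  ring_nf

lemma th2_neg (z : ℂ) : th2 τ (-z) = th2 τ z := by
  unfold th2
  rw [← jacobiTheta₂_neg_left, show z + τ / 2 = -(-z + τ / 2) + τ by ring, jacobiTheta₂_add_left',
    ← mul_assoc, ← Complex.exp_add]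
  ring_nf

lemma th1_neg (z : ℂ) : th1 τ (-z) = -th1 τ z := by
  have h : jacobiTheta₂ (z + 1 / 2 + τ / 2) τ =
      -(cexp (-(2 * π * I * z)) * jacobiTheta₂ (-z + 1 / 2 + τ / 2) τ) := by
    rw [show z + 1 / 2 + τ / 2 = -(-z + 1 / 2 + τ / 2) + 1 + τ by ring, jacobiTheta₂_add_left',
      jacobiTheta₂_add_left, jacobiTheta₂_neg_left, ← neg_mul, ← exp_sub_pi_I]
    ring_nf
  have h2 : cexp (π * I * τ / 4 + π * I * -z) =
      cexp (π * I * τ / 4 + π * I * z) * cexp (-(2 * π * I * z)) := by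
    rw [← Complex.exp_add]
    ring_nf
  unfold th1
  rw [h, h2]
  ring

lemma th1_zero : th1 τ 0 = 0 := by
  have := th1_neg (τ := τ) 0
  rw [neg_zero] at this
  exact self_eq_neg.1 this

/-- The odd function `θ₁(2x; 2τ)`. -/
def tS (τ x : ℂ) : ℂ := -tG τ (2 * x + 1 / 2)

/-- The even function `θ₄(2x; 2τ)`. -/
def tT (τ x : ℂ) : ℂ := tF τ (2 * x + 1 / 2)

lemma tT_neg (x : ℂ) : tT τ (-x) = tT τ x := by
  unfold tT
  rw [← tF_neg, ← tF_add_one]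
  ring_nf

lemma tS_neg (x : ℂ) : tS τ (-x) = -tS τ x := by
  unfold tS
  rw [show 2 * x + 1 / 2 = -(2 * -x + 1 / 2) + 1 by ring, tG_add_one, tG_neg, neg_neg]

/-- The product formula separates x from y. As `tS` is odd and `tT` even, comparing y with −y
isolates single products; injectivity of the parametrization, the Wronskian and one of the three
correspondence relations all come from this. -/
lemma th1_mul_th2 (hτ : 0 < τ.im) (x y : ℂ) :
    th1 τ (x + y) * th2 τ (x - y) = tS τ x * tT τ y + tT τ x * tS τ y := by
  have h := theta_mul_theta hτ (x + y + 1 / 2 + τ / 2) (x - y + τ / 2)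
  rw [show x + y + 1 / 2 + τ / 2 + (x - y + τ / 2) = 2 * x + 1 / 2 + τ by ring,
    show x + y + 1 / 2 + τ / 2 - (x - y + τ / 2) = 2 * y + 1 / 2 by ring, tF_add_tau,
    tG_add_tau] at h
  have he : cexp (π * I * τ / 4 + π * I * (x + y)) * cexp (π * I * τ / 4 + π * I * (x - y)) *
      cexp (-(π * I * τ / 2) - π * I * (2 * x + 1 / 2)) = -I := by
    rw [← Complex.exp_add, ← Complex.exp_add]
    have := exp_pi_I_div_two_add (-(π * I / 2))
    rw [neg_add_cancel, Complex.exp_zero] at this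
    ring_nf at this ⊢
    rw [mul_comm I (π : ℂ)] at this ⊢
    linear_combination I * this + cexp (π * I * (-1 / 2)) * Complex.I_sq
  unfold th1 th2 tS tT
  linear_combination (-I * cexp (π * I * τ / 4 + π * I * (x + y)) *
    cexp (π * I * τ / 4 + π * I * (x - y))) * h - I * (tG τ (2 * x + 1 / 2) * tF τ (2 * y + 1 / 2) +
    tF τ (2 * x + 1 / 2) * tG τ (2 * y + 1 / 2)) * he + (tG τ (2 * x + 1 / 2) * tF τ (2 * y + 1 / 2) +
    tF τ (2 * x + 1 / 2) * tG τ (2 * y + 1 / 2)) * Complex.I_sq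

lemma th3_mul_th4 (hτ : 0 < τ.im) (x y : ℂ) :
    th3 τ (x + y) * th4 τ (x - y) = tT τ x * tT τ y - tS τ x * tS τ y := by
  have h := theta_mul_theta hτ (x + y) (x - y + 1 / 2)
  rw [show x + y + (x - y + 1 / 2) = 2 * x + 1 / 2 by ring,
    show x + y - (x - y + 1 / 2) = 2 * y - 1 / 2 by ring, ← tF_add_one (2 * y - 1 / 2),
    ← neg_neg (tG τ (2 * y - 1 / 2)), ← tG_add_one, show 2 * y - 1 / 2 + 1 = 2 * y + 1 / 2 by ring] at h
  unfold th3 th4 tS tT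
  rw [h]
  ring

/-- The auxiliary theta function of the pair of products `θ₁θ₃`, `θ₂θ₄`. -/
def tA (τ x : ℂ) : ℂ := cexp (π * I * τ / 8 + π * I * x) * tF τ (2 * x + 1 / 2 + τ / 2)

/-- The auxiliary theta function of the pair of products `θ₁θ₄`, `θ₂θ₃`. -/
def tB (τ x : ℂ) : ℂ := cexp (π * I * τ / 8 + π * I * x) * tF τ (2 * x + τ / 2)

/-- Translation by τ exchanges `tF` and `tG` up to an exponential, and reflection brings the
argument back to the one in `tA`. So the `tG` terms of the product formula are values of the same
auxiliary function at −x. -/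
lemma tA_neg (x : ℂ) :
    cexp (π * I * τ / 8 + π * I * x) * tG τ (2 * x + 1 / 2 + τ / 2) = -I * tA τ (-x) := by
  have h := tG_add_tau (τ := τ) (2 * x + 1 / 2 - τ / 2)
  rw [show 2 * x + 1 / 2 - τ / 2 + τ = 2 * x + 1 / 2 + τ / 2 by ring, ← tF_neg, ← tF_add_one,
    show -(2 * x + 1 / 2 - τ / 2) + 1 = 2 * -x + 1 / 2 + τ / 2 by ring] at h
  rw [h, tA, ← mul_assoc, ← Complex.exp_add, ← mul_assoc]
  congr 1
  have := exp_pi_I_div_two_add (π * I * τ / 8 + π * I * -x - π * I / 2)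
  rw [sub_add_cancel] at this
  rw [this, ← mul_assoc, neg_mul, Complex.I_mul_I, neg_neg, one_mul]
  ring_nf

lemma tB_neg (x : ℂ) :
    cexp (π * I * τ / 8 + π * I * x) * tG τ (2 * x + τ / 2) = tB τ (-x) := by
  have h := tG_add_tau (τ := τ) (2 * x - τ / 2)
  rw [show 2 * x - τ / 2 + τ = 2 * x + τ / 2 by ring, ← tF_neg,
    show -(2 * x - τ / 2) = 2 * -x + τ / 2 by ring] at h
  rw [h, tB, ← mul_assoc, ← Complex.exp_add]
  ring_nf

lemma exp_split (x y : ℂ) : cexp (π * I * τ / 4 + π * I * (x + y)) =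
    cexp (π * I * τ / 8 + π * I * x) * cexp (π * I * τ / 8 + π * I * y) := by
  rw [← Complex.exp_add]
  ring_nf

lemma th1_mul_th3 (hτ : 0 < τ.im) (x y : ℂ) : th1 τ (x + y) * th3 τ (x - y) =
    -I * (tA τ x * tA τ y - tA τ (-x) * tA τ (-y)) := by
  have h := theta_mul_theta hτ (x + y + 1 / 2 + τ / 2) (x - y)
  rw [show x + y + 1 / 2 + τ / 2 + (x - y) = 2 * x + 1 / 2 + τ / 2 by ring,
    show x + y + 1 / 2 + τ / 2 - (x - y) = 2 * y + 1 / 2 + τ / 2 by ring] at h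
  have hx := tA_neg (τ := τ) x
  have hy := tA_neg (τ := τ) y
  have : tA τ (-x) * tA τ (-y) = -((-I * tA τ (-x)) * (-I * tA τ (-y))) := by
    linear_combination (tA τ (-x) * tA τ (-y)) * Complex.I_sq
  rw [this, ← hx, ← hy]
  unfold th1 th3 tA
  rw [exp_split]
  linear_combination (-I * cexp (π * I * τ / 8 + π * I * x) * cexp (π * I * τ / 8 + π * I * y)) * h

lemma th2_mul_th4 (hτ : 0 < τ.im) (x y : ℂ) : th2 τ (x + y) * th4 τ (x - y) =
    tA τ x * tA τ y + tA τ (-x) * tA τ (-y) := by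
  have h := theta_mul_theta hτ (x + y + τ / 2) (x - y + 1 / 2)
  rw [show x + y + τ / 2 + (x - y + 1 / 2) = 2 * x + 1 / 2 + τ / 2 by ring,
    show x + y + τ / 2 - (x - y + 1 / 2) = 2 * y - 1 / 2 + τ / 2 by ring,
    ← tF_add_one (2 * y - 1 / 2 + τ / 2), ← neg_neg (tG τ (2 * y - 1 / 2 + τ / 2)), ← tG_add_one,
    show 2 * y - 1 / 2 + τ / 2 + 1 = 2 * y + 1 / 2 + τ / 2 by ring] at h
  have hx := tA_neg (τ := τ) x
  have hy := tA_neg (τ := τ) y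
  have : tA τ (-x) * tA τ (-y) = -((-I * tA τ (-x)) * (-I * tA τ (-y))) := by
    linear_combination (tA τ (-x) * tA τ (-y)) * Complex.I_sq
  rw [this, ← hx, ← hy]
  unfold th2 th4 tA
  rw [exp_split]
  linear_combination (cexp (π * I * τ / 8 + π * I * x) * cexp (π * I * τ / 8 + π * I * y)) * h

lemma th1_mul_th4 (hτ : 0 < τ.im) (x y : ℂ) : th1 τ (x + y) * th4 τ (x - y) =
    -I * (tB τ x * tB τ y - tB τ (-x) * tB τ (-y)) := by
  have h := theta_mul_theta hτ (x + y + 1 / 2 + τ / 2) (x - y + 1 / 2)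
  rw [show x + y + 1 / 2 + τ / 2 + (x - y + 1 / 2) = 2 * x + τ / 2 + 1 by ring,
    show x + y + 1 / 2 + τ / 2 - (x - y + 1 / 2) = 2 * y + τ / 2 by ring, tF_add_one,
    tG_add_one] at h
  rw [← tB_neg x, ← tB_neg y]
  unfold th1 th4 tB
  rw [exp_split]
  linear_combination (-I * cexp (π * I * τ / 8 + π * I * x) * cexp (π * I * τ / 8 + π * I * y)) * h

lemma th2_mul_th3 (hτ : 0 < τ.im) (x y : ℂ) : th2 τ (x + y) * th3 τ (x - y) =
    tB τ x * tB τ y + tB τ (-x) * tB τ (-y) := by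
  have h := theta_mul_theta hτ (x + y + τ / 2) (x - y)
  rw [show x + y + τ / 2 + (x - y) = 2 * x + τ / 2 by ring,
    show x + y + τ / 2 - (x - y) = 2 * y + τ / 2 by ring] at h
  rw [← tB_neg x, ← tB_neg y]
  unfold th2 th3 tB
  rw [exp_split]
  linear_combination (cexp (π * I * τ / 8 + π * I * x) * cexp (π * I * τ / 8 + π * I * y)) * h

end Theta

end NC3

end

/-! ### Zeros, reality and positivity of the theta functions -/

noncomputable section

namespace NC3

section ThetaZeros

open Complex Real Filter Topology

variable {τ : ℂ}

lemma differentiable_theta (hτ : 0 < τ.im) : Differentiable ℂ fun z => jacobiTheta₂ z τ :=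
  fun z => differentiableAt_jacobiTheta₂_fst z hτ

lemma differentiable_tF (hτ : 0 < τ.im) : Differentiable ℂ (tF τ) :=
  differentiable_theta (two_mul_im_pos hτ)

lemma differentiable_tG (hτ : 0 < τ.im) : Differentiable ℂ (tG τ) := by
  have := (differentiable_theta (two_mul_im_pos hτ)).comp
    (differentiable_id.add_const τ : Differentiable ℂ fun w : ℂ => w + τ)
  unfold tG
  exact (by fun_prop : Differentiable ℂ fun w : ℂ => cexp (π * I * τ / 2 + π * I * w)).mul this

lemma differentiable_th1 (hτ : 0 < τ.im) : Differentiable ℂ (th1 τ) := by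
  have := (differentiable_theta hτ).comp
    (by fun_prop : Differentiable ℂ fun w : ℂ => w + 1 / 2 + τ / 2)
  unfold th1
  exact (by fun_prop : Differentiable ℂ fun w : ℂ => -I * cexp (π * I * τ / 4 + π * I * w)).mul this

lemma differentiable_th2 (hτ : 0 < τ.im) : Differentiable ℂ (th2 τ) := by
  have := (differentiable_theta hτ).comp (by fun_prop : Differentiable ℂ fun w : ℂ => w + τ / 2)
  unfold th2
  exact (by fun_prop : Differentiable ℂ fun w : ℂ => cexp (π * I * τ / 4 + π * I * w)).mul this

lemma differentiable_th3 (hτ : 0 < τ.im) : Differentiable ℂ (th3 τ) := differentiable_theta hτ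

lemma differentiable_th4 (hτ : 0 < τ.im) : Differentiable ℂ (th4 τ) :=
  (differentiable_theta hτ).comp (by fun_prop : Differentiable ℂ fun w : ℂ => w + 1 / 2)

/-- The difference is 1 − w⁻¹ times the geometric sum of the 2n + 1 powers wⁿ, …, w⁻ⁿ, each of
modulus at most q⁻ⁿ on the annulus. -/
lemma norm_pow_mul_geom_le {w : ℂ} {q : ℝ} (hq : 0 < q) (h₁ : q ≤ ‖w‖) (h₂ : ‖w‖ ≤ q⁻¹) (n : ℕ) :
    ‖w ^ n - w⁻¹ ^ (n + 1)‖ ≤ ‖1 - w⁻¹‖ * ((2 * n + 1) * q⁻¹ ^ n) := by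
  have hw : w ≠ 0 := norm_pos_iff.1 (hq.trans_le h₁)
  have e : w ^ n - w⁻¹ ^ (n + 1) =
      (1 - w⁻¹) * ∑ j ∈ Finset.range (2 * n + 1), w ^ n * w⁻¹ ^ j := by
    rw [← Finset.mul_sum, mul_left_comm, mul_neg_geom_sum, mul_sub, mul_one,
      show 2 * n + 1 = n + (n + 1) by ring, pow_add _ n (n + 1), ← mul_assoc, ← mul_pow, mul_inv_cancel₀ hw,
      one_pow, one_mul]
  rw [e, norm_mul]
  gcongr
  refine (norm_sum_le _ _).trans ?_
  have : ∀ j ∈ Finset.range (2 * n + 1), ‖w ^ n * w⁻¹ ^ j‖ ≤ q⁻¹ ^ n := by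
    intro j hj
    rw [Finset.mem_range] at hj
    have hv : ‖w‖⁻¹ ≤ q⁻¹ := inv_anti₀ hq h₁
    have hp : 0 < ‖w‖ := norm_pos_iff.2 hw
    rw [norm_mul, norm_pow, norm_pow, norm_inv]
    rcases le_total ‖w‖ 1 with h | h
    · calc ‖w‖ ^ n * ‖w‖⁻¹ ^ j ≤ ‖w‖ ^ n * ‖w‖⁻¹ ^ (2 * n) := by
            gcongr
            · exact (one_le_inv₀ hp).2 h
            · omega
        _ = ‖w‖⁻¹ ^ n := by
            rw [two_mul, pow_add, ← mul_assoc, ← mul_pow, mul_inv_cancel₀ hp.ne', one_pow, one_mul]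
        _ ≤ _ := by gcongr
    · calc ‖w‖ ^ n * ‖w‖⁻¹ ^ j ≤ ‖w‖ ^ n * 1 := by
            gcongr
            exact pow_le_one₀ (by positivity) (inv_le_one_of_one_le₀ h)
        _ ≤ _ := by rw [mul_one]; gcongr
  refine (Finset.sum_le_card_nsmul _ _ _ this).trans ?_
  rw [Finset.card_range, nsmul_eq_mul]
  push_cast
  rfl

lemma two_mul_add_one_le_three_pow (n : ℕ) : (2 * n + 1 : ℝ) ≤ 3 ^ n := by
  have := one_add_mul_le_pow (a := (2 : ℝ)) (by norm_num) n
  norm_num at this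
  linarith

/-- At the argument of θ₁ the terms of index n and −(n + 1) have the same Gaussian factor and
opposite signs. Each pair is thus divisible by 1 − w⁻¹ with w = exp(2πiz), which is how the zero at
w = 1 is factored out. -/
lemma theta_pair (z : ℂ) (n : ℕ) :
    jacobiTheta₂_term n (z + 1 / 2 + τ / 2) τ + jacobiTheta₂_term (-(n + 1 : ℤ)) (z + 1 / 2 + τ / 2) τ =
      (-1) ^ n * cexp (π * I * τ) ^ (n ^ 2 + n) *
        (cexp (2 * π * I * z) ^ n - (cexp (2 * π * I * z))⁻¹ ^ (n + 1)) := by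
  have h1 : ∀ k : ℕ, (-1 : ℂ) ^ k = cexp (k * (π * I)) := fun k => by
    rw [Complex.exp_nat_mul, Complex.exp_pi_mul_I]
  rw [mul_sub]
  have h2 : ∀ a b : ℂ, a - b = a + -1 * b := fun a b => by ring
  rw [h2, h1, ← Complex.exp_neg, ← Complex.exp_nat_mul, ← Complex.exp_nat_mul, ← Complex.exp_nat_mul,
    ← Complex.exp_add, ← Complex.exp_add, ← Complex.exp_add]
  have e1 : jacobiTheta₂_term n (z + 1 / 2 + τ / 2) τ = cexp (n * (π * I) +
      ((n ^ 2 + n : ℕ) : ℂ) * (π * I * τ) + n * (2 * π * I * z)) := by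
    unfold jacobiTheta₂_term
    push_cast
    ring_nf
  have e2 : jacobiTheta₂_term (-(n + 1 : ℤ)) (z + 1 / 2 + τ / 2) τ = -1 * cexp (n * (π * I) +
      ((n ^ 2 + n : ℕ) : ℂ) * (π * I * τ) + ((n + 1 : ℕ) : ℂ) * -(2 * π * I * z)) := by
    rw [neg_one_mul, ← exp_sub_pi_I]
    unfold jacobiTheta₂_term
    push_cast
    have := Complex.exp_periodic.int_mul (-n)
      (n * (π * I) + ((n ^ 2 + n : ℂ)) * (π * I * τ) + ((n + 1 : ℂ)) * -(2 * π * I * z) - π * I)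
    rw [← this]
    push_cast
    ring_nf
  rw [e1, e2]

/-- After pairing, the term n = 0 is 1 − w⁻¹ and the others add up to at most 3q/(1 − 3q) < 1 times
its modulus, q = exp(−π Im τ). So a zero forces w = 1. -/
lemma th1_zero_strip (hτ : 1 ≤ τ.im) {z : ℂ} (hz : |z.im| ≤ τ.im / 2) (h : th1 τ z = 0) :
    ∃ n : ℤ, z = n := by
  have hτ0 : 0 < τ.im := by linarith
  set w := cexp (2 * π * I * z) with hw
  set q := rexp (-(π * τ.im)) with hq
  have hq0 : 0 < q := Real.exp_pos _
  have hQ : ‖cexp (π * I * τ)‖ = q := by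
    rw [Complex.norm_exp]
    simp [hq]
  have hwn : ‖w‖ = rexp (-(2 * π * z.im)) := by
    rw [hw, Complex.norm_exp]
    simp
  have hz' := abs_le.1 hz
  have hw1 : q ≤ ‖w‖ := by
    rw [hwn, hq, Real.exp_le_exp]
    nlinarith [Real.pi_pos]
  have hw2 : ‖w‖ ≤ q⁻¹ := by
    rw [hwn, hq, ← Real.exp_neg, Real.exp_le_exp]
    nlinarith [Real.pi_pos]
  -- The 3 comes from the bound 2n + 1 ≤ 3ⁿ for the number of terms of the geometric sum. A ratio
  -- below 1/2 makes the tail smaller than the leading term.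
  have hq6 : 3 * q < 1 / 2 := by
    have h3 : q ≤ rexp (-3) := by
      rw [hq, Real.exp_le_exp]
      nlinarith [Real.pi_gt_three]
    have h4 : rexp (-3) < 1 / 6 := by
      rw [Real.exp_neg, one_div]
      apply inv_strictAnti₀ (by norm_num)
      have : rexp 3 = rexp 1 ^ 3 := by rw [← Real.exp_nat_mul]; norm_num
      rw [this]
      have := Real.exp_one_gt_d9
      calc (6 : ℝ) < 2 ^ 3 := by norm_num
        _ < rexp 1 ^ 3 := by gcongr; linarith
    linarith
  have h0 : jacobiTheta₂ (z + 1 / 2 + τ / 2) τ = 0 := by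
    unfold th1 at h
    simpa [Complex.exp_ne_zero] using h
  have hs := (hasSum_jacobiTheta₂_term (z + 1 / 2 + τ / 2) hτ0).nat_add_neg_add_one
  rw [h0] at hs
  simp only [theta_pair] at hs
  set f : ℕ → ℂ := fun n => (-1) ^ n * cexp (π * I * τ) ^ (n ^ 2 + n) * (w ^ n - w⁻¹ ^ (n + 1)) with hf
  change HasSum f 0 at hs
  have hb : ∀ n, ‖f n‖ ≤ ‖1 - w⁻¹‖ * (3 * q) ^ n := by
    intro n
    rw [hf]
    simp only [norm_mul, norm_pow, norm_neg, norm_one, one_pow, one_mul, hQ]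
    calc q ^ (n ^ 2 + n) * ‖w ^ n - w⁻¹ ^ (n + 1)‖
        ≤ q ^ (n ^ 2 + n) * (‖1 - w⁻¹‖ * ((2 * n + 1) * q⁻¹ ^ n)) := by
          gcongr
          exact norm_pow_mul_geom_le hq0 hw1 hw2 n
      _ = ‖1 - w⁻¹‖ * ((2 * n + 1) * q ^ (n ^ 2)) := by
          rw [pow_add, inv_pow]
          field_simp
      _ ≤ ‖1 - w⁻¹‖ * (3 ^ n * q ^ n) := by
          gcongr ‖1 - w⁻¹‖ * (?_ * ?_)
          · exact two_mul_add_one_le_three_pow n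
          · exact pow_le_pow_of_le_one hq0.le (by linarith) (Nat.le_self_pow (by norm_num) n)
      _ = _ := by rw [mul_pow]
  have hs1 : HasSum (fun n => f (n + 1)) (-f 0) := by
    have := (hasSum_nat_add_iff' 1).2 hs
    simpa using this
  have hg : HasSum (fun n => ‖1 - w⁻¹‖ * (3 * q) ^ (n + 1))
      (‖1 - w⁻¹‖ * ((3 * q) * (1 - 3 * q)⁻¹)) := by
    have := ((hasSum_geometric_of_lt_one (by positivity) (by linarith : 3 * q < 1)).mul_left
      (3 * q)).mul_left ‖1 - w⁻¹‖
    refine (congrArg (HasSum · _) (funext fun n => ?_)).mpr this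
    rw [pow_succ']
  have hle := hs1.norm_le_of_bounded hg fun n => hb (n + 1)
  have hf0 : f 0 = 1 - w⁻¹ := by simp [hf]
  rw [norm_neg, hf0] at hle
  have hlt : 3 * q * (1 - 3 * q)⁻¹ < 1 := by
    rw [← div_eq_mul_inv, div_lt_one (by linarith)]
    linarith
  have hz0 : ‖1 - w⁻¹‖ = 0 := by
    by_contra hne
    have : 0 < ‖1 - w⁻¹‖ := lt_of_le_of_ne (norm_nonneg _) (Ne.symm hne)
    nlinarith
  have hw1' : w = 1 := by
    rw [norm_eq_zero, sub_eq_zero] at hz0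
    exact inv_eq_one.1 hz0.symm
  obtain ⟨n, hn⟩ := Complex.exp_eq_one_iff.1 hw1'
  refine ⟨n, ?_⟩
  have h2 : (2 * π * I : ℂ) ≠ 0 := Complex.two_pi_I_ne_zero
  apply mul_left_cancel₀ h2
  rw [hn]
  ring

lemma th1_add_int_mul_tau (z : ℂ) (m : ℤ) : th1 τ (z + m * τ) = 0 ↔ th1 τ z = 0 := by
  have key : ∀ z : ℂ, th1 τ (z + τ) = 0 ↔ th1 τ z = 0 := fun z => by
    rw [th1_add_tau]
    simp [autFactor_ne_zero]
  induction m using Int.induction_on with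
  | zero => simp
  | succ k ih =>
    have e : z + ((k + 1 : ℤ) : ℂ) * τ = z + ((k : ℤ) : ℂ) * τ + τ := by push_cast; ring
    rw [e, key]
    exact ih
  | pred k ih =>
    refine Iff.trans ?_ ih
    rw [← key]
    push_cast
    ring_nf

lemma th1_add_int (z : ℂ) (m : ℤ) : th1 τ (z + m) = 0 ↔ th1 τ z = 0 := by
  have key : ∀ z : ℂ, th1 τ (z + 1) = 0 ↔ th1 τ z = 0 := fun z => by
    rw [th1_add_one, neg_eq_zero]
  induction m using Int.induction_on with
  | zero => simp
  | succ k ih =>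
    have e : z + ((k + 1 : ℤ) : ℂ) = z + ((k : ℤ) : ℂ) + 1 := by push_cast; ring
    rw [e, key]
    exact ih
  | pred k ih =>
    refine Iff.trans ?_ ih
    rw [← key]
    push_cast
    ring_nf

lemma th1_zero_of_one_le (hτ : 1 ≤ τ.im) {z : ℂ} (h : th1 τ z = 0) : ∃ m n : ℤ, z = m + n * τ := by
  have hτ0 : 0 < τ.im := by linarith
  set m := round (z.im / τ.im)
  have h' : th1 τ (z - m * τ) = 0 := by
    rw [← th1_add_int_mul_tau _ m]
    simpa using h
  obtain ⟨n, hn⟩ := th1_zero_strip hτ (z := z - m * τ) (by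
    have := abs_sub_round (z.im / τ.im)
    have e : (z - m * τ).im = (z.im / τ.im - m) * τ.im := by
      simp
      field_simp
    rw [e, abs_mul, abs_of_pos hτ0]
    nlinarith) h'
  exact ⟨n, m, by rw [← hn]; ring⟩

lemma th1_add_half (z : ℂ) : th1 τ (z + 1 / 2) = th2 τ z := by
  unfold th1 th2
  rw [show z + 1 / 2 + 1 / 2 + τ / 2 = z + τ / 2 + 1 by ring, jacobiTheta₂_add_left,
    show π * I * τ / 4 + π * I * (z + 1 / 2) = π * I * τ / 4 + π * I * z + π * I / 2 by ring,
    exp_pi_I_div_two_add]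
  linear_combination (-cexp (π * I * τ / 4 + π * I * z) * jacobiTheta₂ (z + τ / 2) τ) * Complex.I_sq

lemma th4_add_half (z : ℂ) : th4 τ (z + 1 / 2) = th3 τ z := by
  unfold th4 th3
  rw [add_assoc]
  norm_num
  exact jacobiTheta₂_add_left _ _

lemma th1_add_half_tau (z : ℂ) : th1 τ (z + τ / 2) = 0 ↔ th4 τ z = 0 := by
  unfold th1 th4
  rw [show z + τ / 2 + 1 / 2 + τ / 2 = z + 1 / 2 + τ by ring, jacobiTheta₂_add_left']
  simp [Complex.exp_ne_zero]

lemma th1_two_mul (x : ℂ) : th1 (2 * τ) (2 * x) = tS τ x := by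
  unfold th1 tS tG
  rw [show π * I * τ / 2 + π * I * (2 * x + 1 / 2) = π * I * (2 * τ) / 4 + π * I * (2 * x) +
    π * I / 2 by ring, exp_pi_I_div_two_add]
  ring_nf

lemma lattice_coord (hτ : 0 < τ.im) {a b c d : ℝ} (h : (a + b * τ : ℂ) = c + d * τ) :
    a = c ∧ b = d := by
  have him := congrArg Complex.im h
  simp at him
  have hb : b = d := him.resolve_right hτ.ne'
  subst hb
  exact ⟨by exact_mod_cast add_right_cancel h, rfl⟩

lemma half_not_lattice {a b : ℝ} (hτ : 0 < τ.im) (hab : a = 1 / 2 ∨ b = 1 / 2) (m n : ℤ) :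
    (a + b * τ : ℂ) ≠ m + n * τ := fun h => by
  have h' : (a + b * τ : ℂ) = (m : ℝ) + (n : ℝ) * τ := by exact_mod_cast h
  obtain ⟨h1, h2⟩ := lattice_coord hτ h'
  have key : ∀ k : ℤ, (1 / 2 : ℝ) ≠ k := fun k hk => by
    have : (1 : ℝ) = ((2 * k : ℤ) : ℝ) := by push_cast; linarith
    have : (1 : ℤ) = 2 * k := by exact_mod_cast this
    omega
  rcases hab with h | h
  · exact key m (h ▸ h1)
  · exact key n (h ▸ h2)

lemma tS_zero : tS τ 0 = 0 := by
  have := tS_neg (τ := τ) 0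
  rw [neg_zero] at this
  exact self_eq_neg.1 this

/-- The zeros of `θ₁` are the lattice points. -/
lemma th1_eq_zero (hτ : 0 < τ.im) {z : ℂ} (h : th1 τ z = 0) : ∃ m n : ℤ, z = m + n * τ := by
  -- The strip estimate requires Im τ ≥ 1, and smaller values are reached by doubling τ. The step
  -- back uses θ₁(z; τ)θ₂(z; τ) = θ₁(2z; 2τ) · `tT τ 0`, so that twice a zero for τ is a zero for
  -- 2τ.
  have key : ∀ k : ℕ, ∀ τ : ℂ, 0 < τ.im → 1 ≤ 2 ^ k * τ.im → ∀ z, th1 τ z = 0 →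
      ∃ m n : ℤ, z = m + n * τ := by
    intro k
    induction k with
    | zero => exact fun τ _ h1 z hz => th1_zero_of_one_le (by simpa using h1) hz
    | succ k ih =>
      intro τ hτ h1 z hz
      have hτ2 := two_mul_im_pos hτ
      have ih' := ih (2 * τ) hτ2 (by
        simp only [mul_im, re_ofNat, im_ofNat, zero_mul, add_zero]
        rw [pow_succ] at h1
        linarith)
      have n1 : th1 (2 * τ) (1 / 2) ≠ 0 := fun h0 => by
        obtain ⟨m, n, hmn⟩ := ih' _ h0
        exact half_not_lattice hτ2 (a := 1 / 2) (b := 0) (Or.inl rfl) m n (by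
          push_cast; rw [← hmn]; ring)
      have n2 : th1 (2 * τ) (1 / 2 + τ) ≠ 0 := fun h0 => by
        obtain ⟨m, n, hmn⟩ := ih' _ h0
        exact half_not_lattice hτ2 (a := 1 / 2) (b := 1 / 2) (Or.inl rfl) m n (by
          push_cast; rw [← hmn]; ring)
      have n3 : th1 (2 * τ) τ ≠ 0 := fun h0 => by
        obtain ⟨m, n, hmn⟩ := ih' _ h0
        exact half_not_lattice hτ2 (a := 0) (b := 1 / 2) (Or.inr rfl) m n (by
          push_cast; rw [← hmn]; ring)
      have f0 : tF τ 0 ≠ 0 := by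
        have := (th1_add_half_tau (τ := 2 * τ) (1 / 2)).not.1 (by rwa [show (1 : ℂ) / 2 + 2 * τ / 2 = 1 / 2 + τ by ring])
        have e := th4_add_half (τ := 2 * τ) 0
        rw [zero_add] at e
        rw [e] at this
        exact this
      have f1 : tG τ 0 ≠ 0 := by
        intro h0
        apply n1
        rw [show (1 : ℂ) / 2 = 2 * (1 / 4) by norm_num, th1_two_mul, tS,
          show (2 : ℂ) * (1 / 4) + 1 / 2 = 0 + 1 by norm_num, tG_add_one, h0]
        simp
      have t0 : tT τ 0 ≠ 0 := by
        have := (th1_add_half_tau (τ := 2 * τ) 0).not.1 (by rwa [show (0 : ℂ) + 2 * τ / 2 = τ by ring])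
        simpa [tT, tF, th4] using this
      have hprod := th1_mul_th2 hτ z 0
      rw [add_zero, hz, zero_mul, tS_zero, mul_zero, add_zero] at hprod
      have hS : tS τ z = 0 := (mul_eq_zero.1 hprod.symm).resolve_right t0
      rw [← th1_two_mul] at hS
      obtain ⟨m, n, hmn⟩ := ih' _ hS
      obtain ⟨j, hj | hj⟩ := Int.even_or_odd' m
      · refine ⟨j, n, ?_⟩
        rw [hj] at hmn
        push_cast at hmn
        linear_combination hmn / 2
      -- An odd m would give a zero at 1/2 modulo the lattice, but θ₁(1/2)² = 2 · `tF τ 0` · `tG τ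
      -- 0`, and both factors are nonzero by the case of 2τ.
      · exfalso
        have hz2 : z = 1 / 2 + j + n * τ := by
          rw [hj] at hmn
          push_cast at hmn
          linear_combination hmn / 2
        rw [hz2, th1_add_int_mul_tau, th1_add_int] at hz
        have hsq := th1_sq hτ (1 / 2)
        rw [hz, show (2 : ℂ) * (1 / 2) = 0 + 1 by norm_num, tF_add_one, tG_add_one] at hsq
        have : tF τ 0 * tG τ 0 = 0 := by linear_combination -hsq / 2
        exact (mul_ne_zero f0 f1) this
  obtain ⟨k, hk⟩ := pow_unbounded_of_one_lt (1 / τ.im) (one_lt_two (α := ℝ))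
  exact key k τ hτ (by rw [div_lt_iff₀ hτ] at hk; exact hk.le) z h

lemma th2_eq_zero (hτ : 0 < τ.im) {z : ℂ} (h : th2 τ z = 0) :
    ∃ m n : ℤ, z + 1 / 2 = m + n * τ := th1_eq_zero hτ (by rwa [th1_add_half])

lemma th4_eq_zero (hτ : 0 < τ.im) {z : ℂ} (h : th4 τ z = 0) :
    ∃ m n : ℤ, z + τ / 2 = m + n * τ := th1_eq_zero hτ (by rwa [th1_add_half_tau])

lemma th3_eq_zero (hτ : 0 < τ.im) {z : ℂ} (h : th3 τ z = 0) :
    ∃ m n : ℤ, z + 1 / 2 + τ / 2 = m + n * τ := th4_eq_zero hτ (by rwa [th4_add_half])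

lemma th12_ne (hτ : 0 < τ.im) {z : ℂ} (h1 : th1 τ z = 0) (h2 : th2 τ z = 0) : False := by
  obtain ⟨m, n, h⟩ := th1_eq_zero hτ h1
  obtain ⟨m', n', h'⟩ := th2_eq_zero hτ h2
  exact half_not_lattice hτ (a := 1 / 2) (b := 0) (Or.inl rfl) (m' - m) (n' - n)
    (by push_cast; linear_combination h' - h)

lemma th34_ne (hτ : 0 < τ.im) {z : ℂ} (h1 : th3 τ z = 0) (h2 : th4 τ z = 0) : False := by
  obtain ⟨m, n, h⟩ := th3_eq_zero hτ h1
  obtain ⟨m', n', h'⟩ := th4_eq_zero hτ h2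
  exact half_not_lattice hτ (a := 1 / 2) (b := 0) (Or.inl rfl) (m - m') (n - n')
    (by push_cast; linear_combination h - h')

lemma th3_ofReal_ne (hτ : 0 < τ.im) (x : ℝ) : th3 τ x ≠ 0 := fun h => by
  obtain ⟨m, n, h⟩ := th3_eq_zero hτ h
  exact half_not_lattice hτ (a := x + 1 / 2) (b := 1 / 2) (Or.inr rfl) m n
    (by push_cast; linear_combination h)

lemma th4_ofReal_ne (hτ : 0 < τ.im) (x : ℝ) : th4 τ x ≠ 0 := fun h => by
  obtain ⟨m, n, h⟩ := th4_eq_zero hτ h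
  exact half_not_lattice hτ (a := x) (b := 1 / 2) (Or.inr rfl) m n
    (by push_cast; linear_combination h)

lemma tT_zero_ne (hτ : 0 < τ.im) : tT τ 0 ≠ 0 := by
  have := th4_ofReal_ne (two_mul_im_pos hτ) 0
  simpa [tT, tF, th4] using this

lemma tS_eq_zero (hτ : 0 < τ.im) {y : ℂ} (h : tS τ y = 0) : ∃ m n : ℤ, 2 * y = m + n * (2 * τ) :=
  th1_eq_zero (two_mul_im_pos hτ) (by rwa [th1_two_mul])

lemma tT_tS_ne (hτ : 0 < τ.im) {y : ℂ} (h1 : tT τ y = 0) (h2 : tS τ y = 0) : False := by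
  obtain ⟨m, n, h⟩ := tS_eq_zero hτ h2
  have h4 : th4 (2 * τ) (2 * y) = 0 := by simpa [tT, tF, th4] using h1
  obtain ⟨m', n', h'⟩ := th4_eq_zero (two_mul_im_pos hτ) h4
  exact half_not_lattice (two_mul_im_pos hτ) (a := 0) (b := 1 / 2) (Or.inr rfl) (m' - m) (n' - n)
    (by push_cast; linear_combination h' - h)

lemma conj_theta {t : ℝ} (z : ℂ) :
    (starRingEnd ℂ) (jacobiTheta₂ z (t * I)) = jacobiTheta₂ ((starRingEnd ℂ) z) (t * I) := by
  rw [jacobiTheta₂_conj]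
  simp

lemma conj_th3 {t : ℝ} (z : ℂ) :
    (starRingEnd ℂ) (th3 (t * I) z) = th3 (t * I) ((starRingEnd ℂ) z) := conj_theta z

lemma conj_th4 {t : ℝ} (z : ℂ) :
    (starRingEnd ℂ) (th4 (t * I) z) = th4 (t * I) ((starRingEnd ℂ) z) := by
  unfold th4
  rw [conj_theta]
  simp [map_ofNat (starRingEnd ℂ) 2]

lemma conj_th2 {t : ℝ} (z : ℂ) :
    (starRingEnd ℂ) (th2 (t * I) z) = th2 (t * I) ((starRingEnd ℂ) z) := by
  unfold th2
  rw [map_mul, conj_theta, ← Complex.exp_conj]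
  simp only [map_add, map_mul, map_div₀, conj_ofReal, conj_I, map_ofNat]
  rw [show (starRingEnd ℂ) z + t * -I / 2 = (starRingEnd ℂ) z - t * I / 2 by ring,
    show (starRingEnd ℂ) z + t * I / 2 = (starRingEnd ℂ) z - t * I / 2 + t * I by ring,
    jacobiTheta₂_add_left']
  conv_rhs => rw [← mul_assoc, ← Complex.exp_add]
  congr 2
  ring

lemma conj_th1 {t : ℝ} (z : ℂ) :
    (starRingEnd ℂ) (th1 (t * I) z) = th1 (t * I) ((starRingEnd ℂ) z) := by
  have := conj_th2 (t := t) (z - 1 / 2)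
  rw [← th1_add_half, ← th1_add_half] at this
  simpa [map_ofNat (starRingEnd ℂ) 2] using this

/-- For a purely imaginary modulus all terms of both series are positive. -/
lemma tF_tG_pos {t : ℝ} (ht : 0 < t) :
    ∃ p q : ℝ, 0 < p ∧ 0 < q ∧ tF (t * I) 0 = p ∧ tG (t * I) 0 = q := by
  have key : ∀ s T : ℝ, 0 < T → ∃ p : ℝ, 0 < p ∧ jacobiTheta₂ (s * I) (T * I) = p := by
    intro s T hT
    have e : ∀ n : ℤ, jacobiTheta₂_term n (s * I) (T * I) =
        ((rexp (-2 * π * n * s - π * n ^ 2 * T) : ℝ) : ℂ) := fun n => by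
      unfold jacobiTheta₂_term
      push_cast
      congr 1
      linear_combination (2 * π * n * s + π * n ^ 2 * T) * Complex.I_sq
    have hs := (summable_jacobiTheta₂_term_iff (s * I) (T * I)).2 (by simpa using hT)
    simp only [e] at hs
    have hs' := Complex.summable_ofReal.1 hs
    refine ⟨_, hs'.tsum_pos (fun n => (Real.exp_pos _).le) 0 (Real.exp_pos _), ?_⟩
    unfold jacobiTheta₂
    simp only [e]
    rw [Complex.ofReal_tsum]
  obtain ⟨p, hp, hp'⟩ := key 0 (2 * t) (by positivity)
  obtain ⟨q, hq, hq'⟩ := key t (2 * t) (by positivity)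
  refine ⟨p, rexp (-(π * t / 2)) * q, hp, by positivity, ?_, ?_⟩
  · unfold tF
    rw [← hp']
    push_cast
    ring_nf
  · unfold tG
    push_cast
    rw [← hq']
    push_cast
    ring_nf
    simp
    ring_nf

end ThetaZeros

end NC3

end

/-! ### Theta constants as functions of t, the Wronskian, and zeros of combinations of squares -/

noncomputable section

namespace NC3

section ThetaConstants

open Complex Real Filter Topology

/-- The square of the ratio of the theta constants `θ₂(0; 2it)`, `θ₃(0; 2it)`. -/
def thetaRatio (t : ℝ) : ℝ := (tG (t * I) 0).re ^ 2 / (tF (t * I) 0).re ^ 2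

lemma tendsto_theta_zero : Tendsto (fun t : ℝ => jacobiTheta₂ 0 (t * I)) atTop (𝓝 1) := by
  rw [tendsto_iff_norm_sub_tendsto_zero]
  have h1 : Tendsto (fun t : ℝ => rexp (-π * t)) atTop (𝓝 0) :=
    Real.tendsto_exp_atBot.comp (tendsto_id.const_mul_atTop_of_neg (by linarith [Real.pi_pos]))
  have h2 : Tendsto (fun t : ℝ => 2 / (1 - rexp (-π * t)) * rexp (-π * t)) atTop
      (𝓝 (2 / (1 - 0) * 0)) :=
    ((tendsto_const_nhds.div (tendsto_const_nhds.sub h1) (by norm_num))).mul h1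
  rw [mul_zero] at h2
  refine squeeze_zero' (Eventually.of_forall fun _ => norm_nonneg _) ?_ h2
  filter_upwards [eventually_gt_atTop 0] with t ht
  have := norm_jacobiTheta_sub_one_le (τ := t * I) (by simpa using ht)
  rw [jacobiTheta_eq_jacobiTheta₂] at this
  simpa using this

lemma mul_I_im_pos {t : ℝ} (ht : 0 < t) : 0 < ((t : ℂ) * I).im := by simpa using ht

lemma tendsto_tF_zero : Tendsto (fun t : ℝ => (tF (t * I) 0).re) atTop (𝓝 1) := by
  have h := tendsto_theta_zero.comp (tendsto_id.const_mul_atTop (two_pos : (0 : ℝ) < 2))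
  have := (continuous_re.tendsto _).comp h
  simp only [one_re] at this
  refine this.congr fun t => ?_
  simp [tF, mul_assoc]

lemma thetaRatio_eq {t : ℝ} (ht : 0 < t) :
    thetaRatio t = (th3 (t * I) 0).re ^ 2 / (tF (t * I) 0).re ^ 2 - 1 := by
  obtain ⟨p, q, hp, hq, e1, e2⟩ := tF_tG_pos ht
  have h := th3_sq (mul_I_im_pos ht) 0
  have hr : (th3 (t * I) 0).im = 0 := by
    rw [← conj_eq_iff_im, conj_th3, map_zero]
  rw [mul_zero, e1, e2, ← re_add_im (th3 (t * I) 0), hr] at h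
  have h' : (th3 (t * I) 0).re ^ 2 = p ^ 2 + q ^ 2 := by
    simp only [ofReal_zero, zero_mul, add_zero] at h
    have : ((th3 (t * I) 0).re ^ 2 : ℝ) = p * p + q * q := by exact_mod_cast h
    rw [this]; ring
  rw [thetaRatio, h', e1, e2, ofReal_re, ofReal_re]
  field_simp
  ring

lemma tendsto_thetaRatio : Tendsto thetaRatio atTop (𝓝 0) := by
  have h3 : Tendsto (fun t : ℝ => (th3 (t * I) 0).re) atTop (𝓝 1) := by
    have := (continuous_re.tendsto _).comp tendsto_theta_zero
    rwa [one_re] at this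
  have := ((h3.pow 2).div (tendsto_tF_zero.pow 2) (by norm_num)).sub_const 1
  norm_num at this
  refine this.congr' ?_
  filter_upwards [eventually_gt_atTop 0] with t ht
  rw [thetaRatio_eq ht]

/-- The functional equation sends the modulus 2it to is with s = 1/(2t), and turns the two constants
into the same multiple of θ₃(0; is) and θ₄(0; is), whose squares are p'² + q'² and p'² − q'². -/
lemma thetaRatio_inv {t : ℝ} (ht : 0 < t) :
    thetaRatio t = (1 - thetaRatio (1 / (2 * t))) / (1 + thetaRatio (1 / (2 * t))) := by
  set s := 1 / (2 * t) with hs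
  have hs0 : 0 < s := by positivity
  obtain ⟨p, q, hp, hq, e1, e2⟩ := tF_tG_pos ht
  obtain ⟨p', q', hp', hq', e1', e2'⟩ := tF_tG_pos hs0
  have htC : (t : ℂ) ≠ 0 := by exact_mod_cast ht.ne'
  have hτ : -1 / (2 * ((t : ℂ) * I)) = s * I := by
    rw [hs]
    push_cast
    field_simp
    linear_combination -Complex.I_sq
  have hF := jacobiTheta₂_functional_equation 0 (2 * (t * I))
  have hG := jacobiTheta₂_functional_equation (t * I) (2 * (t * I))
  rw [hτ] at hF hG
  have hz : (t : ℂ) * I / (2 * (t * I)) = 0 + 1 / 2 := by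
    have := I_ne_zero
    field_simp
    simp
  rw [hz] at hG
  set C := 1 / (-I * (2 * ((t : ℂ) * I))) ^ (1 / 2 : ℂ) with hC
  have hF' : (p : ℂ) = C * th3 (s * I) 0 := by
    rw [← e1, tF, hF, th3]
    simp
  have hG' : (q : ℂ) = C * th4 (s * I) 0 := by
    rw [← e2, tG, zero_add, hG, th4, ← mul_assoc, mul_comm (cexp _), mul_assoc C, ← Complex.exp_add]
    have : -π * I * (t * I) ^ 2 / (2 * (t * I)) + (π * I * (t * I) / 2 + π * I * 0) = 0 := by
      have := I_ne_zero
      field_simp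
      ring
    rw [this, Complex.exp_zero, mul_one]
  have h3 := th3_sq (mul_I_im_pos hs0) 0
  have h4 := th4_sq (mul_I_im_pos hs0) 0
  rw [mul_zero, e1', e2'] at h3 h4
  have key : (q : ℂ) ^ 2 * (p' ^ 2 + q' ^ 2) = p ^ 2 * (p' ^ 2 - q' ^ 2) := by
    rw [hF', hG', mul_pow, mul_pow, h3, h4]
    ring
  have key' : q ^ 2 * (p' ^ 2 + q' ^ 2) = p ^ 2 * (p' ^ 2 - q' ^ 2) := by exact_mod_cast key
  simp only [thetaRatio, e1, e2, e1', e2', ofReal_re]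
  field_simp
  exact key'

lemma continuousOn_thetaRatio : ContinuousOn thetaRatio (Set.Ioi 0) := by
  intro t ht
  have ht : 0 < t := ht
  have h2 := two_mul_im_pos (mul_I_im_pos ht)
  have c : ∀ z : ℝ → ℂ, Continuous z →
      ContinuousAt (fun t : ℝ => jacobiTheta₂ (z t) (2 * ((t : ℂ) * I))) t := fun z hz =>
    ContinuousAt.comp (f := fun t : ℝ => (z t, 2 * ((t : ℂ) * I)))
      (continuousAt_jacobiTheta₂ (z t) h2) (by fun_prop)
  obtain ⟨p, q, hp, hq, e1, e2⟩ := tF_tG_pos ht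
  have cF : ContinuousAt (fun t : ℝ => tF (t * I) 0) t := c (fun _ => 0) continuous_const
  have cG : ContinuousAt (fun t : ℝ => tG (t * I) 0) t := by
    have h := c (fun t => 0 + t * I) (by fun_prop)
    have h' : ContinuousAt (fun t : ℝ => cexp (π * I * (t * I) / 2 + π * I * 0)) t := by fun_prop
    exact h'.mul h
  refine ContinuousAt.continuousWithinAt ?_
  exact ((continuous_re.continuousAt.comp cG).pow 2).div ((continuous_re.continuousAt.comp cF).pow 2)
    (by simp [e1, hp.ne'])

/-- The ratio tends to 0 as t → ∞ and, by `thetaRatio_inv`, to 1 as t → 0. The intermediate value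
theorem gives everything between. -/
lemma exists_thetaRatio {ρ : ℝ} (h0 : 0 < ρ) (h1 : ρ < 1) : ∃ t, 0 < t ∧ thetaRatio t = ρ := by
  obtain ⟨t₁, ht₁, hr₁⟩ := ((tendsto_thetaRatio.eventually (gt_mem_nhds h0)).and
    (eventually_gt_atTop 0)).exists
  have hlim : Tendsto (fun s => (1 - thetaRatio s) / (1 + thetaRatio s)) atTop
      (𝓝 ((1 - 0) / (1 + 0))) :=
    (tendsto_const_nhds.sub tendsto_thetaRatio).div (tendsto_const_nhds.add tendsto_thetaRatio)
      (by norm_num)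
  rw [sub_zero, add_zero, div_one] at hlim
  obtain ⟨s, hs, hs0⟩ := ((hlim.eventually (lt_mem_nhds h1)).and (eventually_gt_atTop 0)).exists
  have ht₂ : 0 < 1 / (2 * s) := by positivity
  have hr₂ := thetaRatio_inv ht₂
  rw [show 1 / (2 * (1 / (2 * s))) = s by field_simp] at hr₂
  obtain ⟨t, ht, hr⟩ := isPreconnected_Ioi.intermediate_value (show t₁ ∈ Set.Ioi (0 : ℝ) from hr₁)
    (show 1 / (2 * s) ∈ Set.Ioi (0 : ℝ) from ht₂) continuousOn_thetaRatio
    (show ρ ∈ Set.Icc (thetaRatio t₁) (thetaRatio (1 / (2 * s))) from ⟨ht₁.le, by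
      rw [hr₂]; exact hs.le⟩)
  exact ⟨t, ht, hr⟩

/-- With r = q²/p² the equation is ((1 − r)/(1 + r))² = K, solved by r = (1 − √K)/(1 + √K), which
lies in (0, 1). -/
lemma exists_theta_constants {K : ℝ} (h0 : 0 < K) (h1 : K < 1) :
    ∃ t p q : ℝ, 0 < t ∧ 0 < p ∧ 0 < q ∧ q < p ∧ tF (t * I) 0 = p ∧ tG (t * I) 0 = q ∧
      (p ^ 2 - q ^ 2) ^ 2 = K * (p ^ 2 + q ^ 2) ^ 2 := by
  have hs0 : 0 < √K := Real.sqrt_pos.2 h0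
  have hs1 : √K < 1 := by rw [Real.sqrt_lt' one_pos]; simpa using h1
  have hsq := Real.sq_sqrt h0.le
  have hρ1 : (1 - √K) / (1 + √K) < 1 := by rw [div_lt_one (by positivity)]; linarith
  obtain ⟨t, ht, hr⟩ := exists_thetaRatio (ρ := (1 - √K) / (1 + √K))
    (div_pos (by linarith) (by linarith)) hρ1
  obtain ⟨p, q, hp, hq, e1, e2⟩ := tF_tG_pos ht
  rw [thetaRatio, e1, e2, ofReal_re, ofReal_re] at hr
  have hpq : q ^ 2 < p ^ 2 := by
    rw [← hr, div_lt_one (by positivity)] at hρ1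
    exact hρ1
  refine ⟨t, p, q, ht, hp, hq, lt_of_pow_lt_pow_left₀ 2 hp.le hpq, e1, e2, ?_⟩
  rw [div_eq_div_iff (by positivity) (by positivity)] at hr
  have : p ^ 2 - q ^ 2 = √K * (p ^ 2 + q ^ 2) := by linarith
  rw [this, mul_pow, hsq]

variable {τ : ℂ}

lemma eq_zero_of_mul_eq_zero {f g : ℂ → ℂ} (hf : Differentiable ℂ f) (hg : Differentiable ℂ g)
    {z₀ : ℂ} (h₀ : f z₀ ≠ 0) (h : ∀ z, f z * g z = 0) (z : ℂ) : g z = 0 := by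
  have ha : AnalyticOnNhd ℂ g Set.univ := hg.differentiableOn.analyticOnNhd isOpen_univ
  have hev : g =ᶠ[𝓝 z₀] 0 := by
    filter_upwards [hf.continuous.continuousAt.eventually_ne h₀] with w hw
    exact (mul_eq_zero.1 (h w)).resolve_left hw
  exact ha.eqOn_zero_of_preconnected_of_eventuallyEq_zero isPreconnected_univ trivial hev trivial

lemma differentiable_tS (hτ : 0 < τ.im) : Differentiable ℂ (tS τ) :=
  ((differentiable_tG hτ).comp (by fun_prop : Differentiable ℂ fun x : ℂ => 2 * x + 1 / 2)).neg

lemma differentiable_tT (hτ : 0 < τ.im) : Differentiable ℂ (tT τ) :=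
  (differentiable_tF hτ).comp (by fun_prop : Differentiable ℂ fun x : ℂ => 2 * x + 1 / 2)

/-- Differentiating `th1_mul_th2` in y at 0 gives `tT τ x` times the derivative of `tS` at 0, since
`tT` is even; and θ₃θ₄ is `tT τ x` times `tT τ 0`. If the derivative of `tS` vanished at 0, then
θ₁/θ₂ would be constant near 0, hence θ₁ identically zero. -/
lemma th_wronskian (hτ : 0 < τ.im) : ∃ κ : ℂ, κ ≠ 0 ∧ ∀ x,
    deriv (th1 τ) x * th2 τ x - th1 τ x * deriv (th2 τ) x = κ * (th3 τ x * th4 τ x) := by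
  have d1 := differentiable_th1 hτ
  have d2 := differentiable_th2 hτ
  have dS := differentiable_tS hτ
  have dT := differentiable_tT hτ
  have hT0 : deriv (tT τ) 0 = 0 := by
    have h := deriv_comp_neg (f := tT τ) (x := 0)
    rw [funext tT_neg, neg_zero] at h
    exact self_eq_neg.1 h
  have hW : ∀ x, deriv (th1 τ) x * th2 τ x - th1 τ x * deriv (th2 τ) x =
      tT τ x * deriv (tS τ) 0 := by
    intro x
    have hl : HasDerivAt (fun y => th1 τ (x + y) * th2 τ (x - y))
        (deriv (th1 τ) x * th2 τ x + th1 τ x * (-deriv (th2 τ) x)) 0 := by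
      have a1 : HasDerivAt (fun y => th1 τ (x + y)) (deriv (th1 τ) x) 0 := by
        have := (d1 (x + 0)).hasDerivAt.comp_const_add x 0
        simpa using this
      have a2 : HasDerivAt (fun y => th2 τ (x - y)) (-deriv (th2 τ) x) 0 := by
        have := (d2 (x - 0)).hasDerivAt.comp_const_sub x 0
        simpa using this
      have := a1.fun_mul a2
      simpa using this
    have hr : HasDerivAt (fun y => tS τ x * tT τ y + tT τ x * tS τ y)
        (tS τ x * deriv (tT τ) 0 + tT τ x * deriv (tS τ) 0) 0 :=
      ((dT 0).hasDerivAt.const_mul _).add ((dS 0).hasDerivAt.const_mul _)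
    rw [← funext fun y => th1_mul_th2 hτ x y] at hr
    have := hl.unique hr
    rw [hT0] at this
    linear_combination this
  have hT : ∀ x, th3 τ x * th4 τ x = tT τ x * tT τ 0 := fun x => by
    have := th3_mul_th4 hτ x 0
    rw [tS_zero] at this
    simpa using this
  refine ⟨deriv (tS τ) 0 / tT τ 0, ?_, fun x => ?_⟩
  · refine div_ne_zero (fun h0 => ?_) (tT_zero_ne hτ)
    have h20 : th2 τ 0 ≠ 0 := fun h => th12_ne hτ th1_zero h
    obtain ⟨r, hr, hball⟩ := Metric.eventually_nhds_iff_ball.1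
      (d2.continuous.continuousAt.eventually_ne h20)
    have hconst : ∀ y ∈ Metric.ball (0 : ℂ) r, th1 τ y / th2 τ y = th1 τ 0 / th2 τ 0 := by
      intro y hy
      refine (Metric.isOpen_ball).is_const_of_deriv_eq_zero
        (convex_ball (0 : ℂ) r).isPreconnected
        (f := fun y => th1 τ y / th2 τ y) (fun y hy => ?_) (fun y hy => ?_) hy
        (Metric.mem_ball_self hr)
      · exact ((d1 y).div (d2 y) (hball y hy)).differentiableWithinAt
      · rw [deriv_fun_div (d1 y) (d2 y) (hball y hy), hW, h0]
        simp
    have hz : th1 τ ((r / 2 : ℝ) : ℂ) = 0 := by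
      have := hconst ((r / 2 : ℝ) : ℂ) (by simp [abs_of_pos hr]; linarith)
      rw [th1_zero, zero_div, div_eq_zero_iff] at this
      exact this.resolve_right (hball _ (by simp [abs_of_pos hr]; linarith))
    have h1z : ∀ z, th1 τ z = 0 := by
      intro z
      have ha : AnalyticOnNhd ℂ (th1 τ) Set.univ := d1.differentiableOn.analyticOnNhd isOpen_univ
      refine ha.eqOn_zero_of_preconnected_of_eventuallyEq_zero isPreconnected_univ
        (Set.mem_univ (0 : ℂ)) ?_ trivial
      filter_upwards [Metric.ball_mem_nhds (0 : ℂ) hr] with y hy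
      have := hconst y hy
      rw [th1_zero, zero_div, div_eq_zero_iff] at this
      exact this.resolve_right (hball _ hy)
    obtain ⟨m, n, h⟩ := th1_eq_zero hτ (h1z (1 / 2))
    exact half_not_lattice hτ (a := 1 / 2) (b := 0) (Or.inl rfl) m n (by
      push_cast; linear_combination h)
  · rw [hW, hT]
    field_simp [tT_zero_ne hτ]

/-- A combination of `θ₁²` and `θ₂²` has a zero. -/
lemma exists_zero_comb (hτ : 0 < τ.im) (A B : ℂ) : ∃ z, A * th1 τ z ^ 2 + B * th2 τ z ^ 2 = 0 := by
  by_contra! hne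
  set f : ℂ → ℂ := fun z => A * th1 τ z ^ 2 + B * th2 τ z ^ 2 with hf
  have df : Differentiable ℂ f :=
    ((differentiable_th1 hτ).pow 2).const_mul A |>.add (((differentiable_th2 hτ).pow 2).const_mul B)
  have f1 : ∀ z, f (z + 1) = f z := fun z => by
    simp only [hf, th1_add_one, th2_add_one]
    ring
  have f2 : ∀ z, f (z + τ) = autFactor τ z ^ 2 * f z := fun z => by
    simp only [hf, th1_add_tau, th2_add_tau]
    ring
  -- Without zeros the logarithmic derivative g is entire, with g(z + 1) = g(z) and g(z + τ) = g(z)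
  -- − 4πi. Its derivative is doubly periodic, hence constant, so g is affine; the period 1 makes it
  -- constant, against the second relation.
  set g : ℂ → ℂ := fun z => deriv f z / f z with hg
  have dg : Differentiable ℂ g := df.deriv.div df hne
  have g1 : ∀ z, g (z + 1) = g z := fun z => by
    have : deriv f (z + 1) = deriv f z := by
      rw [← deriv_comp_add_const, funext f1]
    simp only [hg, this, f1]
  have g2 : ∀ z, g (z + τ) = g z - 4 * π * I := fun z => by
    have h1 : HasDerivAt (fun w => f (w + τ)) (deriv f (z + τ)) z :=
      (df (z + τ)).hasDerivAt.comp_add_const z τ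
    have h2 : HasDerivAt (autFactor τ) (autFactor τ z * (-(2 * π * I))) z := by
      have : HasDerivAt (fun z : ℂ => -(π * I * τ) - 2 * π * I * z) (-(2 * π * I)) z := by
        have := ((hasDerivAt_id z).const_mul (2 * π * I : ℂ)).const_sub (-(π * I * τ))
        simpa using this
      exact this.cexp
    have h3 := (h2.pow 2).mul (df z).hasDerivAt
    rw [funext f2] at h1
    have h4 := h1.unique h3
    simp only [hg, f2, h4]
    have := hne z
    have h5 : f z ≠ 0 := this
    have h6 := autFactor_ne_zero (τ := τ) z
    simp only [Pi.pow_apply]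
    field_simp
    ring
  have dg' := dg.deriv
  have e1 : ∀ z, deriv g (z + 1) = deriv g z := fun z => by
    rw [← deriv_comp_add_const, funext g1]
  have e2 : ∀ z, deriv g (z + τ) = deriv g z := fun z => by
    rw [← deriv_comp_add_const, funext g2, deriv_sub_const]
  obtain ⟨κ, hκ⟩ : ∃ κ, ∀ z, deriv g z = κ := by
    refine dg'.exists_const_forall_eq_of_bounded ?_
    have e1' : ∀ (z : ℂ) (m : ℤ), deriv g (z + m) = deriv g z := fun z m => by
      have hp : Function.Periodic (deriv g) 1 := e1
      simpa using hp.int_mul m z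
    have e2' : ∀ (z : ℂ) (m : ℤ), deriv g (z + m * τ) = deriv g z := fun z m => by
      have hp : Function.Periodic (deriv g) τ := e2
      exact hp.int_mul m z
    have hK : IsCompact ((fun p : ℝ × ℝ => (p.1 + p.2 * τ : ℂ)) ''
        (Set.Icc (0 : ℝ) 1 ×ˢ Set.Icc (0 : ℝ) 1)) :=
      (isCompact_Icc.prod isCompact_Icc).image (by fun_prop)
    refine ((hK.image dg'.continuous).isBounded).subset ?_
    rintro _ ⟨z, rfl⟩
    set b := z.im / τ.im with hb
    set a := z.re - b * τ.re with ha
    have hz : z = a + b * τ := by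
      apply Complex.ext
      · simp [ha]
      · simp [hb, hτ.ne']
    refine ⟨_, ⟨(Int.fract a, Int.fract b), ⟨⟨Int.fract_nonneg _, (Int.fract_lt_one _).le⟩,
      ⟨Int.fract_nonneg _, (Int.fract_lt_one _).le⟩⟩, rfl⟩, ?_⟩
    rw [← e1' _ ⌊a⌋, ← e2' _ ⌊b⌋, hz]
    congr 1
    have h1 : (a : ℂ) = (⌊a⌋ : ℂ) + (Int.fract a : ℝ) := by exact_mod_cast (Int.floor_add_fract a).symm
    have h2 : (b : ℂ) = (⌊b⌋ : ℂ) + (Int.fract b : ℝ) := by exact_mod_cast (Int.floor_add_fract b).symm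
    rw [h1, h2]
    push_cast
    ring
  have hlin : ∀ z, g z - κ * z = g 0 := by
    intro z
    have := is_const_of_deriv_eq_zero (f := fun z => g z - κ * z)
      (dg.sub (differentiable_id.const_mul κ)) (fun w => by
        have : HasDerivAt (fun z => g z - κ * z) (deriv g w - κ * 1) w :=
          (dg w).hasDerivAt.sub ((hasDerivAt_id w).const_mul κ)
        rw [this.deriv, hκ]
        ring) z 0
    simpa using this
  have k1 : κ = 0 := by
    have h1 := hlin 1
    have h2 := g1 0
    rw [zero_add] at h2
    linear_combination h2 - h1
  have h3 := hlin τ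
  have h4 := g2 0
  rw [zero_add] at h4
  rw [k1] at h3
  have : (4 * π * I : ℂ) = 0 := by linear_combination h4 - h3
  simp [Real.pi_ne_zero] at this

end ThetaConstants

end NC3

end

/-! ### Parametrization of the curve by theta functions -/

noncomputable section

namespace NC3

section ThetaData

open Complex Real Filter Topology

/-- The equations of the curve with parameters `s`. -/
def OnC (s : Fin 3 → ℝ) (v : Fin 4 → ℂ) : Prop :=
  ∀ k l : Fin 3, (s l : ℂ) * (v 0 ^ 2 - v k.succ ^ 2) = (s k : ℂ) * (v 0 ^ 2 - v l.succ ^ 2)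

/-- A parametrization of the cone over the curve with parameters `s` by theta functions with the
period lattice `2ℤ + 2itℤ`, together with a real parameter of the point `(1, 1, 1, 1)`. -/
structure ThetaData (s : Fin 3 → ℝ) where
  t : ℝ
  t_pos : 0 < t
  Z : ℂ → Fin 4 → ℂ
  z₀ : ℝ
  diff : ∀ i, Differentiable ℂ fun z => Z z i
  on : ∀ z, OnC s (Z z)
  ne : ∀ z, Z z ≠ 0
  per : ∀ z, Z (z + 2) = Z z
  qper : ∀ z, Z (z + 2 * (t * I)) = cexp (-(4 * π * I * (z + t * I))) • Z z
  conj : ∀ z i, (starRingEnd ℂ) (Z z i) = Z ((starRingEnd ℂ) z) i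
  half : ∃ ε : Fin 4 → ℝ, ∀ z i, Z (z + t * I) i = autFactor (t * I) z * ε i * Z z i
  neg_zero : ∀ z, Z (-z) 0 = -Z z 0
  neg_succ : ∀ z k, Z (-z) (Fin.succ k) = Z z (Fin.succ k)
  inj : ∀ (z w c : ℂ), Z z = c • Z w → ∃ m n : ℤ, z - w = 2 * m + 2 * n * (t * I)
  surj : ∀ v, OnC s v → ∃ z c : ℂ, v = c • Z z
  spec : ∃ c : ℂ, c ≠ 0 ∧ ∀ i, Z z₀ i = c
  corr : ∀ x (k l m : Fin 3), k ≠ l → l ≠ m → m ≠ k →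
    Z (x + z₀) 0 * Z (x - z₀) k.succ - Z (x + z₀) k.succ * Z (x - z₀) 0 =
      Z (x + z₀) l.succ * Z (x - z₀) m.succ + Z (x + z₀) m.succ * Z (x - z₀) l.succ
  wron : ∃ κ : ℂ, κ ≠ 0 ∧ ∀ z (k l m : Fin 3), k ≠ l → l ≠ m → m ≠ k →
    deriv (fun z => Z z k.succ) z * Z z 0 - Z z k.succ * deriv (fun z => Z z 0) z =
      κ * s k * Z z l.succ * Z z m.succ

/-- The vector of multiples of the theta functions in the order `θ₁`, `θ₄`, `θ₃`, `θ₂`. -/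
def thVec (τ : ℂ) (A B C : ℝ) (z : ℂ) : Fin 4 → ℂ :=
  ![A * th1 τ z, th4 τ z, B * th3 τ z, C * th2 τ z]

variable {τ : ℂ} {A B C : ℝ}

lemma thVec_neg (z : ℂ) : thVec τ A B C (-z) =
    ![-thVec τ A B C z 0, thVec τ A B C z 1, thVec τ A B C z 2, thVec τ A B C z 3] := by
  simp [thVec, th1_neg, th2_neg, th3_neg, th4_neg]

lemma thVec_add_one (z : ℂ) : thVec τ A B C (z + 1) =
    ![-thVec τ A B C z 0, thVec τ A B C z 1, thVec τ A B C z 2, -thVec τ A B C z 3] := by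
  simp [thVec, th1_add_one, th2_add_one, th3_add_one, th4_add_one]

lemma thVec_add_tau (z : ℂ) : thVec τ A B C (z + τ) = autFactor τ z •
    ![-thVec τ A B C z 0, -thVec τ A B C z 1, thVec τ A B C z 2, thVec τ A B C z 3] := by
  ext i
  fin_cases i <;> simp [thVec, th1_add_tau, th2_add_tau, th3_add_tau, th4_add_tau] <;> ring

lemma thVec_add_two (z : ℂ) : thVec τ A B C (z + 2) = thVec τ A B C z := by
  rw [show z + 2 = z + 1 + 1 by ring, thVec_add_one, thVec_add_one]
  ext i
  fin_cases i <;> simp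

lemma thVec_add_two_tau (z : ℂ) :
    thVec τ A B C (z + 2 * τ) = cexp (-(4 * π * I * (z + τ))) • thVec τ A B C z := by
  have h : autFactor τ (z + τ) * autFactor τ z = cexp (-(4 * π * I * (z + τ))) := by
    rw [autFactor, autFactor, ← Complex.exp_add]
    ring_nf
  rw [show z + 2 * τ = z + τ + τ by ring, thVec_add_tau, thVec_add_tau, ← h, mul_smul]
  ext i
  fin_cases i <;> simp

lemma thVec_lattice (z : ℂ) (m n : ℤ) :
    ∃ c : ℂ, c ≠ 0 ∧ thVec τ A B C (z + 2 * m + 2 * n * τ) = c • thVec τ A B C z := by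
  have h1 : thVec τ A B C (z + 2 * m) = thVec τ A B C z := by
    have hp : Function.Periodic (thVec τ A B C) 2 := thVec_add_two
    have := hp.int_mul m z
    rwa [mul_comm] at this
  rw [← h1]
  generalize z + 2 * (m : ℂ) = w
  induction n using Int.induction_on with
  | zero => exact ⟨1, one_ne_zero, by simp⟩
  | succ k ih =>
    obtain ⟨c, hc, h⟩ := ih
    refine ⟨cexp (-(4 * π * I * (w + 2 * ((k : ℤ) : ℂ) * τ + τ))) * c,
      mul_ne_zero (Complex.exp_ne_zero _) hc, ?_⟩
    rw [mul_smul, ← h, ← thVec_add_two_tau]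
    push_cast
    ring_nf
  | pred k ih =>
    obtain ⟨c, hc, h⟩ := ih
    have := thVec_add_two_tau (τ := τ) (A := A) (B := B) (C := C)
      (w + 2 * ((-k - 1 : ℤ) : ℂ) * τ)
    rw [show w + 2 * ((-k - 1 : ℤ) : ℂ) * τ + 2 * τ = w + 2 * ((-k : ℤ) : ℂ) * τ by
      push_cast; ring, h] at this
    refine ⟨(cexp (-(4 * π * I * (w + 2 * ((-k - 1 : ℤ) : ℂ) * τ + τ))))⁻¹ * c,
      mul_ne_zero (inv_ne_zero (Complex.exp_ne_zero _)) hc, ?_⟩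
    rw [mul_smul, this, smul_smul, inv_mul_cancel₀ (Complex.exp_ne_zero _), one_smul]

lemma thVec_ne_zero (hτ : 0 < τ.im) (hB : B ≠ 0) (z : ℂ) : thVec τ A B C z ≠ 0 := fun h =>
  th34_ne hτ (z := z) (by simpa [thVec, hB] using congrFun h 2) (by simpa [thVec] using congrFun h 1)

/-- With z = x + y and w = x − y, proportionality gives θ₁(z)θ₂(w) = θ₁(w)θ₂(z), and likewise for θ₃
and θ₄. The parts odd in y of the addition formulas are therefore zero: T(x)S(y) = S(x)S(y) = 0. As
S and T have no common zero, S(y) = 0 and z − w = 2y ∈ ℤ + 2τℤ. -/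
lemma thVec_inj (hτ : 0 < τ.im) (hA : A ≠ 0) (hB : B ≠ 0) (hC : C ≠ 0) {z w c : ℂ}
    (h : thVec τ A B C z = c • thVec τ A B C w) : ∃ m n : ℤ, z - w = 2 * m + 2 * n * τ := by
  have hA' : (A : ℂ) ≠ 0 := by exact_mod_cast hA
  have hB' : (B : ℂ) ≠ 0 := by exact_mod_cast hB
  have hC' : (C : ℂ) ≠ 0 := by exact_mod_cast hC
  have h0 : th1 τ z = c * th1 τ w := by
    have := congrFun h 0
    simp only [thVec, Matrix.cons_val_zero, Pi.smul_apply, smul_eq_mul] at this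
    apply mul_left_cancel₀ hA'
    rw [this]; ring
  have h1 : th4 τ z = c * th4 τ w := by simpa [thVec] using congrFun h 1
  have h2 : th3 τ z = c * th3 τ w := by
    have := congrFun h 2
    simp only [thVec, Matrix.cons_val, Pi.smul_apply, smul_eq_mul] at this
    apply mul_left_cancel₀ hB'
    rw [this]; ring
  have h3 : th2 τ z = c * th2 τ w := by
    have := congrFun h 3
    simp only [thVec, Matrix.cons_val, Pi.smul_apply, smul_eq_mul] at this
    apply mul_left_cancel₀ hC'
    rw [this]; ring
  set x := (z + w) / 2 with hx
  set y := (z - w) / 2 with hy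
  have ez : z = x + y := by rw [hx, hy]; ring
  have ew : w = x - y := by rw [hx, hy]; ring
  have a1 := th1_mul_th2 hτ x y
  have a2 := th1_mul_th2 hτ x (-y)
  have a3 := th3_mul_th4 hτ x y
  have a4 := th3_mul_th4 hτ x (-y)
  rw [sub_neg_eq_add, ← sub_eq_add_neg, tT_neg, tS_neg, ← ez, ← ew] at a2 a4
  rw [← ez, ← ew] at a1 a3
  have e1 : tT τ x * tS τ y = 0 := by
    rw [h0] at a1
    rw [h3] at a2
    linear_combination (a2 - a1) / 2
  have e2 : tS τ x * tS τ y = 0 := by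
    rw [h2] at a3
    rw [h1] at a4
    linear_combination (a3 - a4) / 2
  have hS : tS τ y = 0 := by
    by_contra hne
    exact tT_tS_ne hτ ((mul_eq_zero.1 e1).resolve_right hne) ((mul_eq_zero.1 e2).resolve_right hne)
  obtain ⟨m, n, hmn⟩ := tS_eq_zero hτ hS
  obtain ⟨j, hj | hj⟩ := Int.even_or_odd' m
  · refine ⟨j, n, ?_⟩
    rw [hj] at hmn
    push_cast at hmn
    rw [hy] at hmn
    linear_combination hmn
  -- For m odd, z is w + 1 modulo the period lattice. Translation by 1 negates θ₁, θ₂ and fixes θ₃,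
  -- θ₄, so proportionality would make one of these two pairs vanish at w, which is impossible.
  · exfalso
    rw [hj] at hmn
    push_cast at hmn
    obtain ⟨d, hd, hz⟩ := thVec_lattice (τ := τ) (A := A) (B := B) (C := C) (w + 1) j n
    rw [show w + 1 + 2 * (j : ℂ) + 2 * n * τ = z by rw [hy] at hmn; linear_combination -hmn, h,
      thVec_add_one] at hz
    have g0 : c * th1 τ w = d * -th1 τ w := by
      have := congrFun hz 0
      simp only [thVec, Matrix.cons_val_zero, Pi.smul_apply, smul_eq_mul] at this
      apply mul_left_cancel₀ hA'
      linear_combination this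
    have g1 : c * th4 τ w = d * th4 τ w := by simpa [thVec] using congrFun hz 1
    have g2 : c * th3 τ w = d * th3 τ w := by
      have := congrFun hz 2
      simp only [thVec, Matrix.cons_val, Pi.smul_apply, smul_eq_mul] at this
      apply mul_left_cancel₀ hB'
      linear_combination this
    have g3 : c * th2 τ w = d * -th2 τ w := by
      have := congrFun hz 3
      simp only [thVec, Matrix.cons_val, Pi.smul_apply, smul_eq_mul] at this
      apply mul_left_cancel₀ hC'
      linear_combination this
    have hcd : c = d := by
      by_contra hne
      have hne' : c - d ≠ 0 := sub_ne_zero.2 hne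
      exact th34_ne hτ (z := w)
        ((mul_eq_zero.1 (by linear_combination g2 : (c - d) * th3 τ w = 0)).resolve_left hne')
        ((mul_eq_zero.1 (by linear_combination g1 : (c - d) * th4 τ w = 0)).resolve_left hne')
    have hcd' : c + d ≠ 0 := by
      rw [hcd, ← two_mul]
      exact mul_ne_zero two_ne_zero hd
    exact th12_ne hτ (z := w)
      ((mul_eq_zero.1 (by linear_combination g0 : (c + d) * th1 τ w = 0)).resolve_left hcd')
      ((mul_eq_zero.1 (by linear_combination g3 : (c + d) * th2 τ w = 0)).resolve_left hcd')

/-- The linear relations between the squares of the coordinates determine the curve. -/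
lemma onC_iff {a b c : ℝ} (hc : c ≠ 0) (v : Fin 4 → ℂ) : OnC ![a, b, c] v ↔
    c * (v 0 ^ 2 - v 1 ^ 2) = a * (v 0 ^ 2 - v 3 ^ 2) ∧
    c * (v 0 ^ 2 - v 2 ^ 2) = b * (v 0 ^ 2 - v 3 ^ 2) := by
  have hc' : (c : ℂ) ≠ 0 := by exact_mod_cast hc
  constructor
  · intro h
    exact ⟨h 0 2, h 1 2⟩
  · rintro ⟨h1, h2⟩ k l
    apply mul_left_cancel₀ hc'
    fin_cases k <;> fin_cases l <;> simp [-mul_eq_mul_left_iff] <;>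
      first
      | ring1
      | linear_combination (b : ℂ) * h1 - a * h2
      | linear_combination (a : ℂ) * h2 - b * h1
      | linear_combination (c : ℂ) * h1
      | linear_combination (c : ℂ) * h2
      | linear_combination -(c : ℂ) * h1
      | linear_combination -(c : ℂ) * h2

lemma thVec_surj (hτ : 0 < τ.im) (hA : A ≠ 0) (hC : C ≠ 0) {a b c : ℝ} (hc : c ≠ 0)
    (hon : ∀ z, OnC ![a, b, c] (thVec τ A B C z)) {v : Fin 4 → ℂ} (hv : OnC ![a, b, c] v) :
    ∃ z d : ℂ, v = d • thVec τ A B C z := by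
  have hc' : (c : ℂ) ≠ 0 := by exact_mod_cast hc
  have hA' : (A : ℂ) ≠ 0 := by exact_mod_cast hA
  have hC' : (C : ℂ) ≠ 0 := by exact_mod_cast hC
  -- The set G is stable under every change of signs of the coordinates: these are generated by z ↦
  -- −z, z ↦ z + 1, z ↦ z + τ and multiplication by −1. So it suffices to match the squares of the
  -- coordinates.
  let G : ℂ → ℂ → ℂ → ℂ → Prop := fun x y z w => ∃ u d : ℂ, ![x, y, z, w] = d • thVec τ A B C u
  have flip0 : ∀ {x y z w}, G x y z w → G (-x) y z w := by
    rintro x y z w ⟨u, d, h⟩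
    refine ⟨-u, d, ?_⟩
    rw [thVec_neg]
    ext i
    have h0 := congrFun h 0
    have h1 := congrFun h 1
    have h2 := congrFun h 2
    have h3 := congrFun h 3
    simp only [Matrix.cons_val, Pi.smul_apply, smul_eq_mul] at h0 h1 h2 h3
    fin_cases i
    · simp [h0]
    · simp [h1]
    · simpa using h2
    · simpa using h3
  have flip03 : ∀ {x y z w}, G x y z w → G (-x) y z (-w) := by
    rintro x y z w ⟨u, d, h⟩
    refine ⟨u + 1, d, ?_⟩
    rw [thVec_add_one]
    ext i
    have h0 := congrFun h 0
    have h1 := congrFun h 1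
    have h2 := congrFun h 2
    have h3 := congrFun h 3
    simp only [Matrix.cons_val, Pi.smul_apply, smul_eq_mul] at h0 h1 h2 h3
    fin_cases i
    · simp [h0]
    · simp [h1]
    · simpa using h2
    · simpa using h3
  have flip01 : ∀ {x y z w}, G x y z w → G (-x) (-y) z w := by
    rintro x y z w ⟨u, d, h⟩
    refine ⟨u + τ, d * (autFactor τ u)⁻¹, ?_⟩
    rw [thVec_add_tau, smul_smul, mul_assoc, inv_mul_cancel₀ (autFactor_ne_zero u), mul_one]
    ext i
    have h0 := congrFun h 0
    have h1 := congrFun h 1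
    have h2 := congrFun h 2
    have h3 := congrFun h 3
    simp only [Matrix.cons_val, Pi.smul_apply, smul_eq_mul] at h0 h1 h2 h3
    fin_cases i
    · simp [h0]
    · simp [h1]
    · simpa using h2
    · simpa using h3
  have flip : ∀ {x y z w}, G x y z w → G (-x) (-y) (-z) (-w) := by
    rintro x y z w ⟨u, d, h⟩
    refine ⟨u, -d, ?_⟩
    ext i
    have h0 := congrFun h 0
    have h1 := congrFun h 1
    have h2 := congrFun h 2
    have h3 := congrFun h 3
    simp only [Matrix.cons_val, Pi.smul_apply, smul_eq_mul] at h0 h1 h2 h3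
    fin_cases i
    · simp [h0]
    · simp [h1]
    · simpa using h2
    · simpa using h3
  have flip3 : ∀ {x y z w}, G x y z w → G x y z (-w) := fun h => by simpa using flip0 (flip03 h)
  have flip1 : ∀ {x y z w}, G x y z w → G x (-y) z w := fun h => by simpa using flip0 (flip01 h)
  have flip2 : ∀ {x y z w}, G x y z w → G x y (-z) w := fun h => by
    simpa using flip0 (flip1 (flip3 (flip h)))
  -- A zero of this combination makes the squares of coordinates 0 and 3 proportional to those of v.
  -- The curve equations are linear in the squares and carry this over to coordinates 1 and 2.
  obtain ⟨z, hz⟩ := exists_zero_comb hτ (v 3 ^ 2 * A ^ 2) (-(v 0 ^ 2 * C ^ 2))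
  set u := thVec τ A B C z with hu
  have hz' : v 3 ^ 2 * u 0 ^ 2 = v 0 ^ 2 * u 3 ^ 2 := by
    simp only [hu, thVec, Matrix.cons_val]
    linear_combination hz
  obtain ⟨μ, hμ0, hμ3⟩ : ∃ μ, v 0 ^ 2 = μ * u 0 ^ 2 ∧ v 3 ^ 2 = μ * u 3 ^ 2 := by
    by_cases h0 : u 0 = 0
    · have h3 : u 3 ≠ 0 := fun h3 => th12_ne hτ (z := z)
        (by simpa [hu, thVec, hA] using h0) (by simpa [hu, thVec, hC] using h3)
      refine ⟨v 3 ^ 2 / u 3 ^ 2, ?_, by field_simp⟩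
      rw [h0] at hz' ⊢
      have : v 0 ^ 2 = 0 := by
        have := hz'.symm
        simpa [h3] using this
      rw [this]; ring
    · refine ⟨v 0 ^ 2 / u 0 ^ 2, by field_simp, ?_⟩
      field_simp
      exact hz'
  obtain ⟨ν, hν⟩ := IsAlgClosed.exists_pow_nat_eq μ two_pos
  obtain ⟨o1, o2⟩ := (onC_iff hc v).1 hv
  obtain ⟨p1, p2⟩ := (onC_iff hc u).1 (hon z)
  have hμ1 : v 1 ^ 2 = μ * u 1 ^ 2 := by
    apply mul_left_cancel₀ hc'
    linear_combination -o1 + μ * p1 + (c - a : ℂ) * hμ0 + a * hμ3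
  have hμ2 : v 2 ^ 2 = μ * u 2 ^ 2 := by
    apply mul_left_cancel₀ hc'
    linear_combination -o2 + μ * p2 + (c - b : ℂ) * hμ0 + b * hμ3
  have sg : ∀ i, v i ^ 2 = μ * u i ^ 2 → v i = ν * u i ∨ v i = -(ν * u i) := fun i h =>
    sq_eq_sq_iff_eq_or_eq_neg.1 (by rw [h, mul_pow, hν])
  have h0 : G (ν * u 0) (ν * u 1) (ν * u 2) (ν * u 3) := ⟨z, ν, by
    ext i
    fin_cases i <;> simp [hu]⟩
  have h1 : G (v 0) (ν * u 1) (ν * u 2) (ν * u 3) := by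
    rcases sg 0 hμ0 with h | h
    · rwa [h]
    · rw [h]; exact flip0 h0
  have h2 : G (v 0) (v 1) (ν * u 2) (ν * u 3) := by
    rcases sg 1 hμ1 with h | h
    · rwa [h]
    · rw [h]; exact flip1 h1
  have h3 : G (v 0) (v 1) (v 2) (ν * u 3) := by
    rcases sg 2 hμ2 with h | h
    · rwa [h]
    · rw [h]; exact flip2 h2
  have h4 : G (v 0) (v 1) (v 2) (v 3) := by
    rcases sg 3 hμ3 with h | h
    · rwa [h]
    · rw [h]; exact flip3 h3
  obtain ⟨u', d, h⟩ := h4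
  refine ⟨u', d, ?_⟩
  rw [← h]
  ext i
  fin_cases i <;> rfl

lemma thVec_conj {t : ℝ} (z : ℂ) (i : Fin 4) : (starRingEnd ℂ) (thVec (t * I) A B C z i) =
    thVec (t * I) A B C ((starRingEnd ℂ) z) i := by
  fin_cases i <;> simp [thVec, conj_th1, conj_th2, conj_th3, conj_th4]

/-- The product is T(x)T(0), where T = `tT` is real, continuous and without zeros on the real line,
hence of constant sign. -/
lemma th3_mul_th4_ofReal_pos {t : ℝ} (ht : 0 < t) (x : ℝ) :
    ∃ p : ℝ, 0 < p ∧ th3 (t * I) x * th4 (t * I) x = p := by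
  have hτ := mul_I_im_pos ht
  have hτ2 := two_mul_im_pos hτ
  have e : ∀ y : ℝ, tT (t * I) y = th4 (2 * (t * I)) ((2 * y : ℝ) : ℂ) := fun y => by
    simp [tT, tF, th4]
  let g : ℝ → ℝ := fun y => (tT (t * I) y).re
  have hg : ∀ y : ℝ, tT (t * I) y = (g y : ℂ) := fun y => by
    refine (conj_eq_iff_re.1 ?_).symm
    have := conj_th4 (t := 2 * t) ((2 * y : ℝ) : ℂ)
    rw [conj_ofReal, show ((2 * t : ℝ) : ℂ) * I = 2 * (t * I) by push_cast; ring] at this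
    rw [e, this]
  have hne : ∀ y, g y ≠ 0 := fun y h => by
    have := th4_ofReal_ne hτ2 (2 * y)
    rw [← e, hg, h] at this
    simp at this
  have hcont : Continuous g :=
    continuous_re.comp ((differentiable_tT hτ).continuous.comp continuous_ofReal)
  have hpos : 0 < g x * g 0 := by
    by_contra hle
    have hmul : (0 : ℝ) ∈ Set.uIcc (g 0) (g x) := by
      rw [Set.mem_uIcc]
      rcases lt_or_gt_of_ne (hne 0) with h | h
      · exact Or.inl ⟨h.le, by nlinarith⟩
      · exact Or.inr ⟨by nlinarith, h.le⟩
    obtain ⟨y, -, hy⟩ := intermediate_value_uIcc hcont.continuousOn hmul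
    exact hne y hy
  refine ⟨g x * g 0, hpos, ?_⟩
  have := th3_mul_th4 hτ x 0
  rw [tS_zero, mul_zero, sub_zero, add_zero, sub_zero] at this
  rw [this, hg, show (0 : ℂ) = ((0 : ℝ) : ℂ) by simp, hg]
  push_cast
  rfl

/-- The point (1, 1, 1, 1) is fixed by conjugation, so its parameter has imaginary part in tℤ. An
even multiple is removed by a period. An odd one would give θ₄ = −Bθ₃ at a real argument, against B
> 0 and θ₃θ₄ > 0. -/
lemma exists_real_base {t : ℝ} (ht : 0 < t) (hA : A ≠ 0) (hB : 0 < B) (hC : C ≠ 0) {a b c : ℝ}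
    (hc : c ≠ 0) (hon : ∀ z, OnC ![a, b, c] (thVec (t * I) A B C z)) :
    ∃ z₀ : ℝ, ∃ d : ℂ, d ≠ 0 ∧ ∀ i, thVec (t * I) A B C z₀ i = d := by
  have hτ := mul_I_im_pos ht
  obtain ⟨z, d, h⟩ := thVec_surj hτ hA hC hc hon (v := fun _ => 1) (fun k l => by simp)
  have hd : d ≠ 0 := fun h0 => by
    have := congrFun h 0
    simp [h0] at this
  have hz : ∀ i, thVec (t * I) A B C z i = d⁻¹ := fun i => by
    have := congrFun h i
    simp only [Pi.smul_apply, smul_eq_mul] at this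
    exact eq_inv_of_mul_eq_one_right this.symm
  have hz' : ∀ i, thVec (t * I) A B C ((starRingEnd ℂ) z) i = (starRingEnd ℂ) d⁻¹ := fun i => by
    rw [← thVec_conj, hz]
  obtain ⟨m, n, hmn⟩ := thVec_inj hτ hA hB.ne' hC (z := z) (w := (starRingEnd ℂ) z)
    (c := d⁻¹ * ((starRingEnd ℂ) d⁻¹)⁻¹) (by
      ext i
      rw [hz, Pi.smul_apply, hz', smul_eq_mul, mul_assoc, inv_mul_cancel₀, mul_one]
      simpa using hd)
  have him := congrArg Complex.im hmn
  simp at him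
  have hzt : z = (z.re : ℂ) + n * (t * I) := by
    apply Complex.ext
    · simp
    · simp
      linarith
  obtain ⟨j, hj | hj⟩ := Int.even_or_odd' n
  · obtain ⟨e, he, h1⟩ := thVec_lattice (τ := t * I) (A := A) (B := B) (C := C) (z.re : ℂ) 0 j
    rw [Int.cast_zero, mul_zero, add_zero, show (z.re : ℂ) + 2 * j * (t * I) = z by
      conv_rhs => rw [hzt, hj]
      push_cast
      ring] at h1
    refine ⟨z.re, e⁻¹ * d⁻¹, mul_ne_zero (inv_ne_zero he) (inv_ne_zero hd), fun i => ?_⟩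
    rw [← hz i, h1, Pi.smul_apply, smul_eq_mul, inv_mul_cancel_left₀ he]
  · exfalso
    obtain ⟨e, he, h1⟩ := thVec_lattice (τ := t * I) (A := A) (B := B) (C := C)
      ((z.re : ℂ) + t * I) 0 j
    rw [Int.cast_zero, mul_zero, add_zero, show (z.re : ℂ) + t * I + 2 * j * (t * I) = z by
      conv_rhs => rw [hzt, hj]
      push_cast
      ring, thVec_add_tau] at h1
    have i1 := congrFun h1 1
    have i2 := congrFun h1 2
    rw [hz] at i1 i2
    simp only [thVec, Pi.smul_apply, smul_eq_mul, Matrix.cons_val] at i1 i2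
    have hne : e * autFactor (t * I) z.re ≠ 0 := mul_ne_zero he (autFactor_ne_zero _)
    have h34 : th4 (t * I) z.re = -(B * th3 (t * I) z.re) := by
      apply mul_left_cancel₀ hne
      linear_combination i1 - i2
    obtain ⟨p, hp, hp'⟩ := th3_mul_th4_ofReal_pos ht z.re
    rw [h34] at hp'
    have hr : (th3 (t * I) z.re).im = 0 := by
      rw [← conj_eq_iff_im, conj_th3, conj_ofReal]
    rw [← re_add_im (th3 (t * I) z.re), hr] at hp'
    simp only [ofReal_zero, zero_mul, add_zero] at hp'
    have : (th3 (t * I) z.re).re * -(B * (th3 (t * I) z.re).re) = p := by exact_mod_cast hp'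
    nlinarith [mul_self_nonneg (th3 (t * I) z.re).re]

/-- By the addition formulas both sides of each relation are the same function of x times a constant
depending on z₀. The constants agree because the coordinates at z₀ are all equal: the product of two
of them equals the product of the other two, and these products are the addition formulas with
second argument 0. -/
lemma thVec_corr (hτ : 0 < τ.im) {z₀ d : ℂ} (h : ∀ i, thVec τ A B C z₀ i = d) (x : ℂ) :
    (∀ u v, u = thVec τ A B C (x + z₀) → v = thVec τ A B C (x - z₀) →
      u 0 * v 1 - u 1 * v 0 = u 2 * v 3 + u 3 * v 2 ∧
      u 0 * v 2 - u 2 * v 0 = u 1 * v 3 + u 3 * v 1 ∧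
      u 0 * v 3 - u 3 * v 0 = u 1 * v 2 + u 2 * v 1) := by
  rintro u v rfl rfl
  have e0 := h 0
  have e1 := h 1
  have e2 := h 2
  have e3 := h 3
  simp only [thVec, Matrix.cons_val] at e0 e1 e2 e3 ⊢
  have hneg : x - -z₀ = x + z₀ := sub_neg_eq_add _ _
  have hneg' : x + -z₀ = x - z₀ := (sub_eq_add_neg _ _).symm
  have h20 : th2 τ 0 ≠ 0 := fun h0 => th12_ne hτ th1_zero h0
  refine ⟨?_, ?_, ?_⟩
  · have a0 := th1_mul_th4 hτ z₀ 0
    have b0 := th2_mul_th3 hτ z₀ 0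
    have a1 := th1_mul_th4 hτ x z₀
    have a2 := th1_mul_th4 hτ x (-z₀)
    have b1 := th2_mul_th3 hτ x z₀
    have b2 := th2_mul_th3 hτ x (-z₀)
    rw [hneg, hneg', neg_neg] at a2 b2
    rw [neg_zero, add_zero, sub_zero] at a0 b0
    have hB0 : tB τ 0 ≠ 0 := fun h0 => by
      have := th2_mul_th3 hτ 0 0
      rw [neg_zero, h0] at this
      have h3 := th3_ofReal_ne hτ 0
      simp only [add_zero, sub_zero, mul_zero, ofReal_zero] at this h3
      exact mul_ne_zero h20 h3 this
    have key : -(A * I) * (tB τ z₀ - tB τ (-z₀)) = B * C * (tB τ z₀ + tB τ (-z₀)) := by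
      apply mul_left_cancel₀ hB0
      linear_combination -A * a0 + B * C * b0 + A * th1 τ z₀ * e1 + d * e0 - B * th3 τ z₀ * e3 - d * e2
    linear_combination A * (a1 - a2) - B * C * (b1 + b2) +
      (tB τ x + tB τ (-x)) * key
  · have a0 := th1_mul_th3 hτ z₀ 0
    have b0 := th2_mul_th4 hτ z₀ 0
    have a1 := th1_mul_th3 hτ x z₀
    have a2 := th1_mul_th3 hτ x (-z₀)
    have b1 := th2_mul_th4 hτ x z₀
    have b2 := th2_mul_th4 hτ x (-z₀)
    rw [hneg, hneg', neg_neg] at a2 b2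
    rw [neg_zero, add_zero, sub_zero] at a0 b0
    have hB0 : tA τ 0 ≠ 0 := fun h0 => by
      have := th2_mul_th4 hτ 0 0
      rw [neg_zero, h0] at this
      have h3 := th4_ofReal_ne hτ 0
      simp only [add_zero, sub_zero, mul_zero, ofReal_zero] at this h3
      exact mul_ne_zero h20 h3 this
    have key : -(A * B * I) * (tA τ z₀ - tA τ (-z₀)) = C * (tA τ z₀ + tA τ (-z₀)) := by
      apply mul_left_cancel₀ hB0
      linear_combination -A * B * a0 + C * b0 + A * th1 τ z₀ * e2 + d * e0 - C * th2 τ z₀ * e1 - d * e3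
    linear_combination A * B * (a1 - a2) - C * (b1 + b2) +
      (tA τ x + tA τ (-x)) * key
  · have a0 := th1_mul_th2 hτ z₀ 0
    have b0 := th3_mul_th4 hτ z₀ 0
    have a1 := th1_mul_th2 hτ x z₀
    have a2 := th1_mul_th2 hτ x (-z₀)
    have b1 := th3_mul_th4 hτ x z₀
    have b2 := th3_mul_th4 hτ x (-z₀)
    rw [hneg, hneg', tT_neg, tS_neg] at a2 b2
    rw [add_zero, sub_zero, tS_zero] at a0 b0
    have key : A * C * tS τ z₀ = B * tT τ z₀ := by
      apply mul_left_cancel₀ (tT_zero_ne hτ)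
      linear_combination -A * C * a0 + B * b0 + A * th1 τ z₀ * e3 + d * e0 - B * th3 τ z₀ * e1 - d * e2
    linear_combination A * C * (a1 - a2) - B * (b1 + b2) + 2 * tT τ x * key

lemma deriv_const_mul_th {f : ℂ → ℂ} (c z : ℂ) : deriv (fun z => c * f z) z = c * deriv f z :=
  deriv_const_mul_field c

lemma thVec_diff (hτ : 0 < τ.im) (i : Fin 4) : Differentiable ℂ fun z => thVec τ A B C z i := by
  fin_cases i
  · exact (differentiable_th1 hτ).const_mul (A : ℂ)
  · exact differentiable_th4 hτ
  · exact (differentiable_th3 hτ).const_mul (B : ℂ)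
  · exact (differentiable_th2 hτ).const_mul (C : ℂ)

/-- Differentiating the equations of the curve. -/
lemma onC_deriv {s : Fin 3 → ℝ} {L : ℂ → Fin 4 → ℂ} (hd : ∀ i, Differentiable ℂ fun z => L z i)
    (hon : ∀ z, OnC s (L z)) (z : ℂ) (k l : Fin 3) :
    (s l : ℂ) * L z k.succ * (deriv (fun z => L z k.succ) z * L z 0 -
      L z k.succ * deriv (fun z => L z 0) z) =
    (s k : ℂ) * L z l.succ * (deriv (fun z => L z l.succ) z * L z 0 -
      L z l.succ * deriv (fun z => L z 0) z) := by
  have h0 := (hd 0 z).hasDerivAt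
  have hk := (hd k.succ z).hasDerivAt
  have hl := (hd l.succ z).hasDerivAt
  have e1 := ((h0.fun_pow 2).fun_sub (hk.fun_pow 2)).const_mul (s l : ℂ)
  have e2 := ((h0.fun_pow 2).fun_sub (hl.fun_pow 2)).const_mul (s k : ℂ)
  rw [funext fun z => hon z k l] at e1
  have e := e1.unique e2
  have h := hon z k l
  push_cast at e
  simp only [pow_one] at e
  linear_combination (-L z 0 / 2) * e + deriv (fun z => L z 0) z * h

/-- For the coordinates θ₁, θ₂ this is `th_wronskian`. The others follow from the differentiated
curve equations after cancelling θ₄ or θ₃, which do not vanish identically. -/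
lemma thVec_wron (hτ : 0 < τ.im) (hA : A ≠ 0) (hB : B ≠ 0) (hC : C ≠ 0) {a b c : ℝ}
    (hc : c ≠ 0) (hon : ∀ z, OnC ![a, b, c] (thVec τ A B C z)) : ∃ κ : ℂ, κ ≠ 0 ∧
    ∀ z (k l m : Fin 3), k ≠ l → l ≠ m → m ≠ k →
    deriv (fun z => thVec τ A B C z k.succ) z * thVec τ A B C z 0 -
      thVec τ A B C z k.succ * deriv (fun z => thVec τ A B C z 0) z =
      κ * (![a, b, c] k : ℝ) * thVec τ A B C z l.succ * thVec τ A B C z m.succ := by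
  have hA' : (A : ℂ) ≠ 0 := by exact_mod_cast hA
  have hB' : (B : ℂ) ≠ 0 := by exact_mod_cast hB
  have hC' : (C : ℂ) ≠ 0 := by exact_mod_cast hC
  have hc' : (c : ℂ) ≠ 0 := by exact_mod_cast hc
  obtain ⟨κ, hκ, hW⟩ := th_wronskian hτ
  set u := thVec τ A B C with hu
  have hd : ∀ i, Differentiable ℂ fun z => u z i := thVec_diff hτ
  set κ' : ℂ := -(A * C * κ) / (c * B) with hκ'
  have h3 : ∀ z, deriv (fun z => u z 3) z * u z 0 - u z 3 * deriv (fun z => u z 0) z =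
      κ' * c * u z 1 * u z 2 := by
    intro z
    have d3 : deriv (fun z => u z 3) z = C * deriv (th2 τ) z := deriv_const_mul_th _ _
    have d0 : deriv (fun z => u z 0) z = A * deriv (th1 τ) z := deriv_const_mul_th _ _
    rw [d3, d0]
    simp only [hu, thVec, Matrix.cons_val, hκ']
    field_simp
    linear_combination -hW z
  have hde := fun z => onC_deriv hd hon z
  have h1 : ∀ z, deriv (fun z => u z 1) z * u z 0 - u z 1 * deriv (fun z => u z 0) z =
      κ' * a * u z 2 * u z 3 := by
    intro z
    refine sub_eq_zero.1 (eq_zero_of_mul_eq_zero (f := fun z => u z 1) (z₀ := 0)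
      (g := fun z => deriv (fun z => u z 1) z * u z 0 - u z 1 * deriv (fun z => u z 0) z -
        κ' * a * u z 2 * u z 3) (hd 1) ?_ ?_ ?_ z)
    · exact ((((hd 1).deriv).mul (hd 0)).sub ((hd 1).mul (hd 0).deriv)).sub
        (((hd 2).const_mul _).mul (hd 3))
    · simpa [hu, thVec] using th4_ofReal_ne hτ 0
    · intro w
      have e : (c : ℂ) * u w 1 * (deriv (fun z => u z 1) w * u w 0 -
        u w 1 * deriv (fun z => u z 0) w) = a * u w 3 * (deriv (fun z => u z 3) w * u w 0 -
        u w 3 * deriv (fun z => u z 0) w) := hde w 0 2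
      rw [h3] at e
      apply mul_left_cancel₀ hc'
      linear_combination e
  have h2 : ∀ z, deriv (fun z => u z 2) z * u z 0 - u z 2 * deriv (fun z => u z 0) z =
      κ' * b * u z 1 * u z 3 := by
    intro z
    refine sub_eq_zero.1 (eq_zero_of_mul_eq_zero (f := fun z => u z 2) (z₀ := 0)
      (g := fun z => deriv (fun z => u z 2) z * u z 0 - u z 2 * deriv (fun z => u z 0) z -
        κ' * b * u z 1 * u z 3) (hd 2) ?_ ?_ ?_ z)
    · exact ((((hd 2).deriv).mul (hd 0)).sub ((hd 2).mul (hd 0).deriv)).sub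
        (((hd 1).const_mul _).mul (hd 3))
    · simpa [hu, thVec, hB] using th3_ofReal_ne hτ 0
    · intro w
      have e : (c : ℂ) * u w 2 * (deriv (fun z => u z 2) w * u w 0 -
        u w 2 * deriv (fun z => u z 0) w) = b * u w 3 * (deriv (fun z => u z 3) w * u w 0 -
        u w 3 * deriv (fun z => u z 0) w) := hde w 1 2
      rw [h3] at e
      apply mul_left_cancel₀ hc'
      linear_combination e
  refine ⟨κ', div_ne_zero (neg_ne_zero.2 (mul_ne_zero (mul_ne_zero hA' hC') hκ))
    (mul_ne_zero hc' hB'), fun z k l m hkl hlm hmk => ?_⟩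
  have h1z := h1 z
  have h2z := h2 z
  have h3z := h3 z
  fin_cases k <;> fin_cases l <;> fin_cases m <;> simp at hkl hlm hmk <;>
    simp only [Fin.zero_eta, Fin.mk_one, Fin.reduceFinMk, Fin.succ_zero_eq_one, Fin.succ_one_eq_two,
      Fin.reduceSucc, Matrix.cons_val] <;>
    first
    | linear_combination h1z
    | linear_combination h2z
    | linear_combination h3z

lemma exists_thetaData_sorted {a b c : ℝ} (ha : 0 < a) (hab : a < b) (hbc : b < c) :
    Nonempty (ThetaData ![a, b, c]) := by
  have hb : 0 < b := ha.trans hab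
  have hc : 0 < c := hb.trans hbc
  have hca : 0 < c - a := by linarith
  have hcb : 0 < c - b := by linarith
  have hba : 0 < b - a := by linarith
  -- Comparing coefficients of `tF` and `tG` at 2z, the two curve equations become the four
  -- relations `r1` to `r4`, linear in A², B², C². Their compatibility is ((p² − q²)/(p² + q²))² =
  -- a(c − b)/(b(c − a)), a number in (0, 1) because 0 < a < b < c; the order also makes the
  -- solutions positive.
  obtain ⟨t, p, q, ht, hp, hq, hqp, e1, e2, hK⟩ :=
    exists_theta_constants (K := a * (c - b) / (b * (c - a))) (by positivity)
      (by rw [div_lt_one (by positivity)]; nlinarith)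
  have hτ := mul_I_im_pos ht
  have hpq : 0 < p ^ 2 - q ^ 2 := by nlinarith
  set A := √((p ^ 2 + q ^ 2) * c / (2 * p * q * (c - a))) with hA
  set C := √((p ^ 2 - q ^ 2) * c / (2 * p * q * a)) with hC
  set B := √((c - b) * (p ^ 2 + q ^ 2) / ((c - a) * (p ^ 2 - q ^ 2))) with hB
  have hA2 : A ^ 2 = (p ^ 2 + q ^ 2) * c / (2 * p * q * (c - a)) := Real.sq_sqrt (by positivity)
  have hC2 : C ^ 2 = (p ^ 2 - q ^ 2) * c / (2 * p * q * a) := Real.sq_sqrt (by positivity)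
  have hB2 : B ^ 2 = (c - b) * (p ^ 2 + q ^ 2) / ((c - a) * (p ^ 2 - q ^ 2)) :=
    Real.sq_sqrt (by positivity)
  have hA0 : 0 < A := Real.sqrt_pos.2 (by positivity)
  have hB0 : 0 < B := Real.sqrt_pos.2 (by positivity)
  have hC0 : 0 < C := Real.sqrt_pos.2 (by positivity)
  have hon : ∀ z, OnC ![a, b, c] (thVec (t * I) A B C z) := by
    intro z
    rw [onC_iff hc.ne']
    have s1 := th1_sq hτ z
    have s2 := th2_sq hτ z
    have s3 := th3_sq hτ z
    have s4 := th4_sq hτ z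
    rw [e1, e2] at s1 s2 s3 s4
    simp only [thVec, Matrix.cons_val, mul_pow, s1, s2, s3, s4]
    have r1 : (c - a) * (A ^ 2 * q) + a * (C ^ 2 * q) = c * p := by
      rw [hA2, hC2]
      field_simp
      ring
    have r2 : -(c - a) * (A ^ 2 * p) + a * (C ^ 2 * p) = -(c * q) := by
      rw [hA2, hC2]
      field_simp
      ring
    have hK' : (p ^ 2 - q ^ 2) ^ 2 * (b * (c - a)) = a * (c - b) * (p ^ 2 + q ^ 2) ^ 2 := by
      rw [hK]
      field_simp
    have r3 : (c - b) * (A ^ 2 * q) + b * (C ^ 2 * q) = c * B ^ 2 * p := by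
      rw [hA2, hC2, hB2]
      field_simp
      linear_combination hK'
    have r4 : -(c - b) * (A ^ 2 * p) + b * (C ^ 2 * p) = c * B ^ 2 * q := by
      rw [hA2, hC2, hB2]
      field_simp
      linear_combination hK'
    have r1' : ((c : ℂ) - a) * (A ^ 2 * q) + a * (C ^ 2 * q) = c * p := by exact_mod_cast r1
    have r2' : -((c : ℂ) - a) * (A ^ 2 * p) + a * (C ^ 2 * p) = -(c * q) := by exact_mod_cast r2
    have r3' : ((c : ℂ) - b) * (A ^ 2 * q) + b * (C ^ 2 * q) = c * B ^ 2 * p := by exact_mod_cast r3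
    have r4' : -((c : ℂ) - b) * (A ^ 2 * p) + b * (C ^ 2 * p) = c * B ^ 2 * q := by exact_mod_cast r4
    constructor
    · linear_combination tF (t * I) (2 * z) * r1' + tG (t * I) (2 * z) * r2'
    · linear_combination tF (t * I) (2 * z) * r3' + tG (t * I) (2 * z) * r4'
  obtain ⟨z₀, d, hd, hz₀⟩ := exists_real_base ht hA0.ne' hB0 hC0.ne' hc.ne' hon
  exact ⟨{
    t := t
    t_pos := ht
    Z := thVec (t * I) A B C
    z₀ := z₀
    diff := thVec_diff hτ
    on := hon
    ne := thVec_ne_zero hτ hB0.ne'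
    per := thVec_add_two
    qper := thVec_add_two_tau
    conj := thVec_conj
    half := ⟨![-1, -1, 1, 1], fun z i => by
      rw [thVec_add_tau]
      fin_cases i <;> simp⟩
    neg_zero := fun z => by rw [thVec_neg]; rfl
    neg_succ := fun z k => by rw [thVec_neg]; fin_cases k <;> rfl
    inj := fun z w c h => thVec_inj hτ hA0.ne' hB0.ne' hC0.ne' h
    surj := fun v hv => thVec_surj hτ hA0.ne' hC0.ne' hc.ne' hon hv
    spec := ⟨d, hd, hz₀⟩
    corr := fun x k l m hkl hlm hmk => by
      obtain ⟨g1, g2, g3⟩ := thVec_corr hτ hz₀ x _ _ rfl rfl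
      fin_cases k <;> fin_cases l <;> fin_cases m <;> simp at hkl hlm hmk <;>
        simp only [Fin.zero_eta, Fin.mk_one, Fin.reduceFinMk, Fin.succ_zero_eq_one,
          Fin.succ_one_eq_two, Fin.reduceSucc] <;>
        first
        | linear_combination g1
        | linear_combination g2
        | linear_combination g3
    wron := thVec_wron hτ hA0.ne' hB0.ne' hC0.ne' hc.ne' hon }⟩

/-- The action of a permutation of the last three coordinates. -/
def permVec (ρ : Equiv.Perm (Fin 3)) (v : Fin 4 → ℂ) : Fin 4 → ℂ :=
  Fin.cons (v 0) fun k => v (ρ k).succ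

lemma permVec_zero (ρ : Equiv.Perm (Fin 3)) (v : Fin 4 → ℂ) : permVec ρ v 0 = v 0 := rfl

lemma permVec_succ (ρ : Equiv.Perm (Fin 3)) (v : Fin 4 → ℂ) (k : Fin 3) :
    permVec ρ v k.succ = v (ρ k).succ := rfl

lemma permVec_smul (ρ : Equiv.Perm (Fin 3)) (c : ℂ) (v : Fin 4 → ℂ) :
    permVec ρ (c • v) = c • permVec ρ v := by
  ext i
  refine Fin.cases ?_ (fun k => ?_) i <;> rfl

lemma permVec_symm (ρ : Equiv.Perm (Fin 3)) (v : Fin 4 → ℂ) : permVec ρ.symm (permVec ρ v) = v := by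
  ext i
  refine Fin.cases rfl (fun k => ?_) i
  simp [permVec_succ]

lemma permVec_symm' (ρ : Equiv.Perm (Fin 3)) (v : Fin 4 → ℂ) : permVec ρ (permVec ρ.symm v) = v := by
  ext i
  refine Fin.cases rfl (fun k => ?_) i
  simp [permVec_succ]

/-- Transport of the parametrization along a permutation of the parameters. -/
def ThetaData.perm {s : Fin 3 → ℝ} (ρ : Equiv.Perm (Fin 3)) (D : ThetaData s) :
    ThetaData (s ∘ ρ) where
  t := D.t
  t_pos := D.t_pos
  Z z := permVec ρ (D.Z z)
  z₀ := D.z₀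
  diff i := by
    refine Fin.cases (D.diff 0) (fun k => D.diff (ρ k).succ) i
  on z k l := D.on z (ρ k) (ρ l)
  ne z h := D.ne z (by
    rw [← permVec_symm ρ (D.Z z), h]
    ext i
    refine Fin.cases ?_ (fun k => ?_) i <;> rfl)
  per z := by rw [D.per]
  qper z := by rw [D.qper, permVec_smul]
  conj z i := by
    refine Fin.cases (D.conj z 0) (fun k => D.conj z (ρ k).succ) i
  half := by
    obtain ⟨ε, h⟩ := D.half
    refine ⟨Fin.cons (ε 0) fun k => ε (ρ k).succ, fun z i => ?_⟩
    refine Fin.cases (h z 0) (fun k => h z (ρ k).succ) i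
  neg_zero z := D.neg_zero z
  neg_succ z k := D.neg_succ z (ρ k)
  inj z w c h := D.inj z w c (by
    rw [← permVec_symm ρ (D.Z z), h, permVec_smul, permVec_symm])
  surj v hv := by
    obtain ⟨z, c, h⟩ := D.surj (permVec ρ.symm v) (fun k l => by
      have := hv (ρ.symm k) (ρ.symm l)
      simpa [permVec_succ, permVec_zero] using this)
    exact ⟨z, c, by rw [← permVec_smul, ← h, permVec_symm']⟩
  spec := by
    obtain ⟨c, hc, h⟩ := D.spec
    exact ⟨c, hc, fun i => by refine Fin.cases (h 0) (fun k => h (ρ k).succ) i⟩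
  corr x k l m h1 h2 h3 := D.corr x (ρ k) (ρ l) (ρ m) (ρ.injective.ne h1) (ρ.injective.ne h2)
    (ρ.injective.ne h3)
  wron := by
    obtain ⟨κ, hκ, h⟩ := D.wron
    exact ⟨κ, hκ, fun z k l m h1 h2 h3 => h z (ρ k) (ρ l) (ρ m) (ρ.injective.ne h1)
      (ρ.injective.ne h2) (ρ.injective.ne h3)⟩

/-- The curve with distinct positive parameters has a theta function parametrization. -/
theorem exists_thetaData {s : Fin 3 → ℝ} (hs : ∀ k, 0 < s k) (hinj : Function.Injective s) :
    Nonempty (ThetaData s) := by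
  set ρ := Tuple.sort s
  have hmono : StrictMono (s ∘ ρ) :=
    (Tuple.monotone_sort s).strictMono_of_injective (hinj.comp ρ.injective)
  have e : ![(s ∘ ρ) 0, (s ∘ ρ) 1, (s ∘ ρ) 2] = s ∘ ρ := by
    ext i
    fin_cases i <;> rfl
  obtain ⟨D⟩ := exists_thetaData_sorted (hs (ρ 0)) (hmono (by decide : (0 : Fin 3) < 1))
    (hmono (by decide : (1 : Fin 3) < 2))
  have D' : ThetaData (s ∘ ρ) := e ▸ D
  have D'' := D'.perm ρ.symm
  rw [Function.comp_assoc, Equiv.self_comp_symm, Function.comp_id] at D''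
  exact ⟨D''⟩

end ThetaData

end NC3

end

/-! ### The correspondence: uniqueness of the solution and its theta parametrization -/

noncomputable section

namespace NC3

section Correspondence

/-- The correspondence of the curve with parameters `s`. -/
def CorrS (s : Fin 3 → ℝ) (z w : Fin 4 → ℂ) : Prop :=
  ∀ k l m : Fin 3, k ≠ l → l ≠ m → m ≠ k →
    z 0 * w k.succ - z k.succ * w 0 = z l.succ * w m.succ + z m.succ * w l.succ ∧
    (s k : ℂ) * (z l.succ * w m.succ - z m.succ * w l.succ)
        = - ((s l - s m : ℝ) : ℂ) * (z 0 * w k.succ + z k.succ * w 0)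

variable {s : Fin 3 → ℝ}

lemma onC_sq {z : Fin 4 → ℂ} (hs : ∀ k, 0 < s k) (hz : OnC s z) :
    ∃ q : ℂ, ∀ k : Fin 3, z k.succ ^ 2 = z 0 ^ 2 - s k * q := by
  have h0 : (s 0 : ℂ) ≠ 0 := by exact_mod_cast (hs 0).ne'
  refine ⟨(z 0 ^ 2 - z (Fin.succ 0) ^ 2) / s 0, fun k => ?_⟩
  field_simp
  linear_combination -hz k 0

/-- On the curve z_k² = z₀² − s_k q. As the s_k are distinct and nonzero, the vanishing of two
coordinates forces z₀ = 0 and q = 0, hence z = 0. -/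
lemma OnC.ne_zero {z : Fin 4 → ℂ} (hs : ∀ k, 0 < s k) (hinj : Function.Injective s)
    (hz : OnC s z) (h0 : z ≠ 0) {i j : Fin 4} (hij : i ≠ j) (hi : z i = 0) : z j ≠ 0 := by
  intro hj
  obtain ⟨q, hq⟩ := onC_sq hs hz
  have hsc : ∀ k, (s k : ℂ) ≠ 0 := fun k => by exact_mod_cast (hs k).ne'
  have key : z 0 ^ 2 = 0 ∧ q = 0 := by
    have zc : ∀ k : Fin 3, z 0 = 0 → z k.succ = 0 → z 0 ^ 2 = 0 ∧ q = 0 := fun k h h' => by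
      have := hq k
      rw [h, h'] at this
      refine ⟨by simp [h], ?_⟩
      have h2 : (s k : ℂ) * q = 0 := by linear_combination this
      exact (mul_eq_zero.1 h2).resolve_left (hsc k)
    induction i using Fin.cases with
    | zero =>
      induction j using Fin.cases with
      | zero => exact absurd rfl hij
      | succ k => exact zc k hi hj
    | succ k =>
      induction j using Fin.cases with
      | zero => exact zc k hj hi
      | succ l =>
        have hkl : (s k : ℂ) - s l ≠ 0 := by
          rw [sub_ne_zero]
          exact_mod_cast hinj.ne (fun h => hij (by rw [h]))
        have e1 := hq k
        have e2 := hq l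
        rw [hi] at e1
        rw [hj] at e2
        have h2 : ((s k : ℂ) - s l) * q = 0 := by linear_combination e1 - e2
        have h3 := (mul_eq_zero.1 h2).resolve_left hkl
        rw [h3] at e1
        exact ⟨by linear_combination -e1, h3⟩
  apply h0
  ext i
  induction i using Fin.cases with
  | zero => exact pow_eq_zero_iff two_ne_zero |>.1 key.1
  | succ k => exact pow_eq_zero_iff two_ne_zero |>.1 (by rw [hq k, key.1, key.2]; simp)

lemma third_index : ∀ k l : Fin 3, k ≠ l → ∃ m, l ≠ m ∧ m ≠ k := by decide

/-- The combination of the two relations in which z_m w_l cancels; the relations in this form are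
the ones from which minors are eliminated. -/
lemma CorrS.rel {z w : Fin 4 → ℂ} (h : CorrS s z w) {k l m : Fin 3} (hkl : k ≠ l) (hlm : l ≠ m)
    (hmk : m ≠ k) : 2 * (s k : ℂ) * z l.succ * w m.succ =
      ((s k : ℂ) + s m - s l) * z 0 * w k.succ - ((s k : ℂ) + s l - s m) * z k.succ * w 0 := by
  obtain ⟨h1, h2⟩ := h k l m hkl hlm hmk
  push_cast at h2
  linear_combination h2 - (s k : ℂ) * h1

/-- Let p and P be the 2×2 minors of two solutions with and without the index 0. Eliminating one
entry of w, w' from `CorrS.rel` gives the linear relations `r1` to `r4` between them. Two instances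
of `r1` give Δ p_k = 0, where the quadratic form Δ in z does not depend on the choice of indices, by
the equations of the curve. If Δ ≠ 0 then p = 0, and the coefficients of P in `r2` and `r3` cannot
both vanish. If Δ = 0 then z₀ ≠ 0, and the argument depends on whether one of the numbers s_k + s_m
− s_l is zero. -/
lemma CorrS.minors {z w w' : Fin 4 → ℂ} (hs : ∀ k, 0 < s k)
    (hz : OnC s z) (h0 : z ≠ 0) (h : CorrS s z w) (h' : CorrS s z w')
    {k l m : Fin 3} (hkl : k ≠ l) (hlm : l ≠ m) (hmk : m ≠ k) :
    w 0 * w' k.succ = w k.succ * w' 0 ∧ w k.succ * w' m.succ = w m.succ * w' k.succ := by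
  set p : Fin 3 → ℂ := fun k => w 0 * w' k.succ - w k.succ * w' 0 with hp
  set P : Fin 3 → Fin 3 → ℂ := fun k m => w k.succ * w' m.succ - w m.succ * w' k.succ with hP
  obtain ⟨q, hq⟩ := onC_sq hs hz
  have hsc : ∀ k, (s k : ℂ) ≠ 0 := fun k => by exact_mod_cast (hs k).ne'
  have hPs : ∀ k m, P k m = -P m k := fun k m => by simp only [hP]; ring
  have r1 : ∀ {k l m : Fin 3}, k ≠ l → l ≠ m → m ≠ k →
      2 * (s k : ℂ) * z l.succ * p m = ((s k : ℂ) + s m - s l) * z 0 * p k := by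
    intro k l m hkl hlm hmk
    have e := h.rel hkl hlm hmk
    have e' := h'.rel hkl hlm hmk
    simp only [hp]
    linear_combination w 0 * e' - w' 0 * e
  have r2 : ∀ {k l m : Fin 3}, k ≠ l → l ≠ m → m ≠ k →
      2 * (s k : ℂ) * z l.succ * P m k = -(((s k : ℂ) + s l - s m) * z k.succ * p k) := by
    intro k l m hkl hlm hmk
    have e := h.rel hkl hlm hmk
    have e' := h'.rel hkl hlm hmk
    simp only [hp, hP]
    linear_combination w' k.succ * e - w k.succ * e'
  have r3 : ∀ {k l m : Fin 3}, k ≠ l → l ≠ m → m ≠ k →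
      ((s k : ℂ) + s m - s l) * z 0 * P k m = ((s k : ℂ) + s l - s m) * z k.succ * p m := by
    intro k l m hkl hlm hmk
    have e := h.rel hkl hlm hmk
    have e' := h'.rel hkl hlm hmk
    simp only [hp, hP]
    linear_combination w m.succ * e' - w' m.succ * e
  have r4 : ∀ {k l m : Fin 3}, k ≠ l → l ≠ m → m ≠ k →
      2 * (s k : ℂ) * z l.succ * P m l = ((s k : ℂ) + s m - s l) * z 0 * P k l -
        ((s k : ℂ) + s l - s m) * z k.succ * p l := by
    intro k l m hkl hlm hmk
    have e := h.rel hkl hlm hmk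
    have e' := h'.rel hkl hlm hmk
    simp only [hp, hP]
    linear_combination w' l.succ * e - w l.succ * e'
  suffices key : p k = 0 ∧ P k m = 0 from ⟨sub_eq_zero.1 key.1, sub_eq_zero.1 key.2⟩
  -- the common value of the discriminants
  set Δ : ℂ := ((s k : ℂ) + s m - s l) ^ 2 * z 0 ^ 2 - 4 * s k * s m * z l.succ ^ 2 with hΔ
  have Δl : Δ = ((s k : ℂ) + s m - s l) ^ 2 * z 0 ^ 2 - 4 * s k * s m * z l.succ ^ 2 := rfl
  have Δk : Δ = ((s m : ℂ) + s l - s k) ^ 2 * z 0 ^ 2 - 4 * s m * s l * z k.succ ^ 2 := by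
    rw [Δl, hq, hq]; ring
  have Δm : Δ = ((s k : ℂ) + s l - s m) ^ 2 * z 0 ^ 2 - 4 * s k * s l * z m.succ ^ 2 := by
    rw [Δl, hq, hq]; ring
  have hm0 : ∀ {k l m : Fin 3}, k ≠ l → l ≠ m → m ≠ k →
      Δ = ((s k : ℂ) + s m - s l) ^ 2 * z 0 ^ 2 - 4 * s k * s m * z l.succ ^ 2 → Δ * p k = 0 := by
    intro k l m hkl hlm hmk e
    rw [e]
    linear_combination (-(s k : ℂ) - s m + s l) * z 0 * r1 hkl hlm hmk -
      2 * s k * z l.succ * r1 hlm.symm hkl.symm hmk.symm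
  by_cases hΔ0 : Δ = 0
  · have hz0 : z 0 ≠ 0 := by
      intro hz0
      rw [hΔ0, hz0] at Δl Δk Δm
      have zz : ∀ {a b : Fin 3} {x c : ℂ}, (0 : ℂ) = c ^ 2 * 0 ^ 2 - 4 * s a * s b * x ^ 2 →
          x = 0 := by
        intro a b x c hx
        have : (4 * s a * s b : ℂ) * x ^ 2 = 0 := by linear_combination hx
        simpa [hsc] using this
      apply h0
      ext i
      induction i using Fin.cases with
      | zero => exact hz0
      | succ i =>
        have : i = k ∨ i = l ∨ i = m := by omega
        rcases this with rfl | rfl | rfl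
        · exact zz Δk
        · exact zz Δl
        · exact zz Δm
    have vanish : ∀ {k l m : Fin 3}, k ≠ l → l ≠ m → m ≠ k →
        (s k : ℂ) + s m - s l = 0 → Δ = ((s k : ℂ) + s m - s l) ^ 2 * z 0 ^ 2 -
          4 * s k * s m * z l.succ ^ 2 →
        Δ = ((s m : ℂ) + s l - s k) ^ 2 * z 0 ^ 2 - 4 * s m * s l * z k.succ ^ 2 →
        Δ = ((s k : ℂ) + s l - s m) ^ 2 * z 0 ^ 2 - 4 * s k * s l * z m.succ ^ 2 →
        (p k = 0 ∧ p l = 0 ∧ p m = 0) ∧ P k l = 0 ∧ P l m = 0 ∧ P k m = 0 := by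
      intro k l m hkl hlm hmk hA Δl Δk Δm
      have hAk : (s m : ℂ) + s l - s k ≠ 0 := by
        rw [show (s m : ℂ) + s l - s k = 2 * s m by linear_combination -hA]
        exact mul_ne_zero two_ne_zero (hsc m)
      have hAm : (s k : ℂ) + s l - s m ≠ 0 := by
        rw [show (s k : ℂ) + s l - s m = 2 * s k by linear_combination -hA]
        exact mul_ne_zero two_ne_zero (hsc k)
      have hzk : z k.succ ≠ 0 := by
        intro hzk
        rw [hzk, hΔ0] at Δk
        have : ((s m : ℂ) + s l - s k) ^ 2 * z 0 ^ 2 = 0 := by linear_combination -Δk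
        simp [hz0, hAk] at this
      have hzm : z m.succ ≠ 0 := by
        intro hzm
        rw [hzm, hΔ0] at Δm
        have : ((s k : ℂ) + s l - s m) ^ 2 * z 0 ^ 2 = 0 := by linear_combination -Δm
        simp [hz0, hAm] at this
      have pm : p m = 0 := by
        have := r3 hkl hlm hmk
        rw [hA, zero_mul, zero_mul] at this
        simpa [hAm, hzk] using this.symm
      have pk : p k = 0 := by
        have := r3 hlm.symm hkl.symm hmk.symm
        rw [add_comm (s m : ℂ), hA, zero_mul, zero_mul] at this
        simpa [hAk, hzm] using this.symm
      have pl : p l = 0 := by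
        have := r1 hmk hkl hlm
        rw [pm, mul_zero] at this
        simpa [hsc, hzk] using this
      have Plm : P l m = 0 := by
        have := r3 hkl.symm hmk.symm hlm.symm
        rw [pm, mul_zero, add_comm (s l : ℂ)] at this
        simpa [hAk, hz0] using this
      have Pkl : P k l = 0 := by
        have := r3 hmk.symm hlm.symm hkl.symm
        rw [pl, mul_zero] at this
        simpa [hAm, hz0] using this
      have Pkm : P k m = 0 := by
        have := r4 hmk.symm hlm.symm hkl.symm
        rw [pm, Plm] at this
        simpa [hAm, hz0] using this
      exact ⟨⟨pk, pl, pm⟩, Pkl, Plm, Pkm⟩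
    by_cases hAl : (s k : ℂ) + s m - s l = 0
    · obtain ⟨⟨a, -, -⟩, -, -, b⟩ := vanish hkl hlm hmk hAl Δl Δk Δm
      exact ⟨a, b⟩
    by_cases hAk : (s m : ℂ) + s l - s k = 0
    · obtain ⟨⟨-, a, -⟩, b, -, -⟩ := vanish hmk hkl hlm hAk Δk
        (by rw [Δm]; ring) (by rw [Δl]; ring)
      exact ⟨a, by rw [hPs, b, neg_zero]⟩
    by_cases hAm : (s k : ℂ) + s l - s m = 0
    · obtain ⟨⟨-, -, a⟩, -, b, -⟩ := vanish hlm hmk hkl (by rw [← hAm]; ring) (by rw [Δm]; ring)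
        Δl (by rw [Δk]; ring)
      exact ⟨a, by rw [hPs, b, neg_zero]⟩
    have hzl : z l.succ ≠ 0 := by
      intro hzl
      rw [hzl, hΔ0] at Δl
      have : ((s k : ℂ) + s m - s l) ^ 2 * z 0 ^ 2 = 0 := by linear_combination -Δl
      simp [hz0, hAl] at this
    have pk : p k = 0 := by
      have c1 := r1 hkl hlm hmk
      have c2 := r1 hmk hkl hlm
      have c3 := r1 hlm hmk hkl
      have d2 := r2 hkl hlm hmk
      have d3 := r3 hlm.symm hkl.symm hmk.symm
      -- Two different multiples of p_k vanish. Modulo Δ = 0 they combine to a multiple, `e4`, whose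
      -- factor is a product of nonzero numbers.
      have e1 : (((s k : ℂ) + s l - s m) * ((s k : ℂ) + s m - s l) * z 0 * z k.succ +
          2 * s k * ((s m : ℂ) + s l - s k) * z l.succ * z m.succ) * p k = 0 := by
        linear_combination (((s k : ℂ) + s m - s l) * z 0) * d2 - (2 * s k * z l.succ) * d3
      have e2 : (8 * s k * s l * s m * z k.succ * z l.succ * z m.succ -
          ((s k : ℂ) + s m - s l) * ((s m : ℂ) + s l - s k) * ((s k : ℂ) + s l - s m) * z 0 ^ 3) *
          p k = 0 := by
        linear_combination 4 * s k * s m * z k.succ * z l.succ * c3 +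
          2 * s k * z l.succ * ((s k : ℂ) + s l - s m) * z 0 * c2 +
          ((s k : ℂ) + s l - s m) * ((s m : ℂ) + s l - s k) * z 0 ^ 2 * c1
      have e3 := Δk.symm.trans hΔ0
      have e4 : 2 * ((s m : ℂ) + s l - s k) ^ 2 * ((s k : ℂ) + s m - s l) *
          ((s k : ℂ) + s l - s m) * z 0 ^ 3 * p k = 0 := by
        linear_combination 4 * s l * s m * z k.succ * e1 - ((s m : ℂ) + s l - s k) * e2 +
          ((s k : ℂ) + s m - s l) * ((s k : ℂ) + s l - s m) * z 0 * p k * e3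
      refine (mul_eq_zero.1 e4).resolve_left ?_
      exact mul_ne_zero (mul_ne_zero (mul_ne_zero (mul_ne_zero two_ne_zero (pow_ne_zero _ hAk)) hAl)
        hAm) (pow_ne_zero _ hz0)
    have Pkm : P k m = 0 := by
      have := r2 hkl hlm hmk
      rw [pk, mul_zero, neg_zero] at this
      have h := (mul_eq_zero.1 this).resolve_left (by simp [hsc, hzl])
      rw [hPs, h, neg_zero]
    exact ⟨pk, Pkm⟩
  · have pk : p k = 0 := (mul_eq_zero.1 (hm0 hkl hlm hmk Δl)).resolve_left hΔ0
    have pm : p m = 0 := (mul_eq_zero.1 (hm0 hlm.symm hkl.symm hmk.symm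
      (by rw [Δl]; ring))).resolve_left hΔ0
    refine ⟨pk, ?_⟩
    have a1 := r3 hkl hlm hmk
    have a2 := r2 hkl hlm hmk
    rw [pm, mul_zero] at a1
    rw [pk, mul_zero, neg_zero, hPs] at a2
    by_contra hne
    have b1 : ((s k : ℂ) + s m - s l) * z 0 = 0 := (mul_eq_zero.1 a1).resolve_right hne
    have b2 : 2 * (s k : ℂ) * z l.succ = 0 := (mul_eq_zero.1 a2).resolve_right (neg_ne_zero.2 hne)
    apply hΔ0
    rw [Δl]
    linear_combination ((s k : ℂ) + s m - s l) * z 0 * b1 - 2 * s m * z l.succ * b2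

/-- Two solutions of the correspondence are proportional. -/
lemma CorrS.unique {z w w' : Fin 4 → ℂ} (hs : ∀ k, 0 < s k) (hz : OnC s z) (h0 : z ≠ 0)
    (h : CorrS s z w) (h' : CorrS s z w') (hw : w ≠ 0) : ∃ c : ℂ, w' = c • w := by
  have key : ∀ i j, w i * w' j = w j * w' i := by
    intro i j
    have a0 : ∀ k : Fin 3, w 0 * w' k.succ = w k.succ * w' 0 := by
      intro k
      obtain ⟨m, h1, h2⟩ := third_index k (k + 1) (by simp)
      exact (h.minors hs hz h0 h' (by simp) h1 h2).1
    induction i using Fin.cases with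
    | zero =>
      induction j using Fin.cases with
      | zero => rfl
      | succ k => exact a0 k
    | succ k =>
      induction j using Fin.cases with
      | zero => exact (a0 k).symm
      | succ m =>
        by_cases hkm : m = k
        · rw [hkm]
        · obtain ⟨l, h1, h2⟩ := third_index m k hkm
          exact (h.minors hs hz h0 h' h1 h2 hkm).2
  obtain ⟨i, hi⟩ := Function.ne_iff.1 hw
  simp only [Pi.zero_apply] at hi
  refine ⟨w' i / w i, ?_⟩
  ext j
  simp only [Pi.smul_apply, smul_eq_mul]
  field_simp
  linear_combination key i j

/-- The second relation follows from the first. With z_k² = z₀² − s_k q and w_k² = w₀² − s_k r, the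
products (z_l w_m + z_m w_l)(z_l w_m − z_m w_l) and (z₀w_k − z_k w₀)(z₀w_k + z_k w₀) are s_m − s_l
and s_k times the same number q w₀² − r z₀². The first relation equates the first factors, so the
second relation holds after multiplication by a function of x that is not identically zero, and this
factor can be cancelled by analyticity. -/
lemma ThetaData.corrS (D : ThetaData s) (hs : ∀ k, 0 < s k) (x : ℂ) :
    CorrS s (D.Z (x + D.z₀)) (D.Z (x - D.z₀)) := by
  intro k l m hkl hlm hmk
  refine ⟨D.corr x k l m hkl hlm hmk, ?_⟩
  obtain ⟨c, hc, hspec⟩ := D.spec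
  have d1 : ∀ i, Differentiable ℂ fun x => D.Z (x + D.z₀) i := fun i =>
    (D.diff i).comp (differentiable_id.add_const _)
  have d2 : ∀ i, Differentiable ℂ fun x => D.Z (x - D.z₀) i := fun i =>
    (D.diff i).comp (differentiable_id.sub_const _)
  refine sub_eq_zero.1 (eq_zero_of_mul_eq_zero (z₀ := 0)
    (f := fun x => D.Z (x + D.z₀) 0 * D.Z (x - D.z₀) k.succ -
      D.Z (x + D.z₀) k.succ * D.Z (x - D.z₀) 0)
    (g := fun x => (s k : ℂ) * (D.Z (x + D.z₀) l.succ * D.Z (x - D.z₀) m.succ -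
      D.Z (x + D.z₀) m.succ * D.Z (x - D.z₀) l.succ) - - ((s l - s m : ℝ) : ℂ) *
      (D.Z (x + D.z₀) 0 * D.Z (x - D.z₀) k.succ + D.Z (x + D.z₀) k.succ * D.Z (x - D.z₀) 0))
    (((d1 _).mul (d2 _)).sub ((d1 _).mul (d2 _))) ?_ ?_ ?_ x)
  · exact ((((d1 _).mul (d2 _)).sub ((d1 _).mul (d2 _))).const_mul _).sub
      ((((d1 _).mul (d2 _)).add ((d1 _).mul (d2 _))).const_mul _)
  · rw [zero_add, zero_sub, D.neg_zero, D.neg_succ, hspec, hspec]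
    ring_nf
    simpa using hc
  · intro y
    have hA := D.corr y k l m hkl hlm hmk
    obtain ⟨q, hq⟩ := onC_sq hs (D.on (y + D.z₀))
    obtain ⟨r, hr⟩ := onC_sq hs (D.on (y - D.z₀))
    push_cast
    have qk := hq k; have ql := hq l; have qm := hq m
    have rk := hr k; have rl := hr l; have rm := hr m
    generalize D.Z (y + D.z₀) = Z at *
    generalize D.Z (y - D.z₀) = W at *
    have e1 : (Z l.succ * W m.succ + Z m.succ * W l.succ) *
        (Z l.succ * W m.succ - Z m.succ * W l.succ) =
        ((s m : ℂ) - s l) * (q * W 0 ^ 2 - r * Z 0 ^ 2) := by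
      linear_combination ql * W m.succ ^ 2 + (Z 0 ^ 2 - s l * q) * rm - qm * W l.succ ^ 2 -
        (Z 0 ^ 2 - s m * q) * rl
    have e2 : (Z 0 * W k.succ - Z k.succ * W 0) * (Z 0 * W k.succ + Z k.succ * W 0) =
        s k * (q * W 0 ^ 2 - r * Z 0 ^ 2) := by
      linear_combination Z 0 ^ 2 * rk - qk * W 0 ^ 2
    linear_combination s k * e1 + s k * (Z l.succ * W m.succ - Z m.succ * W l.succ) * hA +
      ((s l : ℂ) - s m) * e2

end Correspondence

end NC3

end

/-! ### The curve in projective space and σ as a translation -/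

noncomputable section

namespace NC3

section Curve

open Complex Real Filter Topology

/-- The absolute values of the parameters. -/
def absS (φ : Fin 3 → ℝ) (k : Fin 3) : ℝ := |s φ k|

variable {φ : Fin 3 → ℝ}

lemma IsGeneric.cos_ne (h : IsGeneric φ) (k : Fin 3) : Real.cos (φ k) ≠ 0 := fun h0 => by
  obtain ⟨n, hn⟩ := Real.cos_eq_zero_iff.1 h0
  exact h.angle k (2 * n + 1) (by rw [hn]; push_cast; ring)

lemma IsGeneric.sin_ne (h : IsGeneric φ) (k : Fin 3) : Real.sin (φ k) ≠ 0 := fun h0 => by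
  obtain ⟨n, hn⟩ := Real.sin_eq_zero_iff.1 h0
  exact h.angle k (2 * n) (by rw [← hn]; push_cast; ring)

lemma IsGeneric.sin_sub_ne (h : IsGeneric φ) {k l : Fin 3} (hkl : k ≠ l) :
    Real.sin (φ k - φ l) ≠ 0 := fun h0 => by
  obtain ⟨n, hn⟩ := Real.sin_eq_zero_iff.1 h0
  exact h.diff k l hkl (2 * n) (by rw [← hn]; push_cast; ring)

lemma absS_pos (he : IsEven φ) (k : Fin 3) : 0 < absS φ k := by
  rcases he with h | h
  · exact abs_pos.2 (h k).ne'
  · exact abs_pos.2 (h k).ne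

lemma IsEven.sign (he : IsEven φ) : ∃ e : ℝ, e ≠ 0 ∧ ∀ k, absS φ k = e * s φ k := by
  rcases he with h | h
  · exact ⟨1, one_ne_zero, fun k => by rw [absS, abs_of_pos (h k), one_mul]⟩
  · exact ⟨-1, by norm_num, fun k => by rw [absS, abs_of_neg (h k), neg_one_mul]⟩

/-- The difference is tan φ_m (tan φ_l − tan φ_k), a nonzero multiple of sin φ_m sin(φ_k − φ_l). -/
lemma s_ne (h : IsGeneric φ) {k l m : Fin 3} (hkl : k ≠ l)
    (hk : s φ k = 1 + Real.tan (φ l) * Real.tan (φ m))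
    (hl : s φ l = 1 + Real.tan (φ m) * Real.tan (φ k)) : s φ k ≠ s φ l := by
  intro e
  rw [hk, hl, Real.tan_eq_sin_div_cos, Real.tan_eq_sin_div_cos, Real.tan_eq_sin_div_cos] at e
  have := h.cos_ne k; have := h.cos_ne l; have := h.cos_ne m
  field_simp at e
  have h1 := h.sin_sub_ne hkl
  rw [Real.sin_sub] at h1
  exact mul_ne_zero (h.sin_ne m) h1 (by linear_combination -e)

lemma absS_injective (h : IsGeneric φ) (he : IsEven φ) : Function.Injective (absS φ) := by
  obtain ⟨e, he0, he⟩ := he.sign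
  intro k l hkl
  by_contra hne
  rw [he, he] at hkl
  have hs := mul_left_cancel₀ he0 hkl
  have : l = k + 1 ∨ k = l + 1 := by omega
  rcases this with rfl | rfl
  · refine s_ne h (m := k + 2) hne rfl ?_ hs
    rw [s]
    congr 3
    all_goals congr 1; omega
  · refine s_ne h (m := l + 2) (Ne.symm hne) rfl ?_ hs.symm
    rw [s]
    congr 3
    all_goals congr 1; omega

lemma onCurve_iff (he : IsEven φ) {z : Fin 4 → ℂ} : OnCurve φ z ↔ OnC (absS φ) z := by
  obtain ⟨e, he0, he⟩ := he.sign
  have he0' : (e : ℂ) ≠ 0 := by exact_mod_cast he0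
  refine forall_congr' fun k => forall_congr' fun l => ?_
  rw [he, he]
  push_cast
  rw [mul_assoc, mul_assoc]
  exact (mul_right_inj' he0').symm

lemma corr_iff (he : IsEven φ) {z w : Fin 4 → ℂ} : Corr φ z w ↔ CorrS (absS φ) z w := by
  obtain ⟨e, he0, he⟩ := he.sign
  have he0' : (e : ℂ) ≠ 0 := by exact_mod_cast he0
  constructor
  · intro h k l m hkl hlm hmk
    obtain ⟨h1, h2⟩ := h k
    rw [he, he, he]
    have : (l = k + 1 ∧ m = k + 2) ∨ (l = k + 2 ∧ m = k + 1) := by omega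
    push_cast at h2 ⊢
    rcases this with ⟨rfl, rfl⟩ | ⟨rfl, rfl⟩
    · exact ⟨h1, by linear_combination e * h2⟩
    · exact ⟨by rw [h1]; ring, by linear_combination -e * h2⟩
  · intro h k
    obtain ⟨h1, h2⟩ := h k (k + 1) (k + 2) (by omega) (by omega) (by omega)
    refine ⟨h1, mul_left_cancel₀ he0' ?_⟩
    rw [he, he, he] at h2
    push_cast at h2 ⊢
    linear_combination h2

lemma continuous_projMk {X : Type*} [TopologicalSpace X] {f : X → Fin 4 → ℂ} (hf : Continuous f)
    (h0 : ∀ x, f x ≠ 0) : Continuous fun x => (Projectivization.mk ℂ (f x) (h0 x) : P3) :=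
  continuous_coinduced_rng.comp (hf.subtype_mk h0)

/-- The rank one projection onto a point of projective space. -/
def projMatrix (v : {v : Fin 4 → ℂ // v ≠ 0}) (ij : Fin 4 × Fin 4) : ℂ :=
  v.1 ij.1 * (starRingEnd ℂ) (v.1 ij.2) / ∑ k, (‖v.1 k‖ ^ 2 : ℝ)

lemma sum_norm_sq_pos {v : Fin 4 → ℂ} (hv : v ≠ 0) : 0 < ∑ k, ‖v k‖ ^ 2 := by
  obtain ⟨i, hi⟩ := Function.ne_iff.1 hv
  exact Finset.sum_pos' (fun _ _ => by positivity)
    ⟨i, Finset.mem_univ i, pow_pos (norm_pos_iff.2 hi) 2⟩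

/-- A line is determined by the orthogonal projection onto it, and the matrix of this projection
depends continuously on the line. The Hausdorff property is what makes compact images such as the
real circles closed. -/
instance : T2Space P3 := by
  let g : P3 → Fin 4 × Fin 4 → ℂ := Projectivization.lift projMatrix (by
    rintro ⟨a, ha⟩ ⟨b, hb⟩ t h
    simp only at h
    subst h
    have ht : t ≠ 0 := by
      rintro rfl
      exact ha (zero_smul _ _)
    ext ij
    have hb' : ((∑ k, (‖b k‖ ^ 2 : ℝ) : ℝ) : ℂ) ≠ 0 := by exact_mod_cast (sum_norm_sq_pos hb).ne'
    simp only [projMatrix, Pi.smul_apply, smul_eq_mul, norm_mul, mul_pow, map_mul] at hb' ⊢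
    push_cast at hb' ⊢
    rw [← Finset.mul_sum, ← mul_conj' t]
    have ht' : (starRingEnd ℂ) t ≠ 0 := by simpa using ht
    field_simp)
  have hg : Continuous g := by
    refine continuous_coinduced_dom.2 ?_
    change Continuous projMatrix
    refine continuous_pi fun ij => ?_
    have hc : ∀ i, Continuous fun v : {v : Fin 4 → ℂ // v ≠ 0} => v.1 i := fun i =>
      (continuous_apply i).comp continuous_subtype_val
    refine ((hc _).mul (continuous_conj.comp (hc _))).div ?_ fun v => ?_
    · exact continuous_ofReal.comp (continuous_finsetSum _ fun k _ => (hc k).norm.pow 2)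
    · exact_mod_cast (sum_norm_sq_pos v.2).ne'
  refine T2Space.of_injective_continuous (f := g) ?_ hg
  intro p q h
  induction p using Projectivization.ind with
  | h v hv =>
  induction q using Projectivization.ind with
  | h w hw =>
  rw [Projectivization.mk_eq_mk_iff']
  obtain ⟨j, hj⟩ := Function.ne_iff.1 hv
  have e : ∀ i, v i * (starRingEnd ℂ) (v j) / ∑ k, (‖v k‖ ^ 2 : ℝ) =
      w i * (starRingEnd ℂ) (w j) / ∑ k, (‖w k‖ ^ 2 : ℝ) := fun i => congrFun h (i, j)
  have hv' : ((∑ k, (‖v k‖ ^ 2 : ℝ) : ℝ) : ℂ) ≠ 0 := by exact_mod_cast (sum_norm_sq_pos hv).ne'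
  have hw' : ((∑ k, (‖w k‖ ^ 2 : ℝ) : ℝ) : ℂ) ≠ 0 := by exact_mod_cast (sum_norm_sq_pos hw).ne'
  have hj' : (starRingEnd ℂ) (v j) ≠ 0 := by simpa using hj
  push_cast at e hv' hw'
  refine ⟨(starRingEnd ℂ) (w j) / (∑ k, (‖w k‖ : ℂ) ^ 2) * (∑ k, (‖v k‖ : ℂ) ^ 2) /
    (starRingEnd ℂ) (v j), ?_⟩
  ext i
  have ei := e i
  simp only [Pi.smul_apply, smul_eq_mul]
  field_simp at ei ⊢
  linear_combination -ei

lemma onCurve_rep {v : Fin 4 → ℂ} (hv : v ≠ 0) :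
    Projectivization.mk ℂ v hv ∈ curve φ ↔ OnCurve φ v := by
  obtain ⟨a, ha⟩ := Projectivization.exists_smul_eq_mk_rep ℂ v hv
  change OnCurve φ _ ↔ _
  rw [← ha]
  refine ⟨fun h => ?_, fun h => h.smul (a : ℂ)⟩
  have := h.smul ((a⁻¹ : ℂˣ) : ℂ)
  rwa [← Units.smul_def, inv_smul_smul] at this

lemma CorrS.smul {s : Fin 3 → ℝ} {z w : Fin 4 → ℂ} (h : CorrS s z w) (a b : ℂ) :
    CorrS s (a • z) (b • w) := by
  intro k l m hkl hlm hmk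
  obtain ⟨h1, h2⟩ := h k l m hkl hlm hmk
  simp only [Pi.smul_apply, smul_eq_mul]
  exact ⟨by linear_combination a * b * h1, by linear_combination a * b * h2⟩

/-- `σ` is determined by the correspondence. -/
lemma sigma_mk (he : IsEven φ) {z w : Fin 4 → ℂ} (hz : z ≠ 0) (hw : w ≠ 0)
    (hon : OnC (absS φ) z) (h : CorrS (absS φ) z w) :
    sigma φ (Projectivization.mk ℂ z hz) = Projectivization.mk ℂ w hw := by
  obtain ⟨a, ha⟩ := Projectivization.exists_smul_eq_mk_rep ℂ z hz
  obtain ⟨b, hb⟩ := Projectivization.exists_smul_eq_mk_rep ℂ w hw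
  have h1 : Corr φ (Projectivization.mk ℂ z hz).rep (Projectivization.mk ℂ w hw).rep := by
    rw [corr_iff he, ← ha, ← hb]
    exact h.smul (a : ℂ) (b : ℂ)
  have h2 := Classical.epsilon_spec
    (p := fun W : P3 => Corr φ (Projectivization.mk ℂ z hz).rep W.rep) ⟨_, h1⟩
  change Corr φ (Projectivization.mk ℂ z hz).rep (sigma φ (Projectivization.mk ℂ z hz)).rep at h2
  rw [corr_iff he] at h1 h2
  obtain ⟨c, hc⟩ := h1.unique (absS_pos he) ((onCurve_iff he).1 ((onCurve_rep hz).2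
    ((onCurve_iff he).2 hon))) (Projectivization.rep_nonzero _) h2 (Projectivization.rep_nonzero _)
  rw [← Projectivization.mk_rep (sigma φ (Projectivization.mk ℂ z hz)),
    ← Projectivization.mk_rep (Projectivization.mk ℂ w hw), Projectivization.mk_eq_mk_iff']
  exact ⟨c, hc.symm⟩

namespace ThetaData

variable (D : ThetaData (absS φ))

/-- The point of the curve with a given theta function parameter. -/
def pt (z : ℂ) : P3 := Projectivization.mk ℂ (D.Z z) (D.ne z)

lemma continuous_Z : Continuous D.Z := continuous_pi fun i => (D.diff i).continuous

lemma continuous_pt : Continuous D.pt := continuous_projMk D.continuous_Z D.ne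

lemma pt_mem (he : IsEven φ) (z : ℂ) : D.pt z ∈ curve φ :=
  (onCurve_rep _).2 ((onCurve_iff he).2 (D.on z))

lemma exists_pt (he : IsEven φ) {p : P3} (hp : p ∈ curve φ) : ∃ z, D.pt z = p := by
  obtain ⟨z, c, h⟩ := D.surj p.rep ((onCurve_iff he).1 hp)
  refine ⟨z, ?_⟩
  rw [← Projectivization.mk_rep p, pt, Eq.comm, Projectivization.mk_eq_mk_iff']
  exact ⟨c, h.symm⟩

lemma pt_lattice (z : ℂ) (m n : ℤ) : D.pt (z + 2 * m + 2 * n * (D.t * I)) = D.pt z := by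
  have h1 : Function.Periodic D.pt 2 := fun z => by simp only [pt, D.per]
  have h2 : Function.Periodic D.pt (2 * (D.t * I)) := fun z => by
    rw [pt, pt, Projectivization.mk_eq_mk_iff']
    exact ⟨_, (D.qper z).symm⟩
  have h3 := (h2.int_mul n) (z + 2 * m)
  rw [show z + 2 * m + 2 * n * (D.t * I) = z + 2 * m + n * (2 * (D.t * I)) by ring, h3]
  rw [mul_comm]
  exact (h1.int_mul m) z

lemma pt_eq_iff {z w : ℂ} :
    D.pt z = D.pt w ↔ ∃ m n : ℤ, z - w = 2 * m + 2 * n * (D.t * I) := by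
  constructor
  · intro h
    rw [pt, pt, Projectivization.mk_eq_mk_iff'] at h
    obtain ⟨c, hc⟩ := h
    exact D.inj z w c hc.symm
  · rintro ⟨m, n, h⟩
    rw [show z = w + 2 * m + 2 * n * (D.t * I) by linear_combination h, pt_lattice]

lemma sigma_pt (he : IsEven φ) (z : ℂ) : sigma φ (D.pt z) = D.pt (z - 2 * D.z₀) := by
  have h := D.corrS (absS_pos he) (z - D.z₀)
  have e1 : z - D.z₀ + D.z₀ = z := by ring
  have e2 : z - D.z₀ - D.z₀ = z - 2 * D.z₀ := by ring
  rw [e1, e2] at h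
  exact sigma_mk he (D.ne _) (D.ne _) (D.on z) h

lemma iterate_sigma_pt (he : IsEven φ) (n : ℕ) (z : ℂ) :
    (sigma φ)^[n] (D.pt z) = D.pt (z - n * (2 * D.z₀)) := by
  induction n with
  | zero => simp
  | succ n ih =>
    rw [Function.iterate_succ_apply', ih, D.sigma_pt he]
    congr 1
    push_cast
    ring

/-- If z₀ were rational with denominator d, then 2dz₀ would be a period and the d-th iterate of σ
the identity. -/
lemma irrational (h : IsGeneric φ) (he : IsEven φ) : Irrational D.z₀ := by
  rintro ⟨q, hq⟩
  obtain ⟨Z, hZ, hne⟩ := h.infiniteOrder q.den q.den_pos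
  obtain ⟨z, rfl⟩ := D.exists_pt he hZ
  apply hne
  rw [D.iterate_sigma_pt he, D.pt_eq_iff]
  refine ⟨-q.num, 0, ?_⟩
  have : (q.den : ℂ) * D.z₀ = q.num := by
    rw [← hq, ofReal_ratCast]
    exact_mod_cast Rat.den_mul_eq_num q
  push_cast
  linear_combination -2 * this

lemma pt_base : D.pt D.z₀ = p₀ := by
  obtain ⟨c, hc, h⟩ := D.spec
  rw [pt, p₀, Projectivization.mk_eq_mk_iff']
  refine ⟨c, ?_⟩
  ext i
  rw [h]
  fin_cases i <;> simp

lemma pt_neg_base : D.pt (-D.z₀) = q₀ := by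
  obtain ⟨c, hc, h⟩ := D.spec
  rw [pt, q₀, Projectivization.mk_eq_mk_iff']
  refine ⟨c, ?_⟩
  ext i
  refine Fin.cases ?_ (fun k => ?_) i
  · rw [D.neg_zero, h]; simp
  · rw [D.neg_succ, h]; fin_cases k <;> simp

end ThetaData

end Curve

end NC3

end

/-! ### Real circles, compact invariant sets and the torus component -/

noncomputable section

namespace NC3

section Components

open Complex Real Filter Topology

/-- The subgroup generated by 2 and 2a is dense because a is irrational, and a closed set stable
under it contains the closure of an orbit. -/
lemma eq_univ_of_irrational {a : ℝ} (ha : Irrational a) {A : Set ℝ} (hA : IsClosed A)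
    (h2 : ∀ x ∈ A, x + 2 ∈ A ∧ x - 2 ∈ A) (hz : ∀ x ∈ A, x + 2 * a ∈ A ∧ x - 2 * a ∈ A)
    (hne : A.Nonempty) : A = Set.univ := by
  obtain ⟨x, hx⟩ := hne
  have hd : Dense (AddSubgroup.closure {2 * a, 2} : Set ℝ) :=
    dense_addSubgroupClosure_pair_iff.2 (by rwa [mul_div_cancel_left₀ a two_ne_zero])
  have hG : ∀ g ∈ AddSubgroup.closure {2 * a, 2}, ∀ x ∈ A, x + g ∈ A ∧ x - g ∈ A := by
    intro g hg
    induction hg using AddSubgroup.closure_induction with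
    | mem g hg =>
      rcases hg with rfl | rfl
      · exact hz
      · exact h2
    | zero => intro x hx; simpa using hx
    | add g g' _ _ h h' =>
      intro x hx
      exact ⟨by rw [← add_assoc]; exact (h' _ (h x hx).1).1,
        by rw [← sub_sub]; exact (h' _ (h x hx).2).2⟩
    | neg g _ h =>
      intro x hx
      exact ⟨by rw [← sub_eq_add_neg]; exact (h x hx).2, by rw [sub_neg_eq_add]; exact (h x hx).1⟩
  refine Set.eq_univ_of_forall fun y => ?_
  have hcl : IsClosed {g : ℝ | x + g ∈ A} := hA.preimage (by fun_prop)
  have : (y - x) ∈ {g : ℝ | x + g ∈ A} :=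
    closure_minimal (fun g hg => (hG g hg x hx).1) hcl (hd (y - x))
  simpa using this

lemma connectedComponentIn_union {X : Type*} [TopologicalSpace X] {A B : Set X} (hA : IsClosed A)
    (hB : IsClosed B) (hAB : Disjoint A B) (hc : IsPreconnected A) {x : X} (hx : x ∈ A) :
    connectedComponentIn (A ∪ B) x = A := by
  refine Set.Subset.antisymm ?_ (hc.subset_connectedComponentIn hx Set.subset_union_left)
  have hsub := connectedComponentIn_subset (A ∪ B) x
  have hmem : x ∈ connectedComponentIn (A ∪ B) x :=
    mem_connectedComponentIn (Set.mem_union_left B hx)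
  rcases isPreconnected_iff_subset_of_disjoint_closed.1
    (isPreconnected_connectedComponentIn (F := A ∪ B) (x := x)) A B hA hB hsub
    (by rw [hAB.inter_eq, Set.inter_empty]) with h | h
  · exact h
  · exact absurd (h hmem) (Set.disjoint_left.1 hAB hx)

variable {φ : Fin 3 → ℝ}

namespace ThetaData

variable (D : ThetaData (absS φ))

/-- A translate of the circle of real parameters. -/
def line (y : ℝ) : Set P3 := Set.range fun x : ℝ => D.pt (x + y * (D.t * I))

lemma mem_line_iff {y : ℝ} {z : ℂ} : D.pt z ∈ D.line y ↔ ∃ n : ℤ, z.im = (y + 2 * n) * D.t := by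
  constructor
  · rintro ⟨x, hx⟩
    obtain ⟨m, n, h⟩ := D.pt_eq_iff.1 hx
    refine ⟨-n, ?_⟩
    have := congrArg Complex.im h
    simp at this
    push_cast
    linarith
  · rintro ⟨n, hn⟩
    refine ⟨z.re, D.pt_eq_iff.2 ⟨0, -n, ?_⟩⟩
    apply Complex.ext
    · simp
    · simp [hn]; ring

lemma isPreconnected_line (y : ℝ) : IsPreconnected (D.line y) :=
  isPreconnected_range (D.continuous_pt.comp (by fun_prop))

lemma pt_add_int (z : ℂ) (m : ℤ) : D.pt (z + 2 * m) = D.pt z := by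
  simpa using D.pt_lattice z m 0

lemma isCompact_line (y : ℝ) : IsCompact (D.line y) := by
  have : D.line y = (fun x : ℝ => D.pt (x + y * (D.t * I))) '' Set.Icc 0 2 := by
    refine Set.Subset.antisymm ?_ (Set.image_subset_range _ _)
    rintro _ ⟨x, rfl⟩
    refine ⟨x - 2 * ⌊x / 2⌋, ⟨?_, ?_⟩, ?_⟩
    · linarith [Int.floor_le (x / 2)]
    · linarith [Int.lt_floor_add_one (x / 2)]
    · have := D.pt_add_int (x + y * (D.t * I)) (-⌊x / 2⌋)
      dsimp only
      rw [← this]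
      congr 1
      push_cast
      ring
  rw [this]
  exact isCompact_Icc.image (D.continuous_pt.comp (by fun_prop))

lemma sigma_line (he : IsEven φ) (y : ℝ) : sigma φ '' D.line y = D.line y := by
  ext p
  constructor
  · rintro ⟨_, ⟨x, rfl⟩, rfl⟩
    refine ⟨x - 2 * D.z₀, ?_⟩
    dsimp only
    rw [D.sigma_pt he]
    congr 1
    push_cast
    ring
  · rintro ⟨x, rfl⟩
    refine ⟨_, ⟨x + 2 * D.z₀, rfl⟩, ?_⟩
    dsimp only
    rw [D.sigma_pt he]
    congr 1
    push_cast
    ring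

lemma disjoint_line : Disjoint (D.line 0) (D.line 1) := by
  rw [Set.disjoint_left]
  rintro _ ⟨x, rfl⟩ h
  obtain ⟨n, hn⟩ := D.mem_line_iff.1 h
  simp at hn
  have h1 : (1 + 2 * n : ℝ) = 0 := hn.resolve_right D.t_pos.ne'
  have h2 : (1 + 2 * n : ℤ) = 0 := by exact_mod_cast h1
  omega

lemma line_subset_curve (he : IsEven φ) (y : ℝ) : D.line y ⊆ curve φ := by
  rintro _ ⟨x, rfl⟩
  exact D.pt_mem he _

/-- Conjugation of a point is conjugation of its parameter, so a point with a real representative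
has z̄ ≡ z modulo the lattice, that is Im z ∈ tℤ; the parity of the multiple selects the circle.
Conversely Z is real on the real line, and real up to the automorphy factor on the line Im z = t. -/
lemma realCurve_eq (he : IsEven φ) : realCurve φ = D.line 0 ∪ D.line 1 := by
  ext p
  constructor
  · rintro ⟨hp, v, hv, rfl⟩
    obtain ⟨z, hz⟩ := D.exists_pt he hp
    rw [← hz, Set.mem_union, D.mem_line_iff, D.mem_line_iff]
    rw [pt, Projectivization.mk_eq_mk_iff'] at hz
    obtain ⟨c, hc⟩ := hz
    have hc0 : c ≠ 0 := by
      rintro rfl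
      exact D.ne z (by rw [← hc, zero_smul])
    have h1 : D.Z ((starRingEnd ℂ) z) = ((starRingEnd ℂ) c / c) • D.Z z := by
      ext i
      rw [← D.conj, ← hc]
      simp only [Pi.smul_apply, smul_eq_mul, map_mul, conj_ofReal]
      field_simp
    obtain ⟨m, n, h⟩ := D.inj _ _ _ h1
    have h2 := congrArg Complex.im h
    simp at h2
    have h3 : z.im = -n * D.t := by linarith
    obtain ⟨j, hj | hj⟩ := Int.even_or_odd' n
    · left
      exact ⟨-j, by rw [h3, hj]; push_cast; ring⟩
    · right
      exact ⟨-j - 1, by rw [h3, hj]; push_cast; ring⟩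
  · have real : ∀ x : ℝ, ∃ v : Fin 4 → ℝ, D.Z x = fun i => (v i : ℂ) := fun x => by
      refine ⟨fun i => (D.Z x i).re, ?_⟩
      ext i
      have := D.conj x i
      rw [conj_ofReal, conj_eq_iff_re] at this
      exact this.symm
    rintro (⟨x, rfl⟩ | ⟨x, rfl⟩)
    · refine ⟨D.pt_mem he _, ?_⟩
      obtain ⟨v, hv⟩ := real x
      refine ⟨v, by rw [← hv]; exact D.ne x, ?_⟩
      simp only [ofReal_zero, zero_mul, add_zero, pt, hv]
    · refine ⟨D.pt_mem he _, ?_⟩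
      obtain ⟨v, hv⟩ := real x
      obtain ⟨ε, hε⟩ := D.half
      have e : D.Z (x + D.t * I) = autFactor (D.t * I) x • fun i => ((ε i * v i : ℝ) : ℂ) := by
        ext i
        rw [hε, hv]
        simp only [Pi.smul_apply, smul_eq_mul]
        push_cast
        ring
      refine ⟨fun i => ε i * v i, fun h0 => D.ne (x + D.t * I) (by rw [e, h0, smul_zero]), ?_⟩
      refine (Projectivization.mk_eq_mk_iff' ℂ _ _ (D.ne _) _).2 ⟨autFactor (D.t * I) x, ?_⟩
      simp only [ofReal_one, one_mul]
      exact e.symm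

lemma connectedComponentIn_line (he : IsEven φ) {y : ℝ} (hy : y = 0 ∨ y = 1) {p : P3}
    (hp : p ∈ D.line y) : connectedComponentIn (realCurve φ) p = D.line y := by
  rw [D.realCurve_eq he]
  rcases hy with rfl | rfl
  · exact connectedComponentIn_union (D.isCompact_line 0).isClosed (D.isCompact_line 1).isClosed
      D.disjoint_line (D.isPreconnected_line 0) hp
  · rw [Set.union_comm]
    exact connectedComponentIn_union (D.isCompact_line 1).isClosed (D.isCompact_line 0).isClosed
      D.disjoint_line.symm (D.isPreconnected_line 1) hp

/-- The admissible x form a closed set, stable under ±2 because 2 is a period and under ±2z₀ because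
K is invariant under σ and under its inverse. -/
lemma pt_add_real_mem (h : IsGeneric φ) (he : IsEven φ) {K : Set P3} (hK : K ⊆ curve φ)
    (hc : IsCompact K) (hσ : sigma φ '' K = K) {w : ℂ} (hw : D.pt w ∈ K) (x : ℝ) :
    D.pt (w + x) ∈ K := by
  have hA : IsClosed {x : ℝ | D.pt (w + x) ∈ K} :=
    hc.isClosed.preimage (D.continuous_pt.comp (by fun_prop))
  have := eq_univ_of_irrational (D.irrational h he) hA (fun x hx => ?_) (fun x hx => ?_)
    ⟨0, by simpa using hw⟩
  · exact (Set.eq_univ_iff_forall.1 this) x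
  · simp only [Set.mem_ofPred_eq] at hx ⊢
    have h1 := D.pt_add_int (w + x) 1
    have h2 := D.pt_add_int (w + x) (-1)
    push_cast at h1 h2 ⊢
    exact ⟨by rw [show w + ((x : ℂ) + 2) = w + x + 2 * 1 by ring, h1]; exact hx,
      by rw [show w + ((x : ℂ) - 2) = w + x + 2 * -1 by ring, h2]; exact hx⟩
  · simp only [Set.mem_ofPred_eq] at hx ⊢
    constructor
    · rw [← hσ] at hx
      obtain ⟨p, hp, hpx⟩ := hx
      obtain ⟨u, rfl⟩ := D.exists_pt he (hK hp)
      rw [D.sigma_pt he, D.pt_eq_iff] at hpx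
      obtain ⟨m, n, hmn⟩ := hpx
      convert hp using 1
      rw [Eq.comm, D.pt_eq_iff]
      refine ⟨m, n, ?_⟩
      push_cast
      linear_combination hmn
    · rw [← hσ]
      refine ⟨_, hx, ?_⟩
      rw [D.sigma_pt he]
      congr 1
      push_cast
      ring

lemma isMinimalInvariant_line (h : IsGeneric φ) (he : IsEven φ) (y : ℝ) :
    IsMinimalInvariant (sigma φ) (D.line y) := by
  refine ⟨Set.range_nonempty _, D.isCompact_line y, D.sigma_line he y, fun K hK hne hc hσ => ?_⟩
  refine hK.antisymm ?_
  rintro _ ⟨x, rfl⟩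
  obtain ⟨p, hp⟩ := hne
  obtain ⟨x', rfl⟩ := hK hp
  have := D.pt_add_real_mem h he (hK.trans (D.line_subset_curve he y)) hc hσ hp (x - x')
  dsimp only
  convert this using 2
  push_cast
  ring

lemma base_mem_line : p₀ ∈ D.line 0 := ⟨D.z₀, by simp [← D.pt_base]⟩

lemma realComp_eq (he : IsEven φ) : realComp φ = D.line 0 :=
  D.connectedComponentIn_line he (Or.inl rfl) D.base_mem_line

/-- The conjugate of W = Z(−z₀ + iy) is Z(−(iy + z₀)). By the parities of the coordinates, the
correspondence at x = iy becomes W₀W̄_k + W̄₀W_k + W_lW̄_m + W̄_lW_m = 0. These three sums are the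
cross terms of every |u_μ|², which therefore equals ¼ Σ |W_i|² for each μ. The line is connected and
passes through q₀; nothing more about the component is needed. -/
lemma pt_mem_torusComp (he : IsEven φ) (y : ℝ) : D.pt (-D.z₀ + y * I) ∈ torusComp φ := by
  have hsub : (Set.range fun y : ℝ => D.pt (-D.z₀ + y * I)) ⊆ torusCurve φ := by
    rintro _ ⟨y, rfl⟩
    refine ⟨D.pt_mem he _, ?_⟩
    dsimp only
    set W := D.Z (-D.z₀ + y * I) with hW
    have hc : ∀ i, (starRingEnd ℂ) (W i) = D.Z (-(y * I + D.z₀)) i := fun i => by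
      rw [hW, D.conj]
      congr 1
      simp
    have hR : ∀ k l m : Fin 3, k ≠ l → l ≠ m → m ≠ k →
        W 0 * (starRingEnd ℂ) (W k.succ) + (starRingEnd ℂ) (W 0) * W k.succ +
        W l.succ * (starRingEnd ℂ) (W m.succ) + (starRingEnd ℂ) (W l.succ) * W m.succ = 0 := by
      intro k l m hkl hlm hmk
      have := D.corr (y * I) k l m hkl hlm hmk
      rw [show (y * I - D.z₀ : ℂ) = -D.z₀ + y * I by ring, ← hW] at this
      rw [hc, hc, hc, hc, D.neg_zero, D.neg_succ, D.neg_succ, D.neg_succ]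
      linear_combination -this
    have h1 := hR 0 1 2 (by decide) (by decide) (by decide)
    have h2 := hR 1 2 0 (by decide) (by decide) (by decide)
    have h3 := hR 2 0 1 (by decide) (by decide) (by decide)
    have key : ∀ μ, (‖M.mulVec W μ‖ ^ 2 : ℂ) = (1 / 4) * ∑ i, W i * (starRingEnd ℂ) (W i) := by
      intro μ
      rw [← mul_conj']
      simp only [Fin.succ_zero_eq_one, Fin.succ_one_eq_two, Fin.reduceSucc] at h1 h2 h3
      have hc2 : (starRingEnd ℂ) 2 = 2 := map_ofNat _ 2
      fin_cases μ <;>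
        simp [hc2, M, Matrix.mulVec, dotProduct, Fin.sum_univ_four] <;>
        first
        | linear_combination (1 / 4 : ℂ) * (h1 + h2 + h3)
        | linear_combination (1 / 4 : ℂ) * (h1 - h2 - h3)
        | linear_combination (1 / 4 : ℂ) * (-h1 + h2 - h3)
        | linear_combination (1 / 4 : ℂ) * (-h1 - h2 + h3)
    intro μ ν
    obtain ⟨a, ha⟩ := Projectivization.exists_smul_eq_mk_rep ℂ W (D.ne _)
    change ‖M.mulVec (Projectivization.mk ℂ W _).rep μ‖ = ‖M.mulVec (Projectivization.mk ℂ W _).rep ν‖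
    rw [← ha, Units.smul_def, Matrix.mulVec_smul, Pi.smul_apply, Pi.smul_apply, smul_eq_mul,
      smul_eq_mul, norm_mul, norm_mul]
    congr 1
    have := (key μ).trans (key ν).symm
    exact (sq_eq_sq₀ (norm_nonneg _) (norm_nonneg _)).1 (by exact_mod_cast this)
  refine (isPreconnected_range (D.continuous_pt.comp (by fun_prop))).subset_connectedComponentIn
    (s := Set.range fun y : ℝ => D.pt (-D.z₀ + y * I)) ⟨0, ?_⟩ hsub ⟨y, rfl⟩
  simp [← D.pt_neg_base]

/-- The coordinate X ↦ z₀ − 2X makes the period 1, and its sign turns z ↦ z − 2z₀ into X ↦ X + z₀.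
-/
lemma exists_homeo (he : IsEven φ) : ∃ h : AddCircle (1 : ℝ) ≃ₜ realComp φ,
    ∀ x, (h (x + (D.z₀ : AddCircle (1 : ℝ))) : P3) = sigma φ (h x) := by
  let f : ℝ → realComp φ := fun X => ⟨D.pt (D.z₀ - 2 * X), by
    rw [D.realComp_eq he]
    exact ⟨D.z₀ - 2 * X, by simp⟩⟩
  have hf : Continuous f := (D.continuous_pt.comp (by fun_prop)).subtype_mk _
  have hp : Function.Periodic f 1 := fun X => by
    apply Subtype.ext
    have := D.pt_add_int (D.z₀ - 2 * X) (-1)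
    change D.pt _ = D.pt _
    rw [← this]
    congr 1
    push_cast
    ring
  let g : AddCircle (1 : ℝ) → realComp φ := hp.lift
  have hg : Continuous g := continuous_coinduced_dom.2 hf
  have hbij : Function.Bijective g := by
    constructor
    · intro a b hab
      induction a using QuotientAddGroup.induction_on with
      | H a =>
      induction b using QuotientAddGroup.induction_on with
      | H b =>
      have h1 : D.pt (D.z₀ - 2 * a) = D.pt (D.z₀ - 2 * b) := congrArg Subtype.val hab
      obtain ⟨m, n, h⟩ := D.pt_eq_iff.1 h1
      have hre := congrArg Complex.re h
      simp at hre
      rw [QuotientAddGroup.eq]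
      exact ⟨m, by simp; linarith⟩
    · rintro ⟨p, hp'⟩
      have hp := hp'
      rw [D.realComp_eq he] at hp
      obtain ⟨x, hx⟩ := hp
      refine ⟨(((D.z₀ - x) / 2 : ℝ) : AddCircle (1 : ℝ)), Subtype.ext ?_⟩
      change D.pt _ = p
      rw [← hx]
      congr 1
      push_cast
      ring
  have : Fact (0 < (1 : ℝ)) := ⟨one_pos⟩
  refine ⟨(isHomeomorph_iff_continuous_bijective.2 ⟨hg, hbij⟩).homeomorph g, fun x => ?_⟩
  induction x using QuotientAddGroup.induction_on with
  | H x =>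
  change D.pt (D.z₀ - 2 * ((x + D.z₀ : ℝ) : ℂ)) = sigma φ (D.pt (D.z₀ - 2 * x))
  rw [D.sigma_pt he]
  congr 1
  push_cast
  ring

/-- The uniformization of the curve by theta functions. -/
def uniformization (he : IsEven φ) : Uniformization φ where
  ω₁ := 2
  ω₂ := 2 * (D.t * I)
  indep := by
    rw [LinearIndependent.pair_iff]
    intro a b h
    have h1 := congrArg Complex.re h
    have h2 := congrArg Complex.im h
    simp [D.t_pos.ne'] at h1 h2
    exact ⟨h1, h2⟩
  lift z := D.Z (z + D.z₀)
  holo := differentiable_pi.2 fun i => (D.diff i).comp (differentiable_id.add_const _)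
  ne_zero z := D.ne _
  map_zero := by simpa [pt] using D.pt_base
  range_eq := by
    ext p
    constructor
    · rintro ⟨z, rfl⟩
      exact D.pt_mem he _
    · intro hp
      obtain ⟨z, hz⟩ := D.exists_pt he hp
      refine ⟨z - D.z₀, ?_⟩
      rw [← hz]
      simp [pt]
  eq_iff z w := by
    refine D.pt_eq_iff.trans (exists_congr fun m => exists_congr fun n => ?_)
    rw [show z + D.z₀ - (w + D.z₀) = z - w by ring, mul_comm (2 : ℂ) m,
      show (2 : ℂ) * n * (D.t * I) = n * (2 * (D.t * I)) by ring]

end ThetaData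

end Components

end NC3

end

/-! ### Uniqueness of the uniformization and the decomposition of invariant sets -/

noncomputable section

namespace NC3

section Uniqueness

open Complex Real Filter Topology

lemma const_of_doubly_periodic {g : ℂ → ℂ} (hg : Differentiable ℂ g) {ω₁ ω₂ : ℂ}
    (hω : LinearIndependent ℝ ![ω₁, ω₂]) (h1 : Function.Periodic g ω₁)
    (h2 : Function.Periodic g ω₂) (z w : ℂ) : g z = g w := by
  refine hg.apply_eq_apply_of_bounded ?_ z w
  let b := basisOfLinearIndependentOfCardEqFinrank hω (by simp)
  have hb0 : b 0 = ω₁ := by simp [b]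
  have hb1 : b 1 = ω₂ := by simp [b]
  have hK : IsCompact ((fun p : ℝ × ℝ => g (p.1 * ω₁ + p.2 * ω₂)) ''
      (Set.Icc 0 1 ×ˢ Set.Icc 0 1)) :=
    (isCompact_Icc.prod isCompact_Icc).image (hg.continuous.comp (by fun_prop))
  refine hK.isBounded.subset ?_
  rintro _ ⟨z, rfl⟩
  have hz := b.sum_repr z
  rw [Fin.sum_univ_two, hb0, hb1] at hz
  set x := b.repr z 0
  set y := b.repr z 1
  refine ⟨(Int.fract x, Int.fract y), ⟨⟨Int.fract_nonneg _, (Int.fract_lt_one _).le⟩,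
    ⟨Int.fract_nonneg _, (Int.fract_lt_one _).le⟩⟩, ?_⟩
  have e1 := h1.int_mul (⌊x⌋)
  have e2 := h2.int_mul (⌊y⌋)
  dsimp only
  rw [← e1, ← e2, ← hz]
  congr 1
  simp only [real_smul, Int.fract]
  push_cast
  ring

/-- On the segment from 0 to z both solutions are bounded and the quadratic right-hand side is
Lipschitz there, so Grönwall's inequality applies to the difference. The equations are needed on the
segment only. -/
lemma euler_ode_unique {f F : ℂ → Fin 3 → ℂ} {c : Fin 3 → ℂ} (z : ℂ)
    (hf : ∀ u ∈ Set.Icc (0 : ℝ) 1, ∀ k, HasDerivAt (fun w => f w k)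
      (c k * f (u * z) (k + 1) * f (u * z) (k + 2)) (u * z))
    (hF : ∀ u ∈ Set.Icc (0 : ℝ) 1, ∀ k, HasDerivAt (fun w => F w k)
      (c k * F (u * z) (k + 1) * F (u * z) (k + 2)) (u * z))
    (h0 : f 0 = F 0) : f z = F z := by
  have path : ∀ {f : ℂ → Fin 3 → ℂ}, (∀ u ∈ Set.Icc (0 : ℝ) 1, ∀ k, HasDerivAt (fun w => f w k)
      (c k * f (u * z) (k + 1) * f (u * z) (k + 2)) (u * z)) → ∀ u ∈ Set.Icc (0 : ℝ) 1,
      HasDerivAt (fun u : ℝ => f (u * z))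
        (fun k => c k * f (u * z) (k + 1) * f (u * z) (k + 2) * z) u := by
    intro f hf u hu
    refine hasDerivAt_pi.2 fun k => ?_
    have hl : HasDerivAt (fun u : ℝ => (u : ℂ) * z) z u := by
      simpa using (ofRealCLM.hasDerivAt (x := u)).mul_const z
    exact (hf u hu k).comp u hl
  have bound : ∀ {f : ℂ → Fin 3 → ℂ}, (∀ u ∈ Set.Icc (0 : ℝ) 1, ∀ k, HasDerivAt (fun w => f w k)
      (c k * f (u * z) (k + 1) * f (u * z) (k + 2)) (u * z)) →
      ∃ B, ∀ u ∈ Set.Icc (0 : ℝ) 1, ‖f (u * z)‖ ≤ B := fun hf =>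
    isCompact_Icc.exists_bound_of_continuousOn
      fun u hu => (path hf u hu).continuousAt.continuousWithinAt
  obtain ⟨B, hB⟩ := bound hf
  obtain ⟨B', hB'⟩ := bound hF
  have hd : ∀ u ∈ Set.Icc (0 : ℝ) 1, HasDerivAt (fun u : ℝ => f (u * z) - F (u * z)) _ u :=
    fun u hu => (path hf u hu).fun_sub (path hF u hu)
  have key := eq_zero_of_abs_deriv_le_mul_abs_self_of_eq_zero_right
    (f := fun u : ℝ => f (u * z) - F (u * z)) (a := 0) (b := 1) (K := ‖c‖ * (B + B') * ‖z‖)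
    (fun u hu => (hd u hu).continuousAt.continuousWithinAt)
    (fun u hu => (hd u (Set.Ico_subset_Icc_self hu)).hasDerivWithinAt) (by simp [h0]) ?_ 1
    ⟨zero_le_one, le_rfl⟩
  · simpa [sub_eq_zero] using key
  · intro u hu
    have hu' := Set.Ico_subset_Icc_self hu
    have hBu := hB u hu'
    have hBu' := hB' u hu'
    have hB0 : 0 ≤ B := (norm_nonneg _).trans hBu
    have hB0' : 0 ≤ B' := (norm_nonneg _).trans hBu'
    refine (pi_norm_le_iff_of_nonneg (by positivity)).2 fun k => ?_
    simp only [Pi.sub_apply]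
    generalize f (u * z) = a at *
    generalize F (u * z) = b at *
    have e : c k * a (k + 1) * a (k + 2) * z - c k * b (k + 1) * b (k + 2) * z =
        c k * ((a - b) (k + 1) * a (k + 2) + b (k + 1) * (a - b) (k + 2)) * z := by
      simp only [Pi.sub_apply]; ring
    rw [e, norm_mul, norm_mul]
    calc ‖c k‖ * ‖(a - b) (k + 1) * a (k + 2) + b (k + 1) * (a - b) (k + 2)‖ * ‖z‖
        ≤ ‖c‖ * (‖a - b‖ * B + B' * ‖a - b‖) * ‖z‖ := by
          gcongr
          · exact norm_le_pi_norm c k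
          · refine (norm_add_le _ _).trans (add_le_add ?_ ?_)
            · rw [norm_mul]
              exact mul_le_mul (norm_le_pi_norm _ _) ((norm_le_pi_norm _ _).trans hBu)
                (norm_nonneg _) (norm_nonneg _)
            · rw [norm_mul]
              exact mul_le_mul ((norm_le_pi_norm _ _).trans hBu') (norm_le_pi_norm _ _)
                (norm_nonneg _) hB0'
      _ = ‖c‖ * (B + B') * ‖z‖ * ‖a - b‖ := by ring

variable {s : Fin 3 → ℝ}

lemma third_index_cases : ∀ {k l m : Fin 3}, k ≠ l → l ≠ m → m ≠ k → ∀ i, i = k ∨ i = l ∨ i = m := by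
  decide

lemma pair_mul_of_third_eq {k l m k' l' m' : Fin 3} (h1 : k ≠ l) (h2 : l ≠ m) (h3 : m ≠ k)
    (h1' : k' ≠ l') (h2' : l' ≠ m') (h3' : m' ≠ k') (f : Fin 3 → ℂ) :
    (k' = k → f l' * f m' = f l * f m) ∧ (k' = l → f l' * f m' = f k * f m) ∧
      (k' = m → f l' * f m' = f k * f l) := by
  have key : ∀ {k l m l' m' : Fin 3}, k ≠ l → l ≠ m → m ≠ k → k ≠ l' → l' ≠ m' → m' ≠ k →
      f l' * f m' = f l * f m := by
    intro k l m l' m' h1 h2 h3 h1' h2' h3'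
    rcases third_index_cases h1 h2 h3 l' with h | h | h
    · exact absurd h.symm h1'
    · rcases third_index_cases h1 h2 h3 m' with h' | h' | h'
      · exact absurd h' h3'
      · exact absurd (h.trans h'.symm) h2'
      · rw [h, h']
    · rcases third_index_cases h1 h2 h3 m' with h' | h' | h'
      · exact absurd h' h3'
      · rw [h, h', mul_comm]
      · exact absurd (h.trans h'.symm) h2'
  refine ⟨?_, ?_, ?_⟩
  · rintro rfl
    exact key h1 h2 h3 h1' h2' h3'
  · rintro rfl
    exact key h1.symm h3.symm h2.symm h1' h2' h3'
  · rintro rfl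
    exact key h3 h1 h2 h1' h2' h3'

/-- On the cone over the curve, the Wronskians of the coordinates of a holomorphic curve are
proportional to products of coordinates. -/
lemma exists_wronskian (hs : ∀ k, 0 < s k) (hinj : Function.Injective s) {L : ℂ → Fin 4 → ℂ}
    (hd : ∀ i, Differentiable ℂ fun z => L z i) (hon : ∀ z, OnC s (L z)) (hne : ∀ z, L z ≠ 0) :
    ∃ g : ℂ → ℂ, Differentiable ℂ g ∧ (∀ z (k l m : Fin 3), k ≠ l → l ≠ m → m ≠ k →
      deriv (fun z => L z k.succ) z * L z 0 - L z k.succ * deriv (fun z => L z 0) z =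
        g z * (s k * L z l.succ * L z m.succ)) ∧
      ∀ z, ∃ k l m : Fin 3, k ≠ l ∧ l ≠ m ∧ m ≠ k ∧ s k * L z l.succ * L z m.succ ≠ 0 := by
  have hsc : ∀ k, (s k : ℂ) ≠ 0 := fun k => by exact_mod_cast (hs k).ne'
  set w : Fin 3 → ℂ → ℂ := fun k z =>
    deriv (fun z => L z k.succ) z * L z 0 - L z k.succ * deriv (fun z => L z 0) z with hw
  have hwd : ∀ k, Differentiable ℂ (w k) := fun k =>
    ((hd _).deriv.mul (hd _)).sub ((hd _).mul (hd _).deriv)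
  have hne2 : ∀ z, ∃ k l m : Fin 3, k ≠ l ∧ l ≠ m ∧ m ≠ k ∧
      s k * L z l.succ * L z m.succ ≠ 0 := by
    intro z
    have h2 : ∀ {a b : Fin 3}, a ≠ b → L z a.succ = 0 → L z b.succ ≠ 0 := fun hab h =>
      (hon z).ne_zero hs hinj (hne z) (fun e => hab (Fin.succ_injective _ e)) h
    by_cases h0 : L z (Fin.succ 0) = 0
    · exact ⟨0, 1, 2, by decide, by decide, by decide, mul_ne_zero (mul_ne_zero (hsc _)
        (h2 (by decide) h0)) (h2 (by decide) h0)⟩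
    · by_cases h1 : L z (Fin.succ 1) = 0
      · exact ⟨1, 0, 2, by decide, by decide, by decide, mul_ne_zero (mul_ne_zero (hsc _) h0)
          (h2 (by decide) h1)⟩
      · exact ⟨2, 0, 1, by decide, by decide, by decide, mul_ne_zero (mul_ne_zero (hsc _) h0) h1⟩
  have hcross : ∀ z (k l m : Fin 3), k ≠ l → l ≠ m → m ≠ k →
      s k * L z l.succ * L z m.succ ≠ 0 → ∀ k' l' m' : Fin 3, k' ≠ l' → l' ≠ m' → m' ≠ k' →
      w k' z = w k z / (s k * L z l.succ * L z m.succ) * (s k' * L z l'.succ * L z m'.succ) := by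
    intro z k l m hkl hlm hmk h0 k' l' m' hkl' hlm' hmk'
    have hl : L z l.succ ≠ 0 := fun h => h0 (by rw [h]; ring)
    have hm : L z m.succ ≠ 0 := fun h => h0 (by rw [h]; ring)
    have e : ∀ k' : Fin 3, (s k' : ℂ) * L z k.succ * w k z = s k * L z k'.succ * w k' z :=
      fun k' => onC_deriv hd hon z k k'
    rw [div_mul_eq_mul_div, eq_div_iff h0]
    have hprod := pair_mul_of_third_eq hkl hlm hmk hkl' hlm' hmk' fun k => L z k.succ
    rcases third_index_cases hkl hlm hmk k' with rfl | rfl | rfl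
    · rw [mul_assoc (s k' : ℂ) (L z l'.succ), hprod.1 rfl]
      ring
    · rw [mul_assoc (s k' : ℂ) (L z l'.succ), hprod.2.1 rfl]
      linear_combination -L z m.succ * e k'
    · rw [mul_assoc (s k' : ℂ) (L z l'.succ), hprod.2.2 rfl]
      linear_combination -L z l.succ * e k'
  -- No single product of coordinates is free of zeros, so the denominator is chosen point by point.
  -- By `hcross` the quotient does not depend on the choice, and near each point it is a quotient
  -- with a fixed nonvanishing denominator.
  choose K Lx Mx h1 h2 h3 h4 using hne2
  refine ⟨fun z => w (K z) z / (s (K z) * L z (Lx z).succ * L z (Mx z).succ), fun z => ?_, ?_, ?_⟩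
  · have hden : Differentiable ℂ fun y => (s (K z) : ℂ) * L y (Lx z).succ * L y (Mx z).succ :=
      ((hd _).const_mul _).mul (hd _)
    have hloc : (fun y => w (K y) y / (s (K y) * L y (Lx y).succ * L y (Mx y).succ)) =ᶠ[𝓝 z]
        fun y => w (K z) y / (s (K z) * L y (Lx z).succ * L y (Mx z).succ) := by
      filter_upwards [hden.continuous.continuousAt.eventually_ne (h4 z)] with y hy
      rw [div_eq_div_iff (h4 y) hy]
      have := hcross y _ _ _ (h1 z) (h2 z) (h3 z) hy _ _ _ (h1 y) (h2 y) (h3 y)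
      rw [div_mul_eq_mul_div, eq_div_iff hy] at this
      exact this
    exact ((hwd _ z).div (hden z) (h4 z)).congr_of_eventuallyEq hloc
  · intro z k l m hkl hlm hmk
    exact hcross z _ _ _ (h1 z) (h2 z) (h3 z) (h4 z) k l m hkl hlm hmk
  · exact fun z => ⟨_, _, _, h1 z, h2 z, h3 z, h4 z⟩

variable {φ : Fin 3 → ℝ}

/-- Replacing a lift by a multiple c(z) of it multiplies both the Wronskians and the products of
coordinates by c(z)². The factor between them is therefore unchanged by a period, hence an entire
doubly periodic function, hence constant. -/
lemma Uniformization.exists_const (h : IsGeneric φ) (he : IsEven φ) (U : Uniformization φ) :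
    ∃ γ : ℂ, ∀ z (k l m : Fin 3), k ≠ l → l ≠ m → m ≠ k →
      deriv (fun z => U.lift z k.succ) z * U.lift z 0 -
        U.lift z k.succ * deriv (fun z => U.lift z 0) z =
        γ * (absS φ k * U.lift z l.succ * U.lift z m.succ) := by
  have hd : ∀ i, Differentiable ℂ fun z => U.lift z i := differentiable_pi.1 U.holo
  have hon : ∀ z, OnC (absS φ) (U.lift z) := fun z => by
    rw [← onCurve_iff he, ← onCurve_rep (U.ne_zero z), ← U.range_eq]
    exact ⟨z, rfl⟩
  obtain ⟨g, hg, hgw, hne⟩ := exists_wronskian (absS_pos he) (absS_injective h he) hd hon U.ne_zero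
  have per : ∀ p : ℂ, (∃ m n : ℤ, p = m * U.ω₁ + n * U.ω₂) → Function.Periodic g p := by
    intro p hp z
    have hmk : ∀ y, ∃ c : ℂ, c • U.lift y = U.lift (y + p) := fun y => by
      rw [← Projectivization.mk_eq_mk_iff' ℂ _ _ (U.ne_zero _) (U.ne_zero _), U.eq_iff]
      obtain ⟨m, n, h⟩ := hp
      exact ⟨m, n, by rw [← h]; ring⟩
    choose c hc using hmk
    obtain ⟨i, hi⟩ := Function.ne_iff.1 (U.ne_zero z)
    simp only [Pi.zero_apply] at hi
    have hsh : ∀ j, Differentiable ℂ fun y => U.lift (y + p) j := fun j =>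
      (hd j).comp (differentiable_id.add_const p)
    have hcd : DifferentiableAt ℂ c z := by
      refine ((hsh i z).div (hd i z) hi).congr_of_eventuallyEq ?_
      filter_upwards [(hd i).continuous.continuousAt.eventually_ne hi] with y hy
      simp only [Pi.div_apply]
      rw [← hc]
      simp [hy]
    have hder : ∀ j, deriv (fun y => U.lift y j) (z + p) =
        deriv c z * U.lift z j + c z * deriv (fun y => U.lift y j) z := fun j => by
      rw [← deriv_comp_add_const]
      have : (fun y => U.lift (y + p) j) = fun y => c y * U.lift y j := by
        ext y; rw [← hc]; rfl
      rw [this]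
      exact (hcd.hasDerivAt.mul (hd j z).hasDerivAt).deriv
    obtain ⟨k, l, m, h1, h2, h3, h4⟩ := hne z
    have e1 := hgw z k l m h1 h2 h3
    have e2 := hgw (z + p) k l m h1 h2 h3
    rw [hder, hder, ← hc] at e2
    simp only [Pi.smul_apply, smul_eq_mul] at e2
    have hc0 : c z ≠ 0 := fun h => U.ne_zero (z + p) (by rw [← hc, h, zero_smul])
    apply mul_right_cancel₀ (mul_ne_zero (pow_ne_zero 2 hc0) h4)
    linear_combination c z ^ 2 * e1 - e2
  refine ⟨g 0, fun z k l m h1 h2 h3 => ?_⟩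
  rw [hgw z k l m h1 h2 h3, const_of_doubly_periodic hg U.indep (per _ ⟨1, 0, by simp⟩)
    (per _ ⟨0, 1, by simp⟩) z 0]

/-- Every uniformization is a linear reparametrization of the one by theta functions. -/
lemma Uniformization.exists_pt_eq (h : IsGeneric φ) (he : IsEven φ) (U : Uniformization φ)
    (D : ThetaData (absS φ)) : ∃ κ : ℂ, ∀ z, U.pt z = D.pt (κ * z + D.z₀) := by
  have hd : ∀ i, Differentiable ℂ fun z => U.lift z i := differentiable_pi.1 U.holo
  obtain ⟨γ, hγ⟩ := U.exists_const h he
  obtain ⟨κ₀, hκ₀, hw⟩ := D.wron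
  -- With the parameter scaled by κ, the theta parametrization has the same Wronskian constant γ as
  -- the lift. The ratios of the coordinates to coordinate 0 then solve the same Euler equations
  -- with the common initial value 1.
  set κ := γ / κ₀ with hκ
  set L' : ℂ → Fin 4 → ℂ := fun z => D.Z (κ * z + D.z₀) with hL'
  have hlin : ∀ z, HasDerivAt (fun z => κ * z + D.z₀) κ z := fun z => by
    simpa using ((hasDerivAt_id z).const_mul κ).add_const (D.z₀ : ℂ)
  have hd' : ∀ i z, HasDerivAt (fun z => L' z i)
      (deriv (fun z => D.Z z i) (κ * z + D.z₀) * κ) z := fun i z =>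
    HasDerivAt.comp z (D.diff i _).hasDerivAt (hlin z)
  have hdd' : ∀ i, Differentiable ℂ fun z => L' z i := fun i z => (hd' i z).differentiableAt
  have ode : ∀ (G : ℂ → Fin 4 → ℂ) (G' : Fin 4 → ℂ) (z : ℂ),
      (∀ i, HasDerivAt (fun z => G z i) (G' i) z) → G z 0 ≠ 0 →
      (∀ k l m : Fin 3, k ≠ l → l ≠ m → m ≠ k → G' k.succ * G z 0 - G z k.succ * G' 0 =
        γ * (absS φ k * G z l.succ * G z m.succ)) → ∀ k : Fin 3,
      HasDerivAt (fun z => G z k.succ / G z 0) (γ * absS φ k * (G z (k + 1).succ / G z 0) *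
        (G z (k + 2).succ / G z 0)) z := by
    intro G G' z hG h0 hrel k
    refine ((hG k.succ).fun_div (hG 0) h0).congr_deriv ?_
    rw [hrel k (k + 1) (k + 2) (by omega) (by omega) (by omega)]
    field_simp
  obtain ⟨c, hc⟩ : ∃ c : ℂ, ∀ i, U.lift 0 i = c := by
    have := U.map_zero
    rw [p₀, Projectivization.mk_eq_mk_iff'] at this
    obtain ⟨c, hc⟩ := this
    refine ⟨c, fun i => ?_⟩
    rw [← hc]
    fin_cases i <;> simp
  have hc0 : c ≠ 0 := fun h => U.ne_zero 0 (by ext i; rw [hc, h]; rfl)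
  obtain ⟨d, hd0, hspec⟩ := D.spec
  have hL0 : ∀ i, L' 0 i = d := fun i => by simp [hL', hspec]
  have hev : ∀ᶠ z in 𝓝 (0 : ℂ), U.lift z 0 ≠ 0 ∧ L' z 0 ≠ 0 :=
    ((hd 0).continuous.continuousAt.eventually_ne (by rw [hc]; exact hc0)).and
      ((hdd' 0).continuous.continuousAt.eventually_ne (by rw [hL0]; exact hd0))
  obtain ⟨r, hr, hball⟩ := Metric.eventually_nhds_iff.1 hev
  have hloc : ∀ z, dist z 0 < r → ∀ i j, U.lift z i * L' z j = U.lift z j * L' z i := by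
    intro z hz
    have hseg : ∀ u ∈ Set.Icc (0 : ℝ) 1, U.lift (u * z) 0 ≠ 0 ∧ L' (u * z) 0 ≠ 0 := by
      intro u hu
      refine hball ?_
      rw [dist_zero_right] at hz ⊢
      rw [norm_mul, norm_real, Real.norm_of_nonneg hu.1]
      exact (mul_le_of_le_one_left (norm_nonneg _) hu.2).trans_lt hz
    have := euler_ode_unique (f := fun z k => U.lift z k.succ / U.lift z 0)
      (F := fun z k => L' z k.succ / L' z 0) (c := fun k => γ * absS φ k) z
      (fun u hu => ode _ (fun i => deriv (fun z => U.lift z i) (u * z)) _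
        (fun i => (hd i _).hasDerivAt) (hseg u hu).1 (hγ _))
      (fun u hu => ode _ _ _ (fun i => hd' i _) (hseg u hu).2 fun k l m h1 h2 h3 => by
        have := hw (κ * (u * z) + D.z₀) k l m h1 h2 h3
        simp only [hL']
        rw [show γ = κ * κ₀ by rw [hκ]; field_simp]
        linear_combination κ * this)
      (by ext k; simp [hc, hL0, hc0, hd0])
    have h0 := hball hz
    have hk : ∀ k : Fin 3, U.lift z k.succ = U.lift z 0 * (L' z k.succ / L' z 0) := fun k => by
      have := congrFun this k
      rw [← this]
      field_simp [h0.1]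
    have hi : ∀ i, U.lift z i = U.lift z 0 / L' z 0 * L' z i := fun i => by
      induction i using Fin.cases with
      | zero => field_simp [h0.2]
      | succ k => rw [hk]; ring
    intro i j
    rw [hi i, hi j]
    ring
  have hall : ∀ z i j, U.lift z i * L' z j = U.lift z j * L' z i := by
    intro z i j
    have h1 : Differentiable ℂ fun z => U.lift z i * L' z j := (hd i).mul (hdd' j)
    have h2 : Differentiable ℂ fun z => U.lift z j * L' z i := (hd j).mul (hdd' i)
    exact congrFun (AnalyticOnNhd.eq_of_eventuallyEq (z₀ := 0)
      (fun z _ => h1.analyticAt z) (fun z _ => h2.analyticAt z)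
      (Metric.eventually_nhds_iff.2 ⟨r, hr, fun z hz => hloc z hz i j⟩)) z
  refine ⟨κ, fun z => ?_⟩
  rw [Uniformization.pt, ThetaData.pt, Projectivization.mk_eq_mk_iff']
  obtain ⟨i, hi⟩ := Function.ne_iff.1 (D.ne (κ * z + D.z₀))
  simp only [Pi.zero_apply] at hi
  refine ⟨U.lift z i / L' z i, ?_⟩
  ext j
  have := hall z i j
  simp only [Pi.smul_apply, smul_eq_mul, hL'] at this ⊢
  field_simp
  linear_combination this

/-- Compact invariant sets are sums with the real component. -/
lemma ThetaData.eq_ellSum (D : ThetaData (absS φ)) (h : IsGeneric φ) (he : IsEven φ)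
    {K : Set P3} (hK : K ⊆ curve φ) (hc : IsCompact K) (hσ : sigma φ '' K = K) :
    K = ellSum φ (K ∩ torusComp φ) (realComp φ) := by
  ext p
  constructor
  · intro hp
    obtain ⟨w, rfl⟩ := D.exists_pt he (hK hp)
    -- The uniformization adds z₀ to its argument. The summands are thus the points with theta
    -- parameters −z₀ + i Im w, on the torus line, and Re w + 2z₀, on the real circle, and their sum
    -- has parameter w.
    refine ⟨D.uniformization he, -2 * D.z₀ + w.im * I, w.re + D.z₀, ⟨?_, ?_⟩, ?_, ?_⟩
    · change D.pt (-2 * D.z₀ + w.im * I + D.z₀) ∈ K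
      have := D.pt_add_real_mem h he hK hc hσ hp (-w.re - D.z₀)
      convert this using 2
      nth_rw 2 [← re_add_im w]
      push_cast
      ring
    · change D.pt (-2 * D.z₀ + w.im * I + D.z₀) ∈ torusComp φ
      convert D.pt_mem_torusComp he w.im using 2
      ring
    · change D.pt (w.re + D.z₀ + D.z₀) ∈ realComp φ
      rw [D.realComp_eq he]
      exact ⟨w.re + D.z₀ + D.z₀, by simp⟩
    · change D.pt (-2 * D.z₀ + w.im * I + (w.re + D.z₀) + D.z₀) = D.pt w
      congr 1
      nth_rw 3 [← re_add_im w]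
      ring
  · rintro ⟨U, a, b, ⟨ha, -⟩, hb, rfl⟩
    obtain ⟨κ, hκ⟩ := U.exists_pt_eq h he D
    rw [hκ] at ha hb ⊢
    rw [D.realComp_eq he] at hb
    obtain ⟨x, hx⟩ := hb
    obtain ⟨m, n, hmn⟩ := D.pt_eq_iff.1 hx
    simp only [ofReal_zero, zero_mul, add_zero] at hmn
    have := D.pt_add_real_mem h he hK hc hσ ha (x - D.z₀)
    convert this using 1
    rw [D.pt_eq_iff]
    refine ⟨-m, -n, ?_⟩
    push_cast
    linear_combination -hmn

end Uniqueness

end NC3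

end

/-! ### A frame of unit vectors over the plane, and local charts -/

noncomputable section

namespace NC3

section Frame

open Complex Real Filter Topology

variable {φ : Fin 3 → ℝ}

lemma IsGeneric.weight_pos (h : IsGeneric φ) (μ : Fin 4) : 0 < weight φ μ := by
  refine Fin.cases ?_ (fun k => ?_) μ
  · exact abs_pos.2 (mul_ne_zero (mul_ne_zero (h.sin_sub_ne (by decide)) (h.sin_sub_ne (by decide)))
      (h.sin_sub_ne (by decide)))
  · exact abs_pos.2 (mul_ne_zero (mul_ne_zero (h.cos_ne _) (h.cos_ne _))
      (h.sin_sub_ne (by simp)))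

lemma hermSq_smul (c : ℂ) (z : Fin 4 → ℂ) : hermSq φ (c • z) = ‖c‖ ^ 2 * hermSq φ z := by
  simp only [hermSq, Finset.mul_sum, Pi.smul_apply, smul_eq_mul, norm_mul]
  exact Finset.sum_congr rfl fun _ _ => by ring

lemma IsGeneric.hermSq_pos (h : IsGeneric φ) {z : Fin 4 → ℂ} (hz : z ≠ 0) : 0 < hermSq φ z := by
  obtain ⟨i, hi⟩ := Function.ne_iff.1 hz
  exact Finset.sum_pos' (fun μ _ => mul_nonneg (h.weight_pos μ).le (by positivity))
    ⟨i, Finset.mem_univ i, mul_pos (h.weight_pos i) (pow_pos (norm_pos_iff.2 hi) 2)⟩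

lemma contDiff_hermSq {n : ℕ∞ω} : ContDiff ℝ n (hermSq φ) := by
  refine ContDiff.sum fun μ _ => contDiff_const.mul ?_
  exact ContDiff.norm_sq ℝ (contDiff_apply ℝ ℂ μ)

lemma Sph.norm_smul_eq {p q : Sph φ} {c : ℂ} (h : p.1 = c • q.1) : ‖c‖ = 1 := by
  have := p.2.2
  rw [h, hermSq_smul, q.2.2, mul_one] at this
  exact (pow_eq_one_iff_of_nonneg (norm_nonneg _) two_ne_zero).1 this

lemma Sph.norm_apply_le (h : IsGeneric φ) : ∃ C : ℝ, ∀ (p : Sph φ) i, ‖p.1 i‖ ≤ C := by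
  refine ⟨∑ i, √((weight φ i)⁻¹), fun p i => ?_⟩
  refine le_trans ?_ (Finset.single_le_sum (f := fun i => √((weight φ i)⁻¹))
    (fun _ _ => Real.sqrt_nonneg _) (Finset.mem_univ i))
  refine Real.le_sqrt_of_sq_le ?_
  rw [inv_eq_one_div, le_div_iff₀ (h.weight_pos i), mul_comm]
  refine le_trans ?_ p.2.2.le
  exact Finset.single_le_sum (f := fun i => weight φ i * ‖p.1 i‖ ^ 2)
    (fun μ _ => mul_nonneg (h.weight_pos μ).le (by positivity)) (Finset.mem_univ i)

lemma Sph.isClosed_range : IsClosed {z : Fin 4 → ℂ | OnCurve φ z ∧ hermSq φ z = 1} := by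
  refine IsClosed.inter ?_ (isClosed_eq (contDiff_hermSq (n := 0)).continuous continuous_const)
  have : {z : Fin 4 → ℂ | OnCurve φ z} = ⋂ k : Fin 3, ⋂ l : Fin 3, {z |
      (s φ l : ℂ) * (z 0 ^ 2 - z k.succ ^ 2) = (s φ k : ℂ) * (z 0 ^ 2 - z l.succ ^ 2)} := by
    ext z
    simp [OnCurve]
  change IsClosed {z : Fin 4 → ℂ | OnCurve φ z}
  rw [this]
  exact isClosed_iInter fun k => isClosed_iInter fun l => isClosed_eq (by fun_prop) (by fun_prop)

lemma Sph.compactSpace (h : IsGeneric φ) : CompactSpace (Sph φ) := by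
  obtain ⟨C, hC⟩ := Sph.norm_apply_le h
  refine isCompact_iff_compactSpace.1 ?_
  refine Metric.isCompact_of_isClosed_isBounded Sph.isClosed_range ?_
  refine (Metric.isBounded_closedBall (x := (0 : Fin 4 → ℂ)) (r := |C|)).subset fun z hz => ?_
  rw [mem_closedBall_zero_iff]
  exact (pi_norm_le_iff_of_nonneg (abs_nonneg _)).2 fun i => (hC ⟨z, hz⟩ i).trans (le_abs_self _)

lemma Sph.continuous_toCurve : Continuous (Sph.toCurve (φ := φ)) :=
  (continuous_projMk continuous_subtype_val fun p : Sph φ => p.ne_zero).subtype_mk _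

lemma Sph.toCurve_eq_iff {p q : Sph φ} : p.toCurve = q.toCurve ↔ ∃ c : ℂ, p.1 = c • q.1 := by
  rw [Subtype.ext_iff]
  change Projectivization.mk ℂ _ _ = Projectivization.mk ℂ _ _ ↔ _
  rw [Projectivization.mk_eq_mk_iff']
  exact exists_congr fun c => eq_comm

namespace ThetaData

variable (D : ThetaData (absS φ))

/-- Points of the curve near a given one have parameters near a given parameter. -/
lemma eventually_exists_pt (he : IsEven φ) (w₀ : ℂ) {ε : ℝ} (hε : 0 < ε) :
    ∀ᶠ x in 𝓝 (D.pt w₀), x ∈ curve φ → ∃ w, dist w w₀ < ε ∧ D.pt w = x := by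
  let B : Set ℂ := (fun p : ℝ × ℝ => (2 * p.1 + 2 * p.2 * (D.t * I) : ℂ)) ''
    (Set.Icc 0 1 ×ˢ Set.Icc 0 1)
  have hB : IsCompact B := (isCompact_Icc.prod isCompact_Icc).image (by fun_prop)
  -- The parameters all of whose translates by periods stay at distance at least ε from w₀. The
  -- image of the part in a compact fundamental domain is closed and misses the given point, so its
  -- complement is the required neighbourhood.
  let C : Set ℂ := {w | ∀ m n : ℤ, ε ≤ dist (w + 2 * m + 2 * n * (D.t * I)) w₀}
  have hC : IsClosed C := by
    simp only [C, Set.ofPred_forall]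
    exact isClosed_iInter fun m => isClosed_iInter fun n =>
      isClosed_le continuous_const (by fun_prop)
  have hcl : IsClosed (D.pt '' (B ∩ C)) := ((hB.inter_right hC).image D.continuous_pt).isClosed
  have hnot : D.pt w₀ ∉ D.pt '' (B ∩ C) := by
    rintro ⟨w, ⟨-, hw⟩, h⟩
    obtain ⟨m, n, hmn⟩ := D.pt_eq_iff.1 h.symm
    have := hw m n
    rw [show w + 2 * m + 2 * n * (D.t * I) = w₀ by linear_combination -hmn, dist_self] at this
    exact absurd hε this.not_gt
  filter_upwards [hcl.isOpen_compl.mem_nhds hnot] with x hx hxc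
  obtain ⟨w, rfl⟩ := D.exists_pt he hxc
  have ht := D.t_pos
  let a := w.re / 2
  let b := w.im / (2 * D.t)
  let w' : ℂ := 2 * (Int.fract a : ℝ) + 2 * (Int.fract b : ℝ) * (D.t * I)
  have hw' : w' = w + 2 * (-⌊a⌋ : ℤ) + 2 * (-⌊b⌋ : ℤ) * (D.t * I) := by
    have ht' : (D.t : ℂ) ≠ 0 := by exact_mod_cast ht.ne'
    have e : w = 2 * (a : ℂ) + 2 * b * (D.t * I) := by
      conv_lhs => rw [← re_add_im w]
      simp only [a, b]
      push_cast
      field_simp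
    conv_rhs => rw [e]
    simp only [w', Int.fract]
    push_cast
    ring
  have hwB : w' ∈ B := ⟨(Int.fract a, Int.fract b), ⟨⟨Int.fract_nonneg _, (Int.fract_lt_one _).le⟩,
    ⟨Int.fract_nonneg _, (Int.fract_lt_one _).le⟩⟩, rfl⟩
  have hpt : D.pt w' = D.pt w := by rw [hw', D.pt_lattice]
  have hwC : w' ∉ C := fun h => hx ⟨w', ⟨hwB, h⟩, hpt⟩
  simp only [C, Set.mem_ofPred_eq, not_forall, not_le] at hwC
  obtain ⟨m, n, hmn⟩ := hwC
  exact ⟨_, hmn, by rw [D.pt_lattice, hpt]⟩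

/-- Local inversion of quotients of coordinates. -/
lemma exists_chart (h : IsGeneric φ) (he : IsEven φ) (w₀ : ℂ) : ∃ (i j : Fin 4) (g : ℂ → ℂ),
    D.Z w₀ j ≠ 0 ∧ ContDiffAt ℂ ω g (D.Z w₀ i / D.Z w₀ j) ∧
      ∀ᶠ w in 𝓝 w₀, g (D.Z w i / D.Z w j) = w := by
  have main : ∀ i j : Fin 4, D.Z w₀ j ≠ 0 → deriv (fun z => D.Z z i) w₀ * D.Z w₀ j -
      D.Z w₀ i * deriv (fun z => D.Z z j) w₀ ≠ 0 → ∃ g : ℂ → ℂ,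
      ContDiffAt ℂ ω g (D.Z w₀ i / D.Z w₀ j) ∧ ∀ᶠ w in 𝓝 w₀, g (D.Z w i / D.Z w j) = w := by
    intro i j hj hW
    have hder := (D.diff i w₀).hasDerivAt.fun_div (D.diff j w₀).hasDerivAt hj
    have hcd : ContDiffAt ℂ ω (fun w => D.Z w i / D.Z w j) w₀ :=
      ((D.diff i).contDiff.contDiffAt).div ((D.diff j).contDiff.contDiffAt) hj
    have hne := div_ne_zero hW (pow_ne_zero 2 hj)
    have hf : HasFDerivAt (fun w => D.Z w i / D.Z w j)
        ((ContinuousLinearEquiv.unitsEquivAut ℂ (Units.mk0 _ hne) : ℂ ≃L[ℂ] ℂ) : ℂ →L[ℂ] ℂ) w₀ := by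
      refine hder.hasFDerivAt.congr_fderiv ?_
      ext
      simp
    refine ⟨hcd.localInverse hf (by simp), hcd.to_localInverse hf (by simp), ?_⟩
    exact (hcd.hasStrictFDerivAt' hf (by simp)).eventually_left_inverse
  obtain ⟨κ, hκ, hw⟩ := D.wron
  -- The Wronskian of Z_k and Z₀ is a nonzero multiple of Z_l Z_m. If Z₀ vanishes then no other
  -- coordinate does, and Z₀/Z₁ is a chart; otherwise some Z_k/Z₀ is one, because at most one
  -- coordinate vanishes.
  by_cases h0 : D.Z w₀ 0 = 0
  · have hk : ∀ k : Fin 3, D.Z w₀ k.succ ≠ 0 := fun k =>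
      (D.on w₀).ne_zero (absS_pos he) (absS_injective h he) (D.ne w₀) (Fin.succ_ne_zero k).symm h0
    have e := hw w₀ 0 1 2 (by decide) (by decide) (by decide)
    obtain ⟨g, hg⟩ := main 0 (Fin.succ 0) (hk 0) (by
      intro hz
      have : κ * absS φ 0 * D.Z w₀ (Fin.succ 1) * D.Z w₀ (Fin.succ 2) = 0 := by
        linear_combination -e - hz
      have hs : (absS φ 0 : ℂ) ≠ 0 := by exact_mod_cast (absS_pos he 0).ne'
      exact mul_ne_zero (mul_ne_zero (mul_ne_zero hκ hs) (hk 1)) (hk 2) this)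
    exact ⟨_, _, g, hk 0, hg⟩
  · obtain ⟨-, -, -, hne⟩ := exists_wronskian (absS_pos he) (absS_injective h he) D.diff D.on D.ne
    obtain ⟨k, l, m, h1, h2, h3, h4⟩ := hne w₀
    have e := hw w₀ k l m h1 h2 h3
    obtain ⟨g, hg⟩ := main k.succ 0 h0 (by
      rw [e]
      intro hz
      exact mul_ne_zero hκ h4 (by linear_combination hz))
    exact ⟨_, _, g, h0, hg⟩

/-- The parameter of the frame. -/
def par (X : ℝ × ℝ) : ℂ := 2 * X.1 - 2 * X.2 * (D.t * I)

/-- Unit vectors over the points of the curve. -/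
def frame (h : IsGeneric φ) (he : IsEven φ) (X : ℝ × ℝ) : Sph φ :=
  ⟨(((√(hermSq φ (D.Z (D.par X))))⁻¹ : ℝ) : ℂ) • D.Z (D.par X),
    ((onCurve_iff he).2 (D.on _)).smul _, by
      have := h.hermSq_pos (D.ne (D.par X))
      rw [hermSq_smul, norm_real, norm_inv, Real.norm_of_nonneg (Real.sqrt_nonneg _), inv_pow,
        Real.sq_sqrt this.le, inv_mul_cancel₀ this.ne']⟩

variable (h : IsGeneric φ) (he : IsEven φ)

lemma frame_val (X : ℝ × ℝ) : (D.frame h he X).1 =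
    (((√(hermSq φ (D.Z (D.par X))))⁻¹ : ℝ) : ℂ) • D.Z (D.par X) := rfl

lemma frame_toCurve (X : ℝ × ℝ) : ((D.frame h he X).toCurve : P3) = D.pt (D.par X) := by
  change Projectivization.mk ℂ _ _ = Projectivization.mk ℂ _ _
  rw [Projectivization.mk_eq_mk_iff']
  exact ⟨_, rfl⟩

lemma contDiff_frame : ContDiff ℝ ∞ fun X => (D.frame h he X).1 := by
  have hZ : ContDiff ℝ ∞ fun X => D.Z (D.par X) := by
    have hp : ContDiff ℝ ∞ D.par := by
      unfold par
      have h1 : ContDiff ℝ ∞ fun X : ℝ × ℝ => (X.1 : ℂ) := ofRealCLM.contDiff.comp contDiff_fst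
      have h2 : ContDiff ℝ ∞ fun X : ℝ × ℝ => (X.2 : ℂ) := ofRealCLM.contDiff.comp contDiff_snd
      exact (contDiff_const.mul h1).sub ((contDiff_const.mul h2).mul contDiff_const)
    exact ContDiff.comp (contDiff_pi.2 fun i => ((D.diff i).contDiff (n := ∞)).restrict_scalars ℝ) hp
  have hn : ContDiff ℝ ∞ fun X => ((√(hermSq φ (D.Z (D.par X))))⁻¹ : ℝ) :=
    ((contDiff_hermSq.comp hZ).sqrt fun X => (h.hermSq_pos (D.ne _)).ne').inv
      fun X => (Real.sqrt_pos.2 (h.hermSq_pos (D.ne _))).ne'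
  exact (ofRealCLM.contDiff.comp hn).smul hZ

lemma frame_add_one (x y : ℝ) : D.frame h he (x + 1, y) = D.frame h he (x, y) := by
  have : D.Z (D.par (x + 1, y)) = D.Z (D.par (x, y)) := by
    rw [← D.per (D.par (x, y))]
    congr 1
    simp only [par]
    push_cast
    ring
  apply Subtype.ext
  rw [frame_val, frame_val, this]

/-- Across the vertical period Z is multiplied by an exponential, of which the normalization leaves
only the phase. Its winding number 4 along x is the source of the entry 4 of the matrix in the
theorem. -/
lemma frame_add_one_snd (x y : ℝ) : (D.frame h he (x, y + 1)).1 =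
    cexp (8 * π * I * x) • (D.frame h he (x, y)).1 := by
  set w := D.par (x, y + 1) with hw
  have e : w + 2 * (D.t * I) = D.par (x, y) := by
    simp only [hw, par]
    push_cast
    ring
  have hq := D.qper w
  rw [e] at hq
  have h0 : D.Z w = cexp (4 * π * I * (w + D.t * I)) • D.Z (D.par (x, y)) := by
    rw [hq, smul_smul, ← Complex.exp_add]
    simp
  have hexp : cexp (4 * π * I * (w + D.t * I)) =
      (Real.exp (4 * π * (2 * y + 1) * D.t) : ℝ) * cexp (8 * π * I * x) := by
    rw [ofReal_exp, ← Complex.exp_add]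
    congr 1
    simp only [hw, par]
    push_cast
    linear_combination (-8 * π * y * D.t - 4 * π * D.t : ℂ) * I_sq
  have hpos := Real.exp_pos (4 * π * (2 * y + 1) * D.t)
  have hun : ‖cexp (8 * π * I * x)‖ = 1 := by
    rw [show (8 * π * I * x : ℂ) = ((8 * π * x : ℝ) : ℂ) * I by push_cast; ring,
      norm_exp_ofReal_mul_I]
  rw [frame_val, frame_val, ← hw, h0, hexp, hermSq_smul, norm_mul, hun, mul_one, norm_real,
    Real.norm_of_nonneg hpos.le, Real.sqrt_mul (by positivity), Real.sqrt_sq hpos.le, smul_smul,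
    smul_smul]
  congr 1
  push_cast
  have : ((Real.exp (4 * π * (2 * y + 1) * D.t) : ℝ) : ℂ) ≠ 0 := by exact_mod_cast hpos.ne'
  push_cast at this
  rw [mul_inv]
  field_simp

lemma frame_step (x y : ℝ) :
    Sph.Step (D.frame h he (x, y)) (D.frame h he (x - D.z₀, y)) := by
  rw [Sph.Step, frame_toCurve, frame_toCurve, D.sigma_pt he]
  congr 1
  simp only [par]
  push_cast
  ring

/-- The coordinates of a parameter. -/
def unpar (w : ℂ) : ℝ × ℝ := (w.re / 2, -w.im / (2 * D.t))

lemma par_unpar (w : ℂ) : D.par (D.unpar w) = w := by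
  have ht : (D.t : ℂ) ≠ 0 := by exact_mod_cast D.t_pos.ne'
  conv_rhs => rw [← re_add_im w]
  simp only [par, unpar]
  push_cast
  field_simp
  ring

lemma exists_frame (p : Sph φ) : ∃ (X : ℝ × ℝ) (c : ℂ), p.1 = c • (D.frame h he X).1 := by
  obtain ⟨w, hw⟩ := D.exists_pt he p.toCurve.2
  refine ⟨D.unpar w, Sph.toCurve_eq_iff.1 (Subtype.ext ?_)⟩
  rw [frame_toCurve, par_unpar, hw]

lemma frame_inj {X Y : ℝ × ℝ} {c : ℂ} (hc : (D.frame h he X).1 = c • (D.frame h he Y).1) :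
    ∃ m n : ℤ, X = (Y.1 + m, Y.2 + n) := by
  have h1 : D.pt (D.par X) = D.pt (D.par Y) := by
    rw [← D.frame_toCurve h he, ← D.frame_toCurve h he, Sph.toCurve_eq_iff.2 ⟨c, hc⟩]
  obtain ⟨m, n, hmn⟩ := D.pt_eq_iff.1 h1
  refine ⟨m, -n, ?_⟩
  have hre := congrArg Complex.re hmn
  have him := congrArg Complex.im hmn
  simp [par] at hre him
  have ht := D.t_pos
  ext
  · simp only
    linarith
  · simp only
    push_cast
    have : (2 * D.t) * (X.2 - Y.2 + n) = 0 := by linarith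
    have := (mul_eq_zero.1 this).resolve_left (by positivity)
    linarith

/-- The frame has smooth local inverses up to phases. -/
lemma exists_local_inverse (p : Sph φ) : ∃ (r : (Fin 4 → ℂ) → ℝ × ℝ) (N : Set (Fin 4 → ℂ)),
    N ∈ 𝓝 p.1 ∧ (∀ z ∈ N, ContDiffAt ℝ ∞ r z) ∧
      ∀ q : Sph φ, q.1 ∈ N → ∃ c : ℂ, q.1 = c • (D.frame h he (r q.1)).1 := by
  obtain ⟨w₀, hw₀⟩ := D.exists_pt he p.toCurve.2
  obtain ⟨i, j, g, hj, hg, hinv⟩ := D.exists_chart h he w₀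
  obtain ⟨a, ha⟩ : ∃ a : ℂ, p.1 = a • D.Z w₀ := by
    change Projectivization.mk ℂ _ _ = Projectivization.mk ℂ _ _ at hw₀
    rw [Projectivization.mk_eq_mk_iff'] at hw₀
    obtain ⟨b, hb⟩ := hw₀
    have hb0 : b ≠ 0 := by
      rintro rfl
      exact D.ne w₀ (by rw [← hb, zero_smul])
    exact ⟨b⁻¹, by rw [← hb, smul_smul, inv_mul_cancel₀ hb0, one_smul]⟩
  have ha0 : a ≠ 0 := by
    rintro rfl
    exact p.ne_zero (by rw [ha, zero_smul])
  have hquot : p.1 i / p.1 j = D.Z w₀ i / D.Z w₀ j := by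
    rw [ha]
    simp only [Pi.smul_apply, smul_eq_mul]
    rw [mul_div_mul_left _ _ ha0]
  have hpj : p.1 j ≠ 0 := by
    rw [ha]
    exact mul_ne_zero ha0 hj
  obtain ⟨ε, hε, hball⟩ := Metric.eventually_nhds_iff.1 hinv
  have hev := D.eventually_exists_pt he w₀ hε
  have hcont : Tendsto (fun q : Sph φ => (q.toCurve : P3)) (𝓝 p) (𝓝 (D.pt w₀)) := by
    rw [hw₀]
    exact (continuous_subtype_val.comp Sph.continuous_toCurve).continuousAt
  have hq := hcont.eventually hev
  obtain ⟨N₁, hN₁, hsub⟩ := (mem_nhds_subtype _ _ _).1 hq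
  let r : (Fin 4 → ℂ) → ℝ × ℝ := fun z => D.unpar (g (z i / z j))
  have hr : ContDiffAt ℝ ω r p.1 := by
    have h1 : ContDiffAt ℝ ω (fun z : Fin 4 → ℂ => g (z i / z j)) p.1 := by
      rw [← hquot] at hg
      have h2 : ContDiffAt ℂ ω (fun z : Fin 4 → ℂ => z i / z j) p.1 :=
        ContDiffAt.div (f := fun z : Fin 4 → ℂ => z i) (g := fun z : Fin 4 → ℂ => z j)
          (contDiff_apply ℂ ℂ i).contDiffAt (contDiff_apply ℂ ℂ j).contDiffAt hpj
      exact (ContDiffAt.comp p.1 hg h2).restrict_scalars ℝ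
    exact ((reCLM.contDiff.contDiffAt.comp p.1 h1).div_const 2).prodMk
      (((imCLM.contDiff.contDiffAt.comp p.1 h1).neg).div_const _)
  refine ⟨r, _, Filter.inter_mem hN₁ (hr.eventually (by simp)), fun z hz =>
    (show ContDiffAt ℝ ω r z from hz.2).of_le (by simp),
    fun q hqN => ?_⟩
  obtain ⟨w, hw, hwq⟩ := hsub (show q ∈ Subtype.val ⁻¹' N₁ from hqN.1) q.toCurve.2
  refine Sph.toCurve_eq_iff.1 (Subtype.ext ?_)
  rw [frame_toCurve]
  have : g (q.1 i / q.1 j) = w := by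
    have hb := hball hw
    change Projectivization.mk ℂ _ _ = Projectivization.mk ℂ _ _ at hwq
    rw [Projectivization.mk_eq_mk_iff'] at hwq
    obtain ⟨b, hb'⟩ := hwq
    have hb0 : b ≠ 0 := by
      rintro rfl
      exact D.ne w (by rw [← hb', zero_smul])
    rw [← hb, ← hb']
    simp only [Pi.smul_apply, smul_eq_mul]
    rw [mul_div_mul_left _ _ hb0]
  simp only [r, this, par_unpar, hwq]

end ThetaData

end Frame

end NC3

end

/-! ### Operators of the crossed product and their coefficients along orbits -/

noncomputable section

namespace NC3

section Matrices

variable {ι : Type*}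

open Classical in
/-- The standard basis of `ℓ²`. -/
def bv (i : ι) : L2 ι := lp.single 2 i 1

lemma bv_self (i : ι) : bv i i = 1 := by
  classical
  simp [bv]

lemma bv_ne {i j : ι} (h : j ≠ i) : bv i j = 0 := by
  classical
  simp [bv, h]

open Classical in
lemma bv_apply (i j : ι) : bv i j = if j = i then 1 else 0 := by
  split_ifs with h
  · rw [h, bv_self]
  · exact bv_ne h

lemma norm_bv (i : ι) : ‖bv i‖ = 1 := by
  classical
  rw [bv, lp.norm_single (by norm_num), norm_one]

lemma hasSum_bv (v : L2 ι) : HasSum (fun i => v i • bv i) v := by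
  classical
  have := lp.hasSum_single (p := 2) (by norm_num) v
  refine (congrArg (HasSum · v) (funext fun i => ?_)).mpr this
  ext j
  simp [bv, Pi.single_apply]

lemma inner_bv (i : ι) (v : L2 ι) : inner ℂ (bv i) v = v i := by
  classical
  rw [bv, lp.inner_single_left]
  simp

lemma norm_apply_le (v : L2 ι) (i : ι) : ‖v i‖ ≤ ‖v‖ := lp.norm_apply_le_norm (by norm_num) v i

lemma norm_entry_le (T : L2 ι →L[ℂ] L2 ι) (i j : ι) : ‖T (bv j) i‖ ≤ ‖T‖ :=
  (norm_apply_le _ _).trans ((T.le_opNorm _).trans (by rw [norm_bv, mul_one]))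

lemma hasSum_entry (T : L2 ι →L[ℂ] L2 ι) (v : L2 ι) (i : ι) :
    HasSum (fun j => v j * T (bv j) i) (T v i) := by
  have h := ((innerSL ℂ (bv i)).hasSum (T.hasSum (hasSum_bv v)))
  rw [innerSL_apply_apply, inner_bv] at h
  refine (congrArg (HasSum · _) (funext fun j => ?_)).mpr h
  rw [innerSL_apply_apply, inner_bv, map_smul]
  rfl

lemma eq_zero_of_bv {T : L2 ι →L[ℂ] L2 ι} (h : ∀ i, T (bv i) = 0) : T = 0 := by
  ext v i
  have := hasSum_entry T v i
  simp only [h] at this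
  exact this.unique (by simp)

lemma continuous_entry (v : L2 ι) (i : ι) : Continuous fun T : L2 ι →L[ℂ] L2 ι => T v i := by
  simp only [← inner_bv]
  exact continuous_const.inner (ContinuousLinearMap.apply ℂ (L2 ι) v).continuous

lemma star_apply_bv (T : L2 ι →L[ℂ] L2 ι) (i j : ι) :
    (star T) (bv i) j = (starRingEnd ℂ) (T (bv j) i) := by
  rw [← inner_bv j, ContinuousLinearMap.star_eq_adjoint, ContinuousLinearMap.adjoint_inner_right,
    ← inner_bv i, inner_conj_symm]

lemma star_mul_apply_bv (T : L2 ι →L[ℂ] L2 ι) (i : ι) :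
    (star T * T) (bv i) i = ((‖T (bv i)‖ ^ 2 : ℝ) : ℂ) := by
  rw [← inner_bv i, mul_apply_eq_comp, ContinuousLinearMap.star_eq_adjoint,
    ContinuousLinearMap.adjoint_inner_right, inner_self_eq_norm_sq_to_K]
  simp

lemma star_weightedShift (e : Equiv.Perm ι) (w : ι → ℂ) (C : ℝ) (hw : ∀ i, ‖w i‖ ≤ C) :
    star (weightedShift e w C hw) = weightedShift e.symm
      (fun i => (starRingEnd ℂ) (w (e.symm i))) C (fun i => by simpa using hw _) := by
  rw [ContinuousLinearMap.star_eq_adjoint, Eq.comm, ContinuousLinearMap.eq_adjoint_iff]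
  intro x y
  rw [lp.inner_eq_tsum, lp.inner_eq_tsum, ← e.tsum_eq]
  refine tsum_congr fun i => ?_
  rw [weightedShift_apply, weightedShift_apply, Equiv.symm_apply_apply]
  simp
  ring

lemma star_weightedShift_apply (e : Equiv.Perm ι) (w : ι → ℂ) (C : ℝ) (hw : ∀ i, ‖w i‖ ≤ C)
    (v : L2 ι) (i : ι) : (star (weightedShift e w C hw)) v i =
      (starRingEnd ℂ) (w (e.symm i)) * v (e.symm i) := by
  rw [star_weightedShift, weightedShift_apply]

end Matrices

section CrossedAlgebra

open Complex BoundedContinuousFunction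

variable {P : Type} [TopologicalSpace P] {step : P → P → Prop} {A₀ A₁ : Set (P →ᵇ ℂ)}

lemma mulOp_apply (a : P →ᵇ ℂ) (v : L2 (Chain step × ℤ)) (Q : Chain step) (k : ℤ) :
    mulOp step a v (Q, k) = a (Q.1 k) * v (Q, k) := rfl

lemma shiftOp_apply (ξ : P →ᵇ ℂ) (v : L2 (Chain step × ℤ)) (Q : Chain step) (k : ℤ) :
    shiftOp step ξ v (Q, k) = ξ (Q.1 k) * v (Q, k + 1) := rfl

lemma star_mulOp_apply (a : P →ᵇ ℂ) (v : L2 (Chain step × ℤ)) (Q : Chain step) (k : ℤ) :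
    (star (mulOp step a)) v (Q, k) = (starRingEnd ℂ) (a (Q.1 k)) * v (Q, k) := by
  rw [mulOp, star_weightedShift_apply]
  rfl

lemma star_shiftOp_apply (ξ : P →ᵇ ℂ) (v : L2 (Chain step × ℤ)) (Q : Chain step) (k : ℤ) :
    (star (shiftOp step ξ)) v (Q, k) = (starRingEnd ℂ) (ξ (Q.1 (k - 1))) * v (Q, k - 1) := by
  rw [shiftOp, star_weightedShift_apply]
  rfl

variable (step A₀ A₁) in
/-- The crossed product C*-algebra of a family of functions and sections. -/
abbrev cross : StarSubalgebra ℂ (L2 (Chain step × ℤ) →L[ℂ] L2 (Chain step × ℤ)) :=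
  (algCrossed step A₀ A₁).topologicalClosure

lemma algCrossed_le_cross : algCrossed step A₀ A₁ ≤ cross step A₀ A₁ :=
  StarSubalgebra.le_topologicalClosure _

lemma algCrossed_induction {p : (L2 (Chain step × ℤ) →L[ℂ] L2 (Chain step × ℤ)) → Prop}
    (h0 : ∀ a ∈ A₀, p (mulOp step a) ∧ p (star (mulOp step a)))
    (h1 : ∀ ξ ∈ A₁, p (shiftOp step ξ) ∧ p (star (shiftOp step ξ)))
    (hc : ∀ c : ℂ, p (algebraMap ℂ _ c)) (hadd : ∀ T T', p T → p T' → p (T + T'))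
    (hmul : ∀ T T', T ∈ algCrossed step A₀ A₁ → T' ∈ algCrossed step A₀ A₁ → p T → p T' →
      p (T * T')) {T} (hT : T ∈ algCrossed step A₀ A₁) : p T := by
  have hT' : T ∈ (algCrossed step A₀ A₁).toSubalgebra := hT
  rw [algCrossed, StarAlgebra.adjoin_toSubalgebra] at hT'
  have hsub : ∀ {T}, T ∈ Algebra.adjoin ℂ ((mulOp step '' A₀ ∪ shiftOp step '' A₁) ∪
      star (mulOp step '' A₀ ∪ shiftOp step '' A₁)) → T ∈ algCrossed step A₀ A₁ := fun h => by
    rw [← StarAlgebra.adjoin_toSubalgebra] at h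
    exact h
  induction hT' using Algebra.adjoin_induction with
  | mem T h =>
    rcases h with (⟨a, ha, rfl⟩ | ⟨ξ, hξ, rfl⟩) | h
    · exact (h0 a ha).1
    · exact (h1 ξ hξ).1
    · rcases h with ⟨a, ha, h⟩ | ⟨ξ, hξ, h⟩
      · rw [← star_star T, ← h]
        exact (h0 a ha).2
      · rw [← star_star T, ← h]
        exact (h1 ξ hξ).2
  | algebraMap r => exact hc r
  | add x y hx hy ihx ihy => exact hadd _ _ (ihx (hsub hx)) (ihy (hsub hy))
  | mul x y hx hy ihx ihy => exact hmul _ _ (hsub hx) (hsub hy) (ihx (hsub hx)) (ihy (hsub hy))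

/-- Operators of the crossed product act in the same way on equivalent chains. -/
lemma cross_covariant {Q R : Chain step} {m : ℤ} {γ : ℤ → ℂ} (hγ : ∀ k, ‖γ k‖ = 1)
    (h0 : ∀ a ∈ A₀, ∀ k, a (Q.1 k) = a (R.1 (k + m)))
    (h1 : ∀ ξ ∈ A₁, ∀ k, γ k * ξ (R.1 (k + m)) = γ (k + 1) * ξ (Q.1 k)) {T}
    (hT : T ∈ cross step A₀ A₁) {v v' : L2 (Chain step × ℤ)}
    (hv : ∀ k, v' (Q, k) = γ k * v (R, k + m)) (k : ℤ) :
    (T v') (Q, k) = γ k * (T v) (R, k + m) := by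
  have main : ∀ T ∈ algCrossed step A₀ A₁, ∀ v v' : L2 (Chain step × ℤ),
      (∀ k, v' (Q, k) = γ k * v (R, k + m)) → ∀ k, (T v') (Q, k) = γ k * (T v) (R, k + m) := by
    intro T hT
    refine algCrossed_induction (p := fun T => ∀ v v' : L2 (Chain step × ℤ),
      (∀ k, v' (Q, k) = γ k * v (R, k + m)) → ∀ k, (T v') (Q, k) = γ k * (T v) (R, k + m))
      ?_ ?_ ?_ ?_ ?_ hT
    · intro a ha
      refine ⟨fun v v' hv k => ?_, fun v v' hv k => ?_⟩
      · rw [mulOp_apply, mulOp_apply, hv, h0 a ha]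
        ring
      · rw [star_mulOp_apply, star_mulOp_apply, hv, h0 a ha]
        ring
    · intro ξ hξ
      refine ⟨fun v v' hv k => ?_, fun v v' hv k => ?_⟩
      · rw [shiftOp_apply, shiftOp_apply, hv, show k + m + 1 = k + 1 + m by ring]
        linear_combination (-v (R, k + 1 + m)) * h1 ξ hξ k
      · rw [star_shiftOp_apply, star_shiftOp_apply, hv, show k + m - 1 = k - 1 + m by ring]
        have h := h1 ξ hξ (k - 1)
        rw [sub_add_cancel] at h
        have hn : ∀ j, γ j * (starRingEnd ℂ) (γ j) = 1 := fun j => by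
          rw [mul_conj', hγ]
          norm_num
        have hc := congrArg (starRingEnd ℂ) h
        rw [map_mul, map_mul] at hc
        linear_combination (-γ (k - 1) * γ k * v (R, k - 1 + m)) * hc +
          γ k * (starRingEnd ℂ) (ξ (R.1 (k - 1 + m))) * v (R, k - 1 + m) * hn (k - 1) -
          γ (k - 1) * (starRingEnd ℂ) (ξ (Q.1 (k - 1))) * v (R, k - 1 + m) * hn k
    · intro c v v' hv k
      change c * v' (Q, k) = γ k * (c * v (R, k + m))
      rw [hv]
      ring
    · intro T T' hT hT' v v' hv k
      change T v' (Q, k) + T' v' (Q, k) = γ k * (T v (R, k + m) + T' v (R, k + m))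
      rw [hT v v' hv, hT' v v' hv]
      ring
    · intro T T' _ _ hT hT' v v' hv k
      exact hT _ _ (hT' v v' hv) k
  have hcl : IsClosed {T : L2 (Chain step × ℤ) →L[ℂ] L2 (Chain step × ℤ) |
      (T v') (Q, k) = γ k * (T v) (R, k + m)} :=
    isClosed_eq (continuous_entry _ _) (continuous_const.mul (continuous_entry _ _))
  exact closure_minimal (fun T hT => main T hT v v' hv k) hcl hT

/-- Covariance of Q with itself, applied to the zero vector and a vector that vanishes along Q: they
agree on Q, hence so do their images. -/
lemma cross_diagonal {T} (hT : T ∈ cross step A₀ A₁) {Q R : Chain step} (hQR : Q ≠ R) (k l : ℤ) :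
    T (bv (R, l)) (Q, k) = 0 := by
  have := cross_covariant (Q := Q) (R := Q) (m := 0) (γ := fun _ => 1) (by simp) (by simp)
    (by simp) hT (v := 0) (v' := bv (R, l)) (fun j => by
      rw [bv_ne (fun h => hQR (congrArg Prod.fst h))]
      simp) k
  simpa using this

end CrossedAlgebra

section OrbitFrame

open Complex BoundedContinuousFunction

variable {P : Type} [TopologicalSpace P]

/-- A family of orbits of `step`, parametrized by the plane, which contains all orbits up to a
change of phases. -/
structure OrbitFrame (step : P → P → Prop) (A₀ A₁ : Set (P →ᵇ ℂ)) (η : ℝ) where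
  e : ℝ × ℝ → P
  cont : Continuous e
  per : ∀ x y, e (x + 1, y) = e (x, y)
  step_e : ∀ x y, step (e (x, y)) (e (x - η, y))
  gauge : ∀ Q : Chain step, ∃ x ∈ Set.Icc (0 : ℝ) 1, ∃ y ∈ Set.Icc (0 : ℝ) 1, ∃ γ : ℤ → ℂ,
    (∀ k, ‖γ k‖ = 1) ∧ (∀ a ∈ A₀, ∀ k : ℤ, a (Q.1 k) = a (e (x - k * η, y))) ∧
    ∀ ξ ∈ A₁, ∀ k : ℤ, γ k * ξ (e (x - k * η, y)) = γ (k + 1) * ξ (Q.1 k)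

namespace OrbitFrame

variable {step : P → P → Prop} {A₀ A₁ : Set (P →ᵇ ℂ)} {η : ℝ} (F : OrbitFrame step A₀ A₁ η)

/-- The orbit of a point of the frame. -/
def chain (X : ℝ × ℝ) : Chain step :=
  ⟨fun k => F.e (X.1 - k * η, X.2), fun k => by
    have := F.step_e (X.1 - k * η) X.2
    rwa [show X.1 - k * η - η = X.1 - ((k + 1 : ℤ) : ℝ) * η by push_cast; ring] at this⟩

lemma chain_apply (X : ℝ × ℝ) (k : ℤ) : (F.chain X).1 k = F.e (X.1 - k * η, X.2) := rfl

lemma chain_zero (X : ℝ × ℝ) : (F.chain X).1 0 = F.e X := by simp [chain_apply]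

lemma chain_add_one (x y : ℝ) : F.chain (x + 1, y) = F.chain (x, y) := by
  refine Subtype.ext (funext fun k => ?_)
  rw [chain_apply, chain_apply]
  show F.e (x + 1 - k * η, y) = F.e (x - k * η, y)
  rw [← F.per (x - k * η) y, show x + 1 - k * η = x - k * η + 1 by ring]

/-- The coefficient of degree `n` of an operator. -/
def coef (T : L2 (Chain step × ℤ) →L[ℂ] L2 (Chain step × ℤ)) (n : ℤ) (X : ℝ × ℝ) : ℂ :=
  T (bv (F.chain X, n)) (F.chain X, 0)

variable {T T' : L2 (Chain step × ℤ) →L[ℂ] L2 (Chain step × ℤ)}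

lemma coef_add_one (n : ℤ) (x y : ℝ) : F.coef T n (x + 1, y) = F.coef T n (x, y) := by
  rw [coef, coef, chain_add_one]

lemma norm_coef_le (n : ℤ) (X : ℝ × ℝ) : ‖F.coef T n X‖ ≤ ‖T‖ := norm_entry_le _ _ _

lemma coef_add (n : ℤ) (X : ℝ × ℝ) : F.coef (T + T') n X = F.coef T n X + F.coef T' n X := rfl

lemma coef_sub (n : ℤ) (X : ℝ × ℝ) : F.coef (T - T') n X = F.coef T n X - F.coef T' n X := rfl

lemma coef_algebraMap (c : ℂ) (n : ℤ) (X : ℝ × ℝ) :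
    F.coef (algebraMap ℂ _ c) n X = if n = 0 then c else 0 := by
  change c * bv (F.chain X, n) (F.chain X, 0) = _
  rw [bv_apply]
  simp [eq_comm]

lemma coef_mulOp (a : P →ᵇ ℂ) (n : ℤ) (X : ℝ × ℝ) :
    F.coef (mulOp step a) n X = if n = 0 then a (F.e X) else 0 := by
  rw [coef, mulOp_apply, chain_zero, bv_apply]
  simp [eq_comm]

lemma coef_star_mulOp (a : P →ᵇ ℂ) (n : ℤ) (X : ℝ × ℝ) :
    F.coef (star (mulOp step a)) n X = if n = 0 then (starRingEnd ℂ) (a (F.e X)) else 0 := by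
  rw [coef, star_mulOp_apply, chain_zero, bv_apply]
  simp [eq_comm]

lemma coef_shiftOp (ξ : P →ᵇ ℂ) (n : ℤ) (X : ℝ × ℝ) :
    F.coef (shiftOp step ξ) n X = if n = 1 then ξ (F.e X) else 0 := by
  rw [coef, shiftOp_apply, chain_zero, bv_apply]
  simp [eq_comm]

lemma coef_star_shiftOp (ξ : P →ᵇ ℂ) (n : ℤ) (X : ℝ × ℝ) :
    F.coef (star (shiftOp step ξ)) n X =
      if n = -1 then (starRingEnd ℂ) (ξ (F.e (X.1 + η, X.2))) else 0 := by
  rw [coef, star_shiftOp_apply, bv_apply, chain_apply]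
  simp [eq_comm]

/-- Renumbering the orbit of X by k gives the orbit of (X₁ − kη, X₂), and covariance with trivial
phases moves row k to row 0. So the coefficients contain all matrix entries over the frame. -/
lemma entry_eq_coef (hT : T ∈ cross step A₀ A₁) (X : ℝ × ℝ) (n k : ℤ) :
    T (bv (F.chain X, n)) (F.chain X, k) = F.coef T (n - k) (X.1 - k * η, X.2) := by
  have hch : ∀ j : ℤ, (F.chain (X.1 - k * η, X.2)).1 j = (F.chain X).1 (j + k) := fun j => by
    rw [chain_apply, chain_apply]
    congr 2
    push_cast
    ring
  have := cross_covariant (Q := F.chain (X.1 - k * η, X.2)) (R := F.chain X) (m := k)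
    (γ := fun _ => 1) (by simp) (fun a _ j => by rw [hch]) (fun ξ _ j => by rw [hch]) hT
    (v := bv (F.chain X, n)) (v' := bv (F.chain (X.1 - k * η, X.2), n - k)) (fun j => by
      rw [bv_apply, bv_apply]
      simp [eq_sub_iff_add_eq]) 0
  rw [one_mul, zero_add] at this
  exact this.symm

lemma apply_chain (hT : T ∈ cross step A₀ A₁) (X : ℝ × ℝ) {s : Finset ℤ}
    (hs : ∀ n ∉ s, F.coef T n X = 0) (v : L2 (Chain step × ℤ)) :
    T v (F.chain X, 0) = ∑ n ∈ s, F.coef T n X * v (F.chain X, n) := by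
  have h := hasSum_entry T v (F.chain X, 0)
  have h2 : HasSum (fun j => v j * T (bv j) (F.chain X, 0)) _ := hasSum_sum_of_ne_finset_zero (s := s.map ⟨fun n => (F.chain X, n), fun a b hab =>
    congrArg Prod.snd hab⟩) (fun j hj => by
      obtain ⟨Q, n⟩ := j
      by_cases hQ : F.chain X = Q
      · subst hQ
        have : n ∉ s := fun hn => hj (Finset.mem_map_of_mem _ hn)
        have := hs n this
        rw [coef] at this
        simp only
        rw [this, mul_zero]
      · simp only
        rw [cross_diagonal hT hQ, mul_zero])
  rw [h.unique h2, Finset.sum_map]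
  exact Finset.sum_congr rfl fun n _ => mul_comm _ _

/-- Row times column: the row of T at place 0 has finite support, and the entries of T' at place k
are coefficients with x shifted by kη. -/
lemma coef_mul (hT : T ∈ cross step A₀ A₁) (hT' : T' ∈ cross step A₀ A₁) (X : ℝ × ℝ)
    {s : Finset ℤ} (hs : ∀ n ∉ s, F.coef T n X = 0) (n : ℤ) : F.coef (T * T') n X =
      ∑ k ∈ s, F.coef T k X * F.coef T' (n - k) (X.1 - k * η, X.2) := by
  rw [coef, mul_apply_eq_comp, F.apply_chain hT X hs]
  exact Finset.sum_congr rfl fun k _ => by rw [F.entry_eq_coef hT']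

lemma coef_star (hT : T ∈ cross step A₀ A₁) (n : ℤ) (X : ℝ × ℝ) :
    F.coef (star T) n X = (starRingEnd ℂ) (F.coef T (-n) (X.1 - n * η, X.2)) := by
  rw [coef, star_apply_bv, F.entry_eq_coef hT, zero_sub]

lemma coef_star_mul_self (X : ℝ × ℝ) :
    F.coef (star T * T) 0 X = ((‖T (bv (F.chain X, 0))‖ ^ 2 : ℝ) : ℂ) := star_mul_apply_bv _ _

/-- An operator of the crossed product vanishes if it does so on the frame. -/
lemma eq_zero (hT : T ∈ cross step A₀ A₁) (h : ∀ x ∈ Set.Icc (0 : ℝ) 1, ∀ y ∈ Set.Icc (0 : ℝ) 1,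
    T (bv (F.chain (x, y), 0)) = 0) : T = 0 := by
  refine eq_zero_of_bv ?_
  rintro ⟨Q, k⟩
  obtain ⟨x, hx, y, hy, γ, h1, h2, h3⟩ := F.gauge ⟨fun j => Q.1 (j + k), fun j => by
    have := Q.2 (j + k)
    rwa [show j + k + 1 = j + 1 + k by ring] at this⟩
  have hz := h x hx y hy
  ext ⟨R, j⟩
  by_cases hR : R = Q
  · subst hR
    -- The gauge was taken for the chain renumbered from place k. Undoing the renumbering carries
    -- the basis vector at place 0 of the frame orbit to the one at place k of the given chain, up
    -- to a phase.
    have key := cross_covariant (Q := R) (R := F.chain (x, y)) (m := -k) (γ := fun j => γ (j - k))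
      (fun j => h1 _) (fun a ha j => by
        have := h2 a ha (j - k)
        simpa [chain_apply, sub_eq_add_neg] using this)
      (fun ξ hξ j => by
        have := h3 ξ hξ (j - k)
        simpa [chain_apply, sub_eq_add_neg, add_right_comm] using this) hT
      (v := bv (F.chain (x, y), 0)) (v' := γ 0 • bv (R, k)) (fun i => by
        change γ 0 * bv (R, k) (R, i) = _
        rw [bv_apply, bv_apply]
        by_cases hik : i = k
        · simp [hik]
        · have : ¬ (i + -k = 0) := fun h => hik (by linarith)
          simp [hik, this]) j
    rw [hz, map_smul] at key
    have hγ0 : γ 0 ≠ 0 := fun h0 => by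
      have := h1 0
      rw [h0, norm_zero] at this
      exact zero_ne_one this
    have key' : γ 0 * T (bv (R, k)) (R, j) = 0 := by
      refine Eq.trans key ?_
      simp
    exact (mul_eq_zero.1 key').resolve_left hγ0
  · exact cross_diagonal hT hR _ _

/-- Operators with finitely many nonzero coefficients, which are functions of class `C^r`. -/
def Reg (r : WithTop ℕ∞) (T : L2 (Chain step × ℤ) →L[ℂ] L2 (Chain step × ℤ)) : Prop :=
  ∃ N : ℕ, (∀ n : ℤ, (N : ℤ) < |n| → ∀ X, F.coef T n X = 0) ∧ ∀ n, ContDiff ℝ r (F.coef T n)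

lemma contDiff_conj {E : Type*} [NormedAddCommGroup E] [NormedSpace ℝ E] {r : WithTop ℕ∞}
    {f : E → ℂ} (hf : ContDiff ℝ r f) : ContDiff ℝ r fun x => (starRingEnd ℂ) (f x) :=
  (conjCLE : ℂ →L[ℝ] ℂ).contDiff.comp hf

lemma contDiff_shift {r : WithTop ℕ∞} {f : ℝ × ℝ → ℂ} (hf : ContDiff ℝ r f) (c : ℝ) :
    ContDiff ℝ r fun X : ℝ × ℝ => f (X.1 - c, X.2) :=
  hf.comp ((contDiff_fst.sub contDiff_const).prodMk contDiff_snd)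

lemma mem_Icc_of_abs_le {N : ℕ} {n : ℤ} (h : n ∉ Finset.Icc (-(N : ℤ)) N) : (N : ℤ) < |n| := by
  rw [Finset.mem_Icc, ← abs_le] at h
  exact not_le.1 h

lemma Reg.mul {r : WithTop ℕ∞} (hT : T ∈ cross step A₀ A₁) (hT' : T' ∈ cross step A₀ A₁)
    (h : F.Reg r T) (h' : F.Reg r T') : F.Reg r (T * T') := by
  obtain ⟨N, hN, hc⟩ := h
  obtain ⟨N', hN', hc'⟩ := h'
  have e : ∀ n X, F.coef (T * T') n X = ∑ k ∈ Finset.Icc (-(N : ℤ)) N,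
      F.coef T k X * F.coef T' (n - k) (X.1 - k * η, X.2) := fun n X =>
    F.coef_mul hT hT' X (fun k hk => hN k (mem_Icc_of_abs_le hk) X) n
  refine ⟨N + N', fun n hn X => ?_, fun n => ?_⟩
  · rw [e]
    refine Finset.sum_eq_zero fun k hk => ?_
    rw [hN', mul_zero]
    rw [Finset.mem_Icc, ← abs_le] at hk
    have := abs_sub_abs_le_abs_sub n k
    push_cast at hn
    linarith
  · rw [funext (e n)]
    exact ContDiff.sum fun k _ => (hc k).mul (contDiff_shift (hc' _) _)

lemma Reg.add {r : WithTop ℕ∞} (h : F.Reg r T) (h' : F.Reg r T') : F.Reg r (T + T') := by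
  obtain ⟨N, hN, hc⟩ := h
  obtain ⟨N', hN', hc'⟩ := h'
  refine ⟨max N N', fun n hn X => ?_, fun n => (hc n).add (hc' n)⟩
  have h1 : (N : ℤ) ≤ max N N' := by exact_mod_cast le_max_left N N'
  have h2 : (N' : ℤ) ≤ max N N' := by exact_mod_cast le_max_right N N'
  rw [coef_add, hN n (h1.trans_lt hn), hN' n (h2.trans_lt hn), add_zero]

lemma Reg.of_single {r : WithTop ℕ∞} {m : ℤ} {f : ℝ × ℝ → ℂ} (hf : ContDiff ℝ r f)
    (h : ∀ n X, F.coef T n X = if n = m then f X else 0) : F.Reg r T := by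
  refine ⟨m.natAbs, fun n hn X => ?_, fun n => ?_⟩
  · rw [h, if_neg]
    rintro rfl
    rw [Int.natCast_natAbs] at hn
    exact lt_irrefl _ hn
  · rw [funext (h n)]
    by_cases hnm : n = m
    · simpa [hnm] using hf
    · simpa [hnm] using contDiff_const

lemma reg_of_mem {r : WithTop ℕ∞} {B₀ B₁ : Set (P →ᵇ ℂ)} (h0 : B₀ ⊆ A₀) (h1 : B₁ ⊆ A₁)
    (hB₀ : ∀ a ∈ B₀, ContDiff ℝ r fun X => a (F.e X))
    (hB₁ : ∀ ξ ∈ B₁, ContDiff ℝ r fun X => ξ (F.e X)) (hT : T ∈ algCrossed step B₀ B₁) :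
    F.Reg r T := by
  have hle : algCrossed step B₀ B₁ ≤ cross step A₀ A₁ :=
    (StarAlgebra.adjoin_mono (Set.union_subset_union (Set.image_mono h0)
      (Set.image_mono h1))).trans algCrossed_le_cross
  exact algCrossed_induction (p := F.Reg r)
    (fun a ha => ⟨Reg.of_single F (hB₀ a ha) (F.coef_mulOp a),
      Reg.of_single F (contDiff_conj (hB₀ a ha)) (F.coef_star_mulOp a)⟩)
    (fun ξ hξ => ⟨Reg.of_single F (hB₁ ξ hξ) (F.coef_shiftOp ξ),
      Reg.of_single F (contDiff_conj (by simpa using contDiff_shift (hB₁ ξ hξ) (-η)))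
        (F.coef_star_shiftOp ξ)⟩)
    (fun c => Reg.of_single F contDiff_const (F.coef_algebraMap c))
    (fun T T' h h' => h.add F h') (fun T T' hT hT' h h' => h.mul F (hle hT) (hle hT') h') hT

/-- Coefficients are bounded by the operator norm, so those of T are uniform limits of the
continuous coefficients of elements of the algebraic crossed product. -/
lemma continuous_coef (hT : T ∈ cross step A₀ A₁) (n : ℤ) : Continuous (F.coef T n) := by
  refine continuous_of_uniform_approx_of_continuous fun u hu => ?_
  obtain ⟨ε, hε, hεu⟩ := Metric.mem_uniformity_dist.1 hu
  obtain ⟨S, hS, hST⟩ := Metric.mem_closure_iff.1 (show T ∈ closure _ from hT) ε hε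
  obtain ⟨-, -, hc⟩ := F.reg_of_mem (r := 0) subset_rfl subset_rfl
    (fun a _ => contDiff_zero.2 (a.continuous.comp F.cont))
    (fun a _ => contDiff_zero.2 (a.continuous.comp F.cont)) hS
  refine ⟨F.coef S n, (hc n).continuous, fun X => hεu ?_⟩
  rw [dist_eq_norm, ← coef_sub]
  rw [dist_eq_norm] at hST
  exact (F.norm_coef_le n X).trans_lt hST

end OrbitFrame

end OrbitFrame

end NC3

end

/-! ### Means over the unit square and the faithful trace -/

noncomputable section

namespace NC3

section Average

lemma continuous_slice {E : Type*} [TopologicalSpace E] {f : ℝ × ℝ → E} (hf : Continuous f)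
    (y : ℝ) : Continuous fun x => f (x, y) := hf.comp (Continuous.prodMk_left y)

variable {E : Type*} [NormedAddCommGroup E] [NormedSpace ℝ E]

/-- The mean of a function on the unit square. -/
def avg (f : ℝ × ℝ → E) : E := ∫ y in (0 : ℝ)..1, ∫ x in (0 : ℝ)..1, f (x, y)

lemma continuous_integral_fst {f : ℝ × ℝ → E} (hf : Continuous f) :
    Continuous fun y => ∫ x in (0 : ℝ)..1, f (x, y) :=
  intervalIntegral.continuous_parametric_intervalIntegral_of_continuous'
    (f := fun y x => f (x, y)) (hf.comp continuous_swap) 0 1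

lemma avg_add {f g : ℝ × ℝ → E} (hf : Continuous f) (hg : Continuous g) :
    avg (fun X => f X + g X) = avg f + avg g := by
  simp only [avg]
  rw [← intervalIntegral.integral_add ((continuous_integral_fst hf).intervalIntegrable _ _)
    ((continuous_integral_fst hg).intervalIntegrable _ _)]
  refine intervalIntegral.integral_congr fun y _ => ?_
  exact intervalIntegral.integral_add ((continuous_slice hf y).intervalIntegrable _ _)
    ((continuous_slice hg y).intervalIntegrable _ _)

lemma avg_const_mul (c : ℂ) (f : ℝ × ℝ → ℂ) : avg (fun X => c * f X) = c * avg f := by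
  simp only [avg, intervalIntegral.integral_const_mul]

lemma avg_zero : avg (fun _ : ℝ × ℝ => (0 : E)) = 0 := by simp [avg]

lemma avg_sum {α : Type*} (s : Finset α) {f : α → ℝ × ℝ → E} (hf : ∀ i ∈ s, Continuous (f i)) :
    avg (fun X => ∑ i ∈ s, f i X) = ∑ i ∈ s, avg (f i) := by
  classical
  induction s using Finset.induction_on with
  | empty => simp [avg_zero]
  | insert i s hi ih =>
    simp only [Finset.sum_insert hi]
    rw [avg_add (hf i (Finset.mem_insert_self _ _)) (continuous_finsetSum _ fun j hj =>
      hf j (Finset.mem_insert_of_mem hj)), ih fun j hj => hf j (Finset.mem_insert_of_mem hj)]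

lemma avg_ofReal (f : ℝ × ℝ → ℝ) : avg (fun X => (f X : ℂ)) = ((avg f : ℝ) : ℂ) := by
  simp only [avg, intervalIntegral.integral_ofReal]

lemma norm_avg_le {f : ℝ × ℝ → E} {C : ℝ} (h : ∀ X, ‖f X‖ ≤ C) : ‖avg f‖ ≤ C := by
  have := intervalIntegral.norm_integral_le_of_norm_le_const (a := (0 : ℝ)) (b := 1)
    (f := fun y => ∫ x in (0 : ℝ)..1, f (x, y)) (C := C) (fun y _ => by
      simpa using intervalIntegral.norm_integral_le_of_norm_le_const (a := (0 : ℝ)) (b := 1)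
        (f := fun x => f (x, y)) (C := C) (fun x _ => h _))
  simpa [avg] using this

lemma integral_comp_sub_of_periodic {f : ℝ → E} (hf : ∀ x, f (x + 1) = f x) (c : ℝ) :
    ∫ x in (0 : ℝ)..1, f (x - c) = ∫ x in (0 : ℝ)..1, f x := by
  rw [intervalIntegral.integral_comp_sub_right]
  have := Function.Periodic.intervalIntegral_add_eq (f := f) (T := 1) hf (0 - c) 0
  rwa [zero_add, show 0 - c + 1 = 1 - c by ring] at this

lemma avg_comp_sub {f : ℝ × ℝ → E} (hf : ∀ x y, f (x + 1, y) = f (x, y)) (c : ℝ) :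
    avg (fun X => f (X.1 - c, X.2)) = avg f :=
  intervalIntegral.integral_congr fun y _ =>
    integral_comp_sub_of_periodic (f := fun x => f (x, y)) (fun x => hf x y) c

lemma avg_pos {f : ℝ × ℝ → ℝ} (hf : Continuous f) (h0 : ∀ X, 0 ≤ f X) {x y : ℝ}
    (hx : x ∈ Set.Icc (0 : ℝ) 1) (hy : y ∈ Set.Icc (0 : ℝ) 1) (h : 0 < f (x, y)) : 0 < avg f := by
  refine intervalIntegral.integral_pos one_pos (continuous_integral_fst hf).continuousOn
    (fun y _ => intervalIntegral.integral_nonneg zero_le_one fun x _ => h0 _) ⟨y, hy, ?_⟩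
  exact intervalIntegral.integral_pos one_pos (continuous_slice hf y).continuousOn
    (fun x _ => h0 _) ⟨x, hx, h⟩

lemma avg_nonneg {f : ℝ × ℝ → ℝ} (h0 : ∀ X, 0 ≤ f X) : 0 ≤ avg f :=
  intervalIntegral.integral_nonneg zero_le_one fun _ _ =>
    intervalIntegral.integral_nonneg zero_le_one fun _ _ => h0 _

end Average

section Trace

open Complex

variable {P : Type} [TopologicalSpace P] {step : P → P → Prop} {A₀ A₁ : Set (P →ᵇ ℂ)} {η : ℝ}

lemma dense_algCrossed : Dense {T : cross step A₀ A₁ | T.1 ∈ algCrossed step A₀ A₁} := by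
  rw [Subtype.dense_iff]
  intro T hT
  refine closure_mono ?_ (show T ∈ closure (algCrossed step A₀ A₁ : Set _) from hT)
  exact fun S hS => ⟨⟨S, algCrossed_le_cross hS⟩, hS, rfl⟩

namespace OrbitFrame

variable (F : OrbitFrame step A₀ A₁ η)

lemma reg_zero {T} (hT : T ∈ algCrossed step A₀ A₁) : F.Reg 0 T :=
  F.reg_of_mem subset_rfl subset_rfl
    (fun a _ => contDiff_zero.2 (a.continuous.comp F.cont))
    (fun a _ => contDiff_zero.2 (a.continuous.comp F.cont)) hT

/-- The trace of the crossed product. -/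
def tr : cross step A₀ A₁ →L[ℂ] ℂ :=
  LinearMap.mkContinuous
    { toFun := fun T => avg (F.coef T.1 0)
      map_add' := fun T T' => avg_add (F.continuous_coef T.2 0) (F.continuous_coef T'.2 0)
      map_smul' := fun c T => avg_const_mul c _ } 1
    (fun T => by
      rw [one_mul]
      exact norm_avg_le fun X => F.norm_coef_le 0 X)

lemma tr_apply (T : cross step A₀ A₁) : F.tr T = avg (F.coef T.1 0) := rfl

lemma tr_one : F.tr 1 = 1 := by
  have : ∀ X, F.coef (1 : L2 (Chain step × ℤ) →L[ℂ] L2 (Chain step × ℤ)) 0 X = 1 := fun X => by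
    have := F.coef_algebraMap 1 0 X
    rwa [map_one, if_pos rfl] at this
  rw [tr_apply]
  simp only [avg, OneMemClass.coe_one, this]
  simp

/-- On the dense algebra both sides are finite sums of means of coefficients of opposite degrees.
The substitution k ↦ −k matches the terms up to a shift by kη in x, which does not change the mean
of a function periodic in x. Continuity extends the identity in one variable at a time. -/
lemma tr_mul_comm (S T : cross step A₀ A₁) : F.tr (S * T) = F.tr (T * S) := by
  have main : ∀ S T : cross step A₀ A₁, S.1 ∈ algCrossed step A₀ A₁ →
      T.1 ∈ algCrossed step A₀ A₁ → F.tr (S * T) = F.tr (T * S) := by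
    intro S T hS hT
    obtain ⟨N, hN, hc⟩ := F.reg_zero hS
    obtain ⟨N', hN', hc'⟩ := F.reg_zero hT
    set s := Finset.Icc (-(max N N' : ℤ)) (max N N') with hs
    have hmem : ∀ k : ℤ, k ∉ s → (max N N' : ℤ) < |k| := fun k hk => by
      rw [hs, Finset.mem_Icc, ← abs_le] at hk
      exact not_le.1 hk
    have hcont : ∀ k, Continuous fun X : ℝ × ℝ =>
        F.coef S.1 k X * F.coef T.1 (0 - k) (X.1 - k * η, X.2) := fun k =>
      ((hc k).mul (contDiff_shift (hc' _) _)).continuous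
    have hcont' : ∀ k, Continuous fun X : ℝ × ℝ =>
        F.coef T.1 k X * F.coef S.1 (0 - k) (X.1 - k * η, X.2) := fun k =>
      ((hc' k).mul (contDiff_shift (hc _) _)).continuous
    rw [tr_apply, tr_apply]
    have e1 : F.coef (S * T : cross step A₀ A₁).1 0 = fun X => ∑ k ∈ s,
        F.coef S.1 k X * F.coef T.1 (0 - k) (X.1 - k * η, X.2) := funext fun X =>
      F.coef_mul S.2 T.2 X (fun k hk => hN k ((le_max_left _ _).trans_lt (hmem k hk)) X) 0
    have e2 : F.coef (T * S : cross step A₀ A₁).1 0 = fun X => ∑ k ∈ s,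
        F.coef T.1 k X * F.coef S.1 (0 - k) (X.1 - k * η, X.2) := funext fun X =>
      F.coef_mul T.2 S.2 X (fun k hk => hN' k ((le_max_right _ _).trans_lt (hmem k hk)) X) 0
    rw [e1, e2, avg_sum s fun k _ => hcont k, avg_sum s fun k _ => hcont' k,
      ← Finset.sum_equiv (Equiv.neg ℤ) (s := s) (t := s) (f := fun k => avg fun X : ℝ × ℝ =>
        F.coef T.1 (-k) X * F.coef S.1 (0 - -k) (X.1 - (-k : ℤ) * η, X.2)) (fun k => by
          rw [hs, Finset.mem_Icc, Finset.mem_Icc, Equiv.neg_apply, neg_le_neg_iff,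
            neg_le, and_comm]) (g := fun k => avg fun X : ℝ × ℝ =>
        F.coef T.1 k X * F.coef S.1 (0 - k) (X.1 - k * η, X.2)) (fun k _ => rfl)]
    refine Finset.sum_congr rfl fun k _ => ?_
    rw [← avg_comp_sub (f := fun X : ℝ × ℝ => F.coef T.1 (-k) X *
      F.coef S.1 (0 - -k) (X.1 - (-k : ℤ) * η, X.2)) (fun x y => ?_) (k * η)]
    · congr 1
      funext X
      rw [mul_comm, zero_sub, zero_sub, neg_neg]
      simp
    · simp only
      rw [coef_add_one, show x + 1 - ((-k : ℤ) : ℝ) * η = x - ((-k : ℤ) : ℝ) * η + 1 by ring,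
        coef_add_one]
  have h1 : ∀ S : cross step A₀ A₁, S.1 ∈ algCrossed step A₀ A₁ →
      (fun T => F.tr (S * T)) = fun T => F.tr (T * S) := fun S hS =>
    Continuous.ext_on dense_algCrossed (F.tr.continuous.comp (continuous_const.mul continuous_id))
      (F.tr.continuous.comp (continuous_id.mul continuous_const)) fun T hT => main S T hS hT
  have h2 : (fun S => F.tr (S * T)) = fun S => F.tr (T * S) :=
    Continuous.ext_on dense_algCrossed (F.tr.continuous.comp (continuous_id.mul continuous_const))
      (F.tr.continuous.comp (continuous_const.mul continuous_id)) fun S hS => congrFun (h1 S hS) T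
  exact congrFun h2 S

lemma tr_star_mul_self (T : cross step A₀ A₁) :
    F.tr (star T * T) = ((avg fun X => ‖T.1 (bv (F.chain X, 0))‖ ^ 2 : ℝ) : ℂ) := by
  rw [tr_apply, ← avg_ofReal]
  exact congrArg avg (funext fun X => F.coef_star_mul_self X)

lemma continuous_norm_sq (T : cross step A₀ A₁) :
    Continuous fun X => ‖T.1 (bv (F.chain X, 0))‖ ^ 2 := by
  have h := continuous_re.comp (F.continuous_coef (star T * T).2 0)
  refine h.congr fun X => ?_
  have := F.coef_star_mul_self (T := T.1) X
  exact (congrArg re this).trans (ofReal_re _)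

/-- The trace is the mean of the continuous function ‖T b_X‖², where b_X is the basis vector at
place 0 of the orbit of X. If it vanishes then T kills all b_X with X in the unit square, which
determine T by `OrbitFrame.eq_zero`. -/
lemma tr_pos {T : cross step A₀ A₁} (hT : T ≠ 0) : 0 < (F.tr (star T * T)).re := by
  rw [tr_star_mul_self, ofReal_re]
  by_contra h
  refine hT (Subtype.ext (F.eq_zero T.2 fun x hx y hy => ?_))
  by_contra h0
  exact h (avg_pos (F.continuous_norm_sq T) (fun X => by positivity) hx hy
    (by have := norm_pos_iff.2 h0; positivity))

end OrbitFrame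

end Trace

end NC3

end

/-! ### Isomorphisms from graphs; the noncommutative torus and its automorphism -/

noncomputable section

namespace NC3

section Graph

/-- Two C*-algebras with faithful traces are isomorphic if they contain dense subalgebras which
are in a trace preserving correspondence. -/
theorem exists_starAlgEquiv_of_graph {A B : Type*} [CStarAlgebra A] [CStarAlgebra B]
    (S : StarSubalgebra ℂ (A × B)) {τ : A → ℂ} {τ' : B → ℂ} (hτ : Continuous τ)
    (hτ' : Continuous τ') (h0 : τ 0 = 0) (h0' : τ' 0 = 0)
    (hf : ∀ a, τ (star a * a) = 0 → a = 0) (hf' : ∀ b, τ' (star b * b) = 0 → b = 0)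
    (heq : ∀ x ∈ S, τ x.1 = τ' x.2) (hd : Dense (Prod.fst '' (S : Set (A × B))))
    (hd' : Dense (Prod.snd '' (S : Set (A × B)))) : Nonempty (A ≃⋆ₐ[ℂ] B) := by
  have hcl : ∀ x ∈ S.topologicalClosure, τ x.1 = τ' x.2 := fun x hx =>
    closure_minimal (s := (S : Set (A × B))) (t := {x : A × B | τ x.1 = τ' x.2}) heq
      (isClosed_eq (hτ.comp continuous_fst) (hτ'.comp continuous_snd)) hx
  let p : S.topologicalClosure →⋆ₐ[ℂ] A := (StarAlgHom.fst ℂ A B).comp S.topologicalClosure.subtype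
  let q : S.topologicalClosure →⋆ₐ[ℂ] B := (StarAlgHom.snd ℂ A B).comp S.topologicalClosure.subtype
  -- A pair (0, b) in the closed graph satisfies τ'(b*b) = τ(0) = 0, so b = 0 by faithfulness. Both
  -- projections of the closed graph are thus injective, hence isometric with closed range, and the
  -- density hypotheses make them onto.
  have hp : Function.Injective p := (injective_iff_map_eq_zero p).2 fun x hx => by
    have h1 : x.1.1 = 0 := hx
    have h := hcl _ (star x * x).2
    have h2 : τ' (star x.1.2 * x.1.2) = 0 := by
      refine h.symm.trans ?_
      change τ (star x.1.1 * x.1.1) = 0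
      rw [h1, mul_zero, h0]
    exact Subtype.ext (Prod.ext h1 (hf' _ h2))
  have hq : Function.Injective q := (injective_iff_map_eq_zero q).2 fun x hx => by
    have h1 : x.1.2 = 0 := hx
    have h := hcl _ (star x * x).2
    have h2 : τ (star x.1.1 * x.1.1) = 0 := by
      refine h.trans ?_
      change τ' (star x.1.2 * x.1.2) = 0
      rw [h1, mul_zero, h0']
    exact Subtype.ext (Prod.ext (hf _ h2) h1)
  have hle : ∀ x ∈ S, x ∈ S.topologicalClosure := fun x hx =>
    S.le_topologicalClosure hx
  have : IsClosed (S.topologicalClosure : Set (A × B)) := S.isClosed_topologicalClosure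
  have hps : Function.Surjective p := by
    rw [← Set.range_eq_univ,
      ← (NonUnitalStarAlgHom.isometry p hp).isClosedEmbedding.isClosed_range.closure_eq]
    refine (hd.mono ?_).closure_eq
    rintro _ ⟨x, hx, rfl⟩
    exact ⟨⟨x, hle x hx⟩, rfl⟩
  have hqs : Function.Surjective q := by
    rw [← Set.range_eq_univ,
      ← (NonUnitalStarAlgHom.isometry q hq).isClosedEmbedding.isClosed_range.closure_eq]
    refine (hd'.mono ?_).closure_eq
    rintro _ ⟨x, hx, rfl⟩
    exact ⟨⟨x, hle x hx⟩, rfl⟩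
  exact ⟨(StarAlgEquiv.ofBijective p ⟨hp, hps⟩).symm.trans (StarAlgEquiv.ofBijective q ⟨hq, hqs⟩)⟩

lemma starAdjoin_induction {A : Type*} [Ring A] [StarRing A] [Algebra ℂ A] [StarModule ℂ A]
    {s : Set A} {p : A → Prop} (h0 : ∀ a ∈ s, p a ∧ p (star a)) (hc : ∀ c : ℂ, p (algebraMap ℂ A c))
    (hadd : ∀ a b, p a → p b → p (a + b)) (hmul : ∀ a b, p a → p b → p (a * b)) {a : A}
    (ha : a ∈ StarAlgebra.adjoin ℂ s) : p a := by
  have ha' : a ∈ (StarAlgebra.adjoin ℂ s).toSubalgebra := ha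
  rw [StarAlgebra.adjoin_toSubalgebra] at ha'
  induction ha' using Algebra.adjoin_induction with
  | mem a h =>
    rcases h with h | h
    · exact (h0 a h).1
    · rw [← star_star a]
      exact (h0 _ h).2
  | algebraMap r => exact hc r
  | add x y hx hy ihx ihy =>
    exact hadd _ _ (ihx (by rw [← StarAlgebra.adjoin_toSubalgebra] at hx; exact hx))
      (ihy (by rw [← StarAlgebra.adjoin_toSubalgebra] at hy; exact hy))
  | mul x y hx hy ihx ihy =>
    exact hmul _ _ (ihx (by rw [← StarAlgebra.adjoin_toSubalgebra] at hx; exact hx))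
      (ihy (by rw [← StarAlgebra.adjoin_toSubalgebra] at hy; exact hy))

/-- The restriction of an automorphism to an invariant subalgebra. -/
def restrictStarAlgEquiv {A : Type*} [Ring A] [StarRing A] [Algebra ℂ A] [StarModule ℂ A]
    (S : StarSubalgebra ℂ A) (f : A ≃⋆ₐ[ℂ] A) (h : ∀ x ∈ S, f x ∈ S) (h' : ∀ x ∈ S, f.symm x ∈ S) :
    S ≃⋆ₐ[ℂ] S :=
  StarAlgEquiv.ofBijective
    (((f : A →⋆ₐ[ℂ] A).comp S.subtype).codRestrict S fun x => h _ x.2)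
    ⟨fun _ _ hxy => Subtype.ext (f.injective (congrArg Subtype.val hxy)), fun y =>
      ⟨⟨f.symm y, h' _ y.2⟩, Subtype.ext (f.apply_symm_apply y.1)⟩⟩

end Graph

section Phase

open Complex

/-- The character `x ↦ e^{2πix}`. -/
def ph (x : ℝ) : ℂ := cexp ((2 * Real.pi * x : ℝ) * I)

lemma ph_add (x y : ℝ) : ph (x + y) = ph x * ph y := by
  rw [ph, ph, ph, ← Complex.exp_add]
  congr 1
  push_cast
  ring

lemma ph_zero : ph 0 = 1 := by simp [ph]

lemma norm_ph (x : ℝ) : ‖ph x‖ = 1 := norm_exp_ofReal_mul_I _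

lemma ph_ne_zero (x : ℝ) : ph x ≠ 0 := exp_ne_zero _

lemma ph_mul_ph_congr {x x' y y' : ℝ} {c c' : ℂ} (h : x + y = x' + y') (hc : c = c') :
    ph x * (ph y * c) = ph x' * (ph y' * c') := by
  rw [← mul_assoc, ← mul_assoc, ← ph_add, ← ph_add, h, hc]

lemma conj_ph (x : ℝ) : (starRingEnd ℂ) (ph x) = ph (-x) := by
  rw [ph, ph, ← exp_conj, map_mul, conj_ofReal, conj_I]
  congr 1
  push_cast
  ring

lemma ph_int (n : ℤ) : ph n = 1 := by
  rw [ph, exp_eq_one_iff]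
  exact ⟨n, by push_cast; ring⟩

lemma ph_add_int (x : ℝ) (n : ℤ) : ph (x + n) = ph x := by rw [ph_add, ph_int, mul_one]

lemma contDiff_ph {r : WithTop ℕ∞} : ContDiff ℝ r ph :=
  ((ofRealCLM.contDiff.comp (contDiff_const.mul contDiff_id)).mul contDiff_const).cexp

lemma continuous_ph : Continuous ph := (contDiff_ph (r := 0)).continuous

lemma ph_eq_one_iff {x : ℝ} : ph x = 1 ↔ ∃ n : ℤ, x = n := by
  rw [ph, exp_eq_one_iff]
  refine exists_congr fun n => ?_
  rw [show ((2 * Real.pi * x : ℝ) : ℂ) * I = (x : ℂ) * (2 * Real.pi * I) by push_cast; ring,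
    mul_left_inj' two_pi_I_ne_zero]
  exact_mod_cast Iff.rfl

lemma ph_eq_ph_iff {x y : ℝ} : ph x = ph y ↔ ∃ n : ℤ, x = y + n := by
  have : ph (x - y) * ph y = ph x := by rw [← ph_add, sub_add_cancel]
  rw [← this, mul_eq_right₀ (ph_ne_zero y), ph_eq_one_iff]
  exact exists_congr fun n => sub_eq_iff_eq_add'

lemma integral_ph_int (j : ℤ) : ∫ x in (0 : ℝ)..1, ph (j * x) = if j = 0 then 1 else 0 := by
  split_ifs with h
  · simp [h, ph_zero]
  · have h0 : (2 * Real.pi * j * I : ℂ) ≠ 0 := by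
      simp [h, Real.pi_ne_zero]
    have := integral_exp_mul_complex (a := 0) (b := 1) h0
    have e : ∀ x : ℝ, ph (j * x) = cexp (2 * Real.pi * j * I * x) := fun x => by
      rw [ph]
      congr 1
      push_cast
      ring
    simp only [e, this]
    have h1 := ph_int j
    rw [show (j : ℝ) = j * 1 by ring, e] at h1
    rw [h1]
    simp

end Phase

section Torus

open Complex

variable (η : ℝ)

/-- The monomial `U₁ʲ U₂ⁿ`. -/
def mon (j n : ℤ) : L2 (ℤ × ℤ) →L[ℂ] L2 (ℤ × ℤ) :=
  weightedShift (Equiv.prodCongr (Equiv.addRight j) (Equiv.addRight n))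
    (fun i => ph (η * n * (i.1 + j))) 1 (fun _ => (norm_ph _).le)

lemma mon_apply (j n : ℤ) (v : L2 (ℤ × ℤ)) (a b : ℤ) :
    mon η j n v (a, b) = ph (η * n * (a + j)) * v (a + j, b + n) := rfl

lemma mon_mul (j n j' n' : ℤ) :
    mon η j n * mon η j' n' = ph (-(η * n * j')) • mon η (j + j') (n + n') := by
  ext v ⟨a, b⟩
  change ph _ * (ph (η * n' * ((a + j : ℤ) + j')) * v (a + j + j', b + n + n')) =
    ph _ * (ph (η * (n + n' : ℤ) * (a + (j + j' : ℤ))) * v (a + (j + j'), b + (n + n')))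
  rw [add_assoc a, add_assoc b]
  refine ph_mul_ph_congr ?_ rfl
  push_cast
  ring

lemma mon_zero : mon η 0 0 = 1 := by
  ext v ⟨a, b⟩
  rw [mon_apply]
  simp [ph_zero]

lemma u₁_eq : u₁ = mon η 1 0 := by
  ext v ⟨a, b⟩
  rw [mon_apply]
  change 1 * v (a + 1, b) = _
  simp [ph_zero]

lemma u₂_eq : u₂ η = mon η 0 1 := by
  ext v ⟨a, b⟩
  rw [mon_apply]
  change cexp ((2 * Real.pi * η * a : ℝ) * I) * v (a, b + 1) = _
  simp [ph, mul_assoc]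

lemma star_mon (j n : ℤ) : star (mon η j n) = ph (-(η * n * j)) • mon η (-j) (-n) := by
  ext v ⟨a, b⟩
  rw [mon, star_weightedShift_apply]
  change (starRingEnd ℂ) (ph (η * n * ((a - j : ℤ) + j))) * v (a - j, b - n) =
    ph _ * (ph (η * (-n : ℤ) * (a + (-j : ℤ))) * v (a + -j, b + -n))
  rw [conj_ph, ← mul_assoc, ← ph_add]
  congr 2
  push_cast
  ring

lemma u₁_mem : u₁ ∈ ncTorus η := (U₁ η).2

lemma u₂_mem : u₂ η ∈ ncTorus η := (U₂ η).2

lemma mon_fst_mem (j : ℤ) : mon η j 0 ∈ ncTorus η := by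
  induction j using Int.induction_on with
  | zero => rw [mon_zero]; exact one_mem _
  | succ j ih =>
    have h := mul_mem ih (u₁_mem η)
    rw [u₁_eq η, mon_mul] at h
    simpa [ph_zero] using h
  | pred j ih =>
    have h := mul_mem ih (star_mem (u₁_mem η))
    rw [u₁_eq η, star_mon, mul_smul_comm, mon_mul] at h
    simpa [ph_zero, sub_eq_add_neg] using h

lemma mon_snd_mem (n : ℤ) : mon η 0 n ∈ ncTorus η := by
  induction n using Int.induction_on with
  | zero => rw [mon_zero]; exact one_mem _
  | succ j ih =>
    have h := mul_mem ih (u₂_mem η)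
    rw [u₂_eq η, mon_mul] at h
    simpa [ph_zero] using h
  | pred j ih =>
    have h := mul_mem ih (star_mem (u₂_mem η))
    rw [u₂_eq η, star_mon, mul_smul_comm, mon_mul] at h
    simpa [ph_zero, sub_eq_add_neg] using h

lemma mon_mem (j n : ℤ) : mon η j n ∈ ncTorus η := by
  have h := mul_mem (mon_fst_mem η j) (mon_snd_mem η n)
  rw [mon_mul] at h
  simpa [ph_zero] using h

/-- Operators commuting with the noncommutative torus. -/
def comm (p q : ℤ) : L2 (ℤ × ℤ) →L[ℂ] L2 (ℤ × ℤ) :=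
  weightedShift (Equiv.prodCongr (Equiv.addRight p) (Equiv.addRight q))
    (fun i => ph (η * p * i.2)) 1 (fun _ => (norm_ph _).le)

lemma comm_apply (p q : ℤ) (v : L2 (ℤ × ℤ)) (a b : ℤ) :
    comm η p q v (a, b) = ph (η * p * b) * v (a + p, b + q) := rfl

lemma mon_mul_comm (j n p q : ℤ) :
    mon η j n * comm η p q = comm η p q * mon η j n := by
  ext v ⟨a, b⟩
  change ph _ * (ph (η * p * (b + n : ℤ)) * v (a + j + p, b + n + q)) =
    ph _ * (ph (η * n * ((a + p : ℤ) + j)) * v (a + p + j, b + q + n))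
  rw [add_right_comm a j, add_right_comm b n]
  refine ph_mul_ph_congr ?_ rfl
  push_cast
  ring

lemma mul_comm_of_mem {x} (hx : x ∈ ncTorus η) (p q : ℤ) : x * comm η p q = comm η p q * x := by
  have h1 : ∀ x ∈ StarAlgebra.adjoin ℂ {u₁, u₂ η}, x * comm η p q = comm η p q * x := by
    intro x hx
    refine starAdjoin_induction (p := fun x => x * comm η p q = comm η p q * x) ?_ ?_ ?_ ?_ hx
    · rintro a (rfl | rfl)
      · rw [u₁_eq η, star_mon, smul_mul_assoc, mul_smul_comm, mon_mul_comm, mon_mul_comm]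
        exact ⟨rfl, rfl⟩
      · rw [u₂_eq η, star_mon, smul_mul_assoc, mul_smul_comm, mon_mul_comm, mon_mul_comm]
        exact ⟨rfl, rfl⟩
    · exact fun c => Algebra.commutes c _
    · intro a b ha hb
      rw [add_mul, mul_add, ha, hb]
    · intro a b ha hb
      rw [mul_assoc, hb, ← mul_assoc, ha, mul_assoc]
  exact closure_minimal (t := {x | x * comm η p q = comm η p q * x}) h1
    (isClosed_eq (continuous_id.mul continuous_const) (continuous_const.mul continuous_id)) hx

lemma comm_bv (p q : ℤ) : comm η p q (bv (0, 0)) = ph (-(η * p * q)) • bv (-p, -q) := by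
  ext ⟨a, b⟩
  change comm η p q (bv (0, 0)) (a, b) = ph _ * bv (-p, -q) (a, b)
  rw [comm_apply, bv_apply, bv_apply]
  by_cases h : a + p = 0 ∧ b + q = 0
  · obtain ⟨rfl, rfl⟩ : a = -p ∧ b = -q := ⟨by linarith [h.1], by linarith [h.2]⟩
    simp
  · rw [if_neg (by simpa using h), if_neg]
    · simp
    · rw [Prod.mk.injEq]
      exact fun h' => h ⟨by linarith [h'.1], by linarith [h'.2]⟩

/-- The vacuum vector separates the noncommutative torus. -/
lemma eq_zero_of_mem_ncTorus {x} (hx : x ∈ ncTorus η) (h : x (bv (0, 0)) = 0) : x = 0 := by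
  refine eq_zero_of_bv fun ⟨p, q⟩ => ?_
  -- The operators `comm` carry the vacuum to every basis vector up to a phase and commute with x,
  -- so the vanishing on the vacuum spreads to all basis vectors.
  have h1 := DFunLike.congr_fun (mul_comm_of_mem η hx (-p) (-q)) (bv (0, 0))
  change x (comm η (-p) (-q) (bv (0, 0))) = comm η (-p) (-q) (x (bv (0, 0))) at h1
  rw [h, map_zero, comm_bv, map_smul, neg_neg, neg_neg] at h1
  exact (smul_eq_zero.1 h1).resolve_left (ph_ne_zero _)

lemma mon_bv (j n : ℤ) : mon η j n (bv (0, 0)) (0, 0) = if j = 0 ∧ n = 0 then 1 else 0 := by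
  rw [mon_apply, bv_apply]
  by_cases h : j = 0 ∧ n = 0
  · simp [h.1, h.2, ph_zero]
  · have : ¬ (((0 : ℤ) + j, (0 : ℤ) + n) = (0, 0)) := by simpa using h
    rw [if_neg this, if_neg h, mul_zero]

/-- The shear implementing the automorphism `U₁ ↦ U₁`, `U₂ ↦ U₁⁴ U₂`. -/
def shear : L2 (ℤ × ℤ) →L[ℂ] L2 (ℤ × ℤ) :=
  weightedShift
    { toFun := fun i => (i.1 - 4 * i.2, i.2)
      invFun := fun i => (i.1 + 4 * i.2, i.2)
      left_inv := fun i => by simp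
      right_inv := fun i => by simp }
    (fun i => ph (-(η * (2 * i.2 * (i.2 + 1))))) 1 (fun _ => (norm_ph _).le)

lemma shear_apply (v : L2 (ℤ × ℤ)) (a b : ℤ) :
    shear η v (a, b) = ph (-(η * (2 * b * (b + 1)))) * v (a - 4 * b, b) := rfl

lemma star_shear_apply (v : L2 (ℤ × ℤ)) (a b : ℤ) :
    (star (shear η)) v (a, b) = ph (η * (2 * b * (b + 1))) * v (a + 4 * b, b) := by
  rw [shear, star_weightedShift_apply]
  change (starRingEnd ℂ) (ph _) * _ = _
  rw [conj_ph, neg_neg]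
  rfl

lemma shear_mem_unitary : shear η ∈ unitary (L2 (ℤ × ℤ) →L[ℂ] L2 (ℤ × ℤ)) := by
  constructor
  · ext v ⟨a, b⟩
    change (star (shear η)) (shear η v) (a, b) = v (a, b)
    rw [star_shear_apply, shear_apply, ← mul_assoc, ← ph_add, add_neg_cancel, ph_zero, one_mul,
      add_sub_cancel_right]
  · ext v ⟨a, b⟩
    change (shear η) (star (shear η) v) (a, b) = v (a, b)
    rw [shear_apply, star_shear_apply, ← mul_assoc, ← ph_add, neg_add_cancel, ph_zero, one_mul,
      sub_add_cancel]

lemma shear_mul_mon_zero (j : ℤ) : shear η * mon η j 0 = mon η j 0 * shear η := by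
  ext v ⟨a, b⟩
  change ph _ * (ph (η * (0 : ℤ) * ((a - 4 * b : ℤ) + j)) * v (a - 4 * b + j, b + 0)) =
    ph (η * (0 : ℤ) * (a + j)) * (ph (-(η * (2 * (b + 0 : ℤ) * ((b + 0 : ℤ) + 1)))) *
      v (a + j - 4 * (b + 0), b + 0))
  rw [add_zero, sub_add_eq_add_sub]
  simp [ph_zero]

/-- The increment 4(b + 1) of the phase 2b(b + 1) compensates the phase of U₂ under the displacement
of the first coordinate by 4b + 4. So U₂ is sent to U₁⁴U₂ without a scalar factor. -/
lemma shear_mul_mon_one (j : ℤ) : shear η * mon η j 1 = mon η (j + 4) 1 * shear η := by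
  ext v ⟨a, b⟩
  change ph _ * (ph (η * (1 : ℤ) * ((a - 4 * b : ℤ) + j)) * v (a - 4 * b + j, b + 1)) =
    ph (η * (1 : ℤ) * (a + (j + 4 : ℤ))) * (ph (-(η * (2 * (b + 1 : ℤ) * ((b + 1 : ℤ) + 1)))) *
      v (a + (j + 4) - 4 * (b + 1), b + 1))
  rw [show a + (j + 4) - 4 * (b + 1) = a - 4 * b + j by ring]
  refine ph_mul_ph_congr ?_ rfl
  push_cast
  ring

/-- The inner automorphism given by the shear. -/
def shearAut : (L2 (ℤ × ℤ) →L[ℂ] L2 (ℤ × ℤ)) ≃⋆ₐ[ℂ] (L2 (ℤ × ℤ) →L[ℂ] L2 (ℤ × ℤ)) :=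
  Unitary.conjStarAlgAut ℂ _ ⟨shear η, shear_mem_unitary η⟩

lemma shearAut_of_comm {x y : L2 (ℤ × ℤ) →L[ℂ] L2 (ℤ × ℤ)} (h : shear η * x = y * shear η) :
    shearAut η x = y := by
  change shear η * x * star (shear η) = y
  rw [h, mul_assoc, (shear_mem_unitary η).2, mul_one]

lemma shearAut_mon_zero (j : ℤ) : shearAut η (mon η j 0) = mon η j 0 :=
  shearAut_of_comm η (shear_mul_mon_zero η j)

lemma shearAut_mon_one (j : ℤ) : shearAut η (mon η j 1) = mon η (j + 4) 1 :=
  shearAut_of_comm η (shear_mul_mon_one η j)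

lemma map_mem_ncTorus {f : (L2 (ℤ × ℤ) →L[ℂ] L2 (ℤ × ℤ)) ≃⋆ₐ[ℂ] (L2 (ℤ × ℤ) →L[ℂ] L2 (ℤ × ℤ))}
    (h1 : f u₁ ∈ ncTorus η) (h2 : f (u₂ η) ∈ ncTorus η) {x} (hx : x ∈ ncTorus η) :
    f x ∈ ncTorus η := by
  have hc : Continuous f := (NonUnitalStarAlgHom.isometry f f.injective).continuous
  have h : StarAlgebra.adjoin ℂ {u₁, u₂ η} ≤ (ncTorus η).comap (f : _ →⋆ₐ[ℂ] _) := by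
    rw [StarAlgebra.adjoin_le_iff]
    rintro a (rfl | rfl)
    · exact h1
    · exact h2
  have hcl : IsClosed (f ⁻¹' (ncTorus η : Set (L2 (ℤ × ℤ) →L[ℂ] L2 (ℤ × ℤ)))) :=
    isClosed_closure.preimage hc
  exact closure_minimal (t := f ⁻¹' (ncTorus η : Set (L2 (ℤ × ℤ) →L[ℂ] L2 (ℤ × ℤ))))
    (fun y hy => h hy) hcl hx

lemma shearAut_mem {x} (hx : x ∈ ncTorus η) : shearAut η x ∈ ncTorus η := by
  refine map_mem_ncTorus η ?_ ?_ hx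
  · rw [u₁_eq η, shearAut_mon_zero]
    exact mon_mem η _ _
  · rw [u₂_eq η, shearAut_mon_one]
    exact mon_mem η _ _

lemma shearAut_symm_mem {x} (hx : x ∈ ncTorus η) : (shearAut η).symm x ∈ ncTorus η := by
  refine map_mem_ncTorus η ?_ ?_ hx
  · rw [u₁_eq η, ← shearAut_mon_zero, StarAlgEquiv.symm_apply_apply]
    exact mon_mem η _ _
  · have := shearAut_mon_one η (-4)
    rw [neg_add_cancel] at this
    rw [u₂_eq η, ← this, StarAlgEquiv.symm_apply_apply]
    exact mon_mem η _ _

/-- The automorphism of the noncommutative torus defined by the matrix with rows `(1, 4)`,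
`(0, 1)`. -/
def beta : ncTorus η ≃⋆ₐ[ℂ] ncTorus η :=
  restrictStarAlgEquiv (ncTorus η) (shearAut η) (fun _ => shearAut_mem η)
    (fun _ => shearAut_symm_mem η)

lemma beta_U₁ : beta η (U₁ η) = U₁ η := by
  refine Subtype.ext ?_
  change shearAut η u₁ = u₁
  rw [u₁_eq η, shearAut_mon_zero]

lemma beta_U₂ : beta η (U₂ η) = U₁ η ^ 4 * U₂ η := by
  refine Subtype.ext ?_
  change shearAut η (u₂ η) = u₁ ^ 4 * u₂ η
  rw [u₂_eq η, shearAut_mon_one, u₁_eq η]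
  simp only [pow_succ, pow_zero, one_mul, mon_mul]
  simp [ph_zero, mon_mul]

end Torus

end NC3

end

/-! ### Fibrewise comparison with noncommutative Laurent polynomials -/

noncomputable section

namespace NC3

section FourierGraph

open Complex BoundedContinuousFunction

/-- The operator `f(x, k) ↦ e^{2πij(x - kη)} f(x, k + n)`. -/
def opM (η : ℝ) (j n : ℤ) : Module.End ℂ (ℝ × ℤ → ℂ) where
  toFun f p := ph (j * (p.1 - p.2 * η)) * f (p.1, p.2 + n)
  map_add' _ _ := funext fun _ => mul_add _ _ _
  map_smul' _ _ := funext fun _ => mul_left_comm _ _ _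

lemma opM_apply (η : ℝ) (j n : ℤ) (f : ℝ × ℤ → ℂ) (x : ℝ) (k : ℤ) :
    opM η j n f (x, k) = ph (j * (x - k * η)) * f (x, k + n) := rfl

lemma opM_mul (η : ℝ) (j n j' n' : ℤ) :
    opM η j n * opM η j' n' = ph (-(η * n * j')) • opM η (j + j') (n + n') := by
  refine LinearMap.ext fun f => funext fun ⟨x, k⟩ => ?_
  change ph _ * (ph (j' * (x - (k + n : ℤ) * η)) * f (x, k + n + n')) =
    ph _ * (ph ((j + j' : ℤ) * (x - k * η)) * f (x, k + (n + n')))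
  rw [add_assoc k]
  refine ph_mul_ph_congr ?_ rfl
  push_cast
  ring

lemma opM_zero (η : ℝ) : opM η 0 0 = 1 := by
  refine LinearMap.ext fun f => funext fun ⟨x, k⟩ => ?_
  rw [opM_apply]
  simp [ph_zero]

/-- The graph of the correspondence between two representations of the algebra of
noncommutative Laurent polynomials. -/
def fourierGraph (η : ℝ) :
    Submodule ℂ ((L2 (ℤ × ℤ) →L[ℂ] L2 (ℤ × ℤ)) × Module.End ℂ (ℝ × ℤ → ℂ)) :=
  Submodule.span ℂ (Set.range fun p : ℤ × ℤ => (mon η p.1 p.2, opM η p.1 p.2))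

variable {η : ℝ}

lemma mem_fourierGraph (j n : ℤ) : (mon η j n, opM η j n) ∈ fourierGraph η :=
  Submodule.subset_span ⟨(j, n), rfl⟩

lemma one_mem_fourierGraph : (1, 1) ∈ fourierGraph η := by
  have := mem_fourierGraph (η := η) 0 0
  rwa [mon_zero, opM_zero] at this

lemma mul_mem_fourierGraph {x y} (hx : x ∈ fourierGraph η) (hy : y ∈ fourierGraph η) :
    x * y ∈ fourierGraph η := by
  have h := Submodule.mul_mem_mul hx hy
  rw [fourierGraph, Submodule.span_mul_span] at h
  refine Submodule.span_le.2 ?_ h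
  rintro _ ⟨_, ⟨⟨j, n⟩, rfl⟩, _, ⟨⟨j', n'⟩, rfl⟩, rfl⟩
  change (mon η j n * mon η j' n', opM η j n * opM η j' n') ∈ fourierGraph η
  rw [mon_mul, opM_mul]
  exact Submodule.smul_mem _ _ (mem_fourierGraph (j + j') (n + n'))

/-- Both sides are linear. On the monomial of degrees (j, n), evaluation of f x leaves n = 0 and the
integral of exp(2πijx) leaves j = 0, which is also the vacuum expectation of U₁ʲU₂ⁿ. -/
lemma fourierGraph_trace {f : ℝ → ℝ × ℤ → ℂ} (hf : ∀ x n, f x (x, n) = if n = 0 then 1 else 0)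
    {z} (hz : z ∈ fourierGraph η) : (Continuous fun x => z.2 (f x) (x, 0)) ∧
      ∫ x in (0 : ℝ)..1, z.2 (f x) (x, 0) = z.1 (bv (0, 0)) (0, 0) := by
  induction hz using Submodule.span_induction with
  | mem z h =>
    obtain ⟨⟨j, n⟩, rfl⟩ := h
    have e : ∀ x, opM η j n (f x) (x, 0) = ph (j * x) * if n = 0 then 1 else 0 := fun x => by
      rw [opM_apply, zero_add, hf]
      simp
    simp only [e, mon_bv]
    refine ⟨(continuous_ph.comp (continuous_const.mul continuous_id)).mul continuous_const, ?_⟩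
    rw [intervalIntegral.integral_mul_const, integral_ph_int]
    by_cases hj : j = 0 <;> by_cases hn : n = 0 <;> simp [hj, hn]
  | zero => exact ⟨continuous_const, by simp⟩
  | add z w _ _ hz hw =>
    refine ⟨hz.1.add hw.1, ?_⟩
    change ∫ x in (0 : ℝ)..1, (z.2 (f x) (x, 0) + w.2 (f x) (x, 0)) =
      z.1 (bv (0, 0)) (0, 0) + w.1 (bv (0, 0)) (0, 0)
    rw [intervalIntegral.integral_add (hz.1.intervalIntegrable _ _) (hw.1.intervalIntegrable _ _),
      hz.2, hw.2]
  | smul c z _ hz =>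
    refine ⟨continuous_const.mul hz.1, ?_⟩
    change ∫ x in (0 : ℝ)..1, c * z.2 (f x) (x, 0) = c * z.1 (bv (0, 0)) (0, 0)
    rw [intervalIntegral.integral_const_mul, hz.2]

end FourierGraph

namespace OrbitFrame

open Complex BoundedContinuousFunction

variable {P : Type} [TopologicalSpace P] {step : P → P → Prop} {A₀ A₁ : Set (P →ᵇ ℂ)} {η : ℝ}
  (F : OrbitFrame step A₀ A₁ η)

/-- On the orbits with second parameter `y`, the operator `T` is given by the same noncommutative
Laurent polynomial as `b`. -/
def MatchAt (y : ℝ) (T : L2 (Chain step × ℤ) →L[ℂ] L2 (Chain step × ℤ))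
    (b : L2 (ℤ × ℤ) →L[ℂ] L2 (ℤ × ℤ)) : Prop :=
  ∃ L, (b, L) ∈ fourierGraph η ∧ ∀ (v : L2 (Chain step × ℤ)) (x : ℝ) (k : ℤ),
    T v (F.chain (x, y), k) = L (fun p => v (F.chain (p.1, y), p.2)) (x, k)

variable {F} {y : ℝ} {T T' : L2 (Chain step × ℤ) →L[ℂ] L2 (Chain step × ℤ)}
  {b b' : L2 (ℤ × ℤ) →L[ℂ] L2 (ℤ × ℤ)}

/-- Matching is a relation and not a map, so sums and products of matched pairs are matched without
any question of well-definedness. -/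
lemma MatchAt.add (h : F.MatchAt y T b) (h' : F.MatchAt y T' b') :
    F.MatchAt y (T + T') (b + b') := by
  obtain ⟨L, h1, h2⟩ := h
  obtain ⟨L', h1', h2'⟩ := h'
  refine ⟨L + L', Submodule.add_mem _ h1 h1', fun v x k => ?_⟩
  change T v _ + T' v _ = L _ _ + L' _ _
  rw [h2, h2']

lemma MatchAt.mul (h : F.MatchAt y T b) (h' : F.MatchAt y T' b') :
    F.MatchAt y (T * T') (b * b') := by
  obtain ⟨L, h1, h2⟩ := h
  obtain ⟨L', h1', h2'⟩ := h'
  refine ⟨L * L', mul_mem_fourierGraph h1 h1', fun v x k => ?_⟩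
  refine (h2 (T' v) x k).trans ?_
  simp only [h2']
  rfl

variable (F) in
lemma matchAt_algebraMap (y : ℝ) (c : ℂ) :
    F.MatchAt y (algebraMap ℂ _ c) (algebraMap ℂ _ c) := by
  refine ⟨algebraMap ℂ _ c, ?_, fun v x k => rfl⟩
  rw [Algebra.algebraMap_eq_smul_one, Algebra.algebraMap_eq_smul_one]
  exact Submodule.smul_mem _ c one_mem_fourierGraph

lemma matchAt_mulOp {a : P →ᵇ ℂ} {c : ℂ} {j : ℤ} (h : ∀ x, a (F.e (x, y)) = c * ph (j * x)) :
    F.MatchAt y (mulOp step a) (c • mon η j 0) ∧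
      F.MatchAt y (star (mulOp step a)) (star (c • mon η j 0)) := by
  constructor
  · refine ⟨c • opM η j 0, Submodule.smul_mem _ c (mem_fourierGraph j 0), fun v x k => ?_⟩
    change _ = c * (ph (j * (x - k * η)) * v (F.chain (x, y), k + 0))
    rw [mulOp_apply, chain_apply, h, mul_assoc, add_zero]
  · rw [star_smul, star_mon]
    refine ⟨(starRingEnd ℂ) c • (ph (-(η * (0 : ℤ) * j)) • opM η (-j) (-0)), Submodule.smul_mem _ _
      (Submodule.smul_mem _ _ (mem_fourierGraph (-j) (-0))), fun v x k => ?_⟩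
    change _ = (starRingEnd ℂ) c * (ph (-(η * (0 : ℤ) * j)) * (ph ((-j : ℤ) * (x - k * η)) *
      v (F.chain (x, y), k + -0)))
    rw [star_mulOp_apply, chain_apply, h, map_mul, conj_ph, neg_zero, add_zero, mul_assoc]
    simp [ph_zero]

lemma matchAt_shiftOp {ξ : P →ᵇ ℂ} {c : ℂ} {j : ℤ} (h : ∀ x, ξ (F.e (x, y)) = c * ph (j * x)) :
    F.MatchAt y (shiftOp step ξ) (c • mon η j 1) ∧
      F.MatchAt y (star (shiftOp step ξ)) (star (c • mon η j 1)) := by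
  constructor
  · refine ⟨c • opM η j 1, Submodule.smul_mem _ c (mem_fourierGraph j 1), fun v x k => ?_⟩
    change _ = c * (ph (j * (x - k * η)) * v (F.chain (x, y), k + 1))
    rw [shiftOp_apply, chain_apply, h, mul_assoc]
  · rw [star_smul, star_mon]
    refine ⟨(starRingEnd ℂ) c • (ph (-(η * (1 : ℤ) * j)) • opM η (-j) (-1)), Submodule.smul_mem _ _
      (Submodule.smul_mem _ _ (mem_fourierGraph (-j) (-1))), fun v x k => ?_⟩
    change _ = (starRingEnd ℂ) c * (ph (-(η * (1 : ℤ) * j)) * (ph ((-j : ℤ) * (x - k * η)) *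
      v (F.chain (x, y), k + -1)))
    rw [star_shiftOp_apply, chain_apply, h, map_mul, conj_ph, mul_assoc, ← mul_assoc (ph _) (ph _),
      ← ph_add, ← sub_eq_add_neg]
    congr 3
    push_cast
    ring

lemma MatchAt.integral_coef (h : F.MatchAt y T b) :
    ∫ x in (0 : ℝ)..1, F.coef T 0 (x, y) = b (bv (0, 0)) (0, 0) := by
  obtain ⟨L, h1, h2⟩ := h
  have := (fourierGraph_trace (f := fun x p => bv (F.chain (x, y), (0 : ℤ)) (F.chain (p.1, y), p.2))
    (fun x n => by simp [bv_apply]) h1).2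
  rw [← this]
  exact intervalIntegral.integral_congr fun x _ => h2 _ _ _

end OrbitFrame

end NC3

end

/-! ### Functions on the unit vectors, and the orbit frames of the curve and of the circle -/

noncomputable section

namespace NC3

open Complex Topology BoundedContinuousFunction

/-- Solutions of a first order recursion on the integers. -/
lemma exists_int_recursion (c : ℤ → ℂ) (hc : ∀ k, ‖c k‖ = 1) :
    ∃ γ : ℤ → ℂ, (∀ k, ‖γ k‖ = 1) ∧ ∀ k, γ (k + 1) * c k = γ k := by
  have h0 : ∀ k, c k ≠ 0 := fun k h => by
    have := hc k
    rw [h, norm_zero] at this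
    exact zero_ne_one this
  refine ⟨fun k => match k with
    | Int.ofNat n => ∏ i ∈ Finset.range n, (c i)⁻¹
    | Int.negSucc n => ∏ i ∈ Finset.range (n + 1), c (-(i + 1)), fun k => ?_, fun k => ?_⟩
  · rcases k with n | n <;> simp [hc]
  · rcases k with n | n
    · change (∏ i ∈ Finset.range (n + 1), (c i)⁻¹) * c n = ∏ i ∈ Finset.range n, (c i)⁻¹
      rw [Finset.prod_range_succ, mul_assoc, inv_mul_cancel₀ (h0 _), mul_one]
    · rcases n with _ | n
      · change (∏ i ∈ Finset.range 0, (c i)⁻¹) * c (-1) = ∏ i ∈ Finset.range (0 + 1), c (-(i + 1))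
        simp
      · change (∏ i ∈ Finset.range (n + 1), c (-(i + 1))) * c (Int.negSucc (n + 1)) =
          ∏ i ∈ Finset.range (n + 1 + 1), c (-(i + 1))
        rw [Finset.prod_range_succ _ (n + 1)]
        congr 2

variable {φ : Fin 3 → ℝ}

/-- The action of phases on unit vectors. -/
def Sph.phase (c : Circle) (p : Sph φ) : Sph φ :=
  ⟨(c : ℂ) • p.1, p.2.1.smul c, by rw [hermSq_smul, p.2.2, Circle.norm_coe]; norm_num⟩

namespace ThetaData

variable (D : ThetaData (absS φ)) (h : IsGeneric φ) (he : IsEven φ)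

lemma continuous_frame : Continuous (D.frame h he) :=
  Continuous.subtype_mk (D.contDiff_frame h he).continuous _

lemma frame_add_int (x y : ℝ) (m : ℤ) : D.frame h he (x + m, y) = D.frame h he (x, y) := by
  induction m using Int.induction_on with
  | zero => simp
  | succ m ih =>
    rw [← ih, ← D.frame_add_one h he (x + (m : ℤ))]
    push_cast
    rw [add_assoc]
  | pred m ih =>
    rw [← ih, ← D.frame_add_one h he (x + ((-(m : ℤ) - 1 : ℤ) : ℝ))]
    push_cast
    congr 2
    ring

lemma frame_succ_snd (x y : ℝ) : (D.frame h he (x, y + 1)).1 =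
    ph (4 * x) • (D.frame h he (x, y)).1 := by
  rw [frame_add_one_snd]
  congr 1
  rw [ph]
  congr 1
  push_cast
  ring

lemma quasi_add_int {F : ℝ × ℝ → ℂ} {a : ℝ} {x : ℝ} (hF : ∀ y, F (x, y + 1) = ph a * F (x, y))
    (y : ℝ) (n : ℤ) : F (x, y + n) = ph (n * a) * F (x, y) := by
  induction n using Int.induction_on with
  | zero => simp [ph_zero]
  | succ n ih =>
    push_cast at ih ⊢
    rw [← add_assoc, hF, ih, ← mul_assoc, ← ph_add]
    congr 2
    ring
  | pred n ih =>
    have h1 := hF (y + ((-(n : ℤ) - 1 : ℤ) : ℝ))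
    rw [show y + ((-(n : ℤ) - 1 : ℤ) : ℝ) + 1 = y + ((-(n : ℤ) : ℤ) : ℝ) by push_cast; ring, ih]
      at h1
    refine mul_left_cancel₀ (ph_ne_zero a) (h1.symm.trans ?_)
    rw [← mul_assoc, ← ph_add]
    congr 2
    push_cast
    ring

lemma frame_add_int_snd (x y : ℝ) (n : ℤ) : (D.frame h he (x, y + n)).1 =
    ph (n * (4 * x)) • (D.frame h he (x, y)).1 :=
  funext fun i => quasi_add_int (F := fun X => (D.frame h he X).1 i)
    (fun y => congrFun (D.frame_succ_snd h he x y) i) y n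

lemma exists_frame_Icc (p : Sph φ) : ∃ x ∈ Set.Icc (0 : ℝ) 1, ∃ y ∈ Set.Icc (0 : ℝ) 1, ∃ c : ℂ,
    p.1 = c • (D.frame h he (x, y)).1 := by
  obtain ⟨⟨x, y⟩, c, hc⟩ := D.exists_frame h he p
  refine ⟨Int.fract x, ⟨Int.fract_nonneg x, (Int.fract_lt_one x).le⟩, Int.fract y,
    ⟨Int.fract_nonneg y, (Int.fract_lt_one y).le⟩, c * ph (⌊y⌋ * (4 * Int.fract x)), ?_⟩
  have h1 := D.frame_add_int_snd h he (Int.fract x) (Int.fract y) ⌊y⌋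
  have h2 := D.frame_add_int h he (Int.fract x) y ⌊x⌋
  rw [Int.fract_add_floor] at h1 h2
  rw [hc, mul_smul, ← h1, h2]

/-- A continuous surjection from a compact space onto a Hausdorff one. It reduces continuity of
functions of unit vectors to continuity in the frame parameters and a phase. -/
lemma isQuotientMap_frame : IsQuotientMap fun t : Set.Icc (0 : ℝ) 1 × Set.Icc (0 : ℝ) 1 × Circle =>
    Sph.phase t.2.2 (D.frame h he (t.1, t.2.1)) := by
  have hc : Continuous fun t : Set.Icc (0 : ℝ) 1 × Set.Icc (0 : ℝ) 1 × Circle =>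
      Sph.phase t.2.2 (D.frame h he (t.1, t.2.1)) := by
    refine Continuous.subtype_mk ?_ _
    have h1 : Continuous fun t : Set.Icc (0 : ℝ) 1 × Set.Icc (0 : ℝ) 1 × Circle => (t.2.2 : ℂ) := by
      fun_prop
    refine h1.smul ?_
    exact continuous_subtype_val.comp ((D.continuous_frame h he).comp (by fun_prop))
  have : T2Space (Sph φ) := inferInstanceAs (T2Space {z : Fin 4 → ℂ // _})
  refine hc.isClosedMap.isQuotientMap hc fun p => ?_
  obtain ⟨x, hx, y, hy, c, hp⟩ := D.exists_frame_Icc h he p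
  exact ⟨(⟨x, hx⟩, ⟨y, hy⟩, ⟨c, mem_sphere_zero_iff_norm.2 (Sph.norm_smul_eq hp)⟩),
    Subtype.ext hp.symm⟩

/-- Quasi-periodic functions on the plane are functions on the unit vectors. -/
lemma exists_lift (d : ℕ) {F : ℝ × ℝ → ℂ} (hF : Continuous F)
    (h1 : ∀ x y, F (x + 1, y) = F (x, y)) (h2 : ∀ x y, F (x, y + 1) = ph (4 * x) ^ d * F (x, y)) :
    ∃ a : Sph φ →ᵇ ℂ, (∀ (p q : Sph φ) (c : ℂ), p.1 = c • q.1 → a p = c ^ d * a q) ∧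
      ∀ X, a (D.frame h he X) = F X := by
  have hph : ∀ (t : ℝ), ph t ^ d = ph (d * t) := fun t => by
    rw [ph, ph, ← Complex.exp_nat_mul]
    congr 1
    push_cast
    ring
  have hF1 : ∀ (x y : ℝ) (m : ℤ), F (x + m, y) = F (x, y) := fun x y m => by
    have hp : Function.Periodic (fun x => F (x, y)) 1 := fun x => h1 x y
    simpa using hp.int_mul m x
  have hF2 : ∀ (x y : ℝ) (n : ℤ), F (x, y + n) = ph (n * (4 * x)) ^ d * F (x, y) := fun x y n => by
    have := quasi_add_int (F := F) (a := d * (4 * x)) (x := x)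
      (fun y => by rw [h2, hph]) y n
    rw [this, hph]
    congr 2
    ring
  choose X c hc using D.exists_frame h he
  -- Two frame descriptions of a unit vector differ by integers m, n and the phase that the frame
  -- acquires over n vertical periods. The quasi-periodicity of F compensates the d-th power of this
  -- phase, so the value does not depend on the description.
  have key : ∀ (p : Sph φ) (Y : ℝ × ℝ) (b : ℂ), p.1 = b • (D.frame h he Y).1 →
      c p ^ d * F (X p) = b ^ d * F Y := by
    intro p Y b hb
    have hb0 : b ≠ 0 := fun h0 => p.ne_zero (by rw [hb, h0, zero_smul])
    have hc0 : c p ≠ 0 := fun h0 => p.ne_zero (by rw [hc, h0, zero_smul])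
    have e : (D.frame h he (X p)).1 = ((c p)⁻¹ * b) • (D.frame h he Y).1 := by
      rw [mul_smul, ← hb, hc p, smul_smul, inv_mul_cancel₀ hc0, one_smul]
    obtain ⟨m, n, hmn⟩ := D.frame_inj h he e
    have e2 : (D.frame h he (X p)).1 = ph (n * (4 * Y.1)) • (D.frame h he Y).1 := by
      rw [hmn, frame_add_int, frame_add_int_snd]
    have e3 : (c p)⁻¹ * b = ph (n * (4 * Y.1)) := by
      obtain ⟨i, hi⟩ := Function.ne_iff.1 (D.frame h he Y).ne_zero
      exact mul_right_cancel₀ hi (congrFun (e.symm.trans e2) i)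
    rw [hmn, hF1, hF2, ← e3, ← mul_assoc, ← mul_pow, mul_inv_cancel_left₀ hc0]
  have hcont : Continuous fun p => c p ^ d * F (X p) := by
    rw [(D.isQuotientMap_frame h he).continuous_iff]
    have : ((fun p => c p ^ d * F (X p)) ∘ fun t : Set.Icc (0 : ℝ) 1 × Set.Icc (0 : ℝ) 1 × Circle =>
        Sph.phase t.2.2 (D.frame h he (t.1, t.2.1))) =
        fun t => (t.2.2 : ℂ) ^ d * F (t.1, t.2.1) := funext fun t => key _ _ _ rfl
    rw [this]
    fun_prop
  have := Sph.compactSpace h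
  refine ⟨mkOfCompact ⟨_, hcont⟩, fun p q b hb => ?_, fun Y => ?_⟩
  · change c p ^ d * F (X p) = b ^ d * (c q ^ d * F (X q))
    rw [← mul_assoc, ← mul_pow]
    refine key p _ _ ?_
    rw [hb, mul_smul, ← hc]
  · change c _ ^ d * F (X _) = _
    rw [key _ Y 1 (one_smul _ _).symm, one_pow, one_mul]

lemma surjective_toCurve {φ : Fin 3 → ℝ} (D : ThetaData (absS φ)) (h : IsGeneric φ)
    (he : IsEven φ) : Function.Surjective (Sph.toCurve (φ := φ)) := fun x => by
  obtain ⟨z, hz⟩ := D.exists_pt he x.2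
  exact ⟨D.frame h he (D.unpar z), Subtype.ext (by rw [frame_toCurve, par_unpar, hz])⟩

lemma mem_baseFun_iff {φ : Fin 3 → ℝ} (D : ThetaData (absS φ)) (h : IsGeneric φ) (he : IsEven φ)
    {a : Sph φ →ᵇ ℂ} :
    a ∈ baseFun φ ↔ ∀ (p q : Sph φ) (c : ℂ), p.1 = c • q.1 → a p = a q := by
  constructor
  · rintro ⟨f, hf⟩ p q c hc
    rw [hf, hf, Sph.toCurve_eq_iff.2 ⟨c, hc⟩]
  · intro ha
    have hs := D.surjective_toCurve h he
    have := Sph.compactSpace h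
    have hq : IsQuotientMap (Sph.toCurve (φ := φ)) :=
      Sph.continuous_toCurve.isClosedMap.isQuotientMap Sph.continuous_toCurve hs
    choose r hr using hs
    have e : ∀ p, a (r p.toCurve) = a p := fun p => by
      obtain ⟨c, hc⟩ := Sph.toCurve_eq_iff.1 (hr p.toCurve)
      exact ha _ _ c hc
    refine ⟨⟨fun x => a (r x), ?_⟩, fun p => (e p).symm⟩
    rw [hq.continuous_iff]
    exact a.continuous.congr fun p => (e p).symm

/-- All orbits of the translation, with trivializations of the line bundle along them. -/
def sphFrame : OrbitFrame (Sph.Step (φ := φ)) (baseFun φ) (lineSec φ) D.z₀ where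
  e := D.frame h he
  cont := D.continuous_frame h he
  per := D.frame_add_one h he
  step_e := D.frame_step h he
  gauge Q := by
    obtain ⟨x, hx, y, hy, c₀, hc₀⟩ := D.exists_frame_Icc h he (Q.1 0)
    have hinj : ∀ p q : Sph φ, sigma φ p.toCurve = sigma φ q.toCurve → p.toCurve = q.toCurve := by
      intro p q hpq
      obtain ⟨z, hz⟩ := D.exists_pt he p.toCurve.2
      obtain ⟨w, hw⟩ := D.exists_pt he q.toCurve.2
      refine Subtype.ext ?_
      rw [← hz, ← hw, D.sigma_pt he, D.sigma_pt he, D.pt_eq_iff] at hpq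
      rw [← hz, ← hw, D.pt_eq_iff]
      simpa using hpq
    have hcurve : ∀ k : ℤ, (Q.1 k).toCurve = (D.frame h he (x - k * D.z₀, y)).toCurve := by
      intro k
      induction k using Int.induction_on with
      | zero => exact Sph.toCurve_eq_iff.2 ⟨c₀, by simpa using hc₀⟩
      | succ k ih =>
        have h1 := Q.2 k
        have h2 := D.frame_step h he (x - k * D.z₀) y
        rw [Sph.Step] at h1 h2
        refine Subtype.ext (h1.trans ?_)
        rw [ih, show x - (((k : ℤ) + 1 : ℤ) : ℝ) * D.z₀ = x - k * D.z₀ - D.z₀ by push_cast; ring, h2]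
        rfl
      | pred k ih =>
        have h1 := Q.2 (-(k : ℤ) - 1)
        have h2 := D.frame_step h he (x - ((-(k : ℤ) - 1 : ℤ) : ℝ) * D.z₀) y
        rw [Sph.Step] at h1 h2
        refine hinj _ _ ?_
        rw [← h1, ← h2, sub_add_cancel, ih, show x - ((-(k : ℤ) - 1 : ℤ) : ℝ) * D.z₀ - D.z₀ =
          x - ((-(k : ℤ) : ℤ) : ℝ) * D.z₀ by push_cast; ring]
    -- The chain and the frame orbit lie over the same points of the curve and differ by phases c_k.
    -- The gauge condition for sections is the recursion γ_{k+1} c_k = γ_k.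
    choose c hc using fun k => Sph.toCurve_eq_iff.1 (hcurve k)
    obtain ⟨γ, hγ1, hγ2⟩ := exists_int_recursion c fun k => Sph.norm_smul_eq (hc k)
    refine ⟨x, hx, y, hy, γ, hγ1, fun a ha k => ?_, fun ξ hξ k => ?_⟩
    · exact (D.mem_baseFun_iff h he).1 ha _ _ _ (hc k)
    · rw [hξ _ _ _ (hc k), ← mul_assoc, hγ2]

end ThetaData

/-- The orbits of a rotation of the circle `C_φ`. -/
def circleFrame {η : ℝ} (g : AddCircle (1 : ℝ) ≃ₜ realComp φ)
    (hg : ∀ x, (g (x + (η : AddCircle (1 : ℝ))) : P3) = sigma φ (g x)) :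
    OrbitFrame (circleStep φ) Set.univ Set.univ η where
  -- The sign is due to the frame convention, in which a step is x ↦ x − η, while g carries the
  -- rotation by +η to σ. The second coordinate is idle.
  e X := g ((-X.1 : ℝ) : AddCircle (1 : ℝ))
  cont := g.continuous.comp (AddCircle.continuous_mk' 1 |>.comp continuous_fst.neg)
  per x y := by
    congr 1
    rw [← AddCircle.coe_add_period 1 (-(x + 1, y).1)]
    congr 1
    ring
  step_e x y := by
    have := hg ((-x : ℝ) : AddCircle (1 : ℝ))
    rw [circleStep, ← this, ← AddCircle.coe_add]
    congr 3
    ring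
  gauge Q := by
    have hs : ∀ k, g.symm (Q.1 (k + 1)) = g.symm (Q.1 k) + (η : AddCircle (1 : ℝ)) := fun k => by
      rw [Homeomorph.symm_apply_eq]
      refine Subtype.ext ?_
      rw [hg, Homeomorph.apply_symm_apply]
      exact Q.2 k
    obtain ⟨t, ht⟩ := QuotientAddGroup.mk_surjective (g.symm (Q.1 0))
    have ht' : ((-Int.fract (-t) : ℝ) : AddCircle (1 : ℝ)) = g.symm (Q.1 0) := by
      rw [← ht, ← Int.self_sub_floor, neg_sub, sub_neg_eq_add]
      have : ((⌊-t⌋ : ℝ) : AddCircle (1 : ℝ)) = 0 := (AddCircle.coe_eq_zero_iff 1).2 ⟨⌊-t⌋, by simp⟩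
      rw [AddCircle.coe_add, this, zero_add]
    have hk : ∀ k : ℤ, Q.1 k = g ((-(Int.fract (-t) - k * η) : ℝ) : AddCircle (1 : ℝ)) := by
      intro k
      rw [← Homeomorph.symm_apply_eq]
      induction k using Int.induction_on with
      | zero => simp [← ht']
      | succ k ih =>
        rw [hs, ih, ← AddCircle.coe_add]
        congr 1
        push_cast
        ring
      | pred k ih =>
        have h1 := hs (-(k : ℤ) - 1)
        rw [sub_add_cancel, ih, ← sub_eq_iff_eq_add] at h1
        rw [← h1, ← AddCircle.coe_sub]
        congr 1
        push_cast
        ring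
    refine ⟨Int.fract (-t), ⟨Int.fract_nonneg _, (Int.fract_lt_one _).le⟩, 0, by simp, fun _ => 1,
      fun _ => norm_one, fun a _ k => by rw [hk], fun ξ _ k => by rw [hk]⟩

end NC3

end

/-! ### Density criteria, traces and mapping tori -/

noncomputable section

namespace NC3

open Complex Topology BoundedContinuousFunction

lemma isClosed_ncTorus (η : ℝ) :
    IsClosed (ncTorus η : Set (L2 (ℤ × ℤ) →L[ℂ] L2 (ℤ × ℤ))) :=
  StarSubalgebra.isClosed_topologicalClosure _

attribute [local instance] isClosed_ncTorus

section Density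

lemma dense_fst_of_adjoin {A B : Type*} [CStarAlgebra A] [CStarAlgebra B] {s : Set A}
    {A' : StarSubalgebra ℂ A} (hA : A' ≤ (StarAlgebra.adjoin ℂ s).topologicalClosure)
    (S : StarSubalgebra ℂ (A' × B))
    (h : ∀ C : StarSubalgebra ℂ A, IsClosed (C : Set A) → (∀ p ∈ S, p.1.1 ∈ C) → s ⊆ C) :
    Dense (Prod.fst '' (S : Set (A' × B))) := by
  let f : (A' × B) →⋆ₐ[ℂ] A := A'.subtype.comp (StarAlgHom.fst ℂ _ B)
  have h1 := h (S.map f).topologicalClosure (StarSubalgebra.isClosed_topologicalClosure _)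
    (fun p hp => StarSubalgebra.le_topologicalClosure _ ⟨p, hp, rfl⟩)
  have h2 : (StarAlgebra.adjoin ℂ s).topologicalClosure ≤ (S.map f).topologicalClosure :=
    StarSubalgebra.topologicalClosure_minimal (StarAlgebra.adjoin_le h1)
      (StarSubalgebra.isClosed_topologicalClosure _)
  rw [Subtype.dense_iff]
  intro T hT
  refine closure_mono ?_ (h2 (hA hT))
  rintro _ ⟨p, hp, rfl⟩
  exact ⟨p.1, ⟨p, hp, rfl⟩, rfl⟩

/-- A closed subalgebra which contains images of functions separating points contains the image
of every continuous function. -/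
lemma map_mem_of_separates {K B : Type*} [TopologicalSpace K] [CompactSpace K] [CStarAlgebra B]
    (f : C(K, ℂ) →⋆ₐ[ℂ] B) {C : StarSubalgebra ℂ B} (hC : IsClosed (C : Set B))
    (h : ∀ x y : K, x ≠ y → ∃ a, f a ∈ C ∧ a x ≠ a y) (a : C(K, ℂ)) : f a ∈ C := by
  have hf : Continuous f := by
    have : LipschitzWith (Real.toNNReal 1) f := AddMonoidHomClass.lipschitz_of_bound f 1 fun x => by
      rw [one_mul]
      exact NonUnitalStarAlgHom.norm_apply_le f x
    exact this.continuous
  have h1 := ContinuousMap.starSubalgebra_topologicalClosure_eq_top_of_separatesPoints (C.comap f)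
    (fun x y hxy => by
      obtain ⟨a, ha, hxy⟩ := h x y hxy
      exact ⟨a, ⟨a, ha, rfl⟩, hxy⟩)
  have h2 : a ∈ (C.comap f).topologicalClosure := by
    rw [h1]
    trivial
  exact closure_minimal (t := f ⁻¹' (C : Set B)) (fun x hx => hx) (hC.preimage hf) h2

/-- Functions on a compact quotient as multiplication operators. -/
def mulHom {P K : Type} [TopologicalSpace P] [TopologicalSpace K] [CompactSpace K]
    (step : P → P → Prop) (r : C(P, K)) :
    C(K, ℂ) →⋆ₐ[ℂ] (L2 (Chain step × ℤ) →L[ℂ] L2 (Chain step × ℤ)) where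
  toFun f := mulOp step ((mkOfCompact f).compContinuous r)
  map_one' := by
    ext v ⟨Q, k⟩
    exact one_mul _
  map_mul' f g := by
    ext v ⟨Q, k⟩
    exact mul_assoc _ _ _
  map_zero' := by
    ext v ⟨Q, k⟩
    exact zero_mul _
  map_add' f g := by
    ext v ⟨Q, k⟩
    exact add_mul _ _ _
  commutes' c := by
    ext v ⟨Q, k⟩
    rfl
  map_star' f := by
    ext v ⟨Q, k⟩
    rw [star_mulOp_apply]
    rfl

lemma mulHom_apply {P K : Type} [TopologicalSpace P] [TopologicalSpace K] [CompactSpace K]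
    (step : P → P → Prop) (r : C(P, K)) (f : C(K, ℂ)) {a : P →ᵇ ℂ} (h : ∀ p, a p = f (r p)) :
    mulHom step r f = mulOp step a := by
  have : (mkOfCompact f).compContinuous r = a := by
    ext p
    exact (h p).symm
  rw [← this]
  rfl

end Density

section Tau

variable (η : ℝ)

/-- The trace of the noncommutative torus. -/
def tau₀ : ncTorus η →L[ℂ] ℂ :=
  LinearMap.mkContinuous
    { toFun := fun b => b.1 (bv (0, 0)) (0, 0)
      map_add' := fun _ _ => rfl
      map_smul' := fun _ _ => rfl } 1
    (fun b => by
      rw [one_mul]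
      exact norm_entry_le b.1 _ _)

lemma tau₀_star_mul_self (b : ncTorus η) :
    tau₀ η (star b * b) = ((‖b.1 (bv (0, 0))‖ ^ 2 : ℝ) : ℂ) := star_mul_apply_bv _ _

lemma tau₀_nonneg (b : ncTorus η) : 0 ≤ (tau₀ η (star b * b)).re := by
  rw [tau₀_star_mul_self, ofReal_re]
  positivity

lemma tau₀_faithful (b : ncTorus η) (h : (tau₀ η (star b * b)).re = 0) : b = 0 := by
  rw [tau₀_star_mul_self, ofReal_re] at h
  exact Subtype.ext (eq_zero_of_mem_ncTorus η b.2
    (norm_eq_zero.1 (pow_eq_zero_iff two_ne_zero |>.1 h)))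

end Tau

section MappingTorus

variable {B : Type*} [CStarAlgebra B] (β : B ≃⋆ₐ[ℂ] B)

/-- The mapping torus, as an algebra of bounded continuous functions. -/
def mtAlg : StarSubalgebra ℂ (ℝ →ᵇ B) where
  carrier := {x | ∀ t, x (t + 1) = β (x t)}
  mul_mem' hx hy t := by simp [hx t, hy t]
  one_mem' t := by simp
  add_mem' hx hy t := by simp [hx t, hy t]
  zero_mem' t := by simp
  algebraMap_mem' c t := (AlgHomClass.commutes (β) c).symm
  star_mem' {x} hx t := by
    change star (x (t + 1)) = β (star (x t))
    rw [hx t]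
    exact (map_star (β) (x t)).symm

lemma norm_aut (x : B) : ‖β x‖ = ‖x‖ :=
  NonUnitalStarAlgHom.norm_map (β) (β).injective x

lemma continuous_aut : Continuous (β) :=
  (NonUnitalStarAlgHom.isometry (β) (β).injective).continuous

lemma isClosed_mtAlg : IsClosed (mtAlg β : Set (ℝ →ᵇ B)) := by
  have : (mtAlg β : Set (ℝ →ᵇ B)) = ⋂ t : ℝ, {x | x (t + 1) = β (x t)} := by
    ext x
    simp only [Set.mem_iInter]
    exact Iff.rfl
  rw [this]
  exact isClosed_iInter fun t => isClosed_eq (continuous_eval_const _)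
    ((continuous_aut β).comp (continuous_eval_const _))

attribute [local instance] isClosed_mtAlg

variable {β}

lemma eq_fract_of_periodic {α : Type*} {f : ℝ → α} (h : ∀ t, f (t + 1) = f t) (t : ℝ) :
    f t = f (Int.fract t) := by
  have hp : Function.Periodic f 1 := h
  have := hp.int_mul (-⌊t⌋) t
  rw [← this, ← Int.self_sub_floor]
  congr 1
  push_cast
  ring

lemma exists_bound_of_periodic {f : ℝ → ℝ} (hf : Continuous f) (h : ∀ t, f (t + 1) = f t) :
    ∃ C, ∀ t, f t ≤ C := by
  obtain ⟨C, hC⟩ := (isCompact_Icc (a := (0 : ℝ)) (b := 1)).bddAbove_image hf.continuousOn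
  refine ⟨C, fun t => ?_⟩
  rw [eq_fract_of_periodic h]
  exact hC ⟨_, ⟨Int.fract_nonneg t, (Int.fract_lt_one t).le⟩, rfl⟩

variable (β)

/-- The mapping torus, as an algebra of continuous functions. -/
def contMT : StarSubalgebra ℂ C(ℝ, B) where
  carrier := {x | ∀ t, x (t + 1) = β (x t)}
  mul_mem' hx hy t := by simp [hx t, hy t]
  one_mem' t := by simp
  add_mem' hx hy t := by simp [hx t, hy t]
  zero_mem' t := by simp
  algebraMap_mem' c t := (AlgHomClass.commutes β c).symm
  star_mem' {x} hx t := by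
    change star (x (t + 1)) = β (star (x t))
    rw [hx t]
    exact (map_star β (x t)).symm

/-- Elements of the mapping torus are automatically bounded. -/
theorem nonempty_mtAlg_equiv : Nonempty (mtAlg β ≃⋆ₐ[ℂ] contMT β) := by
  let f : mtAlg β →⋆ₐ[ℂ] contMT β :=
    { toFun := fun x => ⟨x.1.toContinuousMap, x.2⟩
      map_one' := rfl
      map_mul' := fun _ _ => rfl
      map_zero' := rfl
      map_add' := fun _ _ => rfl
      commutes' := fun _ => rfl
      map_star' := fun _ => rfl }
  refine ⟨StarAlgEquiv.ofBijective f ⟨fun x y h => ?_, fun x => ?_⟩⟩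
  · have h' : x.1.toContinuousMap = y.1.toContinuousMap := congrArg Subtype.val h
    refine Subtype.ext (BoundedContinuousFunction.ext fun t => ?_)
    exact DFunLike.congr_fun h' t
  · obtain ⟨C, hC⟩ := exists_bound_of_periodic (f := fun t => ‖x.1 t‖) x.1.continuous.norm
      (fun t => by
        have := x.2 t
        rw [this, norm_aut β])
    exact ⟨⟨ofNormedAddCommGroup x.1 x.1.continuous C hC, x.2⟩, rfl⟩

variable (τ : B →L[ℂ] ℂ)

/-- The trace of the mapping torus. -/
def mtTr : mtAlg β →L[ℂ] ℂ :=
  LinearMap.mkContinuous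
    { toFun := fun x => ∫ t in (0 : ℝ)..1, τ (x.1 t)
      map_add' := fun x y => by
        refine Eq.trans ?_ (intervalIntegral.integral_add
          ((τ.continuous.comp x.1.continuous).intervalIntegrable _ _)
          ((τ.continuous.comp y.1.continuous).intervalIntegrable _ _))
        exact intervalIntegral.integral_congr fun t _ => map_add τ _ _
      map_smul' := fun c x => (intervalIntegral.integral_congr fun t _ =>
        map_smul τ c _).trans (intervalIntegral.integral_const_mul c _) } ‖τ‖
    (fun x => by
      have := intervalIntegral.norm_integral_le_of_norm_le_const (a := (0 : ℝ)) (b := 1)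
        (f := fun t => τ (x.1 t)) (C := ‖τ‖ * ‖x‖) (fun t _ =>
          (τ.le_opNorm _).trans (mul_le_mul_of_nonneg_left (x.1.norm_coe_le_norm t) (norm_nonneg _)))
      simpa using this)

variable {τ} in
-- The integrand τ(x(t)*x(t)) has continuous nonnegative real part, so the vanishing of its integral
-- gives x = 0 on [0, 1). The rest follows since β is isometric and the norm of x(t) is periodic.
lemma mtTr_faithful (hτ : ∀ b, 0 ≤ (τ (star b * b)).re)
    (hτ' : ∀ b, (τ (star b * b)).re = 0 → b = 0) {x : mtAlg β}
    (h : mtTr β τ (star x * x) = 0) : x = 0 := by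
  have hx : ∀ t, x.1 t = 0 ↔ x.1 (Int.fract t) = 0 := fun t => by
    rw [← norm_eq_zero, ← norm_eq_zero (a := x.1 (Int.fract t)),
      eq_fract_of_periodic (f := fun t => ‖x.1 t‖) (fun t => by
        have := x.2 t
        simp only [this, norm_aut β]) t]
  refine Subtype.ext (BoundedContinuousFunction.ext fun t => (hx t).2 ?_)
  by_contra hne
  have hc : Continuous fun t => (τ (star (x.1 t) * x.1 t)).re :=
    continuous_re.comp (τ.continuous.comp (x.1.continuous.star.mul x.1.continuous))
  have e : (mtTr β τ (star x * x)).re = ∫ t in (0 : ℝ)..1, (τ (star (x.1 t) * x.1 t)).re :=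
    (reCLM.intervalIntegral_comp_comm
      ((τ.continuous.comp (x.1.continuous.star.mul x.1.continuous)).intervalIntegrable 0 1)).symm
  rw [h, zero_re] at e
  refine absurd e (intervalIntegral.integral_pos one_pos hc.continuousOn (fun t _ => hτ _)
    ⟨Int.fract t, ⟨Int.fract_nonneg t, (Int.fract_lt_one t).le⟩, ?_⟩).ne
  exact lt_of_le_of_ne (hτ _) fun h0 => hne (hτ' _ h0.symm)

/-- Functions on the circle as central elements of the mapping torus. -/
def circleHom : C(AddCircle (1 : ℝ), ℂ) →⋆ₐ[ℂ] mtAlg β where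
  toFun f := ⟨ofNormedAddCommGroup (fun t : ℝ => f t • (1 : B))
    ((f.continuous.comp (AddCircle.continuous_mk' 1)).smul continuous_const) (‖f‖ * ‖(1 : B)‖) (fun t =>
      (norm_smul_le _ _).trans (mul_le_mul_of_nonneg_right (f.norm_coe_le_norm _) (norm_nonneg _))), fun t => by
    change f ((t + 1 : ℝ) : AddCircle (1 : ℝ)) • (1 : B) = β (f t • (1 : B))
    rw [AddCircle.coe_add_period, map_smul, map_one]⟩
  map_one' := Subtype.ext (BoundedContinuousFunction.ext fun t => one_smul _ _)
  map_mul' f g := Subtype.ext (BoundedContinuousFunction.ext fun t => by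
    change (f t * g t) • (1 : B) = (f t • (1 : B)) * (g t • (1 : B))
    rw [smul_mul_smul_comm, one_mul])
  map_zero' := Subtype.ext (BoundedContinuousFunction.ext fun t => zero_smul _ _)
  map_add' f g := Subtype.ext (BoundedContinuousFunction.ext fun t => add_smul _ _ _)
  commutes' c := Subtype.ext (BoundedContinuousFunction.ext fun t => by
    change c • (1 : B) = algebraMap ℂ _ c
    rw [Algebra.algebraMap_eq_smul_one])
  map_star' f := Subtype.ext (BoundedContinuousFunction.ext fun t => by
    change (star (f t)) • (1 : B) = star (f t • (1 : B))
    rw [star_smul, star_one])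

/-- A closed subalgebra of the mapping torus which contains the functions on the circle and is
everywhere dense in the fibres is the whole algebra. -/
lemma mem_of_fibrewise {C : StarSubalgebra ℂ (mtAlg β)} (hC : IsClosed (C : Set (mtAlg β)))
    (h1 : ∀ f, circleHom β f ∈ C)
    (h2 : ∀ (t : ℝ) (b : B) (ε : ℝ), 0 < ε → ∃ c ∈ C, ‖c.1 t - b‖ < ε) (x : mtAlg β) :
    x ∈ C := by
  rw [← SetLike.mem_coe, ← hC.closure_eq, Metric.mem_closure_iff]
  intro ε hε
  -- An element of C close to x at t stays close near t, and its distance from x is a function on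
  -- the circle since β is isometric. A partition of unity subordinate to finitely many such
  -- neighbourhoods patches these elements, with weights that lie in C.
  choose c hcC hc using fun t => h2 t (x.1 t) (ε / 2) (by positivity)
  have hper : ∀ t, Function.Periodic (fun s => ‖(c t).1 s - x.1 s‖) 1 := fun t s => by
    change ‖(c t).1 (s + 1) - x.1 (s + 1)‖ = _
    rw [(c t).2 s, x.2 s, ← map_sub, norm_aut β]
  have hcont : ∀ t, Continuous (hper t).lift := fun t =>
    continuous_coinduced_dom.2 (((c t).1.continuous.sub x.1.continuous).norm)
  let V : ℝ → Set (AddCircle (1 : ℝ)) := fun t => {θ | (hper t).lift θ < ε / 2}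
  have hV : ∀ t, IsOpen (V t) := fun t => isOpen_lt (hcont t) continuous_const
  obtain ⟨F, hF⟩ := isCompact_univ.elim_finite_subcover V hV (fun θ _ => by
    obtain ⟨t, rfl⟩ := QuotientAddGroup.mk_surjective θ
    exact Set.mem_iUnion.2 ⟨t, hc t⟩)
  obtain ⟨f, hf⟩ := PartitionOfUnity.exists_isSubordinate (X := AddCircle (1 : ℝ))
    isClosed_univ (fun i : F => V i) (fun i => hV i) (by
      intro θ hθ
      obtain ⟨t, ht, h⟩ := Set.mem_iUnion₂.1 (hF hθ)
      exact Set.mem_iUnion.2 ⟨⟨t, ht⟩, h⟩)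
  let g : F → C(AddCircle (1 : ℝ), ℂ) := fun i => ⟨fun θ => (f i θ : ℂ), by fun_prop⟩
  refine ⟨∑ i, circleHom β (g i) * c i, sum_mem fun i _ => mul_mem (h1 _) (hcC _), ?_⟩
  rw [dist_eq_norm]
  refine lt_of_le_of_lt ?_ (half_lt_self hε)
  refine (BoundedContinuousFunction.norm_le (half_pos hε).le).2 fun s => ?_
  have hsum : ∑ i, f i (s : AddCircle (1 : ℝ)) = 1 := by
    rw [← finsum_eq_sum_of_fintype]
    exact f.sum_eq_one (Set.mem_univ _)
  have e : (x - ∑ i, circleHom β (g i) * c i).1 s =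
      ∑ i, (f i (s : AddCircle (1 : ℝ)) : ℂ) • (x.1 s - (c i).1 s) := by
    have e1 : (∑ i, circleHom β (g i) * c i).1 s = ∑ i, (f i (s : AddCircle (1 : ℝ)) : ℂ) • (c i).1 s := by
      rw [AddSubmonoidClass.coe_finsetSum, BoundedContinuousFunction.sum_apply]
      refine Finset.sum_congr rfl fun i _ => ?_
      change (g i s • (1 : B)) * (c i).1 s = _
      rw [smul_mul_assoc, one_mul]
      rfl
    change x.1 s - (∑ i, circleHom β (g i) * c i).1 s = _
    rw [e1]
    simp only [smul_sub, Finset.sum_sub_distrib, ← Finset.sum_smul]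
    rw [← ofReal_sum, hsum, ofReal_one, one_smul]
  refine (congrArg norm e).trans_le ?_
  calc ‖∑ i, (f i (s : AddCircle (1 : ℝ)) : ℂ) • (x.1 s - (c i).1 s)‖
      ≤ ∑ i, f i (s : AddCircle (1 : ℝ)) * (ε / 2) := by
        refine norm_sum_le_of_le _ fun i _ => ?_
        rw [norm_smul, norm_real, Real.norm_of_nonneg (f.nonneg i _)]
        by_cases h0 : f i (s : AddCircle (1 : ℝ)) = 0
        · simp [h0]
        · refine mul_le_mul_of_nonneg_left ?_ (f.nonneg i _)
          have : (s : AddCircle (1 : ℝ)) ∈ V i := hf i (subset_closure h0)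
          rw [norm_sub_rev]
          exact le_of_lt this
    _ = ε / 2 := by rw [← Finset.sum_mul, hsum, one_mul]

end MappingTorus

end NC3

end

/-! ### The crossed products as a noncommutative torus and as a mapping torus -/

noncomputable section

namespace NC3

open Complex Topology BoundedContinuousFunction

attribute [local instance] isClosed_ncTorus isClosed_mtAlg

section General

lemma norm_weightedShift_le {ι : Type*} (e : Equiv.Perm ι) (w : ι → ℂ) {C : ℝ} (hC : 0 ≤ C)
    (hw : ∀ i, ‖w i‖ ≤ C) : ‖weightedShift e w C hw‖ ≤ C :=
  (LinearMap.mkContinuous_norm_le _ (abs_nonneg C) _).trans (abs_of_nonneg hC).le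

variable {P : Type} [TopologicalSpace P] {step : P → P → Prop} {A₀ A₁ : Set (P →ᵇ ℂ)} {η : ℝ}

lemma isClosed_cross :
    IsClosed (cross step A₀ A₁ : Set (L2 (Chain step × ℤ) →L[ℂ] L2 (Chain step × ℤ))) :=
  StarSubalgebra.isClosed_topologicalClosure _

attribute [local instance] isClosed_cross

/-- The crossed product is isomorphic to a tracial C*-algebra with matching generators. -/
theorem OrbitFrame.nonempty_equiv (F : OrbitFrame step A₀ A₁ η) {B : Type} [CStarAlgebra B]
    {τ : B →L[ℂ] ℂ} (hτ : ∀ b, τ (star b * b) = 0 → b = 0)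
    (ev : ℝ → B →⋆ₐ[ℂ] (L2 (ℤ × ℤ) →L[ℂ] L2 (ℤ × ℤ)))
    (hev : ∀ b, τ b = ∫ y in (0 : ℝ)..1, ev y b (bv (0, 0)) (0, 0))
    (gens : Set (cross step A₀ A₁ × B))
    (hgen : ∀ p ∈ gens, ∀ y, F.MatchAt y p.1.1 (ev y p.2) ∧
      F.MatchAt y (star p.1.1) (star (ev y p.2)))
    (hfst : ∀ C : StarSubalgebra ℂ (L2 (Chain step × ℤ) →L[ℂ] L2 (Chain step × ℤ)),
      IsClosed (C : Set (L2 (Chain step × ℤ) →L[ℂ] L2 (Chain step × ℤ))) →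
      (∀ p ∈ gens, p.1.1 ∈ C) → mulOp step '' A₀ ∪ shiftOp step '' A₁ ⊆ C)
    (hsnd : ∀ C : StarSubalgebra ℂ B, IsClosed (C : Set B) → (∀ p ∈ gens, p.2 ∈ C) → ∀ b, b ∈ C) :
    Nonempty (cross step A₀ A₁ ≃⋆ₐ[ℂ] B) := by
  -- The matching of generators extends to the *-algebra of pairs. Integrated over x and then over
  -- y, it becomes the equality of the two traces required by the graph criterion.
  have hmatch : ∀ p ∈ StarAlgebra.adjoin ℂ gens, ∀ y, F.MatchAt y p.1.1 (ev y p.2) := by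
    intro p hp
    refine starAdjoin_induction (p := fun p : cross step A₀ A₁ × B =>
      ∀ y, F.MatchAt y p.1.1 (ev y p.2)) ?_ ?_ ?_ ?_ hp
    · intro p hp
      refine ⟨fun y => (hgen p hp y).1, fun y => ?_⟩
      have := (hgen p hp y).2
      rw [← map_star] at this
      exact this
    · intro c y
      have := F.matchAt_algebraMap y c
      rw [← AlgHomClass.commutes (ev y)] at this
      exact this
    · intro p q hp hq y
      have := (hp y).add (hq y)
      rw [← map_add] at this
      exact this
    · intro p q hp hq y
      have := (hp y).mul (hq y)
      rw [← map_mul] at this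
      exact this
  refine exists_starAlgEquiv_of_graph (StarAlgebra.adjoin ℂ gens) (τ := F.tr) (τ' := τ)
    F.tr.continuous τ.continuous (map_zero _) (map_zero _) (fun T hT => ?_) hτ (fun p hp => ?_) ?_ ?_
  · by_contra hne
    have := F.tr_pos hne
    rw [hT, zero_re] at this
    exact lt_irrefl _ this
  · rw [hev, F.tr_apply]
    exact intervalIntegral.integral_congr fun y _ => (hmatch p hp y).integral_coef
  · refine dense_fst_of_adjoin (le_refl (cross step A₀ A₁)) _ fun C hC h => ?_
    exact hfst C hC fun p hp => h p (StarAlgebra.subset_adjoin ℂ _ hp)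
  · have h := hsnd ((StarAlgebra.adjoin ℂ gens).map (StarAlgHom.snd ℂ _ B)).topologicalClosure
      (StarSubalgebra.isClosed_topologicalClosure _) (fun p hp =>
        StarSubalgebra.le_topologicalClosure _ ⟨p, StarAlgebra.subset_adjoin ℂ _ hp, rfl⟩)
    exact fun b => h b

lemma fourier_one_injective {x y : AddCircle (1 : ℝ)} (hxy : fourier 1 x = fourier 1 y) : x = y := by
  rw [fourier_one, fourier_one] at hxy
  exact AddCircle.injective_toCircle one_ne_zero (Subtype.ext hxy)

/-- The crossed product is isomorphic to a mapping torus with matching generators. -/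
theorem OrbitFrame.nonempty_equiv_contMT (F : OrbitFrame step A₀ A₁ η) {B : Type} [CStarAlgebra B]
    (β : B ≃⋆ₐ[ℂ] B) {τ : B →L[ℂ] ℂ} (hτ0 : ∀ b, 0 ≤ (τ (star b * b)).re)
    (hτ : ∀ b, (τ (star b * b)).re = 0 → b = 0)
    (j : B →⋆ₐ[ℂ] (L2 (ℤ × ℤ) →L[ℂ] L2 (ℤ × ℤ))) (hj : ∀ b, τ b = j b (bv (0, 0)) (0, 0))
    (gens : Set (cross step A₀ A₁ × mtAlg β))
    (hgen : ∀ p ∈ gens, ∀ y, F.MatchAt y p.1.1 (j (p.2.1 y)) ∧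
      F.MatchAt y (star p.1.1) (star (j (p.2.1 y))))
    (hfst : ∀ C : StarSubalgebra ℂ (L2 (Chain step × ℤ) →L[ℂ] L2 (Chain step × ℤ)),
      IsClosed (C : Set (L2 (Chain step × ℤ) →L[ℂ] L2 (Chain step × ℤ))) →
      (∀ p ∈ gens, p.1.1 ∈ C) → mulOp step '' A₀ ∪ shiftOp step '' A₁ ⊆ C)
    (hsnd : ∀ C : StarSubalgebra ℂ (mtAlg β), (∀ p ∈ gens, p.2 ∈ C) →
      circleHom β (fourier 1) ∈ C ∧ ∀ t, Dense ((fun x : mtAlg β => x.1 t) '' C)) :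
    Nonempty (cross step A₀ A₁ ≃⋆ₐ[ℂ] contMT β) := by
  obtain ⟨e⟩ := nonempty_mtAlg_equiv β
  let ev : ℝ → mtAlg β →⋆ₐ[ℂ] (L2 (ℤ × ℤ) →L[ℂ] L2 (ℤ × ℤ)) := fun y => j.comp
    { toFun := fun x => x.1 y
      map_one' := rfl
      map_mul' := fun _ _ => rfl
      map_zero' := rfl
      map_add' := fun _ _ => rfl
      commutes' := fun _ => rfl
      map_star' := fun _ => rfl }
  obtain ⟨f⟩ := F.nonempty_equiv (τ := mtTr β τ) (fun b hb => mtTr_faithful β hτ0 hτ hb) ev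
    (fun b => intervalIntegral.integral_congr fun y _ => hj _) gens hgen hfst
    (fun C hC h b => by
      obtain ⟨h1, h2⟩ := hsnd C h
      refine mem_of_fibrewise β hC (map_mem_of_separates _ hC fun x y hxy =>
        ⟨fourier 1, h1, fun h => hxy (fourier_one_injective h)⟩) (fun t b ε hε => ?_) b
      obtain ⟨_, ⟨c, hc, rfl⟩, hcb⟩ := Metric.mem_closure_iff.1 (h2 t b) ε hε
      rw [dist_comm, dist_eq_norm] at hcb
      exact ⟨c, hc, hcb⟩)
  exact ⟨f.trans e⟩

lemma dense_of_mem {η : ℝ} {C : StarSubalgebra ℂ (ncTorus η)} (h1 : U₁ η ∈ C) (h2 : U₂ η ∈ C) :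
    Dense (C : Set (ncTorus η)) := by
  have h : ncTorus η ≤ (C.map (ncTorus η).subtype).topologicalClosure := by
    refine StarSubalgebra.topologicalClosure_mono (StarAlgebra.adjoin_le ?_)
    rintro a (rfl | rfl)
    · exact ⟨_, h1, rfl⟩
    · exact ⟨_, h2, rfl⟩
  rw [Subtype.dense_iff]
  exact fun b hb => h hb

end General

section Circle

variable {φ : Fin 3 → ℝ} {η : ℝ}

/-- The crossed product of the circle by a rotation is a noncommutative torus. -/
theorem nonempty_circleCrossed_equiv (g : AddCircle (1 : ℝ) ≃ₜ realComp φ)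
    (hg : ∀ x, (g (x + (η : AddCircle (1 : ℝ))) : P3) = sigma φ (g x)) :
    Nonempty (circleCrossed φ ≃⋆ₐ[ℂ] ncTorus η) := by
  have hcomp : CompactSpace (realComp φ) := g.compactSpace
  -- The exponent −1 undoes the sign in `circleFrame`: on the frame E is exp(2πix) and corresponds
  -- to U₁, while the shift by the constant section 1 corresponds to U₂.
  let E : C(realComp φ, ℂ) := ⟨fun p => fourier (-1) (g.symm p), by fun_prop⟩
  have hE : ∀ X, E ((circleFrame g hg).e X) = ph X.1 := fun X => by
    change fourier (-1) (g.symm (g ((-X.1 : ℝ) : AddCircle (1 : ℝ)))) = _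
    rw [Homeomorph.symm_apply_apply, fourier_coe_apply, ph]
    congr 1
    push_cast
    ring
  have hsurj : ∀ p : realComp φ, ∃ X, p = (circleFrame g hg).e X := fun p => by
    obtain ⟨t, ht⟩ := QuotientAddGroup.mk_surjective (g.symm p)
    refine ⟨(-t, 0), ?_⟩
    rw [Eq.comm]
    change g ((- -t : ℝ) : AddCircle (1 : ℝ)) = p
    rw [neg_neg, ← Homeomorph.eq_symm_apply, ← ht]
  have m1 : mulOp (circleStep φ) (mkOfCompact E) ∈ cross (circleStep φ) Set.univ Set.univ :=
    algCrossed_le_cross (StarAlgebra.subset_adjoin ℂ _ (Or.inl ⟨_, trivial, rfl⟩))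
  have m2 : shiftOp (circleStep φ) 1 ∈ cross (circleStep φ) Set.univ Set.univ :=
    algCrossed_le_cross (StarAlgebra.subset_adjoin ℂ _ (Or.inr ⟨_, trivial, rfl⟩))
  refine (circleFrame g hg).nonempty_equiv (τ := tau₀ η) (fun b hb => tau₀_faithful η b (by
    rw [hb, zero_re])) (fun _ => (ncTorus η).subtype) (fun b => ?_)
    {(⟨_, m1⟩, U₁ η), (⟨_, m2⟩, U₂ η)} ?_ ?_ ?_
  · rw [intervalIntegral.integral_const, sub_zero, one_smul]
    rfl
  · rintro p (rfl | rfl) y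
    · have := OrbitFrame.matchAt_mulOp (F := circleFrame g hg) (y := y) (a := mkOfCompact E) (c := 1) (j := 1)
        (fun x => by
          rw [Int.cast_one, one_mul, one_mul]
          exact hE (x, y))
      rw [one_smul, ← u₁_eq] at this
      exact this
    · have := OrbitFrame.matchAt_shiftOp (F := circleFrame g hg) (y := y) (ξ := 1) (c := 1) (j := 0)
        (fun x => by
          rw [Int.cast_zero, zero_mul, ph_zero, one_mul]
          rfl)
      rw [one_smul, ← u₂_eq] at this
      exact this
  · intro C hC h
    have hm : ∀ a : realComp φ →ᵇ ℂ, mulOp (circleStep φ) a ∈ C := fun a => by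
      have := map_mem_of_separates (mulHom (circleStep φ) (ContinuousMap.id (realComp φ))) hC
        (fun p q hpq => ⟨E, ?_, ?_⟩) a.toContinuousMap
      · rwa [mulHom_apply (a := a) _ _ _ (fun p => rfl)] at this
      · rw [mulHom_apply (a := mkOfCompact E) _ _ _ (fun p => rfl)]
        exact h _ (Or.inl rfl)
      · obtain ⟨X, rfl⟩ := hsurj p
        obtain ⟨Y, rfl⟩ := hsurj q
        rw [hE, hE]
        intro hXY
        obtain ⟨n, hn⟩ := ph_eq_ph_iff.1 hXY
        refine hpq (congrArg g ?_)
        have : ((n : ℝ) : AddCircle (1 : ℝ)) = 0 := (AddCircle.coe_eq_zero_iff 1).2 ⟨n, by simp⟩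
        rw [hn, neg_add, AddCircle.coe_add, AddCircle.coe_neg, AddCircle.coe_neg, this, neg_zero,
          add_zero]
    rintro _ (⟨a, -, rfl⟩ | ⟨a, -, rfl⟩)
    · exact hm a
    · have h2 := mul_mem (hm a) (h _ (Or.inr rfl))
      have e : mulOp (circleStep φ) a * shiftOp (circleStep φ) 1 = shiftOp (circleStep φ) a := by
        ext v ⟨Q, k⟩
        change a (Q.1 k) * (1 * v (Q, k + 1)) = a (Q.1 k) * v (Q, k + 1)
        rw [one_mul]
      rwa [← e]
  · intro C hC h b
    have := dense_of_mem (h _ (Or.inl rfl)) (h _ (Or.inr rfl)) b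
    rwa [hC.closure_eq] at this

end Circle

section Sphere

/-- Continuity of functions glued from infinitely many pieces. -/
lemma continuous_glue {Y E : Type*} [TopologicalSpace Y] [NormedAddCommGroup E] [NormedSpace ℂ E]
    {G : ℤ → Y → E} (hG : ∀ n, Continuous (G n)) (hb : ∀ n y, ‖G n y‖ ≤ 1) :
    Continuous fun p : ℝ × Y => ((|Real.cos (Real.pi * p.1)| : ℝ) : ℂ) • G (round p.1) p.2 := by
  rw [continuous_iff_continuousAt]
  rintro ⟨t, y⟩
  have hcos : Continuous fun p : ℝ × Y => |Real.cos (Real.pi * p.1)| := by fun_prop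
  -- The integer `round` can only jump at half-integers, where the cosine vanishes and the bound on
  -- G gives continuity; elsewhere it is locally constant.
  by_cases h0 : Real.cos (Real.pi * t) = 0
  · have h1 : Filter.Tendsto (fun p : ℝ × Y => |Real.cos (Real.pi * p.1)|) (𝓝 (t, y)) (𝓝 0) := by
      have := hcos.tendsto (t, y)
      simpa [h0] using this
    have h2 := squeeze_zero_norm (fun p : ℝ × Y => (by
      rw [norm_smul, norm_real, Real.norm_of_nonneg (abs_nonneg _)]
      exact mul_le_of_le_one_right (abs_nonneg _) (hb _ _) :
      ‖((|Real.cos (Real.pi * p.1)| : ℝ) : ℂ) • G (round p.1) p.2‖ ≤ |Real.cos (Real.pi * p.1)|)) h1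
    have e : ((|Real.cos (Real.pi * (t, y).1)| : ℝ) : ℂ) • G (round (t, y).1) (t, y).2 = 0 := by
      simp [h0]
    rw [ContinuousAt, e]
    exact h2
  · have h1 : |t - round t| < 1 / 2 := by
      refine lt_of_le_of_ne (abs_sub_round t) fun h => h0 (Real.cos_eq_zero_iff.2 ?_)
      rcases (abs_eq (by norm_num)).1 h with h | h
      · exact ⟨round t, by linear_combination Real.pi * h⟩
      · exact ⟨round t - 1, by push_cast; linear_combination Real.pi * h⟩
    have h2 : ∀ᶠ p : ℝ × Y in 𝓝 (t, y), |p.1 - round t| < 1 / 2 :=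
      ((continuous_fst.sub continuous_const).abs.tendsto (t, y)).eventually (gt_mem_nhds h1)
    have h3 : Continuous fun p : ℝ × Y =>
        ((|Real.cos (Real.pi * p.1)| : ℝ) : ℂ) • G (round t) p.2 :=
      (continuous_ofReal.comp hcos).smul ((hG _).comp continuous_snd)
    refine h3.continuousAt.congr (h2.mono fun p hp => ?_)
    have : round p.1 = round t := by
      rw [round_eq, Int.floor_eq_iff]
      rw [abs_lt] at hp
      constructor <;> linarith [hp.1, hp.2]
    simp only [this]

/-- The profile of the basic sections. -/
def hat (y : ℝ) : ℂ := ((|Real.cos (Real.pi * y)| : ℝ) : ℂ)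

lemma hat_add_one (y : ℝ) : hat (y + 1) = hat y := by
  rw [hat, hat, mul_add, mul_one, Real.cos_add_pi, abs_neg]

/-- This is cos² + sin² = 1. The two basic sections built on these profiles form a normalized system
without common zeros, and so suffice to generate all sections. -/
lemma hat_sq_add (y : ℝ) : hat y ^ 2 + hat (y - 1 / 2) ^ 2 = 1 := by
  rw [hat, hat, ← ofReal_pow, ← ofReal_pow, sq_abs, sq_abs,
    show Real.pi * (y - 1 / 2) = Real.pi * y - Real.pi / 2 by ring, Real.cos_sub_pi_div_two,
    ← ofReal_add, Real.cos_sq_add_sin_sq, ofReal_one]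

lemma conj_hat (y : ℝ) : (starRingEnd ℂ) (hat y) = hat y := conj_ofReal _

lemma norm_hat_le (y : ℝ) : ‖hat y‖ ≤ 1 := by
  rw [hat, norm_real, Real.norm_of_nonneg (abs_nonneg _)]
  exact Real.abs_cos_le_one _

/-- Sections of the line bundle, as functions of the parameters. -/
def gsec (a : ℝ) (X : ℝ × ℝ) : ℂ :=
  hat (X.2 - a) * ph ((4 * round (X.2 - a) : ℤ) * X.1)

lemma continuous_gsec (a : ℝ) : Continuous (gsec a) := by
  have := continuous_glue (Y := ℝ) (G := fun n x => ph ((4 * n : ℤ) * x))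
    (fun n => continuous_ph.comp (continuous_const.mul continuous_id)) (fun n x => (norm_ph _).le)
  exact this.comp (f := fun X : ℝ × ℝ => (X.2 - a, X.1)) (by fun_prop)

lemma gsec_add_one (a x y : ℝ) : gsec a (x + 1, y) = gsec a (x, y) := by
  simp only [gsec]
  rw [mul_add, mul_one, ph_add_int]

/-- The rounded integer grows by one with y, which adds exactly the phase acquired by the frame;
hence `gsec` descends to a section of the line bundle. -/
lemma gsec_add_one_snd (a x y : ℝ) : gsec a (x, y + 1) = ph (4 * x) * gsec a (x, y) := by
  simp only [gsec]
  rw [show y + 1 - a = y - a + 1 by ring, hat_add_one, round_add_one, mul_left_comm, ← ph_add]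
  congr 2
  push_cast
  ring

lemma gsec_mul_conj (a : ℝ) (X : ℝ × ℝ) :
    gsec a X * (starRingEnd ℂ) (gsec a X) = hat (X.2 - a) ^ 2 := by
  rw [gsec, map_mul, conj_hat, conj_ph, mul_mul_mul_comm, ← ph_add, add_neg_cancel, ph_zero]
  ring

/-- The elements of the mapping torus corresponding to the basic sections. -/
def mtSec (η a : ℝ) : mtAlg (beta η) :=
  ⟨ofNormedAddCommGroup (fun y : ℝ => (⟨hat (y - a) • mon η (4 * round (y - a)) 1,
      (ncTorus η).smul_mem (mon_mem η _ _) _⟩ : ncTorus η))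
    (by
      refine Continuous.subtype_mk ?_ _
      have := continuous_glue (Y := Unit) (G := fun n _ => mon η (4 * n) 1)
        (fun n => continuous_const) (fun n x => norm_weightedShift_le _ _ zero_le_one _)
      exact this.comp (f := fun y : ℝ => (y - a, ())) (by fun_prop)) 1
    (fun y => by
      change ‖hat (y - a) • mon η (4 * round (y - a)) 1‖ ≤ 1
      rw [norm_smul]
      exact mul_le_one₀ (norm_hat_le _) (norm_nonneg _) (norm_weightedShift_le _ _ zero_le_one _)),
    fun y => by
    refine Subtype.ext ?_
    change hat (y + 1 - a) • mon η (4 * round (y + 1 - a)) 1 =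
      shearAut η (hat (y - a) • mon η (4 * round (y - a)) 1)
    rw [map_smul, shearAut_mon_one, show y + 1 - a = y - a + 1 by ring, hat_add_one, round_add_one,
      mul_add, mul_one]⟩

/-- The constant function `U₁` in the mapping torus. -/
def mtU₁ (η : ℝ) : mtAlg (beta η) := ⟨const ℝ (U₁ η), fun _ => (beta_U₁ η).symm⟩

/-- Evaluation of elements of the mapping torus. -/
def mtEv (η : ℝ) (y : ℝ) : mtAlg (beta η) →⋆ₐ[ℂ] ncTorus η where
  toFun x := x.1 y
  map_one' := rfl
  map_mul' _ _ := rfl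
  map_zero' := rfl
  map_add' _ _ := rfl
  commutes' _ := rfl
  map_star' _ := rfl

lemma mon_fst_mem_of_mem {η : ℝ} {C : StarSubalgebra ℂ (ncTorus η)} (h1 : U₁ η ∈ C) (j : ℤ) :
    (⟨mon η j 0, mon_mem η j 0⟩ : ncTorus η) ∈ C := by
  induction j using Int.induction_on with
  | zero =>
    convert one_mem C
    exact mon_zero η
  | succ j ih =>
    convert mul_mem ih h1
    change _ = mon η j 0 * u₁
    rw [u₁_eq η, mon_mul]
    simp [ph_zero]
  | pred j ih =>
    convert mul_mem ih (star_mem h1)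
    change _ = mon η (-(j : ℤ)) 0 * star u₁
    rw [u₁_eq η, star_mon, mul_smul_comm, mon_mul]
    simp [ph_zero, sub_eq_add_neg]

/-- At each t one of the two profiles is nonzero. Dividing the corresponding section by it and
removing the power of U₁ recovers U₂ in the fibre. -/
lemma dense_fibre {η : ℝ} {C : StarSubalgebra ℂ (mtAlg (beta η))} (h1 : mtU₁ η ∈ C)
    (h3 : mtSec η 0 ∈ C) (h4 : mtSec η (1 / 2) ∈ C) (t : ℝ) :
    Dense ((fun x : mtAlg (beta η) => x.1 t) '' C) := by
  have hU : U₁ η ∈ C.map (mtEv η t) := ⟨_, h1, rfl⟩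
  have key : ∀ a, mtSec η a ∈ C → hat (t - a) ≠ 0 → U₂ η ∈ C.map (mtEv η t) := by
    intro a ha h0
    have h5 : (mtSec η a).1 t ∈ C.map (mtEv η t) := ⟨_, ha, rfl⟩
    convert SMulMemClass.smul_mem (hat (t - a))⁻¹
      (mul_mem (mon_fst_mem_of_mem hU (-(4 * round (t - a)))) h5)
    refine Subtype.ext ?_
    change u₂ η = (hat (t - a))⁻¹ • (mon η _ 0 * (hat (t - a) • mon η _ 1))
    rw [mul_smul_comm, smul_smul, inv_mul_cancel₀ h0, one_smul, mon_mul, u₂_eq]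
    simp [ph_zero]
  have hU2 : U₂ η ∈ C.map (mtEv η t) := by
    by_cases h0 : hat t = 0
    · refine key (1 / 2) h4 fun h => ?_
      have := hat_sq_add t
      rw [h0, h] at this
      norm_num at this
    · exact key 0 h3 (by rwa [sub_zero])
  exact dense_of_mem hU hU2

variable {φ : Fin 3 → ℝ}

namespace ThetaData

/-- Periodic functions on the plane are functions on the curve. -/
lemma exists_base (D : ThetaData (absS φ)) (h : IsGeneric φ) (he : IsEven φ) {F : ℝ × ℝ → ℂ}
    (hF : Continuous F) (h1 : ∀ x y, F (x + 1, y) = F (x, y))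
    (h2 : ∀ x y, F (x, y + 1) = F (x, y)) : ∃ a ∈ baseFun φ, ∀ X, a (D.frame h he X) = F X := by
  obtain ⟨a, hb, ha⟩ := D.exists_lift h he 0 hF h1 (by simpa using h2)
  exact ⟨a, (D.mem_baseFun_iff h he).2 fun p q c hc => by simpa using hb p q c hc, ha⟩

lemma mulOp_mem_of_isClosed (D : ThetaData (absS φ)) (h : IsGeneric φ) (he : IsEven φ)
    {C : StarSubalgebra ℂ (L2 (Chain (Sph.Step (φ := φ)) × ℤ) →L[ℂ] L2 (Chain (Sph.Step (φ := φ)) × ℤ))}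
    (hC : IsClosed (C : Set (L2 (Chain (Sph.Step (φ := φ)) × ℤ) →L[ℂ]
      L2 (Chain (Sph.Step (φ := φ)) × ℤ)))) {a₁ a₂ : Sph φ →ᵇ ℂ} (hb₁ : a₁ ∈ baseFun φ)
    (hb₂ : a₂ ∈ baseFun φ) (ha₁ : ∀ X, a₁ (D.frame h he X) = ph X.1)
    (ha₂ : ∀ X, a₂ (D.frame h he X) = ph X.2) (h₁ : mulOp Sph.Step a₁ ∈ C)
    (h₂ : mulOp Sph.Step a₂ ∈ C) {a : Sph φ →ᵇ ℂ} (ha : a ∈ baseFun φ) :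
    mulOp Sph.Step a ∈ C := by
  have := Sph.compactSpace h
  have : CompactSpace (curve φ) :=
    (D.surjective_toCurve h he).compactSpace Sph.continuous_toCurve
  obtain ⟨f, hf⟩ := ha
  obtain ⟨f₁, hf₁⟩ := hb₁
  obtain ⟨f₂, hf₂⟩ := hb₂
  have key := map_mem_of_separates (mulHom (Sph.Step (φ := φ))
    ⟨Sph.toCurve, Sph.continuous_toCurve⟩) hC (fun p q hpq => ?_) f
  · rwa [mulHom_apply (a := a) _ _ _ hf] at key
  · by_contra! hcon
    have c1 := hcon f₁ (by rwa [mulHom_apply (a := a₁) _ _ _ hf₁])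
    have c2 := hcon f₂ (by rwa [mulHom_apply (a := a₂) _ _ _ hf₂])
    obtain ⟨z, hz⟩ := D.exists_pt he p.2
    obtain ⟨w, hw⟩ := D.exists_pt he q.2
    have hp : p = (D.frame h he (D.unpar z)).toCurve :=
      Subtype.ext (by rw [frame_toCurve, par_unpar, hz])
    have hq : q = (D.frame h he (D.unpar w)).toCurve :=
      Subtype.ext (by rw [frame_toCurve, par_unpar, hw])
    rw [hp, hq, ← hf₁, ← hf₁, ha₁, ha₁] at c1
    rw [hp, hq, ← hf₂, ← hf₂, ha₂, ha₂] at c2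
    obtain ⟨m, hm⟩ := ph_eq_ph_iff.1 c1
    obtain ⟨n, hn⟩ := ph_eq_ph_iff.1 c2
    refine hpq ?_
    rw [hp, hq]
    refine Sph.toCurve_eq_iff.2 ⟨ph (n * (4 * (D.unpar w).1)), ?_⟩
    rw [show D.unpar z = ((D.unpar w).1 + m, (D.unpar w).2 + n) from Prod.ext hm hn,
      frame_add_int, frame_add_int_snd]

set_option maxHeartbeats 800000 in
/-- The crossed product is a mapping torus of the noncommutative torus. -/
theorem nonempty_crossedProduct_equiv (D : ThetaData (absS φ)) (h : IsGeneric φ) (he : IsEven φ) :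
    Nonempty (crossedProduct φ ≃⋆ₐ[ℂ] mappingTorus (beta D.z₀)) := by
  obtain ⟨a₁, hb₁', ha₁⟩ := D.exists_base h he (F := fun X => ph X.1)
    (continuous_ph.comp continuous_fst) (fun x y => by simpa using ph_add_int x 1) (by simp)
  obtain ⟨a₂, hb₂', ha₂⟩ := D.exists_base h he (F := fun X => ph X.2)
    (continuous_ph.comp continuous_snd) (by simp) (fun x y => by simpa using ph_add_int y 1)
  have hg : ∀ a, ∃ ξ ∈ lineSec φ, ∀ X, ξ (D.frame h he X) = gsec a X := fun a => by
    obtain ⟨ξ, h1, h2⟩ := D.exists_lift h he 1 (continuous_gsec a) (gsec_add_one a) (fun x y => by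
      rw [pow_one]
      exact gsec_add_one_snd a x y)
    exact ⟨ξ, fun p q c hc => by simpa using h1 q p c hc, h2⟩
  choose ξ hξ hξg using hg
  have m1 : ∀ a ∈ baseFun φ, mulOp Sph.Step a ∈ cross Sph.Step (baseFun φ) (lineSec φ) :=
    fun a ha => algCrossed_le_cross (StarAlgebra.subset_adjoin ℂ _ (Or.inl ⟨a, ha, rfl⟩))
  have m2 : ∀ a ∈ lineSec φ, shiftOp Sph.Step a ∈ cross Sph.Step (baseFun φ) (lineSec φ) :=
    fun a ha => algCrossed_le_cross (StarAlgebra.subset_adjoin ℂ _ (Or.inr ⟨a, ha, rfl⟩))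
  refine (D.sphFrame h he).nonempty_equiv_contMT (beta D.z₀) (tau₀_nonneg _) (tau₀_faithful _)
    (ncTorus D.z₀).subtype (fun b => rfl)
    {(⟨_, m1 _ hb₁'⟩, mtU₁ D.z₀), (⟨_, m1 _ hb₂'⟩, circleHom (beta D.z₀) (fourier 1)),
      (⟨_, m2 _ (hξ 0)⟩, mtSec D.z₀ 0), (⟨_, m2 _ (hξ (1 / 2))⟩, mtSec D.z₀ (1 / 2))} ?_ ?_ ?_
  · have hs : ∀ a y, (D.sphFrame h he).MatchAt y (shiftOp Sph.Step (ξ a)) ((mtSec D.z₀ a).1 y).1 ∧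
        (D.sphFrame h he).MatchAt y (star (shiftOp Sph.Step (ξ a)))
          (star ((mtSec D.z₀ a).1 y).1) := fun a y =>
      OrbitFrame.matchAt_shiftOp (F := D.sphFrame h he) (y := y) (ξ := ξ a) (fun x => hξg a (x, y))
    rintro p (rfl | rfl | rfl | rfl) y
    · have := OrbitFrame.matchAt_mulOp (F := D.sphFrame h he) (y := y) (a := a₁) (c := 1) (j := 1)
        (fun x => by
          rw [Int.cast_one, one_mul, one_mul]
          exact ha₁ (x, y))
      rw [one_smul, ← u₁_eq] at this
      exact this
    · have := OrbitFrame.matchAt_mulOp (F := D.sphFrame h he) (y := y) (a := a₂) (c := ph y) (j := 0)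
        (fun x => by
          rw [Int.cast_zero, zero_mul, ph_zero, mul_one]
          exact ha₂ (x, y))
      rw [mon_zero] at this
      have e : fourier 1 (y : AddCircle (1 : ℝ)) = ph y := by
        rw [fourier_coe_apply, ph]
        congr 1
        push_cast
        ring
      rw [← e] at this
      exact this
    · exact hs 0 y
    · exact hs (1 / 2) y
  · intro C hC hmem
    have hm : ∀ a ∈ baseFun φ, mulOp Sph.Step a ∈ C := fun a ha =>
      D.mulOp_mem_of_isClosed h he hC hb₁' hb₂' ha₁ ha₂ (hmem _ (Or.inl rfl))
        (hmem _ (Or.inr (Or.inl rfl))) ha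
    have hsum : ∀ p, ξ 0 p * (starRingEnd ℂ) (ξ 0 p) +
        ξ (1 / 2) p * (starRingEnd ℂ) (ξ (1 / 2) p) = 1 := fun p => by
      obtain ⟨X, c, hc⟩ := D.exists_frame h he p
      have hn : c * (starRingEnd ℂ) c = 1 := by
        rw [mul_conj', Sph.norm_smul_eq hc]
        norm_num
      have e1 : ∀ a, ξ a p * (starRingEnd ℂ) (ξ a p) = hat (X.2 - a) ^ 2 := fun a => by
        rw [hξ a _ _ _ hc, hξg, map_mul, mul_mul_mul_comm, hn, one_mul, gsec_mul_conj]
      rw [e1, e1, sub_zero, hat_sq_add]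
    rintro _ (⟨a, ha, rfl⟩ | ⟨ζ, hζ, rfl⟩)
    · exact hm a ha
    -- Since |ξ₀|² + |ξ_{1/2}|² = 1, a section ζ is the sum of (ζ ξ̄_a) ξ_a over the two basic
    -- sections. The coefficients ζ ξ̄_a have degree zero, so they are functions on the curve.
    · have hprod : ∀ a, ζ * star (ξ a) ∈ baseFun φ := fun a =>
        (D.mem_baseFun_iff h he).2 fun p q c hc => by
          have hn : c * (starRingEnd ℂ) c = 1 := by
            rw [mul_conj', Sph.norm_smul_eq hc]
            norm_num
          change ζ p * (starRingEnd ℂ) (ξ a p) = ζ q * (starRingEnd ℂ) (ξ a q)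
          rw [hζ _ _ _ hc, hξ a _ _ _ hc, map_mul, mul_mul_mul_comm, hn, one_mul]
      have e2 : shiftOp Sph.Step ζ = mulOp Sph.Step (ζ * star (ξ 0)) * shiftOp Sph.Step (ξ 0) +
          mulOp Sph.Step (ζ * star (ξ (1 / 2))) * shiftOp Sph.Step (ξ (1 / 2)) := by
        ext v ⟨Q, k⟩
        change ζ (Q.1 k) * v (Q, k + 1) = ζ (Q.1 k) * (starRingEnd ℂ) (ξ 0 (Q.1 k)) *
          (ξ 0 (Q.1 k) * v (Q, k + 1)) + ζ (Q.1 k) * (starRingEnd ℂ) (ξ (1 / 2) (Q.1 k)) *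
          (ξ (1 / 2) (Q.1 k) * v (Q, k + 1))
        linear_combination (-ζ (Q.1 k) * v (Q, k + 1)) * hsum (Q.1 k)
      rw [e2]
      exact add_mem (mul_mem (hm _ (hprod 0)) (hmem _ (Or.inr (Or.inr (Or.inl rfl)))))
        (mul_mem (hm _ (hprod _)) (hmem _ (Or.inr (Or.inr (Or.inr rfl)))))
  · intro C hmem
    exact ⟨hmem _ (Or.inr (Or.inl rfl)), dense_fibre (hmem _ (Or.inl rfl))
      (hmem _ (Or.inr (Or.inr (Or.inl rfl)))) (hmem _ (Or.inr (Or.inr (Or.inr rfl))))⟩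

end ThetaData

end Sphere

end NC3

end

/-! ### Smooth coefficients and the density of the smooth algebra -/

noncomputable section

namespace NC3

open Complex Topology BoundedContinuousFunction

/-- Smooth functions of the parameters with the quasi-periodicity of the coefficients of
degree `n`. -/
structure IsQP (η : ℝ) (n : ℤ) (f : ℝ × ℝ → ℂ) : Prop where
  smooth : ContDiff ℝ ∞ f
  per : ∀ x y, f (x + 1, y) = f (x, y)
  quasi : ∀ x y, f (x, y + 1) = ph (4 * (n * x - n * (n - 1) / 2 * η)) * f (x, y)

variable {φ : Fin 3 → ℝ}

/-- The coordinates as sections of the line bundle. -/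
def coordSec (h : IsGeneric φ) (i : Fin 4) : Sph φ →ᵇ ℂ :=
  ofNormedAddCommGroup (fun p => p.1 i) ((continuous_apply i).comp continuous_subtype_val)
    (Sph.norm_apply_le h).choose fun p => (Sph.norm_apply_le h).choose_spec p i

lemma coordSec_apply (h : IsGeneric φ) (i : Fin 4) (p : Sph φ) : coordSec h i p = p.1 i := rfl

lemma coordSec_mem (h : IsGeneric φ) (i : Fin 4) : coordSec h i ∈ lineSec φ ∩ smoothFun φ :=
  ⟨fun _ _ _ hc => congrFun hc i, fun z => z i, contDiff_apply ℝ ℂ i, fun _ => rfl⟩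

lemma sum_coordSec (h : IsGeneric φ) (p : Sph φ) :
    ∑ i, (weight φ i : ℂ) * (coordSec h i p * (starRingEnd ℂ) (coordSec h i p)) = 1 := by
  have := congrArg ((↑) : ℝ → ℂ) p.2.2
  rw [hermSq, ofReal_sum, ofReal_one] at this
  refine Eq.trans (Finset.sum_congr rfl fun i _ => ?_) this
  rw [mul_conj']
  push_cast
  rfl

namespace ThetaData

variable (D : ThetaData (absS φ)) (h : IsGeneric φ) (he : IsEven φ)

lemma contDiff_of_mem_smoothFun {a : Sph φ →ᵇ ℂ} (ha : a ∈ smoothFun φ) :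
    ContDiff ℝ ∞ fun X => a (D.frame h he X) := by
  obtain ⟨g, hg, hga⟩ := ha
  simp only [hga]
  exact hg.comp (D.contDiff_frame h he)

-- Smoothness asks for an extension to ℂ⁴. Near a unit vector one extends by a composed with the
-- frame and its local inverse, away from the unit vectors by zero. The prescribed values form
-- convex sets, a point or everything, so a partition of unity patches the local extensions.
open scoped Manifold in
lemma mem_smoothFun {φ : Fin 3 → ℝ} (D : ThetaData (absS φ)) (h : IsGeneric φ) (he : IsEven φ)
    {a : Sph φ →ᵇ ℂ} (ha : a ∈ baseFun φ)
    (hs : ContDiff ℝ ∞ fun X => a (D.frame h he X)) : a ∈ smoothFun φ := by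
  classical
  have hconv : ∀ z : Fin 4 → ℂ, Convex ℝ {c : ℂ | ∀ p : Sph φ, p.1 = z → c = a p} := by
    intro z
    have : {c : ℂ | ∀ p : Sph φ, p.1 = z → c = a p} = ⋂ p : Sph φ, ⋂ _ : p.1 = z, {a p} := by
      ext c
      simp
    rw [this]
    exact convex_iInter fun p => convex_iInter fun _ => convex_singleton _
  obtain ⟨g, hg⟩ := exists_contMDiffMap_forall_mem_convex_of_local (n := (⊤ : ℕ∞))
    𝓘(ℝ, Fin 4 → ℂ) hconv (fun z => by
      by_cases hz : ∃ p : Sph φ, p.1 = z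
      · obtain ⟨p, rfl⟩ := hz
        obtain ⟨r, N, hN, hr, hq⟩ := D.exists_local_inverse h he p
        refine ⟨N, hN, fun z => a (D.frame h he (r z)), fun z hz => ?_, ?_⟩
        · exact (contMDiffAt_iff_contDiffAt.2 (hs.contDiffAt.comp z (hr z hz))).contMDiffWithinAt
        · rintro _ hz q rfl
          obtain ⟨c, hc⟩ := hq q hz
          exact ((D.mem_baseFun_iff h he).1 ha _ _ c hc).symm
      · refine ⟨{z | OnCurve φ z ∧ hermSq φ z = 1}ᶜ, Sph.isClosed_range.isOpen_compl.mem_nhds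
          fun h0 => hz ⟨⟨z, h0⟩, rfl⟩, fun _ => 0, contMDiffOn_const, ?_⟩
        rintro _ hy p rfl
        exact absurd p.2 hy)
  exact ⟨g, contMDiff_iff_contDiff.1 g.contMDiff, fun p => (hg p.1 p rfl).symm⟩

/-- The coefficients of an operator. -/
abbrev cf (T : L2 (Chain (Sph.Step (φ := φ)) × ℤ) →L[ℂ] L2 (Chain (Sph.Step (φ := φ)) × ℤ))
    (n : ℤ) (X : ℝ × ℝ) : ℂ := (D.sphFrame h he).coef T n X

variable {D h he} {T T' : L2 (Chain (Sph.Step (φ := φ)) × ℤ) →L[ℂ] L2 (Chain (Sph.Step (φ := φ)) × ℤ)}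

lemma smooth_le_cross : smoothCrossed φ ≤ cross Sph.Step (baseFun φ) (lineSec φ) :=
  smoothCrossed_le φ

/-- The orbits of (x, y + 1) and (x, y) differ by the phases with exponents 4(x − kη). The gauge
relating them accumulates the exponents over k = 0, …, n − 1, which gives 4(nx − n(n − 1)η/2). -/
lemma cf_succ_snd (hT : T ∈ cross Sph.Step (baseFun φ) (lineSec φ)) (n : ℤ) (x y : ℝ) :
    D.cf h he T n (x, y + 1) =
      ph (4 * (n * x - n * (n - 1) / 2 * D.z₀)) * D.cf h he T n (x, y) := by
  set F := D.sphFrame h he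
  have hfr : ∀ k : ℤ, ((F.chain (x, y + 1)).1 k).1 =
      ph (4 * (x - k * D.z₀)) • ((F.chain (x, y)).1 k).1 := fun k =>
    D.frame_succ_snd h he (x - k * D.z₀) y
  have key := cross_covariant (Q := F.chain (x, y + 1)) (R := F.chain (x, y)) (m := 0)
    (γ := fun k => ph (-(4 * (k * x - k * (k - 1) / 2 * D.z₀)))) (fun k => norm_ph _)
    (fun a ha k => by
      rw [add_zero]
      exact (D.mem_baseFun_iff h he).1 ha _ _ _ (hfr k))
    (fun ξ hξ k => by
      rw [add_zero, hξ _ _ _ (hfr k), ← mul_assoc, ← ph_add]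
      congr 2
      push_cast
      ring) hT
    (v := ph (4 * (n * x - n * (n - 1) / 2 * D.z₀)) • bv (F.chain (x, y), n))
    (v' := bv (F.chain (x, y + 1), n)) (fun k => by
      change bv _ _ = _ * (ph _ * bv _ _)
      rw [bv_apply, bv_apply, add_zero]
      by_cases hk : k = n
      · subst hk
        rw [if_pos rfl, if_pos rfl, ← mul_assoc, ← ph_add, neg_add_cancel, ph_zero, one_mul]
      · rw [if_neg (fun hh => hk (congrArg Prod.snd hh)),
          if_neg (fun hh => hk (congrArg Prod.snd hh)), mul_zero, mul_zero]) 0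
  rw [map_smul] at key
  have h0 : ph (-(4 * (((0 : ℤ) : ℝ) * x - ((0 : ℤ) : ℝ) * (((0 : ℤ) : ℝ) - 1) / 2 * D.z₀))) = 1 := by
    simp [ph_zero]
  exact key.trans ((congrArg (· * _) h0).trans (one_mul _))

variable (D h he)

lemma reg_smooth (hT : T ∈ smoothCrossed φ) : (D.sphFrame h he).Reg ∞ T :=
  (D.sphFrame h he).reg_of_mem Set.inter_subset_left Set.inter_subset_left
    (fun _ ha => D.contDiff_of_mem_smoothFun h he ha.2)
    (fun _ ha => D.contDiff_of_mem_smoothFun h he ha.2) hT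

lemma isQP_cf (hT : T ∈ smoothCrossed φ) (n : ℤ) : IsQP D.z₀ n (D.cf h he T n) where
  smooth := by
    obtain ⟨-, -, hc⟩ := D.reg_smooth h he hT
    exact hc n
  per := (D.sphFrame h he).coef_add_one n
  quasi := cf_succ_snd (smooth_le_cross hT) n

lemma cf_ext (hT : T ∈ cross Sph.Step (baseFun φ) (lineSec φ))
    (hT' : T' ∈ cross Sph.Step (baseFun φ) (lineSec φ))
    (hh : ∀ n X, D.cf h he T n X = D.cf h he T' n X) : T = T' := by
  have hd := sub_mem hT hT'
  refine sub_eq_zero.1 ((D.sphFrame h he).eq_zero hd fun x _ y _ => ?_)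
  ext ⟨Q, k⟩
  by_cases hQ : Q = (D.sphFrame h he).chain (x, y)
  · subst hQ
    rw [OrbitFrame.entry_eq_coef _ hd, OrbitFrame.coef_sub]
    exact sub_eq_zero.2 (hh _ _)
  · exact cross_diagonal hd hQ _ _

lemma cf_sum {α : Type*} (s : Finset α)
    (S : α → (L2 (Chain (Sph.Step (φ := φ)) × ℤ) →L[ℂ] L2 (Chain (Sph.Step (φ := φ)) × ℤ)))
    (n : ℤ) (X : ℝ × ℝ) : D.cf h he (∑ i ∈ s, S i) n X = ∑ i ∈ s, D.cf h he (S i) n X := by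
  classical
  induction s using Finset.induction_on with
  | empty => simp [cf, OrbitFrame.coef]
  | insert i s hi ih =>
    rw [Finset.sum_insert hi, Finset.sum_insert hi, ← ih]
    rfl

/-- `f` is the only coefficient of an element of the smooth algebra. -/
def Realized (n : ℤ) (f : ℝ × ℝ → ℂ) : Prop :=
  ∃ T ∈ smoothCrossed φ, ∀ m X, D.cf h he T m X = if m = n then f X else 0

lemma mulOp_mem_smooth {a : Sph φ →ᵇ ℂ} (ha : a ∈ baseFun φ ∩ smoothFun φ) :
    mulOp Sph.Step a ∈ smoothCrossed φ :=
  StarAlgebra.subset_adjoin ℂ _ (Or.inl ⟨a, ha, rfl⟩)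

lemma shiftOp_mem_smooth (i : Fin 4) : shiftOp Sph.Step (coordSec h i) ∈ smoothCrossed φ :=
  StarAlgebra.subset_adjoin ℂ _ (Or.inr ⟨_, coordSec_mem h i, rfl⟩)

lemma exists_smooth_base {F : ℝ × ℝ → ℂ} (hF : ContDiff ℝ ∞ F)
    (h1 : ∀ x y, F (x + 1, y) = F (x, y)) (h2 : ∀ x y, F (x, y + 1) = F (x, y)) :
    ∃ a ∈ baseFun φ ∩ smoothFun φ, ∀ X, a (D.frame h he X) = F X := by
  obtain ⟨a, ha, haF⟩ := D.exists_base h he hF.continuous h1 h2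
  exact ⟨a, ⟨ha, D.mem_smoothFun h he ha (by rwa [funext haF])⟩, haF⟩

lemma realized_zero {f : ℝ × ℝ → ℂ} (hf : IsQP D.z₀ 0 f) : D.Realized h he 0 f := by
  obtain ⟨a, ha, haf⟩ := D.exists_smooth_base h he hf.smooth hf.per
    (fun x y => by simpa [ph_zero] using hf.quasi x y)
  refine ⟨_, mulOp_mem_smooth ha, fun m X => ?_⟩
  rw [cf, OrbitFrame.coef_mulOp]
  congr 1
  exact haf X

variable {D h he} in
lemma realized_step {n s : ℤ} {f : ℝ × ℝ → ℂ} {g α : Fin 4 → ℝ × ℝ → ℂ}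
    {A : Fin 4 → (L2 (Chain (Sph.Step (φ := φ)) × ℤ) →L[ℂ] L2 (Chain (Sph.Step (φ := φ)) × ℤ))}
    (hA : ∀ i, A i ∈ smoothCrossed φ)
    (hα : ∀ i m X, D.cf h he (A i) m X = if m = s then α i X else 0)
    (hg : ∀ i, D.Realized h he n (g i))
    (hf : ∀ X, f X = ∑ i, (weight φ i : ℂ) * (α i X * g i (X.1 - s * D.z₀, X.2))) :
    D.Realized h he (n + s) f := by
  choose T hT hTg using hg
  refine ⟨∑ i, (weight φ i : ℂ) • (A i * T i), sum_mem fun i _ =>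
    (smoothCrossed φ).smul_mem (mul_mem (hA i) (hT i)) _, fun m X => ?_⟩
  have e : ∀ i, D.cf h he (A i * T i) m X =
      if m = n + s then α i X * g i (X.1 - s * D.z₀, X.2) else 0 := fun i => by
    rw [cf, OrbitFrame.coef_mul _ (smooth_le_cross (hA i)) (smooth_le_cross (hT i)) X (s := {s})
      (fun k hk => (hα i k X).trans (if_neg (by simpa using hk))), Finset.sum_singleton]
    change D.cf h he (A i) s X * D.cf h he (T i) (m - s) (X.1 - s * D.z₀, X.2) = _
    rw [hα, if_pos rfl, hTg]
    simp only [sub_eq_iff_eq_add, mul_ite, mul_zero]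
  rw [cf_sum, hf]
  have e2 : ∀ i, D.cf h he ((weight φ i : ℂ) • (A i * T i)) m X =
    (weight φ i : ℂ) * D.cf h he (A i * T i) m X := fun i => rfl
  simp only [e2, e]
  split_ifs
  · rfl
  · simp

/-- The coordinates z_i are smooth sections with Σ w_i |z_i|² = 1, so f = Σ w_i z_i (z̄_i f), where
z̄_i f, shifted in x, has one degree less. Exchanging z_i and z̄_i lowers the degree instead.
Induction in both directions starts from the smooth functions on the curve in degree 0. -/
lemma realized {n : ℤ} : ∀ {f : ℝ × ℝ → ℂ}, IsQP D.z₀ n f → D.Realized h he n f := by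
  have hz : ∀ i, ContDiff ℝ ∞ fun X => (D.frame h he X).1 i := fun i =>
    contDiff_pi.1 (D.contDiff_frame h he) i
  have hz1 : ∀ i x y, (D.frame h he (x + 1, y)).1 i = (D.frame h he (x, y)).1 i :=
    fun i x y => by rw [D.frame_add_one h he]
  have hz2 : ∀ i x y, (D.frame h he (x, y + 1)).1 i = ph (4 * x) * (D.frame h he (x, y)).1 i :=
    fun i x y => congrFun (D.frame_succ_snd h he x y) i
  induction n using Int.induction_on with
  | zero => exact D.realized_zero h he
  | succ n ih =>
    intro f hf
    refine realized_step (A := fun i => shiftOp Sph.Step (coordSec h i))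
      (α := fun i X => (D.frame h he X).1 i)
      (g := fun i X => (starRingEnd ℂ) ((D.frame h he (X.1 + D.z₀, X.2)).1 i) *
        f (X.1 + D.z₀, X.2)) (fun i => shiftOp_mem_smooth h i)
      (fun i m X => OrbitFrame.coef_shiftOp _ _ _ _) (fun i => ih ⟨?_, fun x y => ?_, fun x y => ?_⟩)
      (fun X => ?_)
    · have := (OrbitFrame.contDiff_conj (hz i)).mul hf.smooth
      simpa using OrbitFrame.contDiff_shift this (-D.z₀)
    · simp only
      rw [add_right_comm, hz1, hf.per]
    · simp only
      rw [hz2, hf.quasi, map_mul, conj_ph, mul_mul_mul_comm, ← ph_add]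
      congr 2
      push_cast
      ring
    · have := sum_coordSec h (D.frame h he X)
      simp only [Int.cast_one, one_mul, sub_add_cancel]
      refine ((one_mul (f X)).symm.trans (congrArg (· * f X) this.symm)).trans ?_
      rw [Finset.sum_mul]
      exact Finset.sum_congr rfl fun i _ => by simp only [coordSec_apply]; ring
  | pred n ih =>
    intro f hf
    refine realized_step (s := -1) (A := fun i => star (shiftOp Sph.Step (coordSec h i)))
      (α := fun i X => (starRingEnd ℂ) ((D.frame h he (X.1 + D.z₀, X.2)).1 i))
      (g := fun i X => (D.frame h he X).1 i * f (X.1 - D.z₀, X.2))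
      (fun i => star_mem (shiftOp_mem_smooth h i))
      (fun i m X => OrbitFrame.coef_star_shiftOp _ _ _ _)
      (fun i => ih ⟨?_, fun x y => ?_, fun x y => ?_⟩) (fun X => ?_)
    · exact (hz i).mul (OrbitFrame.contDiff_shift hf.smooth _)
    · simp only
      rw [add_sub_right_comm, hz1, hf.per]
    · simp only
      rw [hz2, hf.quasi, mul_mul_mul_comm, ← ph_add]
      congr 2
      push_cast
      ring
    · have := sum_coordSec h (D.frame h he (X.1 + D.z₀, X.2))
      simp only [Int.cast_neg, Int.cast_one, neg_one_mul, sub_neg_eq_add, add_sub_cancel_right]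
      refine ((one_mul (f X)).symm.trans (congrArg (· * f X) this.symm)).trans ?_
      rw [Finset.sum_mul]
      exact Finset.sum_congr rfl fun i _ => by simp only [coordSec_apply]; ring

/-- Finite families of smooth quasi-periodic functions are the coefficients of elements of the
smooth algebra. -/
theorem exists_smooth {t : ℤ → ℝ × ℝ → ℂ} (ht : ∀ n, IsQP D.z₀ n (t n)) {N : ℕ}
    (hN : ∀ n : ℤ, (N : ℤ) < |n| → ∀ X, t n X = 0) :
    ∃ T : smoothCrossed φ, ∀ n X, D.cf h he T.1 n X = t n X := by
  choose S hS hSt using fun n => D.realized h he (ht n)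
  refine ⟨⟨∑ n ∈ Finset.Icc (-(N : ℤ)) N, S n, sum_mem fun n _ => hS n⟩, fun n X => ?_⟩
  change D.cf h he (∑ n ∈ Finset.Icc (-(N : ℤ)) N, S n) n X = _
  rw [cf_sum]
  simp only [hSt]
  rw [Finset.sum_ite_eq]
  split_ifs with hn
  · rfl
  · exact (hN n (OrbitFrame.mem_Icc_of_abs_le hn) X).symm

/-- The smooth algebra is dense. -/
theorem topologicalClosure_smooth {φ : Fin 3 → ℝ} (D : ThetaData (absS φ)) (h : IsGeneric φ)
    (he : IsEven φ) : (smoothCrossed φ).topologicalClosure = crossedProduct φ := by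
  refine le_antisymm (StarSubalgebra.topologicalClosure_minimal (smoothCrossed_le φ)
    (StarSubalgebra.isClosed_topologicalClosure _)) ?_
  have hC := StarSubalgebra.isClosed_topologicalClosure (smoothCrossed φ)
  have hle : ∀ T ∈ smoothCrossed φ, T ∈ (smoothCrossed φ).topologicalClosure := fun T hT =>
    (smoothCrossed φ).le_topologicalClosure hT
  obtain ⟨a₁, hb₁, ha₁⟩ := D.exists_smooth_base h he (F := fun X => ph X.1)
    (contDiff_ph.comp contDiff_fst) (fun x y => by simpa using ph_add_int x 1) (by simp)
  obtain ⟨a₂, hb₂, ha₂⟩ := D.exists_smooth_base h he (F := fun X => ph X.2)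
    (contDiff_ph.comp contDiff_snd) (by simp) (fun x y => by simpa using ph_add_int y 1)
  have hm : ∀ a ∈ baseFun φ, mulOp Sph.Step a ∈ (smoothCrossed φ).topologicalClosure :=
    fun a ha => D.mulOp_mem_of_isClosed h he hC hb₁.1 hb₂.1 ha₁ ha₂
      (hle _ (mulOp_mem_smooth hb₁)) (hle _ (mulOp_mem_smooth hb₂)) ha
  refine StarSubalgebra.topologicalClosure_minimal (StarAlgebra.adjoin_le ?_) hC
  rintro _ (⟨a, ha, rfl⟩ | ⟨ξ, hξ, rfl⟩)
  · exact hm a ha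
  -- The identity Σ w_i |z_i|² = 1 writes any continuous section as a combination of the smooth
  -- coordinate sections with continuous functions as coefficients. Those functions are already in
  -- the closure, since exp(2πix) and exp(2πiy) separate the points of the curve.
  · have e : shiftOp Sph.Step ξ = ∑ i, (weight φ i : ℂ) •
        (mulOp Sph.Step (ξ * star (coordSec h i)) * shiftOp Sph.Step (coordSec h i)) := by
      ext v ⟨Q, k⟩
      have hsum : ∀ S : Fin 4 → (L2 (Chain (Sph.Step (φ := φ)) × ℤ) →L[ℂ]
          L2 (Chain (Sph.Step (φ := φ)) × ℤ)), (∑ i, S i) v (Q, k) = ∑ i, S i v (Q, k) := by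
        intro S
        rw [Fin.sum_univ_four, Fin.sum_univ_four]
        rfl
      rw [hsum, shiftOp_apply, ← one_mul (ξ _ * _), ← sum_coordSec h (Q.1 k), Finset.sum_mul]
      refine Finset.sum_congr rfl fun i _ => ?_
      change _ = (weight φ i : ℂ) * ((ξ (Q.1 k) * (starRingEnd ℂ) (coordSec h i (Q.1 k))) *
        (coordSec h i (Q.1 k) * v (Q, k + 1)))
      ring
    rw [e]
    refine sum_mem fun i _ => StarSubalgebra.smul_mem _ (mul_mem (hm _ ?_)
      (hle _ (shiftOp_mem_smooth h i))) _
    refine (D.mem_baseFun_iff h he).2 fun p q c hc => ?_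
    have hn : c * (starRingEnd ℂ) c = 1 := by
      rw [mul_conj', Sph.norm_smul_eq hc]
      norm_num
    change ξ p * (starRingEnd ℂ) (coordSec h i p) = ξ q * (starRingEnd ℂ) (coordSec h i q)
    rw [hξ _ _ _ hc, (coordSec_mem h i).1 _ _ _ hc, map_mul, mul_mul_mul_comm, hn, one_mul]

end ThetaData

end NC3

end

/-! ### The Heisenberg operators on coefficients -/

noncomputable section

namespace NC3

open Complex Topology

lemma hasDerivAt_ph (x : ℝ) : HasDerivAt ph (2 * Real.pi * I * ph x) x := by
  have h1 : HasDerivAt (fun x : ℝ => ((2 * Real.pi * x : ℝ) : ℂ) * I) (2 * Real.pi * I) x := by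
    simpa using (((hasDerivAt_id x).const_mul (2 * Real.pi)).ofReal_comp).mul_const I
  refine h1.cexp.congr_deriv ?_
  rw [ph, mul_comm]

/-- The action of the Heisenberg Lie algebra on the coefficients of degree `n`. -/
def heisOp (A : Matrix (Fin 3) (Fin 3) ℝ) (n : ℤ) (f : ℝ × ℝ → ℂ) (P : ℝ × ℝ) : ℂ :=
  fderiv ℝ f P (A 0 1, A 1 2) + 8 * Real.pi * I * n * (A 0 2 - A 0 1 * P.2) * f P

section heisOp

variable {A B : Matrix (Fin 3) (Fin 3) ℝ} {n k l : ℤ} {f g : ℝ × ℝ → ℂ} {P : ℝ × ℝ} {η : ℝ}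

lemma heisOp_add_left : heisOp (A + B) n f P = heisOp A n f P + heisOp B n f P := by
  simp only [heisOp, Matrix.add_apply]
  rw [← Prod.mk_add_mk, map_add]
  push_cast
  ring

lemma heisOp_smul_left (r : ℝ) : heisOp (r • A) n f P = r * heisOp A n f P := by
  simp only [heisOp, Matrix.smul_apply]
  rw [← Prod.smul_mk, map_smul]
  simp only [real_smul, smul_eq_mul]
  push_cast
  ring

lemma heisOp_sum {ι : Type*} (s : Finset ι) {f : ι → ℝ × ℝ → ℂ}
    (hf : ∀ i ∈ s, DifferentiableAt ℝ (f i) P) :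
    heisOp A n (fun X => ∑ i ∈ s, f i X) P = ∑ i ∈ s, heisOp A n (f i) P := by
  simp only [heisOp]
  rw [fderiv_fun_sum hf, Finset.sum_add_distrib, Finset.mul_sum, _root_.sum_apply]

lemma heisOp_add (hf : DifferentiableAt ℝ f P) (hg : DifferentiableAt ℝ g P) :
    heisOp A n (fun X => f X + g X) P = heisOp A n f P + heisOp A n g P := by
  simp only [heisOp]
  rw [fderiv_fun_add hf hg, _root_.add_apply]
  ring

lemma heisOp_const_mul (c : ℂ) (hf : DifferentiableAt ℝ f P) :
    heisOp A n (fun X => c * f X) P = c * heisOp A n f P := by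
  simp only [heisOp]
  rw [fderiv_const_mul hf, _root_.smul_apply, smul_eq_mul]
  ring

/-- The zeroth order term is proportional to the degree, hence additive under products, so the
Leibniz rule for the derivative survives. -/
lemma heisOp_mul (hf : DifferentiableAt ℝ f P) (hg : DifferentiableAt ℝ g P) :
    heisOp A (k + l) (fun X => f X * g X) P = heisOp A k f P * g P + f P * heisOp A l g P := by
  simp only [heisOp]
  rw [fderiv_fun_mul hf hg]
  simp only [_root_.add_apply, _root_.smul_apply, smul_eq_mul]
  push_cast
  ring

/-- The coefficients of the operator depend on y only, so it commutes with the shifts in x of the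
twisted convolution. -/
lemma heisOp_shift (c : ℝ) :
    heisOp A n (fun X => f (X.1 - c, X.2)) P = heisOp A n f (P.1 - c, P.2) := by
  have e : (fun X : ℝ × ℝ => f (X.1 - c, X.2)) = fun X => f (X - (c, 0)) := by
    funext X
    congr 1
    ext <;> simp
  have e' : P - (c, 0) = (P.1 - c, P.2) := by ext <;> simp
  simp only [heisOp, e, fderiv_comp_sub, e']

lemma heisOp_conj (hf : DifferentiableAt ℝ f P) :
    heisOp A n (fun X => (starRingEnd ℂ) (f X)) P = (starRingEnd ℂ) (heisOp A (-n) f P) := by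
  have := (conjCLE.toContinuousLinearMap.hasFDerivAt (x := f P)).comp P hf.hasFDerivAt
  simp only [heisOp]
  rw [show (fun X => (starRingEnd ℂ) (f X)) = conjCLE.toContinuousLinearMap ∘ f from rfl,
    this.fderiv]
  simp [map_ofNat]

lemma contDiff_heisOp (hf : ContDiff ℝ ∞ f) : ContDiff ℝ ∞ (heisOp A n f) := by
  have h1 : ContDiff ℝ ∞ fun P => fderiv ℝ f P (A 0 1, A 1 2) :=
    (hf.fderiv_right (m := ∞) (by simp)).clm_apply contDiff_const
  have h2 : ContDiff ℝ ∞ fun P : ℝ × ℝ => (P.2 : ℂ) := ofRealCLM.contDiff.comp contDiff_snd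
  exact h1.add ((contDiff_const.mul (contDiff_const.sub (contDiff_const.mul h2))).mul hf)

lemma IsQP.differentiable (hf : IsQP η n f) : Differentiable ℝ f :=
  hf.smooth.differentiable (by simp)

/-- The x-derivative of the quasi-periodicity factor produces 8πin A₀₁, and the term −8πin A₀₁ y
changes by exactly the opposite amount when y increases by 1. -/
lemma IsQP.heisOp (hf : IsQP η n f) : IsQP η n (heisOp A n f) where
  smooth := contDiff_heisOp hf.smooth
  per x y := by
    have e : f = fun X => f (X + (1, 0)) := by
      funext ⟨x, y⟩
      simpa using (hf.per x y).symm
    have e2 := congrArg (fun F => fderiv ℝ F (x, y)) e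
    simp only [fderiv_comp_add_right, Prod.mk_add_mk, add_zero] at e2
    simp only [NC3.heisOp, hf.per, e2]
  quasi x y := by
    have e : (fun X => f (X + (0, 1))) = fun X : ℝ × ℝ =>
        ph (4 * (n * X.1 - n * (n - 1) / 2 * η)) * f X := by
      funext ⟨x, y⟩
      simpa using hf.quasi x y
    have hd : HasFDerivAt (fun X : ℝ × ℝ => ph (4 * (n * X.1 - n * (n - 1) / 2 * η)))
        ((ContinuousLinearMap.fst ℝ ℝ ℝ).smulRight
          (8 * Real.pi * I * n * ph (4 * (n * x - n * (n - 1) / 2 * η)))) (x, y) := by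
      have h1 : HasFDerivAt (fun X : ℝ × ℝ => 4 * (n * X.1 - n * (n - 1) / 2 * η))
          ((4 : ℝ) • ((n : ℝ) • ContinuousLinearMap.fst ℝ ℝ ℝ)) (x, y) :=
        ((hasFDerivAt_fst.const_mul (n : ℝ)).sub_const _).const_mul 4
      refine ((hasDerivAt_ph _).hasFDerivAt.comp (x, y) h1).congr_fderiv ?_
      ext <;> simp
      ring
    have e2 := congrArg (fun F => fderiv ℝ F (x, y)) e
    simp only [fderiv_comp_add_right, Prod.mk_add_mk, add_zero] at e2
    replace e2 := e2.trans (hd.mul hf.differentiable.differentiableAt.hasFDerivAt).fderiv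
    simp only [NC3.heisOp, hf.quasi, e2, _root_.add_apply,
      _root_.smul_apply, ContinuousLinearMap.smulRight_apply, smul_eq_mul,
      ContinuousLinearMap.coe_fst', real_smul]
    push_cast
    ring

/-- The second derivatives cancel by symmetry. What remains comes from differentiating the
multiplier y and is 8πin(A₀₁B₁₂ − B₀₁A₁₂), the action of the only nonzero entry of the bracket. -/
lemma heisOp_lie (hA : ∀ i j, j ≤ i → A i j = 0) (hB : ∀ i j, j ≤ i → B i j = 0)
    (hf : ContDiff ℝ ∞ f) : heisOp ⁅A, B⁆ n f P =
      heisOp A n (heisOp B n f) P - heisOp B n (heisOp A n f) P := by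
  have hsym := (hf.contDiffAt (x := P)).isSymmSndFDerivAt (by
    rw [minSmoothness_of_isRCLikeNormedField]
    exact WithTop.coe_le_coe.2 le_top)
  have hdd : DifferentiableAt ℝ (fderiv ℝ f) P :=
    (hf.fderiv_right (m := ∞) (by simp)).differentiable (by simp) P
  have key : ∀ (B : Matrix (Fin 3) (Fin 3) ℝ) (u : ℝ × ℝ), fderiv ℝ (heisOp B n f) P u =
      fderiv ℝ (fderiv ℝ f) P u (B 0 1, B 1 2) + 8 * Real.pi * I * n *
        ((B 0 2 - B 0 1 * P.2) * fderiv ℝ f P u - B 0 1 * u.2 * f P) := by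
    intro B u
    have h1 := hdd.hasFDerivAt.clm_apply (hasFDerivAt_const ((B 0 1, B 1 2) : ℝ × ℝ) P)
    have h2 : HasFDerivAt (fun P : ℝ × ℝ => (P.2 : ℂ))
        (ofRealCLM.comp (ContinuousLinearMap.snd ℝ ℝ ℝ)) P :=
      ofRealCLM.hasFDerivAt.comp P hasFDerivAt_snd
    have h3 := (((h2.const_mul (B 0 1 : ℂ)).const_sub (B 0 2 : ℂ)).const_mul
      (8 * Real.pi * I * n)).mul (hf.differentiable (by simp) P).hasFDerivAt
    have := (h1.add h3).fderiv
    change fderiv ℝ (heisOp B n f) P = _ at this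
    rw [this]
    simp
    ring
  have e1 : ⁅A, B⁆ 0 1 = 0 := by
    simp [Ring.lie_def, Matrix.mul_apply, Fin.sum_univ_three, hA, hB]
  have e2 : ⁅A, B⁆ 1 2 = 0 := by
    simp [Ring.lie_def, Matrix.mul_apply, Fin.sum_univ_three, hA, hB]
  have e3 : ⁅A, B⁆ 0 2 = A 0 1 * B 1 2 - B 0 1 * A 1 2 := by
    simp [Ring.lie_def, Matrix.mul_apply, Fin.sum_univ_three, hA, hB]
  rw [heisOp.eq_1 A n (heisOp B n f), heisOp.eq_1 B n (heisOp A n f), heisOp.eq_1 ⁅A, B⁆, key, key, hsym.eq, e1, e2, e3]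
  simp only [heisOp, Prod.mk_zero_zero, map_zero]
  push_cast
  ring

end heisOp

end NC3

end

/-! ### Derivations of the smooth algebra and invariance of the trace -/

noncomputable section

namespace NC3

open Complex Topology MeasureTheory BoundedContinuousFunction

namespace ThetaData

variable {φ : Fin 3 → ℝ} (D : ThetaData (absS φ)) (h : IsGeneric φ) (he : IsEven φ)

lemma smooth_ext {a b : smoothCrossed φ} (hab : ∀ n X, D.cf h he a.1 n X = D.cf h he b.1 n X) :
    a = b :=
  Subtype.ext (D.cf_ext h he (smooth_le_cross a.2) (smooth_le_cross b.2) hab)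

lemma differentiable_cf (a : smoothCrossed φ) (n : ℤ) : Differentiable ℝ (D.cf h he a.1 n) :=
  (D.isQP_cf h he a.2 n).differentiable

lemma exists_deriv (A : Matrix (Fin 3) (Fin 3) ℝ) (a : smoothCrossed φ) :
    ∃ b : smoothCrossed φ, ∀ n X, D.cf h he b.1 n X = heisOp A n (D.cf h he a.1 n) X := by
  obtain ⟨N, hN, -⟩ := D.reg_smooth h he a.2
  refine D.exists_smooth h he (fun n => (D.isQP_cf h he a.2 n).heisOp) (N := N) fun n hn X => ?_
  have : D.cf h he a.1 n = fun _ => 0 := funext (hN n hn)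
  rw [this]
  simp [heisOp]

/-- The action on elements of the smooth algebra. -/
def derivFun (A : Matrix (Fin 3) (Fin 3) ℝ) (a : smoothCrossed φ) : smoothCrossed φ :=
  (D.exists_deriv h he A a).choose

lemma cf_derivFun (A : Matrix (Fin 3) (Fin 3) ℝ) (a : smoothCrossed φ) (n : ℤ) (X : ℝ × ℝ) :
    D.cf h he (D.derivFun h he A a).1 n X = heisOp A n (D.cf h he a.1 n) X :=
  (D.exists_deriv h he A a).choose_spec n X

/-- The action as linear maps. -/
def derivEnd (A : Matrix (Fin 3) (Fin 3) ℝ) : Module.End ℂ (smoothCrossed φ) where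
  toFun := D.derivFun h he A
  map_add' a b := D.smooth_ext h he fun n X => by
    rw [cf_derivFun]
    exact (heisOp_add (D.differentiable_cf h he a n _) (D.differentiable_cf h he b n _)).trans
      (congrArg₂ (· + ·) (D.cf_derivFun h he A a n X) (D.cf_derivFun h he A b n X)).symm
  map_smul' c a := D.smooth_ext h he fun n X => by
    rw [cf_derivFun]
    exact (heisOp_const_mul c (D.differentiable_cf h he a n _)).trans
      (congrArg (c * ·) (D.cf_derivFun h he A a n X)).symm

/-- The action of the Heisenberg Lie algebra on the smooth algebra. -/
def deriv : heisenberg →ₗ⁅ℝ⁆ Module.End ℂ (smoothCrossed φ) where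
  toFun X := D.derivEnd h he X.1
  map_add' A B := by
    refine LinearMap.ext fun a => D.smooth_ext h he fun n X => ?_
    refine (D.cf_derivFun h he _ a n X).trans (heisOp_add_left.trans ?_)
    exact (congrArg₂ (· + ·) (D.cf_derivFun h he A a n X) (D.cf_derivFun h he B a n X)).symm
  map_smul' r A := by
    refine LinearMap.ext fun a => D.smooth_ext h he fun n X => ?_
    refine (D.cf_derivFun h he _ a n X).trans ((heisOp_smul_left r).trans ?_)
    exact (congrArg ((r : ℂ) * ·) (D.cf_derivFun h he A a n X)).symm
  map_lie' {A B} := by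
    refine LinearMap.ext fun a => D.smooth_ext h he fun n X => ?_
    refine (D.cf_derivFun h he _ a n X).trans
      ((heisOp_lie A.2 B.2 (D.isQP_cf h he a.2 n).smooth).trans ?_)
    rw [← funext (D.cf_derivFun h he A a n), ← funext (D.cf_derivFun h he B a n),
      ← cf_derivFun, ← cf_derivFun]
    rfl

lemma cf_deriv (A : heisenberg) (a : smoothCrossed φ) (n : ℤ) (X : ℝ × ℝ) :
    D.cf h he (D.deriv h he A a).1 n X = heisOp A.1 n (D.cf h he a.1 n) X :=
  D.cf_derivFun h he A.1 a n X

lemma exists_support (a : smoothCrossed φ) :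
    ∃ s : Finset ℤ, ∀ k ∉ s, ∀ X, D.cf h he a.1 k X = 0 := by
  obtain ⟨N, hN, -⟩ := D.reg_smooth h he a.2
  exact ⟨_, fun k hk => hN k (OrbitFrame.mem_Icc_of_abs_le hk)⟩

variable {D h he} in
lemma cf_mul {a : smoothCrossed φ} {s : Finset ℤ} (hs : ∀ k ∉ s, ∀ X, D.cf h he a.1 k X = 0)
    (b : smoothCrossed φ) (n : ℤ) (X : ℝ × ℝ) : D.cf h he (a * b).1 n X =
      ∑ k ∈ s, D.cf h he a.1 k X * D.cf h he b.1 (n - k) (X.1 - k * D.z₀, X.2) :=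
  OrbitFrame.coef_mul _ (smooth_le_cross a.2) (smooth_le_cross b.2) X (fun k hk => hs k hk X) n

lemma heisOp_sum_mul_shift {A : Matrix (Fin 3) (Fin 3) ℝ} (s : Finset ℤ) {η : ℝ}
    {t t' : ℤ → ℝ × ℝ → ℂ} (ht : ∀ n, ContDiff ℝ ∞ (t n)) (ht' : ∀ n, ContDiff ℝ ∞ (t' n))
    (n : ℤ) (X : ℝ × ℝ) :
    heisOp A n (fun X => ∑ k ∈ s, t k X * t' (n - k) (X.1 - k * η, X.2)) X =
      (∑ k ∈ s, heisOp A k (t k) X * t' (n - k) (X.1 - k * η, X.2)) +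
        ∑ k ∈ s, t k X * heisOp A (n - k) (t' (n - k)) (X.1 - k * η, X.2) := by
  have hd : ∀ k, DifferentiableAt ℝ (t k) X := fun k => (ht k).differentiable (by simp) X
  have hsh : ∀ k : ℤ, DifferentiableAt ℝ (fun X : ℝ × ℝ => t' (n - k) (X.1 - k * η, X.2)) X :=
    fun k => (OrbitFrame.contDiff_shift (ht' (n - k)) _).differentiable (by simp) X
  rw [heisOp_sum s fun k _ => (hd k).fun_mul (hsh k), ← Finset.sum_add_distrib]
  refine Finset.sum_congr rfl fun k _ => ?_
  have := heisOp_mul (A := A) (k := k) (l := n - k) (hd k) (hsh k)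
  rwa [add_sub_cancel, heisOp_shift] at this

lemma cf_mul_add_mul {a a' b b' : smoothCrossed φ} {s : Finset ℤ}
    (hs : ∀ k ∉ s, ∀ X, D.cf h he a.1 k X = 0) (hs' : ∀ k ∉ s, ∀ X, D.cf h he a'.1 k X = 0)
    (n : ℤ) (X : ℝ × ℝ) : D.cf h he (a' * b + a * b').1 n X =
      (∑ k ∈ s, D.cf h he a'.1 k X * D.cf h he b.1 (n - k) (X.1 - k * D.z₀, X.2)) +
        ∑ k ∈ s, D.cf h he a.1 k X * D.cf h he b'.1 (n - k) (X.1 - k * D.z₀, X.2) :=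
  congrArg₂ (· + ·) (cf_mul hs' b n X) (cf_mul hs b' n X)

lemma cf_deriv_mul (A : heisenberg) {a b : smoothCrossed φ} {s : Finset ℤ}
    (hs : ∀ k ∉ s, ∀ X, D.cf h he a.1 k X = 0) (n : ℤ) (X : ℝ × ℝ) :
    D.cf h he (D.deriv h he A (a * b)).1 n X =
      D.cf h he (D.deriv h he A a * b + a * D.deriv h he A b).1 n X := by
  have hs' : ∀ k ∉ s, ∀ X, D.cf h he (D.deriv h he A a).1 k X = 0 := fun k hk X => by
    rw [cf_deriv, show D.cf h he a.1 k = fun _ => 0 from funext (hs k hk)]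
    simp [heisOp]
  refine (D.cf_deriv h he A (a * b) n X).trans ?_
  refine Eq.trans ?_ (D.cf_mul_add_mul h he hs hs' n X).symm
  refine (congrArg (fun f => heisOp A.1 n f X) (funext (cf_mul hs b n))).trans ?_
  refine (heisOp_sum_mul_shift _ (fun n => (D.isQP_cf h he a.2 n).smooth)
    (fun n => (D.isQP_cf h he b.2 n).smooth) n X).trans ?_
  simp only [cf_deriv]

lemma deriv_mul (A : heisenberg) (a b : smoothCrossed φ) :
    D.deriv h he A (a * b) = D.deriv h he A a * b + a * D.deriv h he A b :=
  (D.exists_support h he a).elim fun _ hs => D.smooth_ext h he (D.cf_deriv_mul h he A hs)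

lemma deriv_star (A : heisenberg) (a : smoothCrossed φ) :
    D.deriv h he A (star a) = star (D.deriv h he A a) := by
  refine D.smooth_ext h he fun n X => ?_
  have st : ∀ (a : smoothCrossed φ) (X : ℝ × ℝ), D.cf h he (star a).1 n X =
      (starRingEnd ℂ) (D.cf h he a.1 (-n) (X.1 - n * D.z₀, X.2)) := fun a X =>
    OrbitFrame.coef_star _ (smooth_le_cross a.2) n X
  rw [cf_deriv, st, cf_deriv, funext (st a), heisOp_conj, heisOp_shift]
  exact (OrbitFrame.contDiff_shift (D.isQP_cf h he a.2 (-n)).smooth _).differentiable (by simp) X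

/-- The functions exp(2πix) and exp(2πiy) in degree 0 detect A₀₁ and A₁₂. In degree 1 the coordinate
sections, which do not all vanish at a point, detect A₀₂. -/
lemma deriv_injective : Function.Injective (D.deriv h he) := by
  refine (injective_iff_map_eq_zero _).2 fun A hA => ?_
  have key : ∀ (a : smoothCrossed φ) n X, heisOp A.1 n (D.cf h he a.1 n) X = 0 := fun a n X => by
    rw [← cf_deriv, hA]
    exact congrArg (fun T => D.cf h he T n X) (ZeroMemClass.coe_zero (smoothCrossed φ))
  have base : ∀ F : ℝ × ℝ → ℂ, IsQP D.z₀ 0 F → heisOp A.1 0 F 0 = 0 := fun F hF => by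
    obtain ⟨T, hT, hTF⟩ := D.realized_zero h he hF
    rw [← key ⟨T, hT⟩ 0 0]
    congr 1
    exact funext fun X => (hTF 0 X).symm
  have h01 : A.1 0 1 = 0 := by
    have hd := (hasDerivAt_ph 0).hasFDerivAt.comp (0 : ℝ × ℝ) (hasFDerivAt_fst (𝕜 := ℝ) (E := ℝ) (F := ℝ) (p := 0))
    have := base (fun X => ph X.1) ⟨contDiff_ph.comp contDiff_fst,
      fun x y => by simpa using ph_add_int x 1, fun x y => by simp [ph_zero]⟩
    rw [heisOp, show (fun X : ℝ × ℝ => ph X.1) = ph ∘ Prod.fst from rfl, hd.fderiv] at this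
    simpa [ph_zero, Real.pi_ne_zero] using this
  have h12 : A.1 1 2 = 0 := by
    have hd := (hasDerivAt_ph 0).hasFDerivAt.comp (0 : ℝ × ℝ) (hasFDerivAt_snd (𝕜 := ℝ) (E := ℝ) (F := ℝ) (p := 0))
    have := base (fun X => ph X.2) ⟨contDiff_ph.comp contDiff_snd,
      fun x y => rfl, fun x y => by simpa [ph_zero] using ph_add_int y 1⟩
    rw [heisOp, show (fun X : ℝ × ℝ => ph X.2) = ph ∘ Prod.snd from rfl, hd.fderiv] at this
    simpa [ph_zero, Real.pi_ne_zero] using this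
  have h02 : A.1 0 2 = 0 := by
    by_contra h02
    have hz : ∀ i, (D.frame h he 0).1 i = 0 := fun i => by
      have := key ⟨_, shiftOp_mem_smooth h i⟩ 1 0
      rw [heisOp, h01, h12, Prod.mk_zero_zero, map_zero, cf, OrbitFrame.coef_shiftOp] at this
      have e : coordSec h i ((D.sphFrame h he).e 0) = 0 := by
        simpa [Real.pi_ne_zero, h02] using this
      exact e
    have := sum_coordSec h (D.frame h he 0)
    simp [coordSec_apply, hz] at this
  ext i j
  have hl := A.2
  fin_cases i <;> fin_cases j <;>
    first | exact hl _ _ (by decide) | exact h01 | exact h12 | exact h02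

lemma isDerivationAction : IsDerivationAction (D.deriv h he) where
  leibniz := D.deriv_mul h he
  map_star := D.deriv_star h he
  injective := D.deriv_injective h he

/-- The invariant trace. -/
def trace : crossedProduct φ →ₗ[ℂ] ℂ := (D.sphFrame h he).tr.toLinearMap

lemma trace_apply (T : crossedProduct φ) : D.trace h he T = avg (D.cf h he T.1 0) := rfl

lemma isFaithfulTrace : IsFaithfulTrace (D.trace h he) where
  map_one := (D.sphFrame h he).tr_one
  trace := (D.sphFrame h he).tr_mul_comm
  real a := by
    have := congrArg Complex.im ((D.sphFrame h he).tr_star_mul_self a)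
    exact this.trans (ofReal_im _)
  pos _ ha := (D.sphFrame h he).tr_pos ha

end ThetaData

lemma hasDerivAt_fst {f : ℝ × ℝ → ℂ} (hf : Differentiable ℝ f) (x y : ℝ) :
    HasDerivAt (fun x => f (x, y)) (fderiv ℝ f (x, y) (1, 0)) x :=
  (hf (x, y)).hasFDerivAt.comp_hasDerivAt x ((hasDerivAt_id x).prodMk (hasDerivAt_const x y))

lemma hasDerivAt_snd {f : ℝ × ℝ → ℂ} (hf : Differentiable ℝ f) (x y : ℝ) :
    HasDerivAt (fun y => f (x, y)) (fderiv ℝ f (x, y) (0, 1)) y :=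
  (hf (x, y)).hasFDerivAt.comp_hasDerivAt y ((hasDerivAt_const y x).prodMk (hasDerivAt_id y))

lemma avg_swap {E : Type*} [NormedAddCommGroup E] [NormedSpace ℝ E] {f : ℝ × ℝ → E}
    (hf : Continuous f) : avg (fun X => f (X.2, X.1)) = avg f :=
  intervalIntegral_intervalIntegral_swap (F := fun y x => f (y, x))
    (hf.continuousOn.integrableOn_compact (isCompact_uIcc.prod isCompact_uIcc) |>.mono_set
      (Set.prod_mono Set.uIoc_subset_uIcc Set.uIoc_subset_uIcc))

lemma avg_fderiv {f : ℝ × ℝ → ℂ} (hf : ContDiff ℝ ∞ f) (h1 : ∀ x y, f (x + 1, y) = f (x, y))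
    (h2 : ∀ x y, f (x, y + 1) = f (x, y)) (u : ℝ × ℝ) : avg (fun X => fderiv ℝ f X u) = 0 := by
  have hd : Differentiable ℝ f := hf.differentiable (by simp)
  have hc : ∀ v, Continuous fun X => fderiv ℝ f X v := fun v =>
    (hf.continuous_fderiv (by simp)).clm_apply continuous_const
  have e1 : avg (fun X => fderiv ℝ f X (1, 0)) = 0 := by
    refine (intervalIntegral.integral_congr (g := fun _ => 0) fun y _ => ?_).trans (by simp)
    refine (intervalIntegral.integral_eq_sub_of_hasDerivAt (fun x _ => hasDerivAt_fst hd x y)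
      ((continuous_slice (hc _) y).intervalIntegrable _ _)).trans ?_
    rw [← zero_add (1 : ℝ), h1, sub_self]
  have e2 : avg (fun X => fderiv ℝ f X (0, 1)) = 0 := by
    rw [← avg_swap (hc _)]
    refine (intervalIntegral.integral_congr (g := fun _ => 0) fun x _ => ?_).trans (by simp)
    refine (intervalIntegral.integral_eq_sub_of_hasDerivAt (fun y _ => hasDerivAt_snd hd x y)
      (((hc _).comp (Continuous.prodMk_right x)).intervalIntegrable _ _)).trans ?_
    rw [← zero_add (1 : ℝ), h2, sub_self]
  have e : (fun X => fderiv ℝ f X u) = fun X =>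
      (u.1 : ℂ) * fderiv ℝ f X (1, 0) + (u.2 : ℂ) * fderiv ℝ f X (0, 1) := by
    funext X
    rw [← real_smul, ← real_smul, ← map_smul, ← map_smul, ← map_add]
    simp
  rw [e, avg_add (f := fun X => (u.1 : ℂ) * fderiv ℝ f X (1, 0))
    (g := fun X => (u.2 : ℂ) * fderiv ℝ f X (0, 1)) (continuous_const.mul (hc _))
    (continuous_const.mul (hc _)), avg_const_mul,
    avg_const_mul, e1, e2]
  simp

namespace ThetaData

variable {φ : Fin 3 → ℝ} (D : ThetaData (absS φ)) (h : IsGeneric φ) (he : IsEven φ)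

/-- In degree 0 the multiplier is absent and the coefficient is doubly periodic, so its derivative
has mean zero. -/
lemma trace_deriv (A : heisenberg) (a : smoothCrossed φ) :
    D.trace h he (incl φ (D.deriv h he A a)) = 0 := by
  have hq := D.isQP_cf h he a.2 0
  rw [trace_apply]
  refine Eq.trans ?_ (avg_fderiv hq.smooth hq.per
    (fun x y => by simpa [ph_zero] using hq.quasi x y) (A.1 0 1, A.1 1 2))
  congr 1
  funext X
  refine (D.cf_deriv h he A a 0 X).trans ?_
  simp [heisOp]

end ThetaData

end NC3

end

/-! ### Poincaré inequalities on the unit square and its subdivisions -/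

noncomputable section

namespace NC3

open Complex Topology MeasureTheory

section Poincare

lemma avg_mono {f g : ℝ × ℝ → ℝ} (hf : Continuous f) (hg : Continuous g)
    (h : ∀ x, ∀ y ∈ Set.Icc (0 : ℝ) 1, f (x, y) ≤ g (x, y)) : avg f ≤ avg g :=
  intervalIntegral.integral_mono_on zero_le_one
    ((continuous_integral_fst hf).intervalIntegrable _ _)
    ((continuous_integral_fst hg).intervalIntegrable _ _) fun y hy =>
      intervalIntegral.integral_mono_on zero_le_one
        ((continuous_slice hf y).intervalIntegrable _ _)
        ((continuous_slice hg y).intervalIntegrable _ _) fun x _ => h x y hy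

lemma continuous_norm_pow_two {f : ℝ × ℝ → ℂ} (hf : Continuous f) :
    Continuous fun X => ‖f X‖ ^ 2 := hf.norm.pow 2

lemma sq_integral_le {u : ℝ → ℝ} (hu : Continuous u) :
    (∫ x in (0 : ℝ)..1, u x) ^ 2 ≤ ∫ x in (0 : ℝ)..1, u x ^ 2 := by
  set c := ∫ x in (0 : ℝ)..1, u x
  have h0 : 0 ≤ ∫ x in (0 : ℝ)..1, (u x - c) ^ 2 :=
    intervalIntegral.integral_nonneg zero_le_one fun x _ => sq_nonneg _
  have e : ∀ x, (u x - c) ^ 2 = u x ^ 2 - 2 * c * u x + c ^ 2 := fun x => by ring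
  simp only [e] at h0
  rw [intervalIntegral.integral_add (Continuous.intervalIntegrable (by fun_prop) _ _)
    (Continuous.intervalIntegrable (by fun_prop) _ _),
    intervalIntegral.integral_sub (Continuous.intervalIntegrable (by fun_prop) _ _)
    (Continuous.intervalIntegrable (by fun_prop) _ _), intervalIntegral.integral_const_mul,
    intervalIntegral.integral_const] at h0
  simp only [sub_zero, one_smul] at h0
  change 0 ≤ _ - 2 * c * c + c ^ 2 at h0
  linarith

lemma sq_avg_le {u : ℝ × ℝ → ℝ} (hu : Continuous u) : avg u ^ 2 ≤ avg fun X => u X ^ 2 :=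
  (sq_integral_le (continuous_integral_fst hu)).trans <|
    intervalIntegral.integral_mono_on zero_le_one
      (((continuous_integral_fst hu).pow 2).intervalIntegrable _ _)
      ((continuous_integral_fst (hu.pow 2)).intervalIntegrable _ _) fun y _ =>
        sq_integral_le (continuous_slice hu y)

lemma norm_avg_le_avg {f : ℝ × ℝ → ℂ} (hf : Continuous f) : ‖avg f‖ ≤ avg fun X => ‖f X‖ :=
  intervalIntegral.norm_integral_le_of_norm_le zero_le_one
    (.of_forall fun _ _ => intervalIntegral.norm_integral_le_integral_norm zero_le_one)
    ((continuous_integral_fst hf.norm).intervalIntegrable _ _)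

lemma norm_avg_sq_le {f : ℝ × ℝ → ℂ} (hf : Continuous f) :
    ‖avg f‖ ^ 2 ≤ avg fun X => ‖f X‖ ^ 2 :=
  (pow_le_pow_left₀ (norm_nonneg _) (norm_avg_le_avg hf) 2).trans (sq_avg_le hf.norm)

lemma norm_sub_integral_le {u u' : ℝ → ℂ} (hu : ∀ x, HasDerivAt u (u' x) x) (hu' : Continuous u')
    {x : ℝ} (hx : x ∈ Set.Icc (0 : ℝ) 1) :
    ‖u x - ∫ t in (0 : ℝ)..1, u t‖ ≤ ∫ t in (0 : ℝ)..1, ‖u' t‖ := by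
  have hc : Continuous u := continuous_iff_continuousAt.2 fun x => (hu x).continuousAt
  have e : u x - ∫ t in (0 : ℝ)..1, u t = ∫ t in (0 : ℝ)..1, (u x - u t) := by
    rw [intervalIntegral.integral_sub (by simp) (hc.intervalIntegrable _ _)]
    simp
  rw [e]
  have := intervalIntegral.norm_integral_le_of_norm_le_const (a := (0 : ℝ)) (b := 1)
    (f := fun t => u x - u t) (C := ∫ t in (0 : ℝ)..1, ‖u' t‖) fun t ht => by
      rw [Set.uIoc_of_le zero_le_one] at ht
      rw [← intervalIntegral.integral_eq_sub_of_hasDerivAt (fun x _ => hu x)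
        (hu'.intervalIntegrable t x)]
      refine intervalIntegral.norm_integral_le_abs_integral_norm.trans ?_
      refine (intervalIntegral.abs_integral_mono_interval (c := 0) (d := 1) ?_
        (.of_forall fun _ => norm_nonneg _) (hu'.norm.intervalIntegrable _ _)).trans ?_
      · rw [Set.uIoc_of_le zero_le_one]
        exact Set.Ioc_subset_Ioc (le_min ht.1.le hx.1) (max_le ht.2 hx.2)
      · rw [abs_of_nonneg]
        exact intervalIntegral.integral_nonneg zero_le_one fun _ _ => norm_nonneg _
  simpa using this

variable {g gx gy : ℝ × ℝ → ℂ}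

/-- The Poincaré inequality on the unit square. -/
lemma avg_norm_sq_le (hg : Continuous g) (hgx : Continuous gx) (hgy : Continuous gy)
    (hx : ∀ x y, HasDerivAt (fun x => g (x, y)) (gx (x, y)) x)
    (hy : ∀ x y, HasDerivAt (fun y => g (x, y)) (gy (x, y)) y) :
    (avg fun X => ‖g X‖ ^ 2) ≤
      3 * ((avg fun X => ‖gx X‖ ^ 2) + (avg fun X => ‖gy X‖ ^ 2) + ‖avg g‖ ^ 2) := by
  have hsw : Continuous fun X : ℝ × ℝ => gy (X.2, X.1) := hgy.comp continuous_swap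
  -- The x-mean at height y differs from the total mean by at most the mean of |∂_y g|; then g(x, y)
  -- differs from that x-mean by at most the integral of |∂_x g| at height y. The factor 3 is (p + q
  -- + r)² ≤ 3(p² + q² + r²).
  have h2 : ∀ y ∈ Set.Icc (0 : ℝ) 1, ‖(∫ s in (0 : ℝ)..1, g (s, y)) - avg g‖ ≤
      avg fun X => ‖gy X‖ := by
    intro y hy'
    have hi : Continuous fun s => ∫ t in (0 : ℝ)..1, g (s, t) :=
      continuous_integral_fst (hg.comp continuous_swap)
    rw [← avg_swap hg, ← avg_swap hgy.norm, avg, ← intervalIntegral.integral_sub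
      ((continuous_slice hg y).intervalIntegrable _ _) (hi.intervalIntegrable _ _)]
    exact intervalIntegral.norm_integral_le_of_norm_le zero_le_one
      (.of_forall fun s _ => norm_sub_integral_le (u := fun t => g (s, t)) (hy s)
        (hgy.comp (Continuous.prodMk_right s)) hy')
      ((continuous_integral_fst hsw.norm).intervalIntegrable _ _)
  have hG := continuous_integral_fst (continuous_norm_pow_two hgx)
  have h3 : ∀ y ∈ Set.Icc (0 : ℝ) 1, (∫ x in (0 : ℝ)..1, ‖g (x, y)‖ ^ 2) ≤
      3 * ((∫ r in (0 : ℝ)..1, ‖gx (r, y)‖ ^ 2) +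
        ((avg fun X => ‖gy X‖ ^ 2) + ‖avg g‖ ^ 2)) := by
    intro y hy'
    refine (intervalIntegral.integral_mono_on zero_le_one
      ((continuous_slice (continuous_norm_pow_two hg) y).intervalIntegrable _ _)
      (g := fun _ => 3 * ((∫ r in (0 : ℝ)..1, ‖gx (r, y)‖ ^ 2) +
        ((avg fun X => ‖gy X‖ ^ 2) + ‖avg g‖ ^ 2))) (by simp) fun x hx' => ?_).trans (by simp)
    have a1 := norm_sub_integral_le (u := fun x => g (x, y)) (fun x => hx x y)
      (continuous_slice hgx y) hx'
    have a2 := h2 y hy'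
    have a3 := sq_integral_le (continuous_slice hgx.norm y)
    have a4 := sq_avg_le hgy.norm
    set p := ∫ r in (0 : ℝ)..1, ‖gx (r, y)‖
    set q := avg fun X => ‖gy X‖
    have a5 : ‖g (x, y)‖ ≤ p + q + ‖avg g‖ :=
      calc ‖g (x, y)‖ = ‖(g (x, y) - ∫ s in (0 : ℝ)..1, g (s, y)) +
            ((∫ s in (0 : ℝ)..1, g (s, y)) - avg g) + avg g‖ := by congr 1; ring
        _ ≤ _ := (norm_add₃_le).trans (by gcongr)
    have a6 := pow_le_pow_left₀ (norm_nonneg _) a5 2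
    nlinarith [sq_nonneg (p - q), sq_nonneg (p - ‖avg g‖), sq_nonneg (q - ‖avg g‖)]
  refine (intervalIntegral.integral_mono_on zero_le_one
    ((continuous_integral_fst (continuous_norm_pow_two hg)).intervalIntegrable _ _)
    (Continuous.intervalIntegrable (by fun_prop) _ _) h3).trans (le_of_eq ?_)
  rw [intervalIntegral.integral_const_mul, intervalIntegral.integral_add
    (hG.intervalIntegrable _ _) (by simp), intervalIntegral.integral_const]
  simp only [sub_zero, one_smul, add_assoc]
  rfl

/-- The restriction of a function to a small square, rescaled. -/
def cell {E : Type*} (M i j : ℕ) (f : ℝ × ℝ → E) (X : ℝ × ℝ) : E :=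
  f (X.1 / M + i / M, X.2 / M + j / M)

lemma continuous_cell {E : Type*} [TopologicalSpace E] (M i j : ℕ) {f : ℝ × ℝ → E}
    (hf : Continuous f) : Continuous (cell M i j f) :=
  hf.comp (by fun_prop)

lemma integral_eq_sum_cell {M : ℕ} (hM : 0 < M) {u : ℝ → ℝ} (hu : Continuous u) :
    ∫ x in (0 : ℝ)..1, u x =
      (M : ℝ)⁻¹ * ∑ i ∈ Finset.range M, ∫ x in (0 : ℝ)..1, u (x / M + i / M) := by
  have hM' : (M : ℝ) ≠ 0 := by positivity
  have h1 : ∀ i ∈ Finset.range M, ∫ x in (0 : ℝ)..1, u (x / M + i / M) =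
      M * ∫ x in ((i : ℕ) / M : ℝ)..((i + 1 : ℕ) / M : ℝ), u x := fun i _ => by
    rw [intervalIntegral.integral_comp_div_add _ hM', smul_eq_mul, zero_div, zero_add, ← add_div]
    push_cast
    rw [add_comm (1 : ℝ)]
  rw [Finset.sum_congr rfl h1, ← Finset.mul_sum, inv_mul_cancel_left₀ hM',
    intervalIntegral.sum_integral_adjacent_intervals (a := fun i : ℕ => (i / M : ℝ))
      fun k _ => hu.intervalIntegrable _ _]
  simp [hM']

lemma avg_eq_sum_cell {M : ℕ} (hM : 0 < M) {f : ℝ × ℝ → ℝ} (hf : Continuous f) :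
    avg f = ((M : ℝ) ^ 2)⁻¹ * ∑ i ∈ Finset.range M, ∑ j ∈ Finset.range M, avg (cell M i j f) := by
  have h1 : ∀ y, ∫ x in (0 : ℝ)..1, f (x, y) = (M : ℝ)⁻¹ * ∑ i ∈ Finset.range M,
      ∫ x in (0 : ℝ)..1, f (x / M + i / M, y) := fun y =>
    integral_eq_sum_cell hM (continuous_slice hf y)
  have hc : ∀ i : ℕ, Continuous fun y => ∫ x in (0 : ℝ)..1, f (x / M + i / M, y) := fun i =>
    continuous_integral_fst (f := fun X => f (X.1 / M + i / M, X.2)) (hf.comp (by fun_prop))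
  rw [avg, funext h1, intervalIntegral.integral_const_mul, intervalIntegral.integral_finsetSum
    fun i _ => (hc i).intervalIntegrable _ _, Finset.sum_congr rfl fun i _ =>
      integral_eq_sum_cell hM (hc i), ← Finset.mul_sum, ← mul_assoc, ← mul_inv, ← sq]
  rfl

lemma hasDerivAt_comp_div_add {u : ℝ → ℂ} {u' : ℂ} {M k : ℕ} {x : ℝ}
    (hu : HasDerivAt u u' (x / M + k / M)) :
    HasDerivAt (fun x : ℝ => u (x / M + k / M)) (((1 / M : ℝ) : ℂ) * u') x := by
  have := hu.scomp x (((hasDerivAt_id x).div_const (M : ℝ)).add_const (k / M : ℝ))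
  rwa [real_smul] at this

/-- The Poincaré inequality for a subdivision of the unit square. -/
lemma avg_norm_sq_le_cell {M : ℕ} (hM : 0 < M) (hg : Continuous g) (hgx : Continuous gx)
    (hgy : Continuous gy) (hx : ∀ x y, HasDerivAt (fun x => g (x, y)) (gx (x, y)) x)
    (hy : ∀ x y, HasDerivAt (fun y => g (x, y)) (gy (x, y)) y) :
    (avg fun X => ‖g X‖ ^ 2) ≤
      3 * ((M : ℝ) ^ 2)⁻¹ * ((avg fun X => ‖gx X‖ ^ 2) + (avg fun X => ‖gy X‖ ^ 2)) +
        3 * ∑ i ∈ Finset.range M, ∑ j ∈ Finset.range M, ‖avg (cell M i j g)‖ ^ 2 := by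
  have hM1 : (1 : ℝ) ≤ M := by exact_mod_cast hM
  have hcell : ∀ i j : ℕ, avg (cell M i j fun X => ‖g X‖ ^ 2) ≤
      3 * (((M : ℝ) ^ 2)⁻¹ * avg (cell M i j fun X => ‖gx X‖ ^ 2) +
        ((M : ℝ) ^ 2)⁻¹ * avg (cell M i j fun X => ‖gy X‖ ^ 2) + ‖avg (cell M i j g)‖ ^ 2) := by
    intro i j
    have e : ∀ f : ℝ × ℝ → ℂ, (avg fun X => ‖((1 / M : ℝ) : ℂ) * cell M i j f X‖ ^ 2) =
        ((M : ℝ) ^ 2)⁻¹ * avg (cell M i j fun X => ‖f X‖ ^ 2) := fun f => by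
      have : ∀ X, ‖((1 / M : ℝ) : ℂ) * cell M i j f X‖ ^ 2 =
          ((M : ℝ) ^ 2)⁻¹ * cell M i j (fun X => ‖f X‖ ^ 2) X := fun X => by
        rw [norm_mul, mul_pow, norm_real, Real.norm_of_nonneg (by positivity), one_div, inv_pow]
        rfl
      simp only [this, avg, intervalIntegral.integral_const_mul]
    rw [← e, ← e]
    exact avg_norm_sq_le (continuous_cell M i j hg)
      (continuous_const.mul (continuous_cell M i j hgx))
      (continuous_const.mul (continuous_cell M i j hgy))
      (fun x y => hasDerivAt_comp_div_add (u := fun x => g (x, y / M + j / M)) (hx _ _))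
      (fun x y => hasDerivAt_comp_div_add (u := fun y => g (x / M + i / M, y)) (hy _ _))
  rw [avg_eq_sum_cell hM (continuous_norm_pow_two hg), avg_eq_sum_cell hM (continuous_norm_pow_two hgx),
    avg_eq_sum_cell hM (continuous_norm_pow_two hgy)]
  have hs := Finset.sum_le_sum fun i (_ : i ∈ Finset.range M) =>
    Finset.sum_le_sum fun j (_ : j ∈ Finset.range M) => hcell i j
  simp only [← Finset.mul_sum, Finset.sum_add_distrib] at hs
  set m := ((M : ℝ) ^ 2)⁻¹
  have hm : 0 ≤ m := by positivity
  have hm1 : m ≤ 1 := inv_le_one_of_one_le₀ (one_le_pow₀ hM1)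
  set S := ∑ i ∈ Finset.range M, ∑ j ∈ Finset.range M, ‖avg (cell M i j g)‖ ^ 2
  have hS : 0 ≤ S := Finset.sum_nonneg fun i _ => Finset.sum_nonneg fun j _ => sq_nonneg _
  refine (mul_le_mul_of_nonneg_left hs hm).trans ?_
  have := mul_le_mul_of_nonneg_right hm1 hS
  nlinarith

lemma norm_avg_cell_sq_le {M : ℕ} (hM : 0 < M) (hg : Continuous g) {i j : ℕ} (hi : i < M)
    (hj : j < M) : ‖avg (cell M i j g)‖ ^ 2 ≤ (M : ℝ) ^ 2 * avg fun X => ‖g X‖ ^ 2 := by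
  have hM' : (M : ℝ) ^ 2 ≠ 0 := by positivity
  rw [avg_eq_sum_cell hM (continuous_norm_pow_two hg), mul_inv_cancel_left₀ hM']
  have h0 : ∀ i j, 0 ≤ avg (cell M i j fun X => ‖g X‖ ^ 2) := fun i j =>
    avg_nonneg fun X => sq_nonneg _
  refine (norm_avg_sq_le (continuous_cell M i j hg)).trans ?_
  refine le_trans ?_ (Finset.single_le_sum (fun i _ => Finset.sum_nonneg fun j _ => h0 i j)
    (Finset.mem_range.2 hi))
  exact Finset.single_le_sum (f := fun j => avg (cell M i j fun X => ‖g X‖ ^ 2))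
    (fun j _ => h0 i j) (Finset.mem_range.2 hj)

end Poincare

end NC3

end

/-! ### Compactness of the energy balls and ellipticity -/

noncomputable section

namespace NC3

open Complex Topology

lemma l2Sq_sub_le {φ : Fin 3 → ℝ} {τ : crossedProduct φ →ₗ[ℂ] ℂ} (hτ : IsFaithfulTrace τ)
    (a b : smoothCrossed φ) : l2Sq τ (a - b) ≤ 2 * l2Sq τ a + 2 * l2Sq τ b := by
  have h0 : 0 ≤ l2Sq τ (a + b) := by
    by_cases h : incl φ (a + b) = 0
    · have : incl φ (star (a + b) * (a + b)) = star (incl φ (a + b)) * incl φ (a + b) := rfl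
      rw [l2Sq, this, h, mul_zero, map_zero, zero_re]
    · exact (hτ.pos _ h).le
  have e : incl φ (star (a - b) * (a - b)) + incl φ (star (a + b) * (a + b)) =
      (2 : ℂ) • incl φ (star a * a) + (2 : ℂ) • incl φ (star b * b) := by
    have : star (a - b) * (a - b) + star (a + b) * (a + b) =
        (2 : ℂ) • (star a * a) + (2 : ℂ) • (star b * b) := by
      rw [two_smul, two_smul, star_sub, star_add]
      noncomm_ring
    exact congrArg (incl φ) this
  have e' := congrArg (fun x => (τ x).re) e
  simp only [map_add, map_smul, smul_eq_mul, add_re, mul_re, re_ofNat, im_ofNat, zero_mul,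
    sub_zero] at e'
  change l2Sq τ (a - b) + l2Sq τ (a + b) = 2 * l2Sq τ a + 2 * l2Sq τ b at e'
  linarith

/-- A criterion for total boundedness by finitely many bounded functionals. -/
lemma exists_finite_of_bound {V : Type*} [Sub V] {L Q : V → ℝ}
    (hQ : ∀ a b, Q (a - b) ≤ 2 * Q a + 2 * Q b)
    (H : ∀ κ > 0, ∃ (ι : Type) (_ : Fintype ι) (Φ : V → ι → ℂ) (C : ℝ),
      0 ≤ C ∧ (∀ a b, Φ (a - b) = Φ a - Φ b) ∧ (∀ a k, ‖Φ a k‖ ^ 2 ≤ C * Q a) ∧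
      ∀ a, L a ≤ κ * Q a + 3 * ∑ k, ‖Φ a k‖ ^ 2) {ε : ℝ} (hε : 0 < ε) :
    ∃ t : Set V, t.Finite ∧ ∀ a, Q a ≤ 1 → ∃ b ∈ t, L (a - b) < ε := by
  -- For Q a, Q b ≤ 1 one has Q(a − b) ≤ 4, so κ = ε/8 contributes at most ε/2. Covering the bounded
  -- set of values of Φ up to √(ε/K) with K = 6·card + 1 makes the remaining contribution less than
  -- ε/2.
  obtain ⟨ι, _, Φ, C, hC, hΦ, hb, hl⟩ := H (ε / 8) (by positivity)
  have htb : TotallyBounded (Φ '' {a | Q a ≤ 1}) := by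
    refine (isCompact_closedBall (0 : ι → ℂ) (C + 1)).totallyBounded.subset ?_
    rintro _ ⟨a, ha, rfl⟩
    rw [mem_closedBall_zero_iff]
    refine (pi_norm_le_iff_of_nonneg (by positivity)).2 fun k => ?_
    have h1 := hb a k
    have h2 : C * Q a ≤ C * 1 := mul_le_mul_of_nonneg_left ha hC
    nlinarith [norm_nonneg (Φ a k)]
  set K : ℝ := 6 * Fintype.card ι + 1
  have hK : 0 < K := by positivity
  obtain ⟨t', ht', hfin, hcov⟩ := htb.exists_subset
    (Metric.dist_mem_uniformity (Real.sqrt_pos.2 (div_pos hε hK)))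
  obtain ⟨t, ht, hft, hcov⟩ := (Set.exists_subset_image_finite_and (p := fun t' =>
    Φ '' {a | Q a ≤ 1} ⊆ ⋃ y ∈ t', {x | dist x y < √(ε / K)})).1 ⟨t', ht', hfin, hcov⟩
  refine ⟨t, hft, fun a ha => ?_⟩
  obtain ⟨_, ⟨b, hb', rfl⟩, hab⟩ := Set.mem_iUnion₂.1 (hcov ⟨a, ha, rfl⟩)
  refine ⟨b, hb', (hl (a - b)).trans_lt ?_⟩
  have h1 : ∀ k, ‖Φ (a - b) k‖ ^ 2 ≤ ε / K := fun k => by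
    have h2 : ‖Φ (a - b) k‖ ≤ √(ε / K) := by
      rw [hΦ]
      refine (norm_le_pi_norm _ k).trans ?_
      rw [← dist_eq_norm]
      exact le_of_lt hab
    exact (Real.le_sqrt (norm_nonneg _) (div_pos hε hK).le).1 h2
  have h3 : ∑ k, ‖Φ (a - b) k‖ ^ 2 ≤ Fintype.card ι * (ε / K) := by
    simpa using Finset.sum_le_sum fun k (_ : k ∈ Finset.univ) => h1 k
  have h4 : Q (a - b) ≤ 4 := by
    have hb1 : Q b ≤ 1 := ht hb'
    have ha1 : Q a ≤ 1 := ha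
    linarith [hQ a b]
  have h5 : 6 * (Fintype.card ι * (ε / K)) + ε / K = ε := by
    rw [← mul_assoc, ← add_one_mul]
    exact mul_div_cancel₀ ε hK.ne'
  have h6 : 0 < ε / K := div_pos hε hK
  have h7 := mul_le_mul_of_nonneg_left h4 hε.le
  linarith

lemma l2Sq_sum_sub_le {φ : Fin 3 → ℝ} {τ : crossedProduct φ →ₗ[ℂ] ℂ} (hτ : IsFaithfulTrace τ)
    (δ : Fin 3 → Module.End ℂ (smoothCrossed φ)) (a b : smoothCrossed φ) :
    l2Sq τ (a - b) + ∑ j, l2Sq τ (δ j (a - b)) ≤ 2 * (l2Sq τ a + ∑ j, l2Sq τ (δ j a)) +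
      2 * (l2Sq τ b + ∑ j, l2Sq τ (δ j b)) := by
  have := Finset.sum_le_sum fun j (_ : j ∈ Finset.univ) => l2Sq_sub_le hτ (δ j a) (δ j b)
  rw [Finset.sum_add_distrib, ← Finset.mul_sum, ← Finset.mul_sum] at this
  simp only [map_sub]
  linarith [l2Sq_sub_le hτ a b]

section Estimates

variable {η : ℝ} {n : ℤ} {f : ℝ × ℝ → ℂ}

lemma heisOp_hBasis (n : ℤ) (f : ℝ × ℝ → ℂ) (P : ℝ × ℝ) :
    heisOp (hBasis 0).1 n f P = fderiv ℝ f P (1, 0) - 8 * Real.pi * I * n * P.2 * f P ∧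
    heisOp (hBasis 1).1 n f P = fderiv ℝ f P (0, 1) ∧
    heisOp (hBasis 2).1 n f P = 8 * Real.pi * I * n * f P := by
  refine ⟨?_, ?_, ?_⟩ <;> simp [heisOp, hBasis, heisenbergUnit, Matrix.single]
  · ring
  · exact map_zero (fderiv ℝ f P)

lemma norm_heisOp_two (n : ℤ) (f : ℝ × ℝ → ℂ) (P : ℝ × ℝ) :
    ‖heisOp (hBasis 2).1 n f P‖ = 8 * Real.pi * |(n : ℝ)| * ‖f P‖ := by
  rw [(heisOp_hBasis n f P).2.2]
  simp [abs_of_pos Real.pi_pos]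

/-- The mean square of the derivatives of a coefficient. -/
def energy (n : ℤ) (f : ℝ × ℝ → ℂ) : ℝ :=
  ∑ j, avg fun X => ‖heisOp (hBasis j).1 n f X‖ ^ 2

/-- The third basis element multiplies by 8πin, of modulus greater than M. -/
lemma avg_norm_sq_le_of_lt (hf : ContDiff ℝ ∞ f) {M : ℕ} (hM : 0 < M) (hn : (M : ℤ) < |n|) :
    (avg fun X => ‖f X‖ ^ 2) ≤ ((M : ℝ) ^ 2)⁻¹ * energy n f := by
  have hM2 : (0 : ℝ) < (M : ℝ) ^ 2 := by positivity
  have hn' : (M : ℝ) ≤ |(n : ℝ)| := by exact_mod_cast hn.le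
  have h0 : ∀ j, 0 ≤ avg fun X => ‖heisOp (hBasis j).1 n f X‖ ^ 2 := fun j =>
    avg_nonneg fun X => sq_nonneg _
  rw [inv_mul_eq_div, le_div_iff₀ hM2]
  refine le_trans ?_ (Finset.single_le_sum (fun j _ => h0 j) (Finset.mem_univ 2))
  have e : (avg fun X => ‖f X‖ ^ 2) * (M : ℝ) ^ 2 = avg fun X => (M : ℝ) ^ 2 * ‖f X‖ ^ 2 := by
    simp only [avg, intervalIntegral.integral_const_mul]
    rw [mul_comm]
  rw [e]
  refine avg_mono (continuous_const.mul (continuous_norm_pow_two hf.continuous))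
    (continuous_norm_pow_two (contDiff_heisOp hf).continuous) fun x y _ => ?_
  rw [norm_heisOp_two, ← mul_pow]
  refine pow_le_pow_left₀ (by positivity) (mul_le_mul_of_nonneg_right ?_ (norm_nonneg _)) 2
  nlinarith [Real.pi_gt_three, abs_nonneg (n : ℝ)]

lemma avg_two_mul_add_two_mul {u v : ℝ × ℝ → ℝ} (hu : Continuous u) (hv : Continuous v) :
    (avg fun X => 2 * u X + 2 * v X) = 2 * avg u + 2 * avg v := by
  rw [avg_add (f := fun X => 2 * u X) (g := fun X => 2 * v X) (continuous_const.mul hu)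
    (continuous_const.mul hv)]
  simp only [avg, intervalIntegral.integral_const_mul]

/-- On coefficients ∂_x = X₁ + yX₃ and ∂_y = X₂. Only y in [0, 1] enters the mean, so the unbounded
multiplier y does no harm. -/
lemma avg_norm_fderiv_sq_le (hf : ContDiff ℝ ∞ f) (n : ℤ) :
    (avg fun X => ‖fderiv ℝ f X (1, 0)‖ ^ 2) + (avg fun X => ‖fderiv ℝ f X (0, 1)‖ ^ 2) ≤
      2 * energy n f := by
  have hc' : ∀ j, Continuous fun X => ‖heisOp (hBasis j).1 n f X‖ ^ 2 := fun j =>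
    continuous_norm_pow_two (contDiff_heisOp hf).continuous
  have hd : Continuous fun X => fderiv ℝ f X (1, 0) :=
    (hf.continuous_fderiv (by simp)).clm_apply continuous_const
  have h1 : (avg fun X => ‖fderiv ℝ f X (1, 0)‖ ^ 2) ≤ avg fun X =>
      2 * ‖heisOp (hBasis 0).1 n f X‖ ^ 2 + 2 * ‖heisOp (hBasis 2).1 n f X‖ ^ 2 := by
    refine avg_mono (continuous_norm_pow_two hd) ((continuous_const.mul (hc' 0)).add
      (continuous_const.mul (hc' 2))) fun x y hy => ?_
    have e : fderiv ℝ f (x, y) (1, 0) = heisOp (hBasis 0).1 n f (x, y) +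
        y * heisOp (hBasis 2).1 n f (x, y) := by
      rw [(heisOp_hBasis n f (x, y)).1, (heisOp_hBasis n f (x, y)).2.2]
      ring
    have h2 : ‖fderiv ℝ f (x, y) (1, 0)‖ ≤
        ‖heisOp (hBasis 0).1 n f (x, y)‖ + ‖heisOp (hBasis 2).1 n f (x, y)‖ := by
      rw [e]
      refine (norm_add_le _ _).trans (add_le_add_right ?_ _)
      rw [norm_mul, norm_real, Real.norm_of_nonneg hy.1]
      exact mul_le_of_le_one_left (norm_nonneg _) hy.2
    have h3 := pow_le_pow_left₀ (norm_nonneg _) h2 2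
    nlinarith [sq_nonneg (‖heisOp (hBasis 0).1 n f (x, y)‖ - ‖heisOp (hBasis 2).1 n f (x, y)‖)]
  rw [avg_two_mul_add_two_mul (hc' 0) (hc' 2)] at h1
  have h4 : (avg fun X => ‖fderiv ℝ f X (0, 1)‖ ^ 2) =
      avg fun X => ‖heisOp (hBasis 1).1 n f X‖ ^ 2 := by
    simp only [(heisOp_hBasis n f _).2.1]
  have h5 : 0 ≤ avg fun X => ‖heisOp (hBasis 1).1 n f X‖ ^ 2 := avg_nonneg fun X => sq_nonneg _
  rw [energy, Fin.sum_univ_three, h4]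
  linarith

lemma avg_sub {f g : ℝ × ℝ → ℂ} (hf : Continuous f) (hg : Continuous g) :
    (avg fun X => f X - g X) = avg f - avg g := by
  have := avg_add hf (g := fun X => -1 * g X) (continuous_const.mul hg)
  rw [avg_const_mul, neg_one_mul, ← sub_eq_add_neg] at this
  simpa only [neg_one_mul, ← sub_eq_add_neg] using this

lemma energy_nonneg (n : ℤ) (f : ℝ × ℝ → ℂ) : 0 ≤ energy n f :=
  Finset.sum_nonneg fun _ _ => avg_nonneg fun _ => sq_nonneg _

lemma avg_norm_sq_le_energy (hf : ContDiff ℝ ∞ f) (n : ℤ) {M : ℕ} (hM : 0 < M) :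
    (avg fun X => ‖f X‖ ^ 2) ≤ 6 * ((M : ℝ) ^ 2)⁻¹ * energy n f +
      3 * ∑ i ∈ Finset.range M, ∑ j ∈ Finset.range M, ‖avg (cell M i j f)‖ ^ 2 := by
  have hd : ∀ u, Continuous fun X => fderiv ℝ f X u := fun u =>
    (hf.continuous_fderiv (by simp)).clm_apply continuous_const
  have hdf : Differentiable ℝ f := hf.differentiable (by simp)
  refine (avg_norm_sq_le_cell hM hf.continuous (hd _) (hd _) (hasDerivAt_fst hdf)
    (hasDerivAt_snd hdf)).trans (add_le_add_left ?_ _)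
  have := mul_le_mul_of_nonneg_left (avg_norm_fderiv_sq_le hf n)
    (show 0 ≤ 3 * ((M : ℝ) ^ 2)⁻¹ by positivity)
  linarith

end Estimates

namespace ThetaData

variable {φ : Fin 3 → ℝ} (D : ThetaData (absS φ)) (h : IsGeneric φ) (he : IsEven φ)

/-- The trace property replaces a*a by aa*, whose coefficient of degree 0 is Σ |a_n|² pointwise,
without shifted arguments. -/
lemma l2Sq_eq_sum {a : smoothCrossed φ} {s : Finset ℤ}
    (hs : ∀ k ∉ s, ∀ X, D.cf h he a.1 k X = 0) :
    l2Sq (D.trace h he) a = ∑ n ∈ s, avg fun X => ‖D.cf h he a.1 n X‖ ^ 2 := by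
  have e : D.trace h he (incl φ (star a * a)) = D.trace h he (incl φ (a * star a)) :=
    (D.isFaithfulTrace h he).trace (star (incl φ a)) (incl φ a)
  have e2 : ∀ X, D.cf h he (a * star a).1 0 X =
      ((∑ n ∈ s, ‖D.cf h he a.1 n X‖ ^ 2 : ℝ) : ℂ) := fun X => by
    rw [cf_mul hs]
    push_cast
    refine Finset.sum_congr rfl fun n _ => ?_
    rw [← mul_conj']
    congr 1
    refine (OrbitFrame.coef_star _ (smooth_le_cross a.2) (0 - n) _).trans ?_
    congr 2
    · ring
    · ext <;> simp
  rw [l2Sq, e, trace_apply]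
  change (avg (fun X => D.cf h he (a * star a).1 0 X)).re = _
  rw [funext e2, avg_ofReal, ofReal_re, avg_sum]
  exact fun n _ => continuous_norm_pow_two (D.isQP_cf h he a.2 n).smooth.continuous

lemma l2Sq_add_sum_eq {a : smoothCrossed φ} {s : Finset ℤ}
    (hs : ∀ k ∉ s, ∀ X, D.cf h he a.1 k X = 0) :
    l2Sq (D.trace h he) a + ∑ j, l2Sq (D.trace h he) (D.deriv h he (hBasis j) a) =
      ∑ n ∈ s, ((avg fun X => ‖D.cf h he a.1 n X‖ ^ 2) + energy n (D.cf h he a.1 n)) := by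
  have hs' : ∀ j, ∀ k ∉ s, ∀ X, D.cf h he (D.deriv h he (hBasis j) a).1 k X = 0 :=
    fun j k hk X => by
      rw [cf_deriv, show D.cf h he a.1 k = fun _ => 0 from funext (hs k hk)]
      simp [heisOp]
  rw [D.l2Sq_eq_sum h he hs, Finset.sum_congr rfl fun j _ => D.l2Sq_eq_sum h he (hs' j),
    Finset.sum_comm, Finset.sum_add_distrib]
  simp only [cf_deriv, energy]

/-- The functionals that control the elements of bounded energy. -/
def cellAvg (M : ℕ) (a : smoothCrossed φ)
    (k : Finset.Icc (-(M : ℤ)) M × Fin M × Fin M) : ℂ :=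
  avg (cell M k.2.1 k.2.2 (D.cf h he a.1 k.1))

lemma cellAvg_sub (M : ℕ) (a b : smoothCrossed φ) :
    D.cellAvg h he M (a - b) = D.cellAvg h he M a - D.cellAvg h he M b :=
  funext fun k => avg_sub (continuous_cell M _ _ (D.differentiable_cf h he a k.1).continuous)
    (continuous_cell M _ _ (D.differentiable_cf h he b k.1).continuous)

lemma norm_cellAvg_sq_le {M : ℕ} (hM : 0 < M) {a : smoothCrossed φ} {s : Finset ℤ}
    (hs : ∀ k ∉ s, ∀ X, D.cf h he a.1 k X = 0)
    (k : Finset.Icc (-(M : ℤ)) M × Fin M × Fin M) :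
    ‖D.cellAvg h he M a k‖ ^ 2 ≤ (M : ℝ) ^ 2 *
      (l2Sq (D.trace h he) a + ∑ j, l2Sq (D.trace h he) (D.deriv h he (hBasis j) a)) := by
  refine (norm_avg_cell_sq_le hM (D.differentiable_cf h he a k.1).continuous k.2.1.2
    k.2.2.2).trans (mul_le_mul_of_nonneg_left ?_ (by positivity))
  have h0 : ∀ n, 0 ≤ avg fun X => ‖D.cf h he a.1 n X‖ ^ 2 := fun n =>
    avg_nonneg fun X => sq_nonneg _
  rw [D.l2Sq_add_sum_eq h he (s := insert k.1.1 s) fun n hn =>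
    hs n fun hn' => hn (Finset.mem_insert_of_mem hn')]
  refine le_trans (le_add_of_nonneg_right (energy_nonneg _ _)) (Finset.single_le_sum
    (f := fun n => (avg fun X => ‖D.cf h he a.1 n X‖ ^ 2) + energy n (D.cf h he a.1 n))
    (fun n _ => add_nonneg (h0 n) (energy_nonneg _ _)) (Finset.mem_insert_self _ _))

/-- Degrees |n| > M are controlled by the multiplier 8πin. In the other degrees the Poincaré
inequality on the M² cells gains a factor M⁻², at the price of the finitely many cell means. -/
lemma l2Sq_le {M : ℕ} (hM : 0 < M) {a : smoothCrossed φ} {s : Finset ℤ}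
    (hs : ∀ k ∉ s, ∀ X, D.cf h he a.1 k X = 0) :
    l2Sq (D.trace h he) a ≤ 6 * ((M : ℝ) ^ 2)⁻¹ *
      (l2Sq (D.trace h he) a + ∑ j, l2Sq (D.trace h he) (D.deriv h he (hBasis j) a)) +
        3 * ∑ k, ‖D.cellAvg h he M a k‖ ^ 2 := by
  set I := Finset.Icc (-(M : ℤ)) M
  set m := ((M : ℝ) ^ 2)⁻¹
  have hm : 0 ≤ m := by positivity
  have hs' : ∀ k ∉ I ∪ s, ∀ X, D.cf h he a.1 k X = 0 := fun k hk =>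
    hs k fun hk' => hk (Finset.mem_union_right _ hk')
  set S : ℤ → ℝ := fun n => ∑ i ∈ Finset.range M, ∑ j ∈ Finset.range M,
    ‖avg (cell M i j (D.cf h he a.1 n))‖ ^ 2
  have hsum : ∑ k, ‖D.cellAvg h he M a k‖ ^ 2 = ∑ n ∈ I, S n := by
    simp only [Fintype.sum_prod_type]
    change ∑ n : I, ∑ i : Fin M, ∑ j : Fin M, ‖avg (cell M i j (D.cf h he a.1 n))‖ ^ 2 = _
    rw [Finset.sum_coe_sort I fun n => ∑ i : Fin M, ∑ j : Fin M,
      ‖avg (cell M i j (D.cf h he a.1 n))‖ ^ 2]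
    refine Finset.sum_congr rfl fun n _ => ?_
    rw [Fin.sum_univ_eq_sum_range fun i => ∑ j : Fin M,
      ‖avg (cell M i j (D.cf h he a.1 n))‖ ^ 2]
    refine Finset.sum_congr rfl fun i _ => ?_
    rw [Fin.sum_univ_eq_sum_range fun j => ‖avg (cell M i j (D.cf h he a.1 n))‖ ^ 2]
  have hn : ∀ n ∈ I ∪ s, (avg fun X => ‖D.cf h he a.1 n X‖ ^ 2) ≤
      6 * m * ((avg fun X => ‖D.cf h he a.1 n X‖ ^ 2) + energy n (D.cf h he a.1 n)) +
        if n ∈ I then 3 * S n else 0 := fun n _ => by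
    have hsm := (D.isQP_cf h he a.2 n).smooth
    have h0 : 0 ≤ m * avg fun X => ‖D.cf h he a.1 n X‖ ^ 2 :=
      mul_nonneg hm (avg_nonneg fun X => sq_nonneg _)
    have h1 := mul_nonneg hm (energy_nonneg n (D.cf h he a.1 n))
    split_ifs with hnI
    · have := avg_norm_sq_le_energy hsm n hM
      linarith
    · have := avg_norm_sq_le_of_lt hsm hM (OrbitFrame.mem_Icc_of_abs_le hnI)
      linarith
  have key := Finset.sum_le_sum hn
  rw [Finset.sum_add_distrib, ← Finset.mul_sum, Finset.sum_ite_mem,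
    Finset.inter_eq_right.2 Finset.subset_union_left, ← Finset.mul_sum] at key
  rw [D.l2Sq_add_sum_eq h he hs', D.l2Sq_eq_sum h he hs', hsum]
  exact key

/-- The action is elliptic. -/
theorem isElliptic : IsElliptic (D.deriv h he) (D.trace h he) := by
  refine fun ε hε => exists_finite_of_bound
    (l2Sq_sum_sub_le (D.isFaithfulTrace h he) fun j => D.deriv h he (hBasis j)) (fun κ hκ => ?_) hε
  obtain ⟨M, hM⟩ := exists_nat_gt (6 / κ)
  have hM0 : 0 < M := by exact_mod_cast (div_pos (by norm_num) hκ).trans hM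
  have hM1 : (1 : ℝ) ≤ M := by exact_mod_cast hM0
  have hκM : 6 * ((M : ℝ) ^ 2)⁻¹ ≤ κ := by
    rw [div_lt_iff₀ hκ] at hM
    rw [← div_eq_mul_inv, div_le_iff₀ (by positivity)]
    nlinarith
  refine ⟨_, inferInstance, D.cellAvg h he M, (M : ℝ) ^ 2, by positivity, D.cellAvg_sub h he M,
    fun a k => (D.exists_support h he a).elim fun s hs => D.norm_cellAvg_sq_le h he hM0 hs k,
    fun a => (D.exists_support h he a).elim fun s hs => (D.l2Sq_le h he hM0 hs).trans
      (add_le_add_left (mul_le_mul_of_nonneg_right hκM ?_) _)⟩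
  rw [D.l2Sq_add_sum_eq h he hs]
  exact Finset.sum_nonneg fun n _ => add_nonneg (avg_nonneg fun X => sq_nonneg _)
    (energy_nonneg _ _)

end ThetaData

end NC3

end

/-! ### The theorem -/

theorem mainTheorem6 (φ : Fin 3 → ℝ) (hgen : NC3.IsGeneric φ) (heven : NC3.IsEven φ) :
    -- each component of the real curve is a minimal compact invariant set
    (∀ x ∈ NC3.realCurve φ,
      NC3.IsMinimalInvariant (NC3.sigma φ) (connectedComponentIn (NC3.realCurve φ) x)) ∧
    -- compact invariant sets are sums
    (∀ K ⊆ NC3.curve φ, IsCompact K → NC3.sigma φ '' K = K →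
      K = NC3.ellSum φ (K ∩ NC3.torusComp φ) (NC3.realComp φ)) ∧
    -- the crossed product is a mapping torus
    (∃ η : ℝ, Irrational η ∧
      (∃ h : AddCircle (1 : ℝ) ≃ₜ NC3.realComp φ,
        ∀ x, (h (x + (η : AddCircle (1 : ℝ))) : NC3.P3) = NC3.sigma φ (h x)) ∧
      Nonempty (NC3.circleCrossed φ ≃⋆ₐ[ℂ] NC3.ncTorus η) ∧
      ∃ β : NC3.ncTorus η ≃⋆ₐ[ℂ] NC3.ncTorus η,
        β (NC3.U₁ η) = NC3.U₁ η ∧ β (NC3.U₂ η) = NC3.U₁ η ^ 4 * NC3.U₂ η ∧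
        Nonempty (NC3.crossedProduct φ ≃⋆ₐ[ℂ] NC3.mappingTorus β)) ∧
    -- the elliptic action of the Heisenberg Lie algebra and the invariant trace
    (NC3.smoothCrossed φ).topologicalClosure = NC3.crossedProduct φ ∧
    ∃ (δ : NC3.heisenberg →ₗ⁅ℝ⁆ Module.End ℂ (NC3.smoothCrossed φ))
      (τ : NC3.crossedProduct φ →ₗ[ℂ] ℂ),
      NC3.IsDerivationAction δ ∧ NC3.IsFaithfulTrace τ ∧
      (∀ X a, τ (NC3.incl φ (δ X a)) = 0) ∧ NC3.IsElliptic δ τ := by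
  refine (NC3.exists_thetaData (NC3.absS_pos heven) (NC3.absS_injective hgen heven)).elim fun D => ?_
  refine ⟨fun x hx => ?_, fun K hK hc hσ => D.eq_ellSum hgen heven hK hc hσ, ?_,
    D.topologicalClosure_smooth hgen heven, D.deriv hgen heven, D.trace hgen heven,
    D.isDerivationAction hgen heven, D.isFaithfulTrace hgen heven, D.trace_deriv hgen heven,
    D.isElliptic hgen heven⟩
  · rw [D.realCurve_eq heven] at hx
    rcases hx with hx | hx
    · rw [D.connectedComponentIn_line heven (.inl rfl) hx]
      exact D.isMinimalInvariant_line hgen heven 0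
    · rw [D.connectedComponentIn_line heven (.inr rfl) hx]
      exact D.isMinimalInvariant_line hgen heven 1
  · obtain ⟨g, hg⟩ := D.exists_homeo heven
    exact ⟨D.z₀, D.irrational hgen heven, ⟨g, hg⟩, NC3.nonempty_circleCrossed_equiv g hg,
      NC3.beta D.z₀, NC3.beta_U₁ D.z₀, NC3.beta_U₂ D.z₀,
      D.nonempty_crossedProduct_equiv hgen heven⟩
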